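/- **Setting.** Let $N_0,N_1\ge 0$ be integers with $N=N_0+N_1\ge 1$. Let $\sigma$ be a partition of the trapezoid with vertices $(0,0),(0,1),(N_0,0),(N_1,1)$, that is, a bijection $i\mapsto(\sigma_x(i),\sigma_y(i))$ from $\{\frac12,\frac32,\dots,N-\frac12\}$ onto $\{(\frac12,0),\dots,(N_0-\frac12,0)\}\cup\{(\frac12,1),\dots,(N_1-\frac12,1)\}$ such that $\sigma_x(i)>\sigma_x(j)$ whenever $i<j$ and $\sigma_y(i)=\sigma_y(j)$. Read half-integer indices modulo $N$ and put $\hat I_r=\{k\in\mathbb Z/N\mid \sigma_y(k-\frac12)=\sigma_y(k+\frac12)\}$. The quiver $Q_\sigma$ has vertex set $\mathbb Z/N=\{0,\dots,N-1\}$ and arrows $h^+_{k+1/2}:k\to k+1$ and $h^-_{k+1/2}:k+1\to k$ for all $k$, and a loop $r_k:k\to k$ for every $k\in\hat I_r$. With $\varepsilon_i=(-1)^{\sigma_y(i)}$, its potential is $$w_\sigma=\sum_{k\in\hat I_r}\Bigl(\varepsilon_{k-\frac12}\,r_kh^+_{k-\frac12}h^-_{k-\frac12}-\varepsilon_{k+\frac12}\,r_kh^-_{k+\frac12}h^+_{k+\frac12}\Bigr)+\sum_{k\notin\hat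 I_r}\varepsilon_{k-\frac12}\,h^+_{k-\frac12}h^-_{k-\frac12}h^-_{k+\frac12}h^+_{k+\frac12}.$$ Assume that $\sigma$ is the special partition with loops exactly at the first $N'$ vertices, $\hat I_r=\{0,1,\dots,N'-1\}$ with $0\le N'\le N$. Put $I_2=\{N',N'+2,\dots,N-2\}$ and $I_3=\{N'+1,N'+3,\dots,N-1\}$, and let $C=\{h^-_{k+1/2}\mid k\notin I_2\}$, which is a cut of $(Q_\sigma,w_\sigma)$. **Motives.** Let $\mathbb L=[\mathbb A^1]$, and work in the ring $\mathcal M=K_0(\mathrm{Var}_{\mathbb C})[\mathbb L^{1/2},\mathbb L^{-1/2},(1-\mathbb L^n)^{-1}:n\ge1]$. For $\alpha\in\mathbb N^{\mathbb Z/N}$ let $R(Q_\sigma,\alpha)$ be the space of representations of $Q_\sigma$ of dimension vector $\alpha$, let $G_\alpha=\prod_i\mathrm{GL}_{\alpha_i}$, and let $f_\alpha=\operatorname{Tr}(w_\sigma):R(Q_\sigma,\alpha)\to\mathbb C$. The cut $C$ gives a $\mathbb C^*$-action with weights $0$ and $1$ for which $f_\alpha$ has weight one, and the class of the motivic vanishing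 cycle of $f_\alpha$ is $[\varphi_{f_\alpha}]=[f_\alpha^{-1}(1)]-[f_\alpha^{-1}(0)]$. Put $$[\operatorname{crit} f_\alpha]_{\rm vir}=-(-\mathbb L^{1/2})^{-\dim R(Q_\sigma,\alpha)}[\varphi_{f_\alpha}],\qquad [G_\alpha]_{\rm vir}=(-\mathbb L^{1/2})^{-\dim G_\alpha}[G_\alpha].$$ The universal series is $$A_U^\sigma(y)=A_U^\sigma(y_0,\dots,y_{N-1})=\sum_{\alpha}\frac{[\operatorname{crit} f_\alpha]_{\rm vir}}{[G_\alpha]_{\rm vir}}\,y^\alpha .$$ Let $R(J_{\sigma,C},\alpha)$ be the set of representations of $Q_\sigma$ of dimension vector $\alpha$ that satisfy all relations $\partial w_\sigma/\partial a=0$ and on which the arrows in $C$ act by zero. On such a representation $V=\bigoplus_kV_k$ let $H=\sum_kh^+_{k+1/2}\in\operatorname{End}(V)$. Let $R^I(a)\subset R(J_{\sigma,C},(a,\dots,a))$ be the locus where $H$ is invertible and $R^N(\alpha)\subset R(J_{\sigma,C},\alpha)$ the locus where $H$ is nilpotent, and put $$I^\sigma(y)=\sum_{a\ge0}\frac{[R^I(a)]}{[\mathrm{GL}_a]^N}\,y^a,\qquad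 N^\sigma(y)=\sum_{\alpha}(-\mathbb L^{1/2})^{\sum_{i\in I_2}(\alpha_{i+1}-\alpha_i)^2}\,\frac{[R^N(\alpha)]}{[G_\alpha]}\,y^\alpha .$$ $\operatorname{Exp}$ is the plethystic exponential $\operatorname{Exp}(g)=\sum_n\sigma_n(g)$ of power series without constant term, where $\sigma_n(\mathbb L^{1/2})=\mathbb L^{n/2}$. It is needed only for series with coefficients in $\mathbb Z[\mathbb L^{\pm1/2},(1-\mathbb L^n)^{-1}]$, and there it is $\exp\bigl(\sum_{n\ge1}\psi_n(g)/n\bigr)$, computed over $\mathbb Q(\mathbb L^{1/2})$ with $\psi_n(\mathbb L^{1/2})=\mathbb L^{n/2}$ and $\psi_n(y_i)=y_i^n$. For $a,b\in\mathbb Z/N$ let $y_{[a,b]}=y_ay_{a+1}\cdots y_b$ (the product over the cyclic interval from $a$ to $b$, with between $1$ and $N$ factors), let $y'=y_0y_1\cdots y_{N-1}$, and let $S$ be the set of all $[a,b]$ with ($a\in I_3$ and $b\notin I_2$) or ($a\notin I_3$ and $b\in I_2$). **Proposition.** The classes $[\mathrm{GL}_n]$ are invertible in $\mathcal M$, so that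 the series above are defined, and 1. $A_U^\sigma(y)=I^\sigma(y_0y_1\cdots y_{N-1})\cdot N^\sigma(y)$; 2. $I^\sigma(y)=\operatorname{Exp}\Bigl(\mathbb L\,\dfrac{y}{1-y}\Bigr)$; 3. $N^\sigma(y)=\operatorname{Exp}\Bigl(\dfrac{\mathbb L}{\mathbb L-1}\,\dfrac{1}{1-y'}\Bigl(\sum_{[a,b]\notin S}y_{[a,b]}-\mathbb L^{-1/2}\sum_{[a,b]\in S}y_{[a,b]}\Bigr)\Bigr)$, the sums running over the $N^2$ pairs $(a,b)\in(\mathbb Z/N)^2$. -/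

import Mathlib

noncomputable section

namespace MotivicDT

/-! ## Constructible sets over the complex numbers and their Grothendieck ring -/

/-- Constructible subsets of the affine space `ℂ^ι` (Zariski topology): the smallest Boolean
algebra of subsets that contains the zero loci of polynomials. -/
inductive IsConstructible {ι : Type} : Set (ι → ℂ) → Prop
  | zeroLocus (p : MvPolynomial ι ℂ) : IsConstructible {x | MvPolynomial.eval x p = 0}
  | compl {X : Set (ι → ℂ)} : IsConstructible X → IsConstructible Xᶜ
  | inter {X Y : Set (ι → ℂ)} : IsConstructible X → IsConstructible Y → IsConstructible (X ∩ Y)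

theorem IsConstructible.univ {ι : Type} : IsConstructible (Set.univ : Set (ι → ℂ)) := by
  have h := IsConstructible.zeroLocus (0 : MvPolynomial ι ℂ)
  simpa using h

theorem IsConstructible.union {ι : Type} {X Y : Set (ι → ℂ)} (hX : IsConstructible X)
    (hY : IsConstructible Y) : IsConstructible (X ∪ Y) := by
  have h := (hX.compl.inter hY.compl).compl
  rwa [Set.compl_inter, compl_compl, compl_compl] at h

/-- The preimage of a constructible set under a coordinate map `ℂ^κ → ℂ^ι`. -/
theorem IsConstructible.comap {ι κ : Type} (e : ι → κ) {X : Set (ι → ℂ)}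
    (hX : IsConstructible X) : IsConstructible {z : κ → ℂ | z ∘ e ∈ X} := by
  induction hX with
  | zeroLocus p =>
    have h := IsConstructible.zeroLocus (MvPolynomial.rename e p)
    simpa [MvPolynomial.eval_rename] using h
  | compl _ ih => exact ih.compl
  | inter _ _ ih1 ih2 => exact ih1.inter ih2

/-- The product `X × Y`, as a subset of `ℂ^(ι ⊕ κ) = ℂ^ι × ℂ^κ`. -/
def prodSet {ι κ : Type} (X : Set (ι → ℂ)) (Y : Set (κ → ℂ)) : Set (ι ⊕ κ → ℂ) :=
  {z | z ∘ Sum.inl ∈ X} ∩ {z | z ∘ Sum.inr ∈ Y}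

theorem IsConstructible.prod {ι κ : Type} {X : Set (ι → ℂ)} {Y : Set (κ → ℂ)}
    (hX : IsConstructible X) (hY : IsConstructible Y) : IsConstructible (prodSet X Y) :=
  (hX.comap Sum.inl).inter (hY.comap Sum.inr)

/-- `F` restricts to a regular map on `X`: every component is, Zariski-locally on `X`, a quotient
of two polynomials. -/
def IsRegularOn {ι κ : Type} (X : Set (ι → ℂ)) (F : (ι → ℂ) → (κ → ℂ)) : Prop :=
  ∀ k : κ, ∀ x ∈ X, ∃ p q : MvPolynomial ι ℂ, MvPolynomial.eval x q ≠ 0 ∧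
    ∀ z ∈ X, MvPolynomial.eval z q ≠ 0 →
      F z k = MvPolynomial.eval z p / MvPolynomial.eval z q

/-- `X` and `Y` are isomorphic: there are mutually inverse regular maps between them. -/
def AreIsomorphic {ι κ : Type} (X : Set (ι → ℂ)) (Y : Set (κ → ℂ)) : Prop :=
  ∃ (F : (ι → ℂ) → (κ → ℂ)) (G : (κ → ℂ) → (ι → ℂ)),
    IsRegularOn X F ∧ IsRegularOn Y G ∧ Set.MapsTo F X Y ∧ Set.MapsTo G Y X ∧ Set.InvOn G F X Y

/-- A constructible subset of some finite-dimensional affine space. -/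
structure ConstructibleSet : Type 1 where
  ι : Type
  finite : Finite ι
  carrier : Set (ι → ℂ)
  constructible : IsConstructible carrier

/-- The constructible set given by `X ⊆ ℂ^ι`. -/
def cset {ι : Type} [hι : Finite ι] (X : Set (ι → ℂ)) (hX : IsConstructible X) :
    ConstructibleSet :=
  ⟨ι, hι, X, hX⟩

/-- The defining relations of the Grothendieck ring: isomorphic sets have the same class, the class
is additive on disjoint unions and multiplicative on products, and a point has class `1`. -/
inductive K0Rel : MvPolynomial ConstructibleSet ℤ → Prop
  | iso (X Y : ConstructibleSet) (h : AreIsomorphic X.carrier Y.carrier) :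
      K0Rel (MvPolynomial.X X - MvPolynomial.X Y)
  | union {ι : Type} [Finite ι] (X Y : Set (ι → ℂ)) (hX : IsConstructible X)
      (hY : IsConstructible Y) (h : Disjoint X Y) :
      K0Rel (MvPolynomial.X (cset (X ∪ Y) (hX.union hY)) -
        (MvPolynomial.X (cset X hX) + MvPolynomial.X (cset Y hY)))
  | prod {ι κ : Type} [Finite ι] [Finite κ] (X : Set (ι → ℂ)) (Y : Set (κ → ℂ))
      (hX : IsConstructible X) (hY : IsConstructible Y) :
      K0Rel (MvPolynomial.X (cset (prodSet X Y) (hX.prod hY)) -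
        MvPolynomial.X (cset X hX) * MvPolynomial.X (cset Y hY))
  | point : K0Rel (MvPolynomial.X (cset (Set.univ : Set (Empty → ℂ)) .univ) - 1)

/-- The Grothendieck ring `K₀(Var_ℂ)` of complex varieties, presented by generators and relations.
Every variety is a finite disjoint union of locally closed subsets of affine spaces, and every
constructible set is one of locally closed ones, so constructible sets give the usual ring. -/
abbrev K0 : Type 1 :=
  MvPolynomial ConstructibleSet ℤ ⧸ Ideal.span {r : MvPolynomial ConstructibleSet ℤ | K0Rel r}

/-- The class `[X]` in `K₀(Var_ℂ)` of a constructible set `X ⊆ ℂ^ι`. -/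
def K0.cls {ι : Type} [Finite ι] (X : Set (ι → ℂ)) (hX : IsConstructible X) : K0 :=
  Ideal.Quotient.mk _ (MvPolynomial.X (cset X hX))

/-- The class of the affine line. -/
def K0.lefschetz : K0 := K0.cls (Set.univ : Set (Unit → ℂ)) .univ

/-! ## The ring of motivic weights -/

/-- `K₀(Var_ℂ)[𝕃^{1/2}]`. -/
abbrev K0Sqrt : Type 1 :=
  AdjoinRoot (Polynomial.X ^ 2 - Polynomial.C K0.lefschetz)

/-- The element `𝕃^{1/2}` of `K₀(Var_ℂ)[𝕃^{1/2}]`. -/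
def K0Sqrt.sqrtL : K0Sqrt := AdjoinRoot.root _

/-- The multiplicative set generated by `𝕃^{1/2}` and the `1 - 𝕃^n`, `n ≥ 1`. -/
def motDenominators : Submonoid K0Sqrt :=
  Submonoid.closure
    (insert K0Sqrt.sqrtL (Set.range fun n : ℕ => 1 - K0Sqrt.sqrtL ^ (2 * (n + 1))))

/-- The ring of motivic weights `K₀(Var_ℂ)[𝕃^{1/2}, 𝕃^{-1/2}, (1 - 𝕃^n)^{-1} : n ≥ 1]`. -/
abbrev Mot : Type 1 := Localization motDenominators

/-- `𝕃^{1/2}` as a unit of the ring of motivic weights. -/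
def sqrtL : Motˣ :=
  IsUnit.unit (IsLocalization.map_units Mot
    (⟨K0Sqrt.sqrtL, Submonoid.subset_closure (Set.mem_insert _ _)⟩ : motDenominators))

/-- The class `[X]` in the ring of motivic weights. -/
def motive {ι : Type} [Finite ι] (X : Set (ι → ℂ)) (hX : IsConstructible X) : Mot :=
  algebraMap K0Sqrt Mot (AdjoinRoot.of _ (K0.cls X hX))

/-! ## The plethystic exponential

The ring `ℤ[s^{±1}, (1 - s^{2n})^{-1}]`, with `s = 𝕃^{1/2}`, is a torsion-free `λ`-ring with
`σ_n(s) = s^n`, that is, with Adams operations `ψ_n(s) = s^n`. It is contained in `ℚ(s)` and maps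
to the ring of motivic weights. For a power series `g` over `ℚ(s)` without constant term,
`Exp(g) = ∑ σ_n(g) = exp(∑_{n ≥ 1} ψ_n(g) / n)`, where `ψ_n(y_i) = y_i^n`. -/

/-- The multiplicative set generated by `s` and the `1 - s^{2n}`, `n ≥ 1`. -/
def coeffDenominators : Submonoid (Polynomial ℤ) :=
  Submonoid.closure (insert Polynomial.X
    (Set.range fun n : ℕ => 1 - (Polynomial.X : Polynomial ℤ) ^ (2 * (n + 1))))

/-- The ring `ℤ[s, s^{-1}, (1 - s^{2n})^{-1} : n ≥ 1]`. -/
abbrev CoeffRing : Type := Localization coeffDenominators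

theorem isUnit_eval₂_sqrtL (p : coeffDenominators) :
    IsUnit (Polynomial.eval₂RingHom (Int.castRingHom Mot) (sqrtL : Mot) p) := by
  have hle : coeffDenominators ≤ (IsUnit.submonoid Mot).comap
      (Polynomial.eval₂RingHom (Int.castRingHom Mot) (sqrtL : Mot)) := by
    refine Submonoid.closure_le.2 ?_
    rintro _ (rfl | ⟨n, rfl⟩)
    · change IsUnit _
      simp
    · change IsUnit _
      have h := IsLocalization.map_units Mot
        (⟨1 - K0Sqrt.sqrtL ^ (2 * (n + 1)),
          Submonoid.subset_closure (Set.mem_insert_of_mem _ ⟨n, rfl⟩)⟩ : motDenominators)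
      simpa [sqrtL] using h
  exact hle p.2

/-- The ring homomorphism from `ℤ[s^{±1}, (1 - s^{2n})^{-1}]` to the ring of motivic weights with
`s ↦ 𝕃^{1/2}`. -/
def toMot : CoeffRing →+* Mot := IsLocalization.lift isUnit_eval₂_sqrtL

theorem isUnit_eval₂_ratFunc (p : coeffDenominators) :
    IsUnit (Polynomial.eval₂RingHom (Int.castRingHom (RatFunc ℚ)) RatFunc.X p) := by
  have hle : coeffDenominators ≤ (IsUnit.submonoid (RatFunc ℚ)).comap
      (Polynomial.eval₂RingHom (Int.castRingHom (RatFunc ℚ)) RatFunc.X) := by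
    refine Submonoid.closure_le.2 ?_
    rintro _ (rfl | ⟨n, rfl⟩)
    · change IsUnit _
      simp [RatFunc.X_ne_zero]
    · change IsUnit _
      simp only [map_sub, map_one, map_pow, Polynomial.coe_eval₂RingHom, Polynomial.eval₂_X,
        isUnit_iff_ne_zero, ne_eq, sub_eq_zero]
      intro h
      rw [← RatFunc.algebraMap_X, ← map_pow, ← map_one (algebraMap (Polynomial ℚ) (RatFunc ℚ))]
        at h
      have h2 := congrArg Polynomial.natDegree (RatFunc.algebraMap_injective ℚ h)
      simp at h2
  exact hle p.2

/-- The inclusion of `ℤ[s^{±1}, (1 - s^{2n})^{-1}]` into `ℚ(s)`. -/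
def toRatFunc : CoeffRing →+* RatFunc ℚ := IsLocalization.lift isUnit_eval₂_ratFunc

theorem nonZeroDivisors_le_comap_expand (n : ℕ) :
    nonZeroDivisors (Polynomial ℚ) ≤ (nonZeroDivisors (Polynomial ℚ)).comap
      (Polynomial.expand ℚ (n + 1)) := by
  intro p hp
  rw [Submonoid.mem_comap, mem_nonZeroDivisors_iff_ne_zero]
  rw [mem_nonZeroDivisors_iff_ne_zero] at hp
  exact (Polynomial.expand_ne_zero n.succ_pos).2 hp

/-- The Adams operation `ψ_{n+1}` on `ℚ(s)`: the field endomorphism with `s ↦ s^{n+1}`. -/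
def adams (n : ℕ) : RatFunc ℚ →+* RatFunc ℚ :=
  RatFunc.mapRingHom (Polynomial.expand ℚ (n + 1)) (nonZeroDivisors_le_comap_expand n)

open Classical in
/-- `∑_{n ≥ 1} ψ_n(g) / n`: the coefficient of `y^α` is the sum of `ψ_m(g_{α/m}) / m` over the
`m = n + 1 ≥ 1` that divide `α`. -/
def adamsSum {τ : Type} (g : MvPowerSeries τ (RatFunc ℚ)) : MvPowerSeries τ (RatFunc ℚ) :=
  fun α => ∑ n ∈ Finset.range α.degree,
    if ∀ i, n + 1 ∣ α i then
      ((n + 1 : ℕ) : RatFunc ℚ)⁻¹ *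
        adams n (MvPowerSeries.coeff (α.mapRange (· / (n + 1)) (Nat.zero_div _)) g)
    else 0

/-- The plethystic exponential of a power series over `ℚ(s)` without constant term. -/
def plethysticExp {τ : Type} (g : MvPowerSeries τ (RatFunc ℚ)) : MvPowerSeries τ (RatFunc ℚ) :=
  PowerSeries.subst (adamsSum g) (PowerSeries.exp (RatFunc ℚ))

/-- `F = Exp(g)`, for a power series `F` over the ring of motivic weights: all coefficients of
`Exp(g)` lie in `ℤ[s^{±1}, (1 - s^{2n})^{-1}]`, and `s ↦ 𝕃^{1/2}` turns `Exp(g)` into `F`. -/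
def IsPlethysticExp {τ : Type} (F : MvPowerSeries τ Mot) (g : MvPowerSeries τ (RatFunc ℚ)) :
    Prop :=
  ∃ E : MvPowerSeries τ CoeffRing,
    MvPowerSeries.map toRatFunc E = plethysticExp g ∧ MvPowerSeries.map toMot E = F

/-! ## Polynomial functions (used to see that the sets below are constructible) -/

def IsPolyFun {ι : Type} (f : (ι → ℂ) → ℂ) : Prop :=
  ∃ p : MvPolynomial ι ℂ, ∀ x, f x = MvPolynomial.eval x p

theorem IsPolyFun.const {ι : Type} (c : ℂ) : IsPolyFun (fun _ : ι → ℂ => c) :=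
  ⟨MvPolynomial.C c, fun x => by simp⟩

theorem IsPolyFun.coord {ι : Type} (i : ι) : IsPolyFun (fun x : ι → ℂ => x i) :=
  ⟨MvPolynomial.X i, fun x => by simp⟩

theorem IsPolyFun.add {ι : Type} {f g : (ι → ℂ) → ℂ} (hf : IsPolyFun f) (hg : IsPolyFun g) :
    IsPolyFun (fun x => f x + g x) := by
  obtain ⟨p, hp⟩ := hf
  obtain ⟨q, hq⟩ := hg
  exact ⟨p + q, fun x => by simp [hp, hq]⟩

theorem IsPolyFun.mul {ι : Type} {f g : (ι → ℂ) → ℂ} (hf : IsPolyFun f) (hg : IsPolyFun g) :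
    IsPolyFun (fun x => f x * g x) := by
  obtain ⟨p, hp⟩ := hf
  obtain ⟨q, hq⟩ := hg
  exact ⟨p * q, fun x => by simp [hp, hq]⟩

theorem IsPolyFun.sum {κ : Type*} {τ : Type} (s : Finset κ) {f : κ → (τ → ℂ) → ℂ}
    (hf : ∀ k, IsPolyFun (f k)) : IsPolyFun (fun x => ∑ k ∈ s, f k x) := by
  choose p hp using hf
  exact ⟨∑ k ∈ s, p k, fun x => by simp [hp, map_sum]⟩

theorem IsPolyFun.prod {κ : Type*} {τ : Type} (s : Finset κ) {f : κ → (τ → ℂ) → ℂ}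
    (hf : ∀ k, IsPolyFun (f k)) : IsPolyFun (fun x => ∏ k ∈ s, f k x) := by
  choose p hp using hf
  exact ⟨∏ k ∈ s, p k, fun x => by simp [hp, map_prod]⟩

theorem IsPolyFun.constructible {ι : Type} {f : (ι → ℂ) → ℂ} (hf : IsPolyFun f) (c : ℂ) :
    IsConstructible {x | f x = c} := by
  obtain ⟨p, hp⟩ := hf
  have h := IsConstructible.zeroLocus (p - MvPolynomial.C c)
  simpa [hp, sub_eq_zero] using h

theorem IsConstructible.forall {ι : Type} {κ : Type*} [Finite κ] {P : κ → (ι → ℂ) → Prop}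
    (h : ∀ k, IsConstructible {x | P k x}) : IsConstructible {x | ∀ k, P k x} := by
  have key : ∀ s : Set κ, s.Finite → IsConstructible {x | ∀ k ∈ s, P k x} := by
    intro s hs
    induction s, hs using Set.Finite.induction_on with
    | empty => simpa using (IsConstructible.univ (ι := ι))
    | insert _ _ ih =>
      rename_i a s _ _
      have h2 := (h a).inter ih
      have h3 : {x | ∀ k ∈ insert a s, P k x} = {x | P a x} ∩ {x | ∀ k ∈ s, P k x} := by
        ext x
        simp
      rwa [h3]
  simpa using key Set.univ Set.finite_univ

/-- A matrix-valued function with polynomial entries. -/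
def IsPolyMat {ι m : Type} (f : (ι → ℂ) → Matrix m m ℂ) : Prop :=
  ∀ i j, IsPolyFun (fun x => f x i j)

theorem IsPolyMat.zero_constructible {ι m : Type} [Finite m] {f : (ι → ℂ) → Matrix m m ℂ}
    (hf : IsPolyMat f) : IsConstructible {x | f x = 0} := by
  have h : IsConstructible {x | ∀ i j, f x i j = 0} :=
    IsConstructible.forall fun i => IsConstructible.forall fun j => (hf i j).constructible 0
  have h2 : {x | f x = 0} = {x | ∀ i j, f x i j = 0} := by
    ext x
    simp [← Matrix.ext_iff]
  rwa [h2]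

theorem IsPolyMat.mul {ι m : Type} [Fintype m] {f g : (ι → ℂ) → Matrix m m ℂ}
    (hf : IsPolyMat f) (hg : IsPolyMat g) : IsPolyMat (fun x => f x * g x) := by
  intro i j
  simp only [Matrix.mul_apply]
  exact IsPolyFun.sum _ fun k => (hf i k).mul (hg k j)

theorem IsPolyMat.one {ι m : Type} [DecidableEq m] :
    IsPolyMat (fun _ : ι → ℂ => (1 : Matrix m m ℂ)) :=
  fun _ _ => IsPolyFun.const _

theorem IsPolyMat.pow {ι m : Type} [Fintype m] [DecidableEq m] {f : (ι → ℂ) → Matrix m m ℂ}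
    (hf : IsPolyMat f) (n : ℕ) : IsPolyMat (fun x => f x ^ n) := by
  induction n with
  | zero => simpa using (IsPolyMat.one (ι := ι) (m := m))
  | succ n ih => simpa only [pow_succ] using ih.mul hf

theorem IsPolyMat.sum {ι m : Type} {κ : Type*} (s : Finset κ) {f : κ → (ι → ℂ) → Matrix m m ℂ}
    (hf : ∀ k, IsPolyMat (f k)) : IsPolyMat (fun x => ∑ k ∈ s, f k x) := by
  intro i j
  simp only [Matrix.sum_apply]
  exact IsPolyFun.sum s fun k => hf k i j

theorem IsPolyMat.smul {ι m : Type} (c : ℂ) {f : (ι → ℂ) → Matrix m m ℂ}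
    (hf : IsPolyMat f) : IsPolyMat (fun x => c • f x) :=
  fun i j => (IsPolyFun.const c).mul (hf i j)

theorem IsPolyMat.det {ι m : Type} [Fintype m] [DecidableEq m] {f : (ι → ℂ) → Matrix m m ℂ}
    (hf : IsPolyMat f) : IsPolyFun (fun x => (f x).det) := by
  simp only [Matrix.det_apply']
  exact IsPolyFun.sum _ fun g => (IsPolyFun.const _).mul (IsPolyFun.prod _ fun i => hf _ _)

theorem IsPolyMat.isUnit_constructible {ι m : Type} [Fintype m] [DecidableEq m]
    {f : (ι → ℂ) → Matrix m m ℂ} (hf : IsPolyMat f) : IsConstructible {x | IsUnit (f x)} := by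
  have h := (hf.det.constructible 0).compl
  have h2 : {x | IsUnit (f x)} = {x | (f x).det = 0}ᶜ := by
    ext x
    simp [Matrix.isUnit_iff_isUnit_det, isUnit_iff_ne_zero]
  rwa [h2]

theorem IsPolyMat.isNilpotent_constructible {ι m : Type} [Fintype m] [DecidableEq m]
    {f : (ι → ℂ) → Matrix m m ℂ} (hf : IsPolyMat f) :
    IsConstructible {x | IsNilpotent (f x)} := by
  have h := (hf.pow (Fintype.card m)).zero_constructible
  have h2 : {x | IsNilpotent (f x)} = {x | f x ^ Fintype.card m = 0} := by
    ext x
    refine ⟨fun hx => ?_, fun hx => ⟨_, hx⟩⟩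
    have h3 := (Matrix.isNilpotent_charpoly_sub_pow_of_isNilpotent hx).eq_zero
    have h4 := Matrix.aeval_self_charpoly (f x)
    rw [sub_eq_zero.1 h3] at h4
    simpa using h4
  rwa [h2]

/-! ## Quivers with potential -/

/-- A quiver with vertex set `V` and arrow set `A`. -/
structure ArrowQuiver (V A : Type) where
  src : A → V
  tgt : A → V

/-- A potential on a quiver with arrow set `A`: a linear combination of cyclic paths. The word
`[a₁, …, a_n]` stands for the composition `a₁ ∘ ⋯ ∘ a_n`. -/
abbrev Potential (A : Type) : Type := List A →₀ ℂ

namespace ArrowQuiver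

variable {V A : Type} (Q : ArrowQuiver V A)

/-- The coordinates on `R(Q, α) = ⨁_a Hom(ℂ^(α (src a)), ℂ^(α (tgt a)))`: the matrix entries. -/
abbrev Coord (α : V → ℕ) : Type := (a : A) × (Fin (α (Q.tgt a)) × Fin (α (Q.src a)))

/-- The space `R(Q, α)`. -/
abbrev Rep (α : V → ℕ) : Type := Q.Coord α → ℂ

variable {Q} in
/-- The map of the arrow `a` in the representation `M`, as an endomorphism of `⨁_v ℂ^(α v)`
(a block matrix whose only block is the one from `src a` to `tgt a`). -/
def Rep.mat [DecidableEq V] {α : V → ℕ} (M : Q.Rep α) (a : A) :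
    Matrix ((v : V) × Fin (α v)) ((v : V) × Fin (α v)) ℂ :=
  fun x y => if h : x.1 = Q.tgt a ∧ y.1 = Q.src a then
    M ⟨a, Fin.cast (congrArg α h.1) x.2, Fin.cast (congrArg α h.2) y.2⟩ else 0

theorem isPolyMat_mat [DecidableEq V] {α : V → ℕ} (a : A) : IsPolyMat (fun M : Q.Rep α => M.mat a) := by
  intro i j
  simp only [Rep.mat]
  split_ifs with h
  · exact IsPolyFun.coord _
  · exact IsPolyFun.const 0

variable [Fintype V] [DecidableEq V] [Fintype A] [DecidableEq A]

variable {Q} in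
/-- The composition of the maps along a word of arrows. -/
def Rep.word {α : V → ℕ} (M : Q.Rep α) (w : List A) :
    Matrix ((v : V) × Fin (α v)) ((v : V) × Fin (α v)) ℂ :=
  (w.map M.mat).prod

variable {Q} in
/-- The function `f_α = Tr(W) : R(Q, α) → ℂ` of the potential `W`. -/
def Rep.traceFun {α : V → ℕ} (M : Q.Rep α) (W : Potential A) : ℂ :=
  W.sum fun w c => c * (M.word w).trace

variable {Q} in
/-- The value on `M` of the cyclic derivative `∂W/∂a`: the derivative of the cyclic word
`a₁ ⋯ a_n` is the sum, over the `j` with `a_j = a`, of the words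
`a_{j+1} ⋯ a_n a₁ ⋯ a_{j-1}`. -/
def Rep.cyclicDeriv {α : V → ℕ} (M : Q.Rep α) (W : Potential A) (a : A) :
    Matrix ((v : V) × Fin (α v)) ((v : V) × Fin (α v)) ℂ :=
  W.sum fun w c => c • ∑ j : Fin w.length,
    if w.get j = a then M.word (w.drop (j + 1) ++ w.take j) else 0

/-- `R(J_C, α)`: the representations of the truncated Jacobian algebra
`J_C = J(Q, W) / ⟨C⟩`, that is, the representations of `Q` that satisfy the relations `∂W/∂a = 0`
and on which the arrows in `C` act by zero. -/
def truncatedReps (W : Potential A) (C : Set A) (α : V → ℕ) : Set (Q.Rep α) :=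
  {M | (∀ a ∈ C, M.mat a = 0) ∧ ∀ a, M.cyclicDeriv W a = 0}

theorem isPolyMat_word {α : V → ℕ} (w : List A) :
    IsPolyMat (fun M : Q.Rep α => M.word w) := by
  induction w with
  | nil => simpa [Rep.word] using (IsPolyMat.one (ι := Q.Coord α))
  | cons a w ih => simpa [Rep.word] using (Q.isPolyMat_mat a).mul ih

theorem isPolyFun_traceFun {α : V → ℕ} (W : Potential A) :
    IsPolyFun (fun M : Q.Rep α => M.traceFun W) := by
  refine IsPolyFun.sum _ fun w => (IsPolyFun.const _).mul ?_
  exact IsPolyFun.sum _ fun i => Q.isPolyMat_word w i i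

theorem isPolyMat_cyclicDeriv {α : V → ℕ} (W : Potential A) (a : A) :
    IsPolyMat (fun M : Q.Rep α => M.cyclicDeriv W a) := by
  refine IsPolyMat.sum _ fun w => IsPolyMat.smul _ (IsPolyMat.sum _ fun j => ?_)
  split_ifs with h
  · exact Q.isPolyMat_word _
  · exact fun _ _ => IsPolyFun.const 0

theorem constructible_truncatedReps (W : Potential A) (C : Set A) (α : V → ℕ) :
    IsConstructible (Q.truncatedReps W C α) := by
  refine IsConstructible.inter (X := {M : Q.Rep α | ∀ a ∈ C, M.mat a = 0}) ?_
    (IsConstructible.forall fun a => (Q.isPolyMat_cyclicDeriv W a).zero_constructible)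
  have h : IsConstructible {M : Q.Rep α | ∀ a : C, M.mat (a : A) = 0} :=
    IsConstructible.forall fun a => (Q.isPolyMat_mat a).zero_constructible
  simpa using h

/-- `[GL_n]`. -/
def _root_.MotivicDT.motiveGL (n : ℕ) : Mot :=
  motive {g : Fin n × Fin n → ℂ | IsUnit (Matrix.of fun i j => g (i, j))}
    (IsPolyMat.isUnit_constructible fun i j => IsPolyFun.coord (i, j))

/-- `[G_α] = ∏_v [GL_(α_v)]`. -/
def _root_.MotivicDT.motiveG (α : V → ℕ) : Mot := ∏ v, motiveGL (α v)

/-- The dimension of `R(Q, α)`. -/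
def dimRep (α : V → ℕ) : ℕ := ∑ a, α (Q.tgt a) * α (Q.src a)

/-- The class `[φ_f] = [f⁻¹(1)] - [f⁻¹(0)]` of the motivic vanishing cycle of `f = f_α = Tr(W)` on
`R(Q, α)`. (This is the class for potentials that admit a cut: `f` then has weight one for the
linear `ℂ^*`-action with weights `0` and `1` given by the cut.) -/
def vanishingCycle (W : Potential A) (α : V → ℕ) : Mot :=
  motive {M : Q.Rep α | M.traceFun W = 1} ((Q.isPolyFun_traceFun W).constructible 1) -
    motive {M : Q.Rep α | M.traceFun W = 0} ((Q.isPolyFun_traceFun W).constructible 0)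

/-- The virtual motive `[crit(f_α)]_vir = -(-𝕃^{1/2})^{-dim R(Q, α)} [φ_{f_α}]`. -/
def virtualCrit (W : Potential A) (α : V → ℕ) : Mot :=
  -(((-sqrtL) ^ (-(Q.dimRep α : ℤ)) : Motˣ) : Mot) * Q.vanishingCycle W α

/-- The virtual motive `[G_α]_vir = (-𝕃^{1/2})^{-dim G_α} [G_α]`. -/
def _root_.MotivicDT.virtualG (α : V → ℕ) : Mot :=
  (((-sqrtL) ^ (-(∑ v, (α v : ℤ) ^ 2)) : Motˣ) : Mot) * motiveG α

/-- The universal series `A_U(y) = ∑_α [crit(f_α)]_vir / [G_α]_vir y^α`. -/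
def universalSeries (W : Potential A) : MvPowerSeries V Mot :=
  fun α => Q.virtualCrit W α * Ring.inverse (virtualG (α : V → ℕ))

end ArrowQuiver

/-! ## The quiver with potential of a partition of the trapezoid -/

/-- A partition `σ` of the trapezoid with vertices `(0,0)`, `(0,1)`, `(N₀,0)`, `(N₁,1)`. The
element `j` of `ZMod (N₀ + N₁)` stands for the half-integer `j + 1/2`, and the natural number
`σx j` for the half-integer `σ_x(j + 1/2) = σx j + 1/2`. -/
structure TrapezoidPartition (N₀ N₁ : ℕ) where
  σx : ZMod (N₀ + N₁) → ℕ
  σy : ZMod (N₀ + N₁) → Fin 2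
  bijOn : Set.BijOn (fun j => (σx j, σy j)) Set.univ
    {z : ℕ × Fin 2 | (z.2 = 0 ∧ z.1 < N₀) ∨ (z.2 = 1 ∧ z.1 < N₁)}
  anti : ∀ i j, i.val < j.val → σy i = σy j → σx j < σx i

namespace TrapezoidPartition

variable {N₀ N₁ : ℕ} (σ : TrapezoidPartition N₀ N₁)

/-- The set `Î_r` of vertices that carry a loop: the `k` with `σ_y(k - 1/2) = σ_y(k + 1/2)`. -/
def loopVertices : Set (ZMod (N₀ + N₁)) := {k | σ.σy (k - 1) = σ.σy k}

instance : DecidablePred (· ∈ σ.loopVertices) :=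
  fun k => inferInstanceAs (Decidable (σ.σy (k - 1) = σ.σy k))

/-- The arrows of `Q_σ`: `h^+_{j+1/2}`, `h^-_{j+1/2}` for `j ∈ ℤ/N`, and `r_k` for `k ∈ Î_r`. -/
abbrev Arrow : Type := ZMod (N₀ + N₁) ⊕ ZMod (N₀ + N₁) ⊕ {k // k ∈ σ.loopVertices}

/-- `h^+_{j+1/2} : j → j + 1`. -/
abbrev hPlus (j : ZMod (N₀ + N₁)) : σ.Arrow := Sum.inl j

/-- `h^-_{j+1/2} : j + 1 → j`. -/
abbrev hMinus (j : ZMod (N₀ + N₁)) : σ.Arrow := Sum.inr (Sum.inl j)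

/-- `r_k : k → k`. -/
abbrev loop (k : {k // k ∈ σ.loopVertices}) : σ.Arrow := Sum.inr (Sum.inr k)

/-- The quiver `Q_σ`. -/
def quiver : ArrowQuiver (ZMod (N₀ + N₁)) σ.Arrow where
  src := Sum.elim (fun j => j) (Sum.elim (fun j => j + 1) (fun k => k))
  tgt := Sum.elim (fun j => j + 1) (Sum.elim (fun j => j) (fun k => k))

/-- The sign `(-1)^{σ_y(j + 1/2)}`. -/
def sign (j : ZMod (N₀ + N₁)) : ℂ := (-1) ^ (σ.σy j : ℕ)

variable [NeZero (N₀ + N₁)]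

/-- The potential `w_σ`. Every vertex `k ∈ Î_r` (a row of hexagons of the bipartite graph on the
torus) contributes the two terms `r_k h^+_{k-1/2} h^-_{k-1/2}` and `r_k h^-_{k+1/2} h^+_{k+1/2}`
with opposite signs, and every other vertex (a row of rhombi) the term
`h^+_{k-1/2} h^-_{k-1/2} h^-_{k+1/2} h^+_{k+1/2}`. The signs are such that every arrow occurs in one
term with the sign `+` and in one with the sign `-`. -/
def potential : Potential σ.Arrow :=
  ∑ k : ZMod (N₀ + N₁),
    if hk : k ∈ σ.loopVertices then
      Finsupp.single [σ.loop ⟨k, hk⟩, σ.hPlus (k - 1), σ.hMinus (k - 1)] (σ.sign (k - 1)) +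
        Finsupp.single [σ.loop ⟨k, hk⟩, σ.hMinus k, σ.hPlus k] (-σ.sign k)
    else
      Finsupp.single [σ.hPlus (k - 1), σ.hMinus (k - 1), σ.hMinus k, σ.hPlus k] (σ.sign (k - 1))

/-- The universal series `A_U^σ(y_0, …, y_{N-1})`. -/
def universalSeries : MvPowerSeries (ZMod (N₀ + N₁)) Mot := σ.quiver.universalSeries σ.potential

/-! ### The special partition: loops at the first `N'` vertices -/

/-- `I₂ = {N', N' + 2, …, N - 2}`. -/
def _root_.MotivicDT.I₂ (N N' : ℕ) : Set (ZMod N) := {k | N' ≤ k.val ∧ Even (k.val - N')}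

/-- `I₃ = {N' + 1, N' + 3, …, N - 1}`. -/
def _root_.MotivicDT.I₃ (N N' : ℕ) : Set (ZMod N) := {k | N' ≤ k.val ∧ Odd (k.val - N')}

/-- The cut `C = {h^-_i | i - 1/2 ∉ I₂}`. -/
def cut (N' : ℕ) : Set σ.Arrow := {a | ∃ j, j ∉ I₂ (N₀ + N₁) N' ∧ a = σ.hMinus j}

variable {σ} in
/-- The endomorphism `H = ∑_i h^+_i` of `⨁_k V_k`. -/
def cyclicMap {α : ZMod (N₀ + N₁) → ℕ} (M : σ.quiver.Rep α) :
    Matrix ((k : ZMod (N₀ + N₁)) × Fin (α k)) ((k : ZMod (N₀ + N₁)) × Fin (α k)) ℂ :=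
  ∑ j, M.mat (σ.hPlus j)

theorem isPolyMat_cyclicMap {α : ZMod (N₀ + N₁) → ℕ} :
    IsPolyMat (fun M : σ.quiver.Rep α => cyclicMap M) :=
  IsPolyMat.sum _ fun j => σ.quiver.isPolyMat_mat (σ.hPlus j)

/-- `[R^I(a)]`, where `R^I(a)` is the set of the `J_{σ,C}`-modules of dimension vector `(a, …, a)`
for which `H` is invertible. -/
def motiveInvertible (N' a : ℕ) : Mot :=
  motive (σ.quiver.truncatedReps σ.potential (σ.cut N') (fun _ => a) ∩ {M | IsUnit (cyclicMap M)})
    ((σ.quiver.constructible_truncatedReps _ _ _).inter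
      σ.isPolyMat_cyclicMap.isUnit_constructible)

/-- `[R^N(α)]`, where `R^N(α)` is the set of the `J_{σ,C}`-modules of dimension vector `α` for which
`H` is nilpotent. -/
def motiveNilpotent (N' : ℕ) (α : ZMod (N₀ + N₁) → ℕ) : Mot :=
  motive (σ.quiver.truncatedReps σ.potential (σ.cut N') α ∩ {M | IsNilpotent (cyclicMap M)})
    ((σ.quiver.constructible_truncatedReps _ _ _).inter
      σ.isPolyMat_cyclicMap.isNilpotent_constructible)

/-- `I^σ(y) = ∑_a [R^I(a)] / [GL_a]^N y^a`. -/
def invertibleSeries (N' : ℕ) : PowerSeries Mot :=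
  PowerSeries.mk fun a => σ.motiveInvertible N' a * Ring.inverse (motiveGL a ^ (N₀ + N₁))

open Classical in
/-- `N^σ(y) = ∑_α (-𝕃^{1/2})^{∑_{i ∈ I₂} (α_{i+1} - α_i)²} [R^N(α)] / [G_α] y^α`. -/
def nilpotentSeries (N' : ℕ) : MvPowerSeries (ZMod (N₀ + N₁)) Mot :=
  fun α =>
    (((-sqrtL) ^ (∑ i with i ∈ I₂ (N₀ + N₁) N', ((α (i + 1) : ℤ) - (α i : ℤ)) ^ 2) : Motˣ) : Mot) *
      (σ.motiveNilpotent N' α * Ring.inverse (motiveG (α : ZMod (N₀ + N₁) → ℕ)))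

end TrapezoidPartition

/-! ## The arguments of the plethystic exponentials -/

/-- `𝕃^{1/2}` in `ℚ(s)`. -/
def sq : RatFunc ℚ := RatFunc.X

/-- `y_[a,b] = y_a y_{a+1} ⋯ y_b`, where `[a, b]` is the cyclic interval from `a` to `b`. -/
def yInterval {N : ℕ} (a b : ZMod N) : MvPowerSeries (ZMod N) (RatFunc ℚ) :=
  ∏ r ∈ Finset.range ((b - a).val + 1), MvPowerSeries.X (a + (r : ZMod N))

/-- `S`: the `[a, b]` with `a ∈ I₃` and `b ∉ I₂`, or `a ∉ I₃` and `b ∈ I₂`. -/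
def intervalSet (N N' : ℕ) : Set (ZMod N × ZMod N) :=
  {z | (z.1 ∈ I₃ N N' ∧ z.2 ∉ I₂ N N') ∨ (z.1 ∉ I₃ N N' ∧ z.2 ∈ I₂ N N')}

/-- `𝕃 y / (1 - y)`. -/
def invertibleArgument : PowerSeries (RatFunc ℚ) :=
  PowerSeries.C (sq ^ 2) * (PowerSeries.X * (1 - PowerSeries.X)⁻¹)

open Classical in
/-- `𝕃/(𝕃-1) · 1/(1-y') · (∑_{[a,b] ∉ S} y_[a,b] - 𝕃^{-1/2} ∑_{[a,b] ∈ S} y_[a,b])` with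
`y' = y_0 ⋯ y_{N-1}`. -/
def nilpotentArgument (N N' : ℕ) [NeZero N] : MvPowerSeries (ZMod N) (RatFunc ℚ) :=
  MvPowerSeries.C (sq ^ 2 / (sq ^ 2 - 1)) * (1 - ∏ i : ZMod N, MvPowerSeries.X i)⁻¹ *
    ((∑ z : ZMod N × ZMod N with z ∉ intervalSet N N', yInterval z.1 z.2) -
      MvPowerSeries.C sq⁻¹ *
        ∑ z : ZMod N × ZMod N with z ∈ intervalSet N N', yInterval z.1 z.2)

end MotivicDT

end

noncomputable section

namespace MotivicDT

/-! ## Tame maps: maps given by field operations, with `0⁻¹ = 0` -/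

section Tame

variable {E F G : Type} [AddCommGroup E] [Module ℂ E] [AddCommGroup F] [Module ℂ F]
  [AddCommGroup G] [Module ℂ G]

/-- The functions generated by linear forms and constants under the field operations. -/
inductive TameFn : (E → ℂ) → Prop
  | linear (φ : E →ₗ[ℂ] ℂ) : TameFn (fun x => φ x)
  | const (c : ℂ) : TameFn (fun _ => c)
  | add {f g : E → ℂ} : TameFn f → TameFn g → TameFn (fun x => f x + g x)
  | mul {f g : E → ℂ} : TameFn f → TameFn g → TameFn (fun x => f x * g x)
  | inv {f : E → ℂ} : TameFn f → TameFn (fun x => (f x)⁻¹)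

/-- A map all of whose coordinates are generated by linear forms under the field operations. -/
@[fun_prop]
def Tame (f : E → F) : Prop := ∀ φ : F →ₗ[ℂ] ℂ, TameFn (fun x => φ (f x))

theorem tame_iff_tameFn {f : E → ℂ} : Tame f ↔ TameFn f := by
  refine ⟨fun h => h LinearMap.id, fun h φ => ?_⟩
  have : (fun x => φ (f x)) = fun x => f x * φ 1 := by
    funext x
    rw [← smul_eq_mul, ← map_smul, smul_eq_mul, mul_one]
  rw [this]
  exact h.mul (.const _)

theorem TameFn.comp {g : F → ℂ} (hg : TameFn g) {f : E → F} (hf : Tame f) :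
    TameFn (fun x => g (f x)) := by
  induction hg with
  | linear φ => exact hf φ
  | const c => exact .const c
  | add _ _ h1 h2 => exact h1.add h2
  | mul _ _ h1 h2 => exact h1.mul h2
  | inv _ h => exact h.inv

@[fun_prop]
theorem tame_id : Tame (fun x : E => x) := fun φ => .linear φ

@[fun_prop]
theorem tame_const (c : F) : Tame (fun _ : E => c) := fun φ => .const (φ c)

@[fun_prop]
theorem Tame.comp {g : F → G} {f : E → F} (hg : Tame g) (hf : Tame f) :
    Tame (fun x => g (f x)) := fun φ => (hg φ).comp hf

theorem Tame.linear (L : F →ₗ[ℂ] G) {f : E → F} (hf : Tame f) : Tame (fun x => L (f x)) :=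
  fun φ => hf (φ ∘ₗ L)

@[fun_prop]
theorem Tame.add {f g : E → F} (hf : Tame f) (hg : Tame g) : Tame (fun x => f x + g x) := by
  intro φ
  simpa only [map_add] using (hf φ).add (hg φ)

@[fun_prop]
theorem Tame.mul {f g : E → ℂ} (hf : Tame f) (hg : Tame g) : Tame (fun x => f x * g x) :=
  tame_iff_tameFn.2 ((tame_iff_tameFn.1 hf).mul (tame_iff_tameFn.1 hg))

@[fun_prop]
theorem Tame.inv {f : E → ℂ} (hf : Tame f) : Tame (fun x => (f x)⁻¹) :=
  tame_iff_tameFn.2 (tame_iff_tameFn.1 hf).inv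

@[fun_prop]
theorem Tame.smul {f : E → ℂ} {g : E → F} (hf : Tame f) (hg : Tame g) :
    Tame (fun x => f x • g x) := by
  intro φ
  simpa only [map_smul, smul_eq_mul] using (tame_iff_tameFn.1 hf).mul (hg φ)

@[fun_prop]
theorem Tame.neg {f : E → F} (hf : Tame f) : Tame (fun x => -f x) := by
  simpa only [neg_smul, one_smul] using (tame_const (-1 : ℂ)).smul hf

@[fun_prop]
theorem Tame.sub {f g : E → F} (hf : Tame f) (hg : Tame g) : Tame (fun x => f x - g x) := by
  simpa only [sub_eq_add_neg] using hf.add hg.neg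

@[fun_prop]
theorem Tame.div {f g : E → ℂ} (hf : Tame f) (hg : Tame g) : Tame (fun x => f x / g x) := by
  simpa only [div_eq_mul_inv] using hf.mul hg.inv

@[fun_prop]
theorem Tame.sum {κ : Type*} (s : Finset κ) {f : κ → E → F} (hf : ∀ k, Tame (f k)) :
    Tame (fun x => ∑ k ∈ s, f k x) := by
  classical
  induction s using Finset.induction_on with
  | empty => simpa using tame_const (0 : F)
  | insert a s ha ih => simpa only [Finset.sum_insert ha] using (hf a).add ih

@[fun_prop]
theorem Tame.prod {κ : Type*} (s : Finset κ) {f : κ → E → ℂ} (hf : ∀ k, Tame (f k)) :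
    Tame (fun x => ∏ k ∈ s, f k x) := by
  classical
  induction s using Finset.induction_on with
  | empty => simpa using tame_const (1 : ℂ)
  | insert a s ha ih => simpa only [Finset.prod_insert ha] using (hf a).mul ih

@[fun_prop]
theorem Tame.prodMk {f : E → F} {g : E → G} (hf : Tame f) (hg : Tame g) :
    Tame (fun x => (f x, g x)) := by
  intro φ
  have h := (hf (φ ∘ₗ LinearMap.inl ℂ F G)).add (hg (φ ∘ₗ LinearMap.inr ℂ F G))
  simpa [← map_add] using h

@[fun_prop]
theorem Tame.fst {f : E → F × G} (hf : Tame f) : Tame (fun x => (f x).1) :=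
  hf.linear (LinearMap.fst ℂ F G)

@[fun_prop]
theorem Tame.snd {f : E → F × G} (hf : Tame f) : Tame (fun x => (f x).2) :=
  hf.linear (LinearMap.snd ℂ F G)

@[fun_prop]
theorem Tame.pi {ι : Type} [Finite ι] {V : ι → Type} [∀ i, AddCommGroup (V i)]
    [∀ i, Module ℂ (V i)] {f : E → ∀ i, V i} (hf : ∀ i, Tame (fun x => f x i)) : Tame f := by
  classical
  have := Fintype.ofFinite ι
  have : f = fun x => ∑ i, LinearMap.single ℂ V i (f x i) := by
    funext x
    simp [LinearMap.coe_single, Finset.univ_sum_single]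
  rw [this]
  exact Tame.sum _ fun i => (hf i).linear _

@[fun_prop]
theorem tame_apply {ι : Type} {V : ι → Type} [∀ i, AddCommGroup (V i)] [∀ i, Module ℂ (V i)]
    (i : ι) : Tame (fun x : ∀ i, V i => x i) := fun φ => .linear (φ ∘ₗ LinearMap.proj i)

theorem Tame.apply {ι : Type} {V : ι → Type} [∀ i, AddCommGroup (V i)]
    [∀ i, Module ℂ (V i)] {f : E → ∀ i, V i} (hf : Tame f) (i : ι) : Tame (fun x => f x i) :=
  hf.linear (LinearMap.proj i)

theorem Tame.matrix {m n : Type} [Finite m] [Finite n] {A : E → Matrix m n ℂ}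
    (h : ∀ i j, Tame (fun x => A x i j)) : Tame A :=
  Tame.pi (V := fun _ : m => n → ℂ) fun i => Tame.pi fun j => h i j

theorem Tame.entry {m n : Type} {A : E → Matrix m n ℂ} (h : Tame A) (i : m) (j : n) :
    Tame (fun x => A x i j) :=
  h.linear (Matrix.entryLinearMap ℂ ℂ i j)

@[fun_prop]
theorem Tame.matrixMul {l m n : Type} [Finite l] [Fintype m] [Finite n] {A : E → Matrix l m ℂ}
    {B : E → Matrix m n ℂ} (hA : Tame A) (hB : Tame B) : Tame (fun x => A x * B x) := by
  refine Tame.matrix fun i j => ?_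
  simp only [Matrix.mul_apply]
  exact Tame.sum _ fun k => (hA.entry i k).mul (hB.entry k j)

@[fun_prop]
theorem Tame.mulVec {m n : Type} [Finite m] [Fintype n] {A : E → Matrix m n ℂ}
    {b : E → n → ℂ} (hA : Tame A) (hb : Tame b) : Tame (fun x => (A x).mulVec (b x)) := by
  refine Tame.pi fun i => ?_
  simp only [Matrix.mulVec, dotProduct]
  exact Tame.sum _ fun k => (hA.entry i k).mul (hb.apply k)

@[fun_prop]
theorem Tame.matrixPow {m : Type} [Fintype m] [DecidableEq m] {A : E → Matrix m m ℂ}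
    (hA : Tame A) (n : ℕ) : Tame (fun x => A x ^ n) := by
  induction n with
  | zero => simpa using tame_const (1 : Matrix m m ℂ)
  | succ n ih => simpa only [pow_succ] using ih.matrixMul hA

@[fun_prop]
theorem Tame.det {m : Type} [Fintype m] [DecidableEq m] {A : E → Matrix m m ℂ}
    (hA : Tame A) : Tame (fun x => (A x).det) := by
  simp only [Matrix.det_apply']
  exact Tame.sum _ fun σ => (tame_const _).mul (Tame.prod _ fun i => hA.entry _ _)

@[fun_prop]
theorem Tame.matrixInv {m : Type} [Fintype m] [DecidableEq m] {A : E → Matrix m m ℂ}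
    (hA : Tame A) : Tame (fun x => (A x)⁻¹) := by
  simp only [Matrix.inv_def, Ring.inverse_eq_inv']
  refine hA.det.inv.smul (Tame.matrix fun i j => ?_)
  simp only [Matrix.adjugate_apply]
  refine Tame.det (Tame.matrix fun k l => ?_)
  by_cases h : k = j
  · subst h
    simpa using tame_const _
  · simpa [Matrix.updateRow_ne h] using hA.entry k l

@[fun_prop]
theorem Tame.submatrix {m n m' n' : Type} [Finite m'] [Finite n'] {A : E → Matrix m n ℂ}
    (hA : Tame A) (e : m' → m) (e' : n' → n) : Tame (fun x => (A x).submatrix e e') :=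
  Tame.matrix fun i j => hA.entry (e i) (e' j)

@[fun_prop]
theorem Tame.fromBlocks {m n m' n' : Type} [Finite m] [Finite n] [Finite m'] [Finite n']
    {A : E → Matrix m n ℂ} {B : E → Matrix m n' ℂ} {C : E → Matrix m' n ℂ}
    {D : E → Matrix m' n' ℂ} (hA : Tame A) (hB : Tame B) (hC : Tame C) (hD : Tame D) :
    Tame (fun x => Matrix.fromBlocks (A x) (B x) (C x) (D x)) := by
  refine Tame.matrix fun i j => ?_
  rcases i with i | i <;> rcases j with j | j
  · exact hA.entry i j
  · exact hB.entry i j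
  · exact hC.entry i j
  · exact hD.entry i j

theorem Tame.ite_ne {f : E → ℂ} {g h : E → F} (hf : Tame f) (hg : Tame g) (hh : Tame h) :
    Tame (fun x => (f x * (f x)⁻¹) • g x + (1 - f x * (f x)⁻¹) • h x) := by
  fun_prop

/-! ### Constructible subsets of vector spaces -/

/-- A constructible subset of a vector space: the zero locus of a tame function. -/
def Cons (X : Set E) : Prop := ∃ f : E → ℂ, Tame f ∧ X = {x | f x = 0}

theorem Cons.eq_zero {f : E → ℂ} (hf : Tame f) : Cons {x | f x = 0} := ⟨f, hf, rfl⟩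

theorem Cons.compl {X : Set E} (hX : Cons X) : Cons Xᶜ := by
  obtain ⟨f, hf, rfl⟩ := hX
  refine ⟨fun x => 1 - f x * (f x)⁻¹, by fun_prop, ?_⟩
  ext x
  by_cases h : f x = 0 <;> simp [h]

theorem Cons.inter {X Y : Set E} (hX : Cons X) (hY : Cons Y) : Cons (X ∩ Y) := by
  obtain ⟨f, hf, rfl⟩ := hX
  obtain ⟨g, hg, rfl⟩ := hY
  refine ⟨fun x => 1 - (1 - f x * (f x)⁻¹) * (1 - g x * (g x)⁻¹), by fun_prop, ?_⟩
  ext x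
  by_cases h : f x = 0 <;> by_cases h' : g x = 0 <;> simp [h, h']

theorem Cons.univ : Cons (Set.univ : Set E) := ⟨fun _ => 0, by fun_prop, by simp⟩

theorem Cons.empty : Cons (∅ : Set E) := by simpa using (Cons.univ (E := E)).compl

theorem Cons.union {X Y : Set E} (hX : Cons X) (hY : Cons Y) : Cons (X ∪ Y) := by
  have h := (hX.compl.inter hY.compl).compl
  rwa [Set.compl_inter, compl_compl, compl_compl] at h

theorem Cons.diff {X Y : Set E} (hX : Cons X) (hY : Cons Y) : Cons (X \ Y) :=
  hX.inter hY.compl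

theorem Cons.preimage {X : Set F} (hX : Cons X) {f : E → F} (hf : Tame f) :
    Cons {x | f x ∈ X} := by
  obtain ⟨g, hg, rfl⟩ := hX
  exact ⟨fun x => g (f x), hg.comp hf, rfl⟩

theorem Cons.and {p q : E → Prop} (hp : Cons {x | p x}) (hq : Cons {x | q x}) :
    Cons {x | p x ∧ q x} := hp.inter hq

theorem Cons.biInter {κ : Type*} (s : Finset κ) {X : κ → Set E} (h : ∀ k ∈ s, Cons (X k)) :
    Cons (⋂ k ∈ s, X k) := by
  classical
  induction s using Finset.induction_on with
  | empty => simpa using Cons.univ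
  | insert a s ha ih =>
    rw [Finset.set_biInter_insert]
    exact (h a (Finset.mem_insert_self a s)).inter
      (ih fun k hk => h k (Finset.mem_insert_of_mem hk))

theorem Cons.forall {κ : Type*} [Finite κ] {p : κ → E → Prop} (h : ∀ k, Cons {x | p k x}) :
    Cons {x | ∀ k, p k x} := by
  have := Fintype.ofFinite κ
  have := Cons.biInter (Finset.univ : Finset κ) (X := fun k => {x | p k x}) fun k _ => h k
  simpa [Set.ofPred_forall] using this

theorem Cons.eq [FiniteDimensional ℂ F] {f g : E → F} (hf : Tame f) (hg : Tame g) :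
    Cons {x | f x = g x} := by
  let b := Module.finBasis ℂ F
  have h : Cons {x | ∀ i, b.coord i (f x - g x) = 0} :=
    Cons.forall fun i => Cons.eq_zero ((hf.sub hg).linear (b.coord i))
  convert h using 1
  ext x
  simp only [Set.mem_ofPred_eq, Module.Basis.forall_coord_eq_zero_iff, sub_eq_zero]

theorem Cons.isUnit {m : Type} [Fintype m] [DecidableEq m] {A : E → Matrix m m ℂ}
    (hA : Tame A) : Cons {x | IsUnit (A x)} := by
  have := (Cons.eq_zero hA.det).compl
  convert this using 1
  ext x
  simp [Matrix.isUnit_iff_isUnit_det]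

theorem Cons.prodSet {X : Set E} {Y : Set F} (hX : Cons X) (hY : Cons Y) : Cons (X ×ˢ Y) :=
  (hX.preimage (f := fun z : E × F => z.1) (by fun_prop)).inter
    (hY.preimage (f := fun z : E × F => z.2) (by fun_prop))

theorem Cons.pi {ι : Type} [Finite ι] {V : ι → Type} [∀ i, AddCommGroup (V i)]
    [∀ i, Module ℂ (V i)] {X : ∀ i, Set (V i)} (hX : ∀ i, Cons (X i)) :
    Cons {x : ∀ i, V i | ∀ i, x i ∈ X i} :=
  Cons.forall fun i => (hX i).preimage (by fun_prop)

end Tame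

/-! ### Tame functions are piecewise rational -/

section Piecewise

variable {ι : Type}

/-- The restriction of `f` to the fibres of `l` is given by quotients of polynomials. -/
def IsRationalOnFibres {L : Type} (l : (ι → ℂ) → L) (f : (ι → ℂ) → ℂ) : Prop :=
  ∀ i, ∃ p q : MvPolynomial ι ℂ, ∀ x, l x = i →
    MvPolynomial.eval x q ≠ 0 ∧ f x = MvPolynomial.eval x p / MvPolynomial.eval x q

/-- A map to a finite set with constructible fibres. -/
structure ConsLabel (ι : Type) where
  L : Type
  finite : Finite L
  l : (ι → ℂ) → L
  cons : ∀ i, IsConstructible {x | l x = i}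

/-- The common refinement of two labelings. -/
def ConsLabel.inf (a b : ConsLabel ι) : ConsLabel ι where
  L := a.L × b.L
  finite := by
    have := a.finite
    have := b.finite
    infer_instance
  l x := (a.l x, b.l x)
  cons i := by
    have := (a.cons i.1).inter (b.cons i.2)
    convert this using 1
    ext x
    simp [Prod.ext_iff]

theorem IsRationalOnFibres.inf_left {a : ConsLabel ι} {f : (ι → ℂ) → ℂ}
    (h : IsRationalOnFibres a.l f) (b : ConsLabel ι) : IsRationalOnFibres (a.inf b).l f := by
  intro i
  obtain ⟨p, q, hpq⟩ := h i.1
  exact ⟨p, q, fun x hx => hpq x (congrArg Prod.fst hx)⟩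

theorem IsRationalOnFibres.inf_right {b : ConsLabel ι} {f : (ι → ℂ) → ℂ}
    (h : IsRationalOnFibres b.l f) (a : ConsLabel ι) : IsRationalOnFibres (a.inf b).l f := by
  intro i
  obtain ⟨p, q, hpq⟩ := h i.2
  exact ⟨p, q, fun x hx => hpq x (congrArg Prod.snd hx)⟩

/-- The labeling with one label. -/
def ConsLabel.triv : ConsLabel ι where
  L := Unit
  finite := inferInstance
  l _ := ()
  cons _ := by simpa using IsConstructible.univ

theorem isConstructible_biUnion {κ : Type*} (s : Finset κ) {X : κ → Set (ι → ℂ)}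
    (h : ∀ k ∈ s, IsConstructible (X k)) : IsConstructible (⋃ k ∈ s, X k) := by
  classical
  induction s using Finset.induction_on with
  | empty => simpa using (IsConstructible.univ (ι := ι)).compl
  | insert a s ha ih =>
    rw [Finset.set_biUnion_insert]
    exact (h a (Finset.mem_insert_self a s)).union
      (ih fun k hk => h k (Finset.mem_insert_of_mem hk))

theorem IsRationalOnFibres.isConstructible_zero {a : ConsLabel ι} {f : (ι → ℂ) → ℂ}
    (h : IsRationalOnFibres a.l f) : IsConstructible {x | f x = 0} := by
  have := a.finite
  have := Fintype.ofFinite a.L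
  choose p q hpq using h
  have h1 := isConstructible_biUnion (Finset.univ : Finset a.L)
    (X := fun i => {x | a.l x = i} ∩ {x | MvPolynomial.eval x (p i) = 0})
    fun i _ => (a.cons i).inter (.zeroLocus (p i))
  convert h1 using 1
  ext x
  have := hpq (a.l x) x rfl
  simp [this.2, this.1]

theorem TameFn.exists_label [Finite ι] {f : (ι → ℂ) → ℂ} (hf : TameFn f) :
    ∃ a : ConsLabel ι, IsRationalOnFibres a.l f := by
  classical
  have := Fintype.ofFinite ι
  induction hf with
  | linear φ =>
    refine ⟨.triv, fun _ => ⟨∑ i, MvPolynomial.C (φ (Pi.single i 1)) * MvPolynomial.X i, 1,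
      fun x _ => ⟨by simp, ?_⟩⟩⟩
    simp only [map_sum, map_mul, MvPolynomial.eval_C, MvPolynomial.eval_X, map_one, div_one]
    conv_lhs => rw [← Finset.univ_sum_single x, map_sum]
    refine Finset.sum_congr rfl fun i _ => ?_
    rw [mul_comm, ← smul_eq_mul, ← map_smul, ← Pi.single_smul, smul_eq_mul, mul_one]
  | const c => exact ⟨.triv, fun _ => ⟨MvPolynomial.C c, 1, fun x _ => by simp⟩⟩
  | @add f g _ _ hf hg =>
    obtain ⟨a, ha⟩ := hf
    obtain ⟨b, hb⟩ := hg
    refine ⟨a.inf b, fun i => ?_⟩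
    obtain ⟨p, q, hpq⟩ := ha.inf_left b i
    obtain ⟨p', q', hpq'⟩ := hb.inf_right a i
    refine ⟨p * q' + q * p', q * q', fun x hx => ⟨?_, ?_⟩⟩
    · simpa using ⟨(hpq x hx).1, (hpq' x hx).1⟩
    · beta_reduce
      rw [(hpq x hx).2, (hpq' x hx).2, div_add_div _ _ (hpq x hx).1 (hpq' x hx).1]
      simp
  | @mul f g _ _ hf hg =>
    obtain ⟨a, ha⟩ := hf
    obtain ⟨b, hb⟩ := hg
    refine ⟨a.inf b, fun i => ?_⟩
    obtain ⟨p, q, hpq⟩ := ha.inf_left b i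
    obtain ⟨p', q', hpq'⟩ := hb.inf_right a i
    refine ⟨p * p', q * q', fun x hx => ⟨?_, ?_⟩⟩
    · simpa using ⟨(hpq x hx).1, (hpq' x hx).1⟩
    · beta_reduce
      rw [(hpq x hx).2, (hpq' x hx).2, div_mul_div_comm]
      simp
  | @inv f _ hf =>
    obtain ⟨a, ha⟩ := hf
    have hz := ha.isConstructible_zero
    refine ⟨a.inf ⟨Prop, inferInstance, fun x => f x = 0, fun i => ?_⟩, fun i => ?_⟩
    · by_cases h : i
      · simpa [h] using hz
      · simpa [h, Set.compl_def] using hz.compl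
    · obtain ⟨p, q, hpq⟩ := ha i.1
      by_cases h : i.2
      · refine ⟨0, 1, fun x hx => ⟨by simp, ?_⟩⟩
        have : f x = 0 := (congrArg Prod.snd hx).mpr h
        simp [this]
      · refine ⟨q, p, fun x hx => ?_⟩
        have h1 : f x ≠ 0 := fun h' => h ((congrArg Prod.snd hx).mp h')
        obtain ⟨h2, h3⟩ := hpq x (congrArg Prod.fst hx)
        rw [h3] at h1
        exact ⟨(div_ne_zero_iff.1 h1).1, by beta_reduce; rw [h3, inv_div]⟩

theorem exists_label_forall [Finite ι] {κ : Type} [Finite κ] {f : κ → (ι → ℂ) → ℂ}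
    (hf : ∀ k, TameFn (f k)) : ∃ a : ConsLabel ι, ∀ k, IsRationalOnFibres a.l (f k) := by
  choose a ha using fun k => (hf k).exists_label
  refine ⟨⟨∀ k, (a k).L, ?_, fun x k => (a k).l x, fun i => ?_⟩, fun k i => ?_⟩
  · have := fun k => (a k).finite
    infer_instance
  · have := IsConstructible.forall fun k => (a k).cons (i k)
    convert this using 1
    ext x
    simp [funext_iff]
  · obtain ⟨p, q, hpq⟩ := ha k (i k)
    exact ⟨p, q, fun x hx => hpq x (congrFun hx k)⟩

theorem TameFn.isConstructible_zero [Finite ι] {f : (ι → ℂ) → ℂ} (hf : TameFn f) :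
    IsConstructible {x | f x = 0} := by
  obtain ⟨a, ha⟩ := hf.exists_label
  exact ha.isConstructible_zero

theorem Cons.isConstructible [Finite ι] {X : Set (ι → ℂ)} (hX : Cons X) : IsConstructible X := by
  obtain ⟨f, hf, rfl⟩ := hX
  exact (tame_iff_tameFn.1 hf).isConstructible_zero

theorem tame_eval [Finite ι] (p : MvPolynomial ι ℂ) :
    Tame (fun x : ι → ℂ => MvPolynomial.eval x p) := by
  induction p using MvPolynomial.induction_on with
  | C a => simpa using tame_const a
  | add p q hp hq => simpa using hp.add hq
  | mul_X p i hp => simpa using hp.mul (tame_id.apply i)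

theorem IsConstructible.cons [Finite ι] {X : Set (ι → ℂ)} (hX : IsConstructible X) : Cons X := by
  induction hX with
  | zeroLocus p => exact ⟨_, tame_eval p, rfl⟩
  | compl _ ih => exact ih.compl
  | inter _ _ h1 h2 => exact h1.inter h2

end Piecewise

/-! ### Classes of constructible sets in the ring of motivic weights -/

section Motive

variable {ι κ : Type}

theorem isRegularOn_of_label {a : ConsLabel ι} {i : a.L} {X : Set (ι → ℂ)}
    (hX : ∀ x ∈ X, a.l x = i) {f : (ι → ℂ) → κ → ℂ}
    (hf : ∀ k, IsRationalOnFibres a.l (fun x => f x k)) : IsRegularOn X f := by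
  intro k x hx
  obtain ⟨p, q, hpq⟩ := hf k i
  exact ⟨p, q, (hpq x (hX x hx)).1, fun z hz _ => (hpq z (hX z hz)).2⟩

variable [Finite ι] [Finite κ]

theorem cls_congr {X : Set (ι → ℂ)} {Y : Set (κ → ℂ)} (hX : IsConstructible X)
    (hY : IsConstructible Y) (h : AreIsomorphic X Y) : K0.cls X hX = K0.cls Y hY :=
  Ideal.Quotient.eq.2 (Ideal.subset_span (K0Rel.iso (cset X hX) (cset Y hY) h))

theorem cls_union {X Y : Set (ι → ℂ)} (hX : IsConstructible X) (hY : IsConstructible Y)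
    (h : Disjoint X Y) : K0.cls (X ∪ Y) (hX.union hY) = K0.cls X hX + K0.cls Y hY :=
  Ideal.Quotient.eq.2 (Ideal.subset_span (K0Rel.union X Y hX hY h))

theorem cls_prod {X : Set (ι → ℂ)} {Y : Set (κ → ℂ)} (hX : IsConstructible X)
    (hY : IsConstructible Y) :
    K0.cls (MotivicDT.prodSet X Y) (hX.prod hY) = K0.cls X hX * K0.cls Y hY :=
  Ideal.Quotient.eq.2 (Ideal.subset_span (K0Rel.prod X Y hX hY))

theorem cls_point : K0.cls (Set.univ : Set (Empty → ℂ)) .univ = 1 :=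
  Ideal.Quotient.eq.2 (Ideal.subset_span K0Rel.point)

theorem cls_empty : K0.cls (∅ : Set (ι → ℂ)) Cons.empty.isConstructible = 0 := by
  have h := cls_union (Cons.empty.isConstructible (ι := ι)) Cons.empty.isConstructible
    (disjoint_bot_left)
  simpa using h

theorem cls_biUnion {τ : Type*} (s : Finset τ) {X : τ → Set (ι → ℂ)}
    (h : ∀ k, IsConstructible (X k)) (hd : ∀ i ∈ s, ∀ j ∈ s, i ≠ j → Disjoint (X i) (X j)) :
    K0.cls (⋃ k ∈ s, X k) (isConstructible_biUnion s fun k _ => h k) =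
      ∑ k ∈ s, K0.cls (X k) (h k) := by
  classical
  induction s using Finset.induction_on with
  | empty =>
    simp only [Finset.sum_empty]
    rw [← cls_empty (ι := ι)]
    congr 1
    simp
  | insert a s ha ih =>
    rw [Finset.sum_insert ha, ← ih fun i hi j hj => hd i (Finset.mem_insert_of_mem hi) j
      (Finset.mem_insert_of_mem hj), ← cls_union]
    · congr 1
      rw [Finset.set_biUnion_insert]
    · refine Set.disjoint_iUnion₂_right.2 fun j hj => ?_
      exact hd a (Finset.mem_insert_self a s) j (Finset.mem_insert_of_mem hj)
        (fun h => ha (h ▸ hj))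

theorem cls_congr_of_tame {X : Set (ι → ℂ)} {Y : Set (κ → ℂ)} (hX : IsConstructible X)
    (hY : IsConstructible Y) {f : (ι → ℂ) → κ → ℂ} {g : (κ → ℂ) → ι → ℂ} (hf : Tame f)
    (hg : Tame g) (hXY : ∀ x ∈ X, f x ∈ Y ∧ g (f x) = x) (hYX : ∀ y ∈ Y, g y ∈ X ∧ f (g y) = y) :
    K0.cls X hX = K0.cls Y hY := by
  classical
  obtain ⟨a, ha⟩ := exists_label_forall (f := fun k x => f x k)
    fun k => tame_iff_tameFn.1 (hf.apply k)
  obtain ⟨b, hb⟩ := exists_label_forall (f := fun k y => g y k)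
    fun k => tame_iff_tameFn.1 (hg.apply k)
  have := a.finite
  have := b.finite
  have := Fintype.ofFinite a.L
  have := Fintype.ofFinite b.L
  let XX : a.L × b.L → Set (ι → ℂ) := fun i => {x | x ∈ X ∧ a.l x = i.1 ∧ b.l (f x) = i.2}
  let YY : a.L × b.L → Set (κ → ℂ) := fun i => {y | y ∈ Y ∧ a.l (g y) = i.1 ∧ b.l y = i.2}
  have hXX : ∀ i, IsConstructible (XX i) := fun i => Cons.isConstructible
    (hX.cons.and ((a.cons i.1).cons.and ((b.cons i.2).cons.preimage hf)))
  have hYY : ∀ i, IsConstructible (YY i) := fun i => Cons.isConstructible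
    (hY.cons.and (((a.cons i.1).cons.preimage hg).and (b.cons i.2).cons))
  have h1 : K0.cls X hX = ∑ i ∈ Finset.univ, K0.cls (XX i) (hXX i) := by
    rw [← cls_biUnion]
    · congr 1
      ext x
      simp [XX]
    · intro i _ j _ hij
      refine Set.disjoint_left.2 fun x hx hx' => hij ?_
      exact Prod.ext (hx.2.1.symm.trans hx'.2.1) (hx.2.2.symm.trans hx'.2.2)
  have h2 : K0.cls Y hY = ∑ i ∈ Finset.univ, K0.cls (YY i) (hYY i) := by
    rw [← cls_biUnion]
    · congr 1
      ext x
      simp [YY]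
    · intro i _ j _ hij
      refine Set.disjoint_left.2 fun x hx hx' => hij ?_
      exact Prod.ext (hx.2.1.symm.trans hx'.2.1) (hx.2.2.symm.trans hx'.2.2)
  rw [h1, h2]
  refine Finset.sum_congr rfl fun i _ => cls_congr _ _ ⟨f, g, ?_, ?_, ?_, ?_, ?_, ?_⟩
  · exact isRegularOn_of_label (i := i.1) (fun x hx => hx.2.1) ha
  · exact isRegularOn_of_label (i := i.2) (fun x hx => hx.2.2) hb
  · intro x hx
    exact ⟨(hXY x hx.1).1, by rw [(hXY x hx.1).2]; exact hx.2.1, hx.2.2⟩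
  · intro y hy
    exact ⟨(hYX y hy.1).1, hy.2.1, by rw [(hYX y hy.1).2]; exact hy.2.2⟩
  · exact fun x hx => (hXY x hx.1).2
  · exact fun y hy => (hYX y hy.1).2

end Motive

section Mu

variable {E F : Type} [AddCommGroup E] [Module ℂ E] [FiniteDimensional ℂ E]
  [AddCommGroup F] [Module ℂ F] [FiniteDimensional ℂ F]

/-- Linear coordinates on a finite-dimensional vector space. -/
def coords (E : Type) [AddCommGroup E] [Module ℂ E] [FiniteDimensional ℂ E] :
    E ≃ₗ[ℂ] (Fin (Module.finrank ℂ E) → ℂ) := (Module.finBasis ℂ E).equivFun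

theorem Cons.coords {X : Set E} (hX : Cons X) :
    IsConstructible {z | (coords E).symm z ∈ X} :=
  Cons.isConstructible (hX.preimage (f := fun z => (MotivicDT.coords E).symm z)
    (tame_id.linear (MotivicDT.coords E).symm.toLinearMap))

open Classical in
/-- The class of a constructible subset of a vector space in the ring of motivic weights. -/
def mu (X : Set E) : Mot :=
  if h : Cons X then motive {z | (coords E).symm z ∈ X} h.coords else 0

theorem cons_of_bij {X : Set E} {Y : Set F} (hX : Cons X) {f : E → F} {g : F → E} (hf : Tame f)
    (hg : Tame g) (hXY : ∀ x ∈ X, f x ∈ Y ∧ g (f x) = x)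
    (hYX : ∀ y ∈ Y, g y ∈ X ∧ f (g y) = y) : Cons Y := by
  have h := (hX.preimage hg).and (Cons.eq (hf.comp hg) (tame_id (E := F)))
  convert h using 1
  ext y
  exact ⟨fun hy => hYX y hy, fun hy => hy.2 ▸ (hXY _ hy.1).1⟩

theorem mu_congr {X : Set E} {Y : Set F} (f : E → F) (g : F → E) (hf : Tame f)
    (hg : Tame g) (hXY : ∀ x ∈ X, f x ∈ Y ∧ g (f x) = x)
    (hYX : ∀ y ∈ Y, g y ∈ X ∧ f (g y) = y) : mu X = mu Y := by
  by_cases hX : Cons X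
  · have hY := cons_of_bij hX hf hg hXY hYX
    simp only [mu, hX, hY, dif_pos, motive]
    congr 2
    refine cls_congr_of_tame _ _ (f := fun z => coords F (f ((coords E).symm z)))
      (g := fun z => coords E (g ((coords F).symm z))) ?_ ?_ ?_ ?_
    · exact (hf.comp (tame_id.linear (coords E).symm.toLinearMap)).linear (coords F).toLinearMap
    · exact (hg.comp (tame_id.linear (coords F).symm.toLinearMap)).linear (coords E).toLinearMap
    · intro x hx
      simpa using ⟨(hXY _ hx).1, by rw [(hXY _ hx).2]; simp⟩
    · intro x hx
      simpa using ⟨(hYX _ hx).1, by rw [(hYX _ hx).2]; simp⟩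
  · have hY : ¬ Cons Y := fun hY => hX (cons_of_bij hY hg hf hYX hXY)
    simp [mu, hX, hY]

theorem motive_eq_mu {ι : Type} [Finite ι] {X : Set (ι → ℂ)} (hX : IsConstructible X) :
    motive X hX = mu X := by
  simp only [mu, hX.cons, dif_pos, motive]
  congr 2
  refine cls_congr_of_tame _ _ (f := fun z => coords (ι → ℂ) z)
    (g := fun z => (coords (ι → ℂ)).symm z) (tame_id.linear (coords (ι → ℂ)).toLinearMap)
    (tame_id.linear (coords (ι → ℂ)).symm.toLinearMap) ?_ ?_
  · intro x hx
    simpa using hx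
  · intro x hx
    simpa using hx

theorem mu_empty : mu (∅ : Set E) = 0 := by
  simp only [mu, Cons.empty, dif_pos, motive]
  have := cls_empty (ι := Fin (Module.finrank ℂ E))
  simp only [Set.mem_empty_iff_false, Set.ofPred_false, this, map_zero]

theorem mu_union {X Y : Set E} (hX : Cons X) (hY : Cons Y) (h : Disjoint X Y) :
    mu (X ∪ Y) = mu X + mu Y := by
  simp only [mu, hX, hY, hX.union hY, dif_pos, motive]
  rw [← map_add, ← map_add, ← cls_union hX.coords hY.coords]
  · rfl
  · exact Set.disjoint_left.2 fun z hz hz' => Set.disjoint_left.1 h hz hz'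

theorem mu_biUnion {τ : Type*} (s : Finset τ) {X : τ → Set E} (h : ∀ k ∈ s, Cons (X k))
    (hd : ∀ i ∈ s, ∀ j ∈ s, i ≠ j → Disjoint (X i) (X j)) :
    mu (⋃ k ∈ s, X k) = ∑ k ∈ s, mu (X k) := by
  classical
  have hc : ∀ s : Finset τ, (∀ k ∈ s, Cons (X k)) → Cons (⋃ k ∈ s, X k) := by
    intro s hs
    have := (Cons.biInter s fun k hk => (hs k hk).compl).compl
    simpa using this
  induction s using Finset.induction_on with
  | empty => simpa using mu_empty
  | insert a s ha ih =>
    have h' : ∀ k ∈ s, Cons (X k) := fun k hk => h k (Finset.mem_insert_of_mem hk)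
    rw [Finset.sum_insert ha, ← ih h' fun i hi j hj => hd i (Finset.mem_insert_of_mem hi) j
      (Finset.mem_insert_of_mem hj), Finset.set_biUnion_insert,
      mu_union (h a (Finset.mem_insert_self a s)) (hc s h')]
    refine Set.disjoint_iUnion₂_right.2 fun j hj => ?_
    exact hd a (Finset.mem_insert_self a s) j (Finset.mem_insert_of_mem hj)
      (fun h => ha (h ▸ hj))

/-- Decomposition of a set according to finitely many labels. -/
theorem mu_eq_sum {τ : Type*} (s : Finset τ) {Y : Set E} {X : τ → Set E} (h : ∀ k ∈ s, Cons (X k))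
    (hY : ∀ y, y ∈ Y ↔ ∃ k ∈ s, y ∈ X k)
    (hd : ∀ i ∈ s, ∀ j ∈ s, ∀ y, y ∈ X i → y ∈ X j → i = j) : mu Y = ∑ k ∈ s, mu (X k) := by
  rw [← mu_biUnion s h]
  · congr 1
    ext y
    simp [hY]
  · intro i hi j hj hij
    exact Set.disjoint_left.2 fun y hy hy' => hij (hd i hi j hj y hy hy')

theorem mu_diff {X Y : Set E} (hX : Cons X) (hY : Cons Y) (h : Y ⊆ X) :
    mu (X \ Y) = mu X - mu Y := by
  rw [eq_sub_iff_add_eq, ← mu_union (hX.diff hY) hY Set.disjoint_sdiff_left,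
    Set.sdiff_union_of_subset h]

theorem mu_prod {X : Set E} {Y : Set F} (hX : Cons X) (hY : Cons Y) :
    mu (X ×ˢ Y) = mu X * mu Y := by
  have h : mu (X ×ˢ Y) = motive (MotivicDT.prodSet {z | (coords E).symm z ∈ X}
      {z | (coords F).symm z ∈ Y}) (hX.coords.prod hY.coords) := by
    rw [motive_eq_mu]
    refine mu_congr (fun z => Sum.elim (coords E z.1) (coords F z.2))
      (fun z => ((coords E).symm (z ∘ Sum.inl), (coords F).symm (z ∘ Sum.inr))) ?_ ?_ ?_ ?_
    · refine Tame.pi fun i => ?_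
      rcases i with i | i
      · exact (Tame.linear (coords E).toLinearMap tame_id.fst).apply i
      · exact (Tame.linear (coords F).toLinearMap tame_id.snd).apply i
    · refine Tame.prodMk (Tame.linear (coords E).symm.toLinearMap (Tame.pi fun i => ?_))
        (Tame.linear (coords F).symm.toLinearMap (Tame.pi fun i => ?_))
      · exact tame_id.apply _
      · exact tame_id.apply _
    · intro z hz
      simpa [MotivicDT.prodSet, Sum.elim_comp_inl, Sum.elim_comp_inr] using hz
    · intro z hz
      simpa [MotivicDT.prodSet] using hz
  rw [h]
  simp only [mu, hX, hY, dif_pos, motive]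
  rw [cls_prod hX.coords hY.coords, map_mul, map_mul]

theorem mu_singleton (x : E) : mu ({x} : Set E) = 1 := by
  have h : mu ({x} : Set E) = mu (Set.univ : Set (Empty → ℂ)) :=
    mu_congr (fun _ => 0) (fun _ => x) (by fun_prop) (by fun_prop) (by simp)
      (fun y _ => ⟨by simp, Subsingleton.elim _ _⟩)
  rw [h, ← motive_eq_mu .univ, motive, cls_point, map_one, map_one]

/-- The class of the affine line in the ring of motivic weights. -/
def LL : Mot := (sqrtL : Mot) ^ 2

theorem LL_eq : LL = mu (Set.univ : Set ℂ) := by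
  have h : mu (Set.univ : Set ℂ) = mu (Set.univ : Set (Unit → ℂ)) :=
    mu_congr (fun z _ => z) (fun z => z ()) (Tame.pi fun _ => tame_id) (by fun_prop)
      (by simp) (by simp)
  rw [h, ← motive_eq_mu .univ, motive, LL]
  change (algebraMap K0Sqrt Mot (AdjoinRoot.root _)) ^ 2 = _
  rw [← map_pow]
  congr 1
  have h2 := AdjoinRoot.eval₂_root (Polynomial.X ^ 2 - Polynomial.C K0.lefschetz)
  rw [Polynomial.eval₂_sub, Polynomial.eval₂_pow, Polynomial.eval₂_X, Polynomial.eval₂_C,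
    sub_eq_zero] at h2
  exact h2

theorem mu_pi {ι : Type} [Finite ι] {V : ι → Type} [∀ i, AddCommGroup (V i)]
    [∀ i, Module ℂ (V i)] [∀ i, FiniteDimensional ℂ (V i)] {X : ∀ i, Set (V i)}
    (hX : ∀ i, Cons (X i)) :
    mu {x : ∀ i, V i | ∀ i, x i ∈ X i} = ∏ᶠ i, mu (X i) := by
  revert V
  refine Finite.induction_empty_option (P := fun ι => ∀ {V : ι → Type} [∀ i, AddCommGroup (V i)]
    [∀ i, Module ℂ (V i)] [∀ i, FiniteDimensional ℂ (V i)] [Finite ι] {X : ∀ i, Set (V i)}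
    (_ : ∀ i, Cons (X i)), mu {x : ∀ i, V i | ∀ i, x i ∈ X i} = ∏ᶠ i, mu (X i)) ?_ ?_ ?_ ι
  · intro α β e ih V _ _ _ _ X hX
    have := Finite.of_equiv _ e.symm
    rw [← finprod_comp_equiv e, ← ih (V := fun a => V (e a)) fun i => hX (e i)]
    refine mu_congr (fun x a => x (e a)) (LinearEquiv.piCongrLeft ℂ V e) (by fun_prop)
      (tame_id.linear (LinearEquiv.piCongrLeft ℂ V e).toLinearMap) ?_ ?_
    · intro x hx
      refine ⟨fun i => hx _, ?_⟩
      exact (LinearEquiv.piCongrLeft ℂ V e).apply_symm_apply x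
    · intro y hy
      refine ⟨fun i => ?_, ?_⟩
      · obtain ⟨a, rfl⟩ := e.surjective i
        have : (LinearEquiv.piCongrLeft ℂ V e) y (e a) = y a :=
          Equiv.piCongrLeft_apply_apply V e y a
        rw [this]
        exact hy a
      · exact (LinearEquiv.piCongrLeft ℂ V e).symm_apply_apply y
  · intro V _ _ _ _ X _
    rw [finprod_of_isEmpty]
    have : {x : ∀ i, V i | ∀ i, x i ∈ X i} = {0} := by
      ext x
      simp [funext_iff]
    rw [this, mu_singleton]
  · intro α _ ih V _ _ _ _ X hX
    have := Fintype.ofFinite α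
    rw [finprod_eq_prod_of_fintype, Fintype.prod_option, ← finprod_eq_prod_of_fintype,
      ← ih (V := fun a => V (some a)) fun i => hX (some i),
      ← mu_prod (hX none) (Cons.pi fun i => hX (some i))]
    refine mu_congr (fun x => (x none, fun a => x (some a)))
      (fun y i => match i with | none => y.1 | some a => y.2 a) (by fun_prop) ?_ ?_ ?_
    · refine Tame.pi fun i => ?_
      rcases i with _ | a
      · exact tame_id.fst
      · exact tame_id.snd.apply a
    · intro x hx
      refine ⟨⟨hx none, fun i => hx (some i)⟩, ?_⟩
      funext i
      rcases i with _ | a <;> rfl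
    · intro y hy
      refine ⟨fun i => ?_, rfl⟩
      rcases i with _ | a
      · exact hy.1
      · exact hy.2 a

theorem mu_univ_fun (ι : Type) [Fintype ι] :
    mu (Set.univ : Set (ι → ℂ)) = LL ^ Fintype.card ι := by
  have h := mu_pi (ι := ι) (V := fun _ => ℂ) (X := fun _ => Set.univ) fun _ => Cons.univ
  rw [finprod_eq_prod_of_fintype] at h
  simp only [Finset.prod_const, Finset.card_univ, ← LL_eq] at h
  rw [← h]
  congr 1
  ext
  simp

theorem mu_univ : mu (Set.univ : Set E) = LL ^ Module.finrank ℂ E := by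
  have h := mu_univ_fun (Fin (Module.finrank ℂ E))
  rw [Fintype.card_fin] at h
  rw [← h]
  exact mu_congr (coords E) (coords E).symm (tame_id.linear (coords E).toLinearMap)
    (tame_id.linear (coords E).symm.toLinearMap) (by simp) (by simp)

end Mu

/-- Pairs of square matrices. -/
abbrev MatPair (B : Type) : Type := Matrix B B ℂ × Matrix B B ℂ

/-- Triples of square matrices. -/
abbrev MatTriple (B : Type) : Type := Matrix B B ℂ × MatPair B

/-! ## Tame solutions of linear systems -/

section Select

variable {E F F' : Type} [AddCommGroup E] [Module ℂ E] [AddCommGroup F] [Module ℂ F]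
  [AddCommGroup F'] [Module ℂ F']

theorem exists_tame_select {κ : Type} [Finite κ] {f : κ → E → F} {Q : κ → E → ℂ}
    (hf : ∀ k, Tame (f k)) (hQ : ∀ k, Tame (Q k)) :
    ∃ s : E → F, Tame s ∧ ∀ x, (∃ k, Q k x ≠ 0) → ∃ k, Q k x ≠ 0 ∧ s x = f k x := by
  classical
  have := Fintype.ofFinite κ
  have key : ∀ t : Finset κ, ∃ s : E → F, Tame s ∧ ∀ x, (∃ k ∈ t, Q k x ≠ 0) →
      ∃ k, Q k x ≠ 0 ∧ s x = f k x := by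
    intro t
    induction t using Finset.induction_on with
    | empty => exact ⟨fun _ => 0, by fun_prop, by simp⟩
    | insert a t _ ih =>
      obtain ⟨s, hs, h⟩ := ih
      refine ⟨_, Tame.ite_ne (hQ a) (hf a) hs, fun x hx => ?_⟩
      by_cases hq : Q a x = 0
      · obtain ⟨k, hk, hk'⟩ := hx
        rcases Finset.mem_insert.1 hk with rfl | hk
        · exact absurd hq hk'
        · obtain ⟨k, hk, hk'⟩ := h x ⟨k, hk, hk'⟩
          exact ⟨k, hk, by simp [hq, hk']⟩
      · exact ⟨a, hq, by simp [hq]⟩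
  obtain ⟨s, hs, h⟩ := key Finset.univ
  exact ⟨s, hs, fun x ⟨k, hk⟩ => h x ⟨k, Finset.mem_univ k, hk⟩⟩

theorem exists_tame_solve_matrix {m : Type} [Finite m] (n : ℕ) {A : E → Matrix m (Fin n) ℂ}
    {b : E → m → ℂ} (hA : Tame A) (hb : Tame b) :
    ∃ s : E → Fin n → ℂ, Tame s ∧
      ∀ x, (∃ v, (A x).mulVec v = b x) → (A x).mulVec (s x) = b x := by
  have := Fintype.ofFinite m
  induction n generalizing b with
  | zero =>
    refine ⟨fun _ => 0, by fun_prop, fun x ⟨v, hv⟩ => ?_⟩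
    rw [← hv]
    congr 1
    exact Subsingleton.elim _ _
  | succ n ih =>
    have hent : ∀ i j, Tame fun x => A x i j := fun i j => hA.entry i j
    have hbent : ∀ i, Tame fun x => b x i := fun i => hb.apply i
    obtain ⟨s0, hs0, h0⟩ := ih (A := fun x => (A x).submatrix id Fin.succ) (by fun_prop) hb
    have hred : ∀ i : m, ∃ s : E → Fin n → ℂ, Tame s ∧ ∀ x, (∃ v, (Matrix.of fun k (j : Fin n) =>
        A x k j.succ - A x k 0 / A x i 0 * A x i j.succ).mulVec v =
          fun k => b x k - A x k 0 / A x i 0 * b x i) →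
        (Matrix.of fun k (j : Fin n) =>
        A x k j.succ - A x k 0 / A x i 0 * A x i j.succ).mulVec (s x) =
          fun k => b x k - A x k 0 / A x i 0 * b x i := by
      intro i
      refine ih (A := fun x => Matrix.of fun k (j : Fin n) =>
        A x k j.succ - A x k 0 / A x i 0 * A x i j.succ) ?_ ?_
      · refine Tame.matrix fun k j => ?_
        simp only [Matrix.of_apply]
        fun_prop
      · fun_prop
    choose s hs h using hred
    obtain ⟨t, ht, h'⟩ := exists_tame_select (κ := Option m) (E := E) (F := Fin (n + 1) → ℂ)
      (f := fun k x => match k with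
        | none => Fin.cons 0 (s0 x)
        | some i => Fin.cons ((b x i - ∑ j : Fin n, A x i j.succ * s i x j) / A x i 0) (s i x))
      (Q := fun k x => match k with
        | none => ∏ i, (1 - A x i 0 * (A x i 0)⁻¹)
        | some i => A x i 0) (by
        intro k
        refine Tame.pi fun j => ?_
        rcases k with _ | i <;> refine Fin.cases ?_ (fun j => ?_) j
        · exact tame_const 0
        · simpa using hs0.apply j
        · have := fun j => (hs i).apply j
          simp only [Fin.cons_zero]
          fun_prop
        · simpa using (hs i).apply j) (by
        intro k
        rcases k with _ | i
        · fun_prop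
        · exact hent i 0)
    refine ⟨t, ht, fun x ⟨v, hv⟩ => ?_⟩
    have hv' : ∀ k, A x k 0 * v 0 + ∑ j : Fin n, A x k j.succ * v j.succ = b x k := by
      intro k
      rw [← hv, Matrix.mulVec, dotProduct, Fin.sum_univ_succ]
    obtain ⟨k, hk, hk'⟩ := h' x (by
      by_contra hcon
      push Not at hcon
      have h1 := hcon none
      simp only [fun i => hcon (some i)] at h1
      simp at h1)
    funext l
    rw [hk', Matrix.mulVec, dotProduct, Fin.sum_univ_succ]
    rcases k with _ | i
    · have hz : ∀ i, A x i 0 = 0 := by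
        intro i
        by_contra hi
        refine hk (Finset.prod_eq_zero (Finset.mem_univ i) ?_)
        rw [mul_inv_cancel₀ hi, sub_self]
      have h2 := congrFun (h0 x ⟨fun j => v j.succ, ?_⟩) l
      · simpa [Matrix.mulVec, dotProduct] using h2
      · funext k
        simpa [Matrix.mulVec, dotProduct, hz] using hv' k
    · have hi : A x i 0 ≠ 0 := hk
      have h2 := congrFun (h i x ⟨fun j => v j.succ, ?_⟩) l
      · simp only [Matrix.mulVec, dotProduct, Matrix.of_apply, sub_mul, Finset.sum_sub_distrib,
          mul_assoc, ← Finset.mul_sum] at h2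
        simp only [Fin.cons_zero, Fin.cons_succ]
        field_simp at h2 ⊢
        linear_combination h2
      · funext k
        simp only [Matrix.mulVec, dotProduct, Matrix.of_apply, sub_mul, Finset.sum_sub_distrib,
          mul_assoc, ← Finset.mul_sum]
        rw [← hv' k, ← hv' i]
        field_simp
        ring

variable [FiniteDimensional ℂ F] [FiniteDimensional ℂ F']

theorem tame_hom {A : E → F →ₗ[ℂ] F'} (h : ∀ v, Tame (fun x => A x v)) : Tame A := by
  let b := Module.finBasis ℂ F
  have : A = fun x => b.constr ℂ (fun i => A x (b i)) := by
    funext x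
    exact (b.constr_self (S := ℂ) (A x)).symm
  rw [this]
  exact Tame.linear (b.constr ℂ (M' := F')).toLinearMap (Tame.pi fun i => h (b i))

theorem Tame.homApply {A : E → F →ₗ[ℂ] F'} {v : E → F} (hA : Tame A) (hv : Tame v) :
    Tame (fun x => A x (v x)) := by
  let b := Module.finBasis ℂ F
  have : (fun x => A x (v x)) = fun x => ∑ i, b.coord i (v x) • A x (b i) := by
    funext x
    conv_lhs => rw [← b.sum_repr (v x), map_sum]
    simp only [map_smul, Module.Basis.coord_apply]
  rw [this]
  exact Tame.sum _ fun i => (hv.linear (b.coord i)).smul (hA.linear (LinearMap.applyₗ (b i)))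

theorem exists_tame_solve {A : E → F →ₗ[ℂ] F'} {b : E → F'} (hA : Tame A) (hb : Tame b) :
    ∃ s : E → F, Tame s ∧ ∀ x, (∃ v, A x v = b x) → A x (s x) = b x := by
  let e := Module.finBasis ℂ F
  let e' := Module.finBasis ℂ F'
  obtain ⟨s, hs, h⟩ := exists_tame_solve_matrix (Module.finrank ℂ F)
    (A := fun x => LinearMap.toMatrix e e' (A x)) (b := fun x => e'.equivFun (b x))
    (hA.linear (LinearMap.toMatrix e e').toLinearMap) (hb.linear e'.equivFun.toLinearMap)
  refine ⟨fun x => e.equivFun.symm (s x), hs.linear e.equivFun.symm.toLinearMap,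
    fun x ⟨v, hv⟩ => ?_⟩
  have key : ∀ w : Fin (Module.finrank ℂ F) → ℂ,
      (LinearMap.toMatrix e e' (A x)).mulVec w = e'.equivFun (A x (e.equivFun.symm w)) := by
    intro w
    have := LinearMap.toMatrix_mulVec_repr e e' (A x) (e.equivFun.symm w)
    have h2 : ⇑(e.repr (e.equivFun.symm w)) = w := e.equivFun.apply_symm_apply w
    rw [h2] at this
    exact this
  have h3 := h x ⟨e.equivFun v, by rw [key]; simp [hv]⟩
  rw [key] at h3
  exact e'.equivFun.injective h3

theorem exists_generalized_inverse (A : F →ₗ[ℂ] F') : ∃ X : F' →ₗ[ℂ] F, A ∘ₗ X ∘ₗ A = A := by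
  obtain ⟨h, hh⟩ := A.rangeRestrict.exists_rightInverse_of_surjective A.range_rangeRestrict
  obtain ⟨p, hp⟩ := (LinearMap.range A).subtype.exists_leftInverse_of_injective
    (Submodule.ker_subtype _)
  refine ⟨h ∘ₗ p, ?_⟩
  ext v
  have h1 : p (A v) = A.rangeRestrict v := LinearMap.congr_fun hp (A.rangeRestrict v)
  have h2 := LinearMap.congr_fun hh (A.rangeRestrict v)
  simp only [LinearMap.comp_apply, h1]
  exact congrArg Subtype.val h2

theorem exists_tame_ker_proj {A : E → F →ₗ[ℂ] F'} (hA : Tame A) :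
    ∃ P : E → F →ₗ[ℂ] F, Tame P ∧ (∀ x v, A x (P x v) = 0) ∧ ∀ x v, A x v = 0 → P x v = v := by
  let Ψ : E → (F' →ₗ[ℂ] F) →ₗ[ℂ] (F →ₗ[ℂ] F') := fun x =>
    { toFun := fun X => A x ∘ₗ X ∘ₗ A x
      map_add' := fun X Y => by ext; simp
      map_smul' := fun c X => by ext; simp }
  have hAv : ∀ v, Tame fun x => A x v := fun v => hA.homApply (tame_const v)
  have hΨ : Tame Ψ := tame_hom fun X => tame_hom fun v =>
    hA.homApply ((hAv v).linear X)
  obtain ⟨X, hX, h⟩ := exists_tame_solve hΨ hA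
  refine ⟨fun x => LinearMap.id - X x ∘ₗ A x, tame_hom fun v => ?_, fun x v => ?_, fun x v hv => ?_⟩
  · exact (tame_const v).sub (hX.homApply (hAv v))
  · have := LinearMap.congr_fun (h x (exists_generalized_inverse (A x))) v
    simp only [LinearMap.sub_apply, LinearMap.id_apply, LinearMap.comp_apply, map_sub]
    rw [sub_eq_zero]
    exact this.symm
  · simp [hv]

theorem exists_nat_det_ne_zero {m : Type} [Fintype m] [DecidableEq m] (A B : Matrix m m ℂ)
    (t : ℂ) (h : (t • A + B).det ≠ 0) :
    ∃ k : Fin (Fintype.card m + 1), (((k : ℕ) : ℂ) • A + B).det ≠ 0 := by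
  let p : Polynomial ℂ := ((Polynomial.X : Polynomial ℂ) • A.map Polynomial.C +
    B.map Polynomial.C).det
  have hp : ∀ t : ℂ, p.eval t = (t • A + B).det := by
    intro t
    have h1 := RingHom.map_det (Polynomial.evalRingHom t)
      ((Polynomial.X : Polynomial ℂ) • A.map Polynomial.C + B.map Polynomial.C)
    simp only [Polynomial.coe_evalRingHom] at h1
    rw [h1]
    congr 1
    ext i j
    simp
    exact mul_comm _ _
  have hdeg : p.natDegree ≤ Fintype.card m := Polynomial.natDegree_det_X_add_C_le A B
  by_contra hcon
  push Not at hcon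
  have h0 : p ≠ 0 := fun h0 => h (by rw [← hp, h0, Polynomial.eval_zero])
  refine h0 (Polynomial.eq_zero_of_natDegree_lt_card_of_eval_eq_zero p
    (f := fun k : Fin (Fintype.card m + 1) => ((k : ℕ) : ℂ)) ?_ (fun k => ?_) ?_)
  · intro a b hab
    exact Fin.ext (Nat.cast_injective hab)
  · rw [hp, hcon]
  · simpa using Nat.lt_succ_of_le hdeg

theorem exists_grid_det_ne_zero {m κ : Type} [Fintype m] [DecidableEq m] [Fintype κ]
    (M : κ → Matrix m m ℂ) (h : ∃ c : κ → ℂ, (∑ i, c i • M i).det ≠ 0) :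
    ∃ c : κ → Fin (Fintype.card m + 1), (∑ i, ((c i : ℕ) : ℂ) • M i).det ≠ 0 := by
  classical
  have key : ∀ s : Finset κ, ∃ c : κ → ℂ, (∀ i ∈ s, ∃ k : Fin (Fintype.card m + 1), c i = (k : ℕ)) ∧
      (∑ i, c i • M i).det ≠ 0 := by
    intro s
    induction s using Finset.induction_on with
    | empty =>
      obtain ⟨c, hc⟩ := h
      exact ⟨c, by simp, hc⟩
    | insert a s has ih =>
      obtain ⟨c, hc, hd⟩ := ih
      have hsum : ∀ t : ℂ, ∑ i, Function.update c a t i • M i =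
          t • M a + ∑ i ∈ Finset.univ.erase a, c i • M i := by
        intro t
        rw [← Finset.add_sum_erase _ _ (Finset.mem_univ a), Function.update_self]
        congr 1
        refine Finset.sum_congr rfl fun i hi => ?_
        rw [Function.update_of_ne (Finset.ne_of_mem_erase hi)]
      have hd' : (c a • M a + ∑ i ∈ Finset.univ.erase a, c i • M i).det ≠ 0 := by
        rwa [← hsum, Function.update_eq_self]
      obtain ⟨k, hk⟩ := exists_nat_det_ne_zero _ _ _ hd'
      refine ⟨Function.update c a (k : ℕ), fun i hi => ?_, by rwa [hsum]⟩
      by_cases hia : i = a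
      · subst hia
        exact ⟨k, by simp⟩
      · rw [Function.update_of_ne hia]
        exact hc i ((Finset.mem_insert.1 hi).resolve_left hia)
  obtain ⟨c, hc, hd⟩ := key Finset.univ
  choose k hk using fun i => hc i (Finset.mem_univ i)
  exact ⟨k, by simpa only [← hk] using hd⟩

/-- Tame solutions of a homogeneous linear system subject to a nonvanishing determinant. -/
theorem exists_tame_isUnit_section {m : Type} [Fintype m] [DecidableEq m] {A : E → F →ₗ[ℂ] F'}
    {L : E → F →ₗ[ℂ] Matrix m m ℂ} (hA : Tame A) (hL : Tame L) :
    ∃ s : E → F, Tame s ∧ ∀ x, (∃ v, A x v = 0 ∧ IsUnit (L x v)) →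
      A x (s x) = 0 ∧ IsUnit (L x (s x)) := by
  obtain ⟨P, hP, hP0, hP1⟩ := exists_tame_ker_proj hA
  let b := Module.finBasis ℂ F
  let w : (Fin (Module.finrank ℂ F) → Fin (Fintype.card m + 1)) → F := fun c =>
    ∑ i, ((c i : ℕ) : ℂ) • b i
  obtain ⟨s, hs, h⟩ := exists_tame_select (f := fun c x => P x (w c))
    (Q := fun c x => (L x (P x (w c))).det)
    (fun c => hP.homApply (tame_const _)) (fun c => (hL.homApply (hP.homApply (tame_const _))).det)
  refine ⟨s, hs, fun x ⟨v, hv, hv'⟩ => ?_⟩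
  obtain ⟨c, hc, hc'⟩ := h x (by
    obtain ⟨c, hc⟩ := exists_grid_det_ne_zero (fun i => L x (P x (b i))) ⟨b.equivFun v, by
      rw [Matrix.isUnit_iff_isUnit_det, isUnit_iff_ne_zero, ← hP1 x v hv] at hv'
      rw [← b.sum_equivFun v, map_sum, map_sum] at hv'
      simpa only [map_smul] using hv'⟩
    exact ⟨c, by simpa [w, map_sum, map_smul] using hc⟩)
  rw [hc']
  refine ⟨hP0 x _, ?_⟩
  rwa [Matrix.isUnit_iff_isUnit_det, isUnit_iff_ne_zero]

end Select

/-! ## The class of the general linear group -/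

theorem exists_tame_matrix_ginv (m n : Type) [Fintype m] [Fintype n] :
    ∃ X : Matrix m n ℂ → Matrix n m ℂ, Tame X ∧ ∀ A, A * X A * A = A := by
  classical
  let Ψ : Matrix m n ℂ → Matrix n m ℂ →ₗ[ℂ] Matrix m n ℂ := fun A =>
    { toFun := fun X => A * X * A
      map_add' := fun X Y => by rw [Matrix.mul_add, Matrix.add_mul]
      map_smul' := fun c X => by simp }
  obtain ⟨X, hX, h⟩ := exists_tame_solve (A := Ψ) (b := fun A => A)
    (tame_hom fun X => (tame_id.matrixMul (tame_const X)).matrixMul tame_id) tame_id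
  refine ⟨X, hX, fun A => h A ?_⟩
  obtain ⟨Y, hY⟩ := exists_generalized_inverse (Matrix.toLin' A)
  refine ⟨LinearMap.toMatrix' Y, ?_⟩
  have := congrArg LinearMap.toMatrix' hY
  simpa [Ψ, LinearMap.toMatrix'_comp, Matrix.mul_assoc] using this

theorem ginv_mul_eq_one {m n : Type} [Fintype m] [Fintype n] [DecidableEq n] {A : Matrix m n ℂ}
    {X Y : Matrix n m ℂ} (h : A * X * A = A) (hY : Y * A = 1) : X * A = 1 := by
  have := congrArg (Y * ·) h
  simpa only [← Matrix.mul_assoc, hY, Matrix.one_mul] using this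

/-- The matrices with a left inverse. -/
def injMatrices (m n : Type) [Fintype m] [DecidableEq n] : Set (Matrix m n ℂ) :=
  {A | ∃ X : Matrix n m ℂ, X * A = 1}

theorem mu_injMatrices (m k : ℕ) :
    Cons (injMatrices (Fin m) (Fin k)) ∧
      mu (injMatrices (Fin m) (Fin k)) = ∏ i ∈ Finset.range k, (LL ^ m - LL ^ i) := by
  have hcons : ∀ k, Cons (injMatrices (Fin m) (Fin k)) := by
    intro k
    obtain ⟨X, hX, h⟩ := exists_tame_matrix_ginv (Fin m) (Fin k)
    convert Cons.eq (hX.matrixMul tame_id) (tame_const (1 : Matrix (Fin k) (Fin k) ℂ)) using 1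
    ext A
    refine ⟨fun ⟨Y, hY⟩ => ?_, fun hA => ⟨_, hA⟩⟩
    exact ginv_mul_eq_one (h A) hY
  refine ⟨hcons k, ?_⟩
  induction k with
  | zero =>
    have : injMatrices (Fin m) (Fin 0) = {0} := by
      ext A
      refine ⟨fun _ => Subsingleton.elim _ _, fun _ => ⟨0, Subsingleton.elim _ _⟩⟩
    rw [this, mu_singleton]
    simp
  | succ k ih =>
    obtain ⟨X, hX, h⟩ := exists_tame_matrix_ginv (Fin m) (Fin k)
    have hX1 : ∀ A ∈ injMatrices (Fin m) (Fin k), X A * A = 1 := by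
      rintro A ⟨Y, hY⟩
      exact ginv_mul_eq_one (h A) hY
    let Z : Set (Matrix (Fin m) (Fin k) ℂ × (Fin m → ℂ)) :=
      {z | z.1 ∈ injMatrices (Fin m) (Fin k) ∧ z.1.mulVec ((X z.1).mulVec z.2) = z.2}
    have hZ : Cons Z := by
      refine ((hcons k).preimage (f := fun z : Matrix (Fin m) (Fin k) ℂ × (Fin m → ℂ) => z.1)
        (by fun_prop)).and (Cons.eq ?_ (by fun_prop))
      exact tame_id.fst.mulVec ((hX.comp tame_id.fst).mulVec tame_id.snd)
    have hZmu : mu Z = mu (injMatrices (Fin m) (Fin k)) * LL ^ k := by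
      have hk := mu_univ_fun (Fin k)
      rw [Fintype.card_fin] at hk
      rw [← hk, ← mu_prod (hcons k) Cons.univ]
      refine mu_congr (fun z => (z.1, (X z.1).mulVec z.2)) (fun z => (z.1, z.1.mulVec z.2))
        (tame_id.fst.prodMk ((hX.comp tame_id.fst).mulVec tame_id.snd)) (by fun_prop) ?_ ?_
      · rintro ⟨A, v⟩ ⟨hA, hv⟩
        exact ⟨⟨hA, trivial⟩, Prod.ext rfl hv⟩
      · rintro ⟨A, c⟩ ⟨hA, _⟩
        have : (X A).mulVec (A.mulVec c) = c := by
          rw [Matrix.mulVec_mulVec, hX1 A hA, Matrix.one_mulVec]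
        exact ⟨⟨hA, by simp only [this]⟩, Prod.ext rfl this⟩
    have hsub : Z ⊆ injMatrices (Fin m) (Fin k) ×ˢ Set.univ := fun z hz => ⟨hz.1, trivial⟩
    rw [Finset.prod_range_succ, ← ih]
    have hm := mu_univ_fun (Fin m)
    rw [Fintype.card_fin] at hm
    rw [mul_sub, ← hZmu, ← hm, ← mu_prod (hcons k) Cons.univ,
      ← mu_diff ((hcons k).prodSet Cons.univ) hZ hsub]
    refine mu_congr (fun A => (A.submatrix id Fin.castSucc, fun i => A i (Fin.last k)))
      (fun z => Matrix.of fun i => Fin.snoc (z.1 i) (z.2 i)) ?_ ?_ ?_ ?_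
    · exact Tame.prodMk (by fun_prop) (Tame.pi fun i => tame_id.entry i _)
    · refine Tame.matrix fun i j => ?_
      refine Fin.lastCases ?_ (fun j => ?_) j
      · simpa using tame_id.snd.apply i
      · simpa using tame_id.fst.entry i j
    · rintro A ⟨Y, hY⟩
      refine ⟨⟨⟨⟨Y.submatrix Fin.castSucc id, ?_⟩, trivial⟩, ?_⟩, ?_⟩
      · have := congrArg (fun M => M.submatrix Fin.castSucc Fin.castSucc) hY
        rw [Matrix.submatrix_one _ (Fin.castSucc_injective k)] at this
        exact this
      · rintro ⟨-, hv⟩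
        simp only at hv
        let w : Fin (k + 1) → ℂ :=
          Fin.snoc ((X (A.submatrix id Fin.castSucc)).mulVec fun i => A i (Fin.last k)) (-1)
        have hw : A.mulVec w = 0 := by
          funext i
          have := congrFun hv i
          simp only [Matrix.mulVec, dotProduct, Matrix.submatrix_apply, id] at this
          simp only [Matrix.mulVec, dotProduct, Fin.sum_univ_castSucc, w, Fin.snoc_castSucc,
            Fin.snoc_last, Pi.zero_apply]
          rw [this]
          ring
        have h0 : w = 0 := by
          have := congrArg (fun v => Y.mulVec v) hw
          simpa [Matrix.mulVec_mulVec, hY] using this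
        have := congrFun h0 (Fin.last k)
        simp [w] at this
      · ext i j
        refine Fin.lastCases ?_ (fun j => ?_) j <;> simp
    · rintro ⟨A, v⟩ ⟨⟨hA, -⟩, hv⟩
      refine ⟨?_, ?_⟩
      · have hinj : Function.Injective
            (Matrix.mulVecLin (Matrix.of fun i => (Fin.snoc (A i) (v i) : Fin (k + 1) → ℂ))) := by
          rw [← LinearMap.ker_eq_bot, LinearMap.ker_eq_bot']
          intro w hw
          have hw' : ∀ i, (A.mulVec fun j => w j.castSucc) i + v i * w (Fin.last k) = 0 := by
            intro i
            have := congrFun hw i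
            simpa [Matrix.mulVec, dotProduct, Fin.sum_univ_castSucc] using this
          have hl : w (Fin.last k) = 0 := by
            by_contra hl
            refine hv ⟨hA, ?_⟩
            let u : Fin k → ℂ := fun j => -(w (Fin.last k))⁻¹ * w j.castSucc
            have hu : A.mulVec u = v := by
              funext i
              have h1 := hw' i
              have h2 : A.mulVec u i = -(w (Fin.last k))⁻¹ * (A.mulVec fun j => w j.castSucc) i := by
                simp only [Matrix.mulVec, dotProduct, u, Finset.mul_sum]
                exact Finset.sum_congr rfl fun j _ => by ring
              rw [h2, eq_neg_of_add_eq_zero_left h1]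
              field_simp
            simp only
            rw [← hu, Matrix.mulVec_mulVec _ (X A) A, hX1 A hA, Matrix.one_mulVec]
          have hA0 : A.mulVec (fun j => w j.castSucc) = 0 := by
            funext i
            simpa [hl] using hw' i
          have h0 := congrArg (fun v => (X A).mulVec v) hA0
          simp only [Matrix.mulVec_mulVec, hX1 A hA, Matrix.one_mulVec, Matrix.mulVec_zero] at h0
          funext j
          refine Fin.lastCases hl (fun j => ?_) j
          exact congrFun h0 j
        obtain ⟨g, hg⟩ := LinearMap.exists_leftInverse_of_injective _ (LinearMap.ker_eq_bot.2 hinj)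
        refine ⟨LinearMap.toMatrix' g, ?_⟩
        have := congrArg LinearMap.toMatrix' hg
        rwa [LinearMap.toMatrix'_comp, LinearMap.toMatrix'_id, ← Matrix.toLin'_apply',
          LinearMap.toMatrix'_toLin'] at this
      · ext1
        · ext i j
          simp
        · funext i
          simp

theorem motiveGL_eq_mu (n : ℕ) :
    motiveGL n = mu {A : Matrix (Fin n) (Fin n) ℂ | IsUnit A} := by
  rw [motiveGL, motive_eq_mu]
  refine mu_congr (fun g => Matrix.of fun i j => g (i, j)) (fun A z => A z.1 z.2)
    (Tame.matrix fun i j => tame_id.apply (i, j)) (Tame.pi fun z => tame_id.entry _ _) ?_ ?_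
  · intro x hx
    exact ⟨hx, rfl⟩
  · intro y hy
    exact ⟨hy, rfl⟩

theorem motiveGL_eq (n : ℕ) : motiveGL n = ∏ i ∈ Finset.range n, (LL ^ n - LL ^ i) := by
  rw [motiveGL_eq_mu, ← (mu_injMatrices n n).2]
  congr 1
  ext A
  refine ⟨fun h => ⟨A⁻¹, Matrix.nonsing_inv_mul A ((Matrix.isUnit_iff_isUnit_det A).1 h)⟩,
    fun ⟨X, hX⟩ => ?_⟩
  exact IsUnit.of_mul_eq_one X (mul_eq_one_comm.1 hX)

theorem isUnit_LL : IsUnit LL := sqrtL.isUnit.pow 2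

theorem isUnit_one_sub_LL_pow (n : ℕ) : IsUnit (1 - LL ^ (n + 1)) := by
  have h := IsLocalization.map_units Mot
    (⟨1 - K0Sqrt.sqrtL ^ (2 * (n + 1)),
      Submonoid.subset_closure (Set.mem_insert_of_mem _ ⟨n, rfl⟩)⟩ : motDenominators)
  simpa [LL, sqrtL, ← pow_mul] using h

theorem isUnit_motiveGL (n : ℕ) : IsUnit (motiveGL n) := by
  rw [motiveGL_eq]
  refine (IsUnit.prod_iff).2 fun i hi => ?_
  obtain ⟨k, rfl⟩ := Nat.exists_eq_add_of_lt (Finset.mem_range.1 hi)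
  have : LL ^ (i + k + 1) - LL ^ i = -(LL ^ i * (1 - LL ^ (k + 1))) := by ring
  rw [this]
  exact ((isUnit_LL.pow i).mul (isUnit_one_sub_LL_pow k)).neg

/-! ## Dimension reduction along a cut -/

theorem mu_fibre_one_sub_zero {ι κ : Type} [Finite ι] [Fintype κ] {D : (ι → ℂ) → κ → ℂ}
    (hD : Tame D) :
    mu {z : (ι → ℂ) × (κ → ℂ) | ∑ k, z.2 k * D z.1 k = 1} -
      mu {z : (ι → ℂ) × (κ → ℂ) | ∑ k, z.2 k * D z.1 k = 0} =
      -(LL ^ Fintype.card κ * mu {x | D x = 0}) := by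
  classical
  have hDk : ∀ k, Tame fun z : (ι → ℂ) × (κ → ℂ) => D z.1 k :=
    fun k => (hD.comp tame_id.fst).apply k
  have hz : ∀ k, Tame fun z : (ι → ℂ) × (κ → ℂ) => z.2 k := fun k => tame_id.snd.apply k
  have hf : Tame fun z : (ι → ℂ) × (κ → ℂ) => ∑ k, z.2 k * D z.1 k :=
    Tame.sum _ fun k => (hz k).mul (hDk k)
  have hc : ∀ c : ℂ, Cons {z : (ι → ℂ) × (κ → ℂ) | ∑ k, z.2 k * D z.1 k = c} :=
    fun c => Cons.eq hf (tame_const c)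
  have hD0 : Cons {z : (ι → ℂ) × (κ → ℂ) | D z.1 = 0} :=
    Cons.eq (hD.comp tame_id.fst) (tame_const 0)
  have hsub : {z : (ι → ℂ) × (κ → ℂ) | D z.1 = 0} ⊆ {z | ∑ k, z.2 k * D z.1 k = 0} := by
    intro z hz
    have hz : D z.1 = 0 := hz
    simp [hz]
  have h1 := mu_diff (hc 0) hD0 hsub
  have h2 : mu {z : (ι → ℂ) × (κ → ℂ) | D z.1 = 0} = LL ^ Fintype.card κ * mu {x | D x = 0} := by
    rw [mul_comm, ← mu_univ_fun κ, ← mu_prod (Cons.eq hD (tame_const 0)) Cons.univ]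
    congr 1
    ext z
    simp
  obtain ⟨u, hu, h⟩ := exists_tame_solve (A := fun x : ι → ℂ => (Fintype.linearCombination ℂ (D x)))
    (b := fun _ => (1 : ℂ)) (tame_hom fun v => by
      simp only [Fintype.linearCombination_apply]
      exact Tame.sum _ fun k => (tame_const _).smul (hD.apply k)) (tame_const 1)
  have hu1 : ∀ x, D x ≠ 0 → ∑ k, u x k * D x k = 1 := by
    intro x hx
    obtain ⟨k, hk⟩ := Function.ne_iff.1 hx
    have := h x ⟨Pi.single k (D x k)⁻¹, by
      rw [Fintype.linearCombination_apply_single]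
      simpa using inv_mul_cancel₀ hk⟩
    simpa [Fintype.linearCombination_apply] using this
  have h3 : mu {z : (ι → ℂ) × (κ → ℂ) | ∑ k, z.2 k * D z.1 k = 1} =
      mu ({z : (ι → ℂ) × (κ → ℂ) | ∑ k, z.2 k * D z.1 k = 0} \ {z | D z.1 = 0}) := by
    refine mu_congr (fun z => (z.1, z.2 - u z.1)) (fun z => (z.1, z.2 + u z.1))
      (tame_id.fst.prodMk (tame_id.snd.sub (hu.comp tame_id.fst)))
      (tame_id.fst.prodMk (tame_id.snd.add (hu.comp tame_id.fst))) ?_ ?_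
    · rintro ⟨x, y⟩ hz
      simp only [Set.mem_ofPred_eq] at hz
      have hx : D x ≠ 0 := fun hx => by simp [hx] at hz
      refine ⟨⟨?_, hx⟩, by simp⟩
      simp only [Set.mem_ofPred_eq, Pi.sub_apply, sub_mul, Finset.sum_sub_distrib, hu1 x hx, hz,
        sub_self]
    · rintro ⟨x, y⟩ ⟨hz, hx⟩
      simp only [Set.mem_ofPred_eq] at hz hx
      refine ⟨?_, by simp⟩
      simp only [Set.mem_ofPred_eq, Pi.add_apply, add_mul, Finset.sum_add_distrib, hu1 x hx, hz,
        zero_add]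
  rw [h3, h1, h2]
  ring

namespace ArrowQuiver

variable {V A : Type} (Q : ArrowQuiver V A) [Fintype V] [DecidableEq V] [Fintype A] [DecidableEq A]

/-- Every word of the potential is a cyclic path of length at least two with exactly one arrow
in `C`. -/
def IsCut (W : Potential A) (C : Set A) : Prop :=
  ∀ w ∈ W.support, 2 ≤ w.length ∧ (∃ j : Fin w.length, ∀ i, w.get i ∈ C ↔ i = j) ∧
    ∀ i : Fin w.length,
      (∀ x ∈ (w.drop (i + 1) ++ w.take i).head?, Q.tgt x = Q.src (w.get i)) ∧
      (∀ x ∈ (w.drop (i + 1) ++ w.take i).getLast?, Q.src x = Q.tgt (w.get i))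

variable {Q} {α : V → ℕ}

theorem word_append (M : Q.Rep α) (u v : List A) : M.word (u ++ v) = M.word u * M.word v := by
  simp [Rep.word]

theorem word_cons (M : Q.Rep α) (a : A) (w : List A) : M.word (a :: w) = M.mat a * M.word w := by
  simp [Rep.word]

theorem mem_rest {w : List A} {i : Fin w.length} {x : A} (hx : x ∈ w.drop (i + 1) ++ w.take i) :
    ∃ j : Fin w.length, j ≠ i ∧ w.get j = x := by
  rcases List.mem_append.1 hx with hx | hx
  · obtain ⟨n, hn, rfl⟩ := List.mem_iff_getElem.1 hx
    rw [List.length_drop] at hn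
    refine ⟨⟨i + 1 + n, by omega⟩, fun h => ?_, ?_⟩
    · have := congrArg Fin.val h
      simp only at this
      omega
    · simp
  · obtain ⟨n, hn, rfl⟩ := List.mem_iff_getElem.1 hx
    rw [List.length_take] at hn
    refine ⟨⟨n, by omega⟩, fun h => ?_, ?_⟩
    · have := congrArg Fin.val h
      simp only at this
      omega
    · simp

theorem get_mem_rest {w : List A} {i j : Fin w.length} (h : j ≠ i) :
    w.get j ∈ w.drop (i + 1) ++ w.take i := by
  rw [List.mem_append]
  rcases lt_or_gt_of_ne (fun hv => h (Fin.ext hv) : (j : ℕ) ≠ i) with hlt | hlt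
  · right
    refine List.mem_iff_getElem.2 ⟨j, by simp; omega, by simp⟩
  · left
    refine List.mem_iff_getElem.2 ⟨j - (i + 1), by simp; omega, ?_⟩
    simp only [List.getElem_drop, List.get_eq_getElem]
    congr 1
    omega

theorem trace_mat_mul_rest (M : Q.Rep α) (w : List A) (j : Fin w.length) :
    (M.mat (w.get j) * M.word (w.drop (j + 1) ++ w.take j)).trace = (M.word w).trace := by
  have h : w = w.take j ++ (w.get j :: w.drop (j + 1)) := by
    simp
  have h2 : M.word w = M.word (w.take j) * (M.mat (w.get j) * M.word (w.drop (j + 1))) := by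
    rw [← word_cons, ← word_append]
    exact congrArg M.word h
  rw [h2, word_append, ← mul_assoc, Matrix.trace_mul_comm]

theorem word_eq_zero (M : Q.Rep α) {w : List A} {a : A} (ha : a ∈ w) (h : M.mat a = 0) :
    M.word w = 0 :=
  List.prod_eq_zero (List.mem_map.2 ⟨a, ha, h⟩)

theorem mat_apply_ne_zero {M : Q.Rep α} {a : A} {x y} (h : M.mat a x y ≠ 0) :
    x.1 = Q.tgt a ∧ y.1 = Q.src a := by
  by_contra hc
  exact h (by simp [Rep.mat, hc])

theorem word_apply_ne_zero {M : Q.Rep α} {w : List A} (hw : w ≠ []) {x y}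
    (h : M.word w x y ≠ 0) :
    (∀ a ∈ w.head?, x.1 = Q.tgt a) ∧ (∀ a ∈ w.getLast?, y.1 = Q.src a) := by
  constructor
  · intro a ha
    obtain ⟨t, rfl⟩ : ∃ t, w = a :: t := by
      cases w with
      | nil => simp at ha
      | cons b t => exact ⟨t, by simpa using ha⟩
    by_contra hx
    refine h ?_
    simp only [Rep.word, List.map_cons, List.prod_cons, Matrix.mul_apply]
    refine Finset.sum_eq_zero fun z _ => ?_
    have : M.mat a x z = 0 := by
      by_contra h0
      exact hx (mat_apply_ne_zero h0).1
    rw [this, zero_mul]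
  · intro a ha
    obtain ⟨t, rfl⟩ : ∃ t, w = t ++ [a] := by
      obtain ⟨t, ht⟩ := List.mem_getLast?_eq_getLast ha
      exact ⟨w.dropLast, by rw [ht]; exact (List.dropLast_append_getLast _).symm⟩
    by_contra hx
    refine h ?_
    rw [word_append, Matrix.mul_apply]
    refine Finset.sum_eq_zero fun z _ => ?_
    have : M.word [a] z y = 0 := by
      by_contra h0
      refine hx (mat_apply_ne_zero (M := M) (x := z) ?_).2
      simpa [Rep.word] using h0
    rw [this, mul_zero]

variable {W : Potential A} {C : Set A}

theorem cyclicDeriv_apply_ne_zero (hC : Q.IsCut W C) {M : Q.Rep α} {a : A} {x y}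
    (h : M.cyclicDeriv W a x y ≠ 0) : x.1 = Q.src a ∧ y.1 = Q.tgt a := by
  by_contra hc
  refine h ?_
  rw [Rep.cyclicDeriv, Finsupp.sum, Matrix.sum_apply]
  refine Finset.sum_eq_zero fun w hw => ?_
  rw [Matrix.smul_apply, Matrix.sum_apply, Finset.sum_eq_zero, smul_zero]
  intro j _
  split_ifs with hj
  · by_contra h0
    obtain ⟨h2, -, h3⟩ := hC w hw
    have hne : w.drop (j + 1) ++ w.take j ≠ [] := by
      intro h
      have := congrArg List.length h
      simp at this
      omega
    obtain ⟨h4, h5⟩ := word_apply_ne_zero hne h0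
    refine hc ⟨?_, ?_⟩
    · have hm := List.head?_eq_some_head hne
      rw [h4 _ hm, (h3 j).1 _ hm, hj]
    · have hm := List.getLast?_eq_some_getLast hne
      rw [h5 _ hm, (h3 j).2 _ hm, hj]
  · rfl

theorem cyclicDeriv_congr (hC : Q.IsCut W C) {M M' : Q.Rep α}
    (h : ∀ a, a ∉ C → M.mat a = M'.mat a) {a : A} (ha : a ∈ C) :
    M.cyclicDeriv W a = M'.cyclicDeriv W a := by
  rw [Rep.cyclicDeriv, Rep.cyclicDeriv]
  refine Finset.sum_congr rfl fun w hw => ?_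
  dsimp only
  congr 1
  refine Finset.sum_congr rfl fun j _ => ?_
  split_ifs with hj
  · obtain ⟨-, ⟨j₀, hj₀⟩, -⟩ := hC w hw
    rw [Rep.word, Rep.word]
    congr 1
    refine List.map_congr_left fun b hb => h b fun hbC => ?_
    obtain ⟨i, hi, rfl⟩ := mem_rest hb
    refine hi ?_
    rw [(hj₀ i).1 hbC, (hj₀ j).1 (hj ▸ ha)]
  · rfl

theorem cyclicDeriv_eq_zero (hC : Q.IsCut W C) {M : Q.Rep α} (h : ∀ a ∈ C, M.mat a = 0) {a : A}
    (ha : a ∉ C) : M.cyclicDeriv W a = 0 := by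
  rw [Rep.cyclicDeriv]
  refine Finset.sum_eq_zero fun w hw => ?_
  dsimp only
  rw [Finset.sum_eq_zero, smul_zero]
  intro j _
  split_ifs with hj
  · obtain ⟨-, ⟨j₀, hj₀⟩, -⟩ := hC w hw
    have hC0 := (hj₀ j₀).2 rfl
    refine word_eq_zero M (get_mem_rest (j := j₀) ?_) (h _ hC0)
    rintro rfl
    exact ha (hj ▸ hC0)
  · rfl

open Classical in
theorem traceFun_eq (hC : Q.IsCut W C) (M : Q.Rep α) :
    M.traceFun W = ∑ a with a ∈ C, (M.mat a * M.cyclicDeriv W a).trace := by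
  simp only [Rep.traceFun, Rep.cyclicDeriv, Finsupp.sum, Finset.mul_sum, Matrix.trace_sum,
    mul_smul_comm, Matrix.trace_smul]
  rw [Finset.sum_comm]
  refine Finset.sum_congr rfl fun w hw => ?_
  obtain ⟨-, ⟨j₀, hj₀⟩, -⟩ := hC w hw
  rw [← Finset.smul_sum, smul_eq_mul]
  congr 1
  rw [Finset.sum_comm, Finset.sum_eq_single j₀, Finset.sum_eq_single (w.get j₀)]
  · rw [if_pos rfl, trace_mat_mul_rest]
  · intro b _ hb
    rw [if_neg (Ne.symm hb), mul_zero, Matrix.trace_zero]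
  · intro h
    exact absurd (Finset.mem_filter.2 ⟨Finset.mem_univ _, (hj₀ j₀).2 rfl⟩) h
  · intro j _ hj
    refine Finset.sum_eq_zero fun a ha => ?_
    rw [if_neg, mul_zero, Matrix.trace_zero]
    rintro rfl
    exact hj ((hj₀ j).1 (Finset.mem_filter.1 ha).2)
  · simp

theorem mat_apply_mk (M : Q.Rep α) (a : A) (i : Fin (α (Q.tgt a))) (j : Fin (α (Q.src a))) :
    M.mat a ⟨Q.tgt a, i⟩ ⟨Q.src a, j⟩ = M ⟨a, i, j⟩ := by
  simp [Rep.mat]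

theorem trace_mat_mul (M : Q.Rep α) (a : A)
    (X : Matrix ((v : V) × Fin (α v)) ((v : V) × Fin (α v)) ℂ) :
    (M.mat a * X).trace =
      ∑ z : Fin (α (Q.tgt a)) × Fin (α (Q.src a)), M ⟨a, z⟩ * X ⟨Q.src a, z.2⟩ ⟨Q.tgt a, z.1⟩ := by
  simp only [Matrix.trace, Matrix.diag_apply, Matrix.mul_apply]
  rw [Fintype.sum_prod_type, Fintype.sum_sigma, Finset.sum_eq_single (Q.tgt a)]
  · refine Finset.sum_congr rfl fun i _ => ?_
    rw [Fintype.sum_sigma, Finset.sum_eq_single (Q.src a)]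
    · exact Finset.sum_congr rfl fun j _ => by rw [mat_apply_mk]
    · intro v _ hv
      refine Finset.sum_eq_zero fun j _ => ?_
      have : M.mat a ⟨Q.tgt a, i⟩ ⟨v, j⟩ = 0 := by
        by_contra h
        exact hv (mat_apply_ne_zero h).2
      rw [this, zero_mul]
    · simp
  · intro v _ hv
    refine Finset.sum_eq_zero fun i _ => Finset.sum_eq_zero fun y _ => ?_
    have : M.mat a ⟨v, i⟩ y = 0 := by
      by_contra h
      exact hv (mat_apply_ne_zero h).1
    rw [this, zero_mul]
  · simp

theorem mat_congr {M M' : Q.Rep α} {a : A} (h : ∀ z, M ⟨a, z⟩ = M' ⟨a, z⟩) : M.mat a = M'.mat a := by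
  ext x y
  simp only [Rep.mat, h]

theorem mat_eq_zero_iff {M : Q.Rep α} {a : A} : M.mat a = 0 ↔ ∀ z, M ⟨a, z⟩ = 0 := by
  refine ⟨fun h z => ?_, fun h => ?_⟩
  · rw [← mat_apply_mk M a z.1 z.2, h, Matrix.zero_apply]
  · ext x y
    simp [Rep.mat, h]

theorem tame_mat (a : A) : Tame fun M : Q.Rep α => M.mat a := by
  refine Tame.matrix fun i j => ?_
  simp only [Rep.mat]
  split_ifs with h
  · exact tame_apply _
  · exact tame_const 0

theorem tame_word (w : List A) : Tame fun M : Q.Rep α => M.word w := by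
  induction w with
  | nil => simpa [Rep.word] using tame_const _
  | cons a w ih => simpa [Rep.word] using (tame_mat a).matrixMul ih

theorem tame_cyclicDeriv (a : A) : Tame fun M : Q.Rep α => M.cyclicDeriv W a := by
  refine Tame.sum _ fun w => (tame_const _).smul (Tame.sum _ fun j => ?_)
  split_ifs
  · exact tame_word _
  · exact tame_const 0

open Classical in
/-- Dimension reduction: the vanishing cycle of a potential with a cut. -/
theorem vanishingCycle_eq (hC : Q.IsCut W C) (α : V → ℕ) :
    Q.vanishingCycle W α = -(LL ^ (∑ a with a ∈ C, α (Q.tgt a) * α (Q.src a)) *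
      mu (Q.truncatedReps W C α)) := by
  let ι := {x : Q.Coord α // x.1 ∉ C}
  let κ := {x : Q.Coord α // x.1 ∈ C}
  let ext0 : (ι → ℂ) × (κ → ℂ) → Q.Rep α := fun z x =>
    if h : x.1 ∈ C then z.2 ⟨x, h⟩ else z.1 ⟨x, h⟩
  let res : Q.Rep α → (ι → ℂ) × (κ → ℂ) := fun M => (fun x => M x, fun x => M x)
  have hext : Tame ext0 := by
    refine Tame.pi fun x => ?_
    simp only [ext0]
    split_ifs
    · exact tame_id.snd.apply _
    · exact tame_id.fst.apply _
  have hres : Tame res := by fun_prop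
  have hre : ∀ M, ext0 (res M) = M := by
    intro M
    funext x
    by_cases h : x.1 ∈ C <;> simp [ext0, res, h]
  have her : ∀ z, res (ext0 z) = z := by
    rintro ⟨z, z'⟩
    refine Prod.ext ?_ ?_
    · funext x
      simp [ext0, res, x.2]
    · funext x
      simp [ext0, res, x.2]
  have hmatC : ∀ z, ∀ a ∉ C, (ext0 z).mat a = (ext0 (z.1, 0)).mat a := by
    intro z a ha
    exact mat_congr fun y => by simp [ext0, ha]
  have hmat0 : ∀ x, ∀ a ∈ C, (ext0 (x, 0)).mat a = 0 := by
    intro x a ha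
    exact mat_eq_zero_iff.2 fun y => by simp [ext0, ha]
  let D : (ι → ℂ) → κ → ℂ := fun x y => (ext0 (x, 0)).cyclicDeriv W y.1.1
    ⟨Q.src y.1.1, y.1.2.2⟩ ⟨Q.tgt y.1.1, y.1.2.1⟩
  have hD : Tame D := by
    refine Tame.pi fun y => ?_
    exact ((tame_cyclicDeriv y.1.1).comp (hext.comp (tame_id.prodMk (tame_const 0)))).entry _ _
  have htr : ∀ z, (ext0 z).traceFun W = ∑ k, z.2 k * D z.1 k := by
    intro z
    rw [traceFun_eq hC]
    simp only [trace_mat_mul]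
    have h1 : ∀ a ∈ C, (ext0 z).cyclicDeriv W a = (ext0 (z.1, 0)).cyclicDeriv W a :=
      fun a ha => cyclicDeriv_congr hC (hmatC z) ha
    let g : Q.Coord α → ℂ := fun x => ext0 z x * (ext0 (z.1, 0)).cyclicDeriv W x.1
      ⟨Q.src x.1, x.2.2⟩ ⟨Q.tgt x.1, x.2.1⟩
    have h2 : ∑ k, z.2 k * D z.1 k = ∑ x : Q.Coord α with x.1 ∈ C, g x := by
      rw [Finset.sum_subtype (p := fun x : Q.Coord α => x.1 ∈ C) _ (by simp)]
      exact Finset.sum_congr rfl fun k _ => by simp [g, D, ext0, k.2]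
    rw [h2, Finset.sum_filter, Finset.sum_filter, Fintype.sum_sigma]
    refine Finset.sum_congr rfl fun a _ => ?_
    split_ifs with ha
    · exact Finset.sum_congr rfl fun y _ => by rw [h1 a ha]
    · exact Finset.sum_const_zero.symm
  have hvan : ∀ c : ℂ, mu {M : Q.Rep α | M.traceFun W = c} =
      mu {z : (ι → ℂ) × (κ → ℂ) | ∑ k, z.2 k * D z.1 k = c} := by
    intro c
    refine mu_congr res ext0 hres hext ?_ ?_
    · intro M hM
      refine ⟨?_, hre M⟩
      rw [Set.mem_ofPred_eq, ← htr, hre]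
      exact hM
    · intro z hz
      refine ⟨?_, her z⟩
      rw [Set.mem_ofPred_eq, htr]
      exact hz
  have hcard : Fintype.card κ = ∑ a with a ∈ C, α (Q.tgt a) * α (Q.src a) := by
    rw [Fintype.card_subtype, Finset.card_filter, Fintype.sum_sigma, Finset.sum_filter]
    refine Finset.sum_congr rfl fun a _ => ?_
    split_ifs <;> simp
  have htrunc : mu (Q.truncatedReps W C α) = mu {x | D x = 0} := by
    refine mu_congr (fun M => (res M).1) (fun x => ext0 (x, 0)) hres.fst
      (hext.comp (tame_id.prodMk (tame_const 0))) ?_ ?_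
    · rintro M ⟨hM, hM'⟩
      have h0 : ext0 ((res M).1, 0) = M := by
        funext x
        by_cases h : x.1 ∈ C
        · simpa [ext0, h] using (mat_eq_zero_iff.1 (hM x.1 h) x.2).symm
        · simp [ext0, res, h]
      refine ⟨?_, h0⟩
      funext y
      simp only [D, h0, hM', Matrix.zero_apply, Pi.zero_apply]
    · intro x hx
      refine ⟨⟨hmat0 x, fun a => ?_⟩, by rw [her]⟩
      by_cases ha : a ∈ C
      · ext u v
        by_contra hne
        obtain ⟨hu, hv⟩ := cyclicDeriv_apply_ne_zero hC hne
        obtain ⟨u, i⟩ := u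
        obtain ⟨v, j⟩ := v
        simp only at hu hv
        subst hu hv
        exact hne (congrFun hx ⟨⟨a, j, i⟩, ha⟩)
      · exact cyclicDeriv_eq_zero hC (hmat0 x) ha
  rw [vanishingCycle, motive_eq_mu, motive_eq_mu, hvan, hvan, mu_fibre_one_sub_zero hD, hcard,
    htrunc]

end ArrowQuiver

/-! ## Graded matrices and the matrix model of the truncated Jacobian algebra -/

section JReps

variable {N : ℕ} {B C : Type}

/-- Matrices of degree `e` between graded sets. -/
def IsDeg (dC : C → ZMod N) (dB : B → ZMod N) (e : ZMod N) (M : Matrix C B ℂ) : Prop :=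
  ∀ c b, M c b ≠ 0 → dC c = dB b + e

variable [Fintype B]

/-- The pairs `(K, R)`, where `K` lowers the degree by one and has image in degrees from `J`, and
`R` has degree zero and lives in the degrees `k` such that neither `k` nor `k - 1` lies in `J`. -/
def jSpace (J : Set (ZMod N)) (d : B → ZMod N) : Submodule ℂ (MatPair B) where
  carrier := {y | (∀ c b, y.1 c b ≠ 0 → d b = d c + 1 ∧ d c ∈ J) ∧
    ∀ c b, y.2 c b ≠ 0 → d c = d b ∧ d c ∉ J ∧ d c - 1 ∉ J}
  add_mem' := by
    rintro y z ⟨h1, h2⟩ ⟨h3, h4⟩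
    refine ⟨fun c b h => ?_, fun c b h => ?_⟩
    · by_cases hy : y.1 c b = 0
      · exact h3 c b fun hz => h (by simp [hy, hz])
      · exact h1 c b hy
    · by_cases hy : y.2 c b = 0
      · exact h4 c b fun hz => h (by simp [hy, hz])
      · exact h2 c b hy
  zero_mem' := by simp
  smul_mem' := by
    rintro a y ⟨h1, h2⟩
    exact ⟨fun c b h => h1 c b fun h0 => h (by simp [h0]),
      fun c b h => h2 c b fun h0 => h (by simp [h0])⟩

/-- The degree zero endomorphism `HK + KH + R`. -/
def rho (H : Matrix B B ℂ) (y : MatPair B) : Matrix B B ℂ :=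
  H * y.1 + y.1 * H + y.2

/-- The matrix model of the representations of the truncated Jacobian algebra. -/
def jReps (J : Set (ZMod N)) (d : B → ZMod N) :
    Set (MatTriple B) :=
  {z | IsDeg d d 1 z.1 ∧ z.2 ∈ jSpace J d ∧ rho z.1 z.2 * z.1 = z.1 * rho z.1 z.2}

theorem cons_isDeg [Fintype C] {E : Type} [AddCommGroup E] [Module ℂ E] (dC : C → ZMod N)
    (dB : B → ZMod N) (e : ZMod N) {A : E → Matrix C B ℂ} (hA : Tame A) :
    Cons {x | IsDeg dC dB e (A x)} := by
  refine Cons.forall fun c => Cons.forall fun b => ?_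
  by_cases h : dC c = dB b + e
  · simpa [h] using Cons.univ
  · simpa [h] using Cons.eq_zero (hA.entry c b)

theorem cons_jSpace (J : Set (ZMod N)) (d : B → ZMod N) :
    Cons (jSpace J d : Set (MatPair B)) := by
  refine Cons.and (Cons.forall fun c => Cons.forall fun b => ?_)
    (Cons.forall fun c => Cons.forall fun b => ?_)
  · by_cases h : d b = d c + 1 ∧ d c ∈ J
    · simpa [h] using Cons.univ (E := MatPair B)
    · simpa [h] using Cons.eq_zero (E := MatPair B) (tame_id.fst.entry c b)
  · by_cases h : d c = d b ∧ d c ∉ J ∧ d c - 1 ∉ J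
    · convert Cons.univ (E := MatPair B)
      exact Set.eq_univ_of_forall fun _ _ => h
    · simpa only [h, imp_false, not_not] using Cons.eq_zero (tame_id.snd.entry c b)

theorem tame_rho : Tame fun z : MatTriple B => rho z.1 z.2 := by
  unfold rho
  fun_prop

theorem cons_jReps (J : Set (ZMod N)) (d : B → ZMod N) : Cons (jReps J d) :=
  (cons_isDeg d d 1 tame_id.fst).and (((cons_jSpace J d).preimage tame_id.snd).and
    (Cons.eq (tame_rho.matrixMul tame_id.fst) (tame_id.fst.matrixMul tame_rho)))

end JReps

namespace TrapezoidPartition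

variable {N₀ N₁ : ℕ} (σ : TrapezoidPartition N₀ N₁) [NeZero (N₀ + N₁)]

theorem mem_support_potential {w : List σ.Arrow} (hw : w ∈ σ.potential.support) :
    ∃ k, (∃ hk : k ∈ σ.loopVertices, w = [σ.loop ⟨k, hk⟩, σ.hPlus (k - 1), σ.hMinus (k - 1)] ∨
      w = [σ.loop ⟨k, hk⟩, σ.hMinus k, σ.hPlus k]) ∨
      (k ∉ σ.loopVertices ∧ w = [σ.hPlus (k - 1), σ.hMinus (k - 1), σ.hMinus k, σ.hPlus k]) := by
  classical
  have h1 := Finsupp.support_finsetSum hw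
  rw [Finset.mem_biUnion] at h1
  obtain ⟨k, -, hk⟩ := h1
  refine ⟨k, ?_⟩
  split_ifs at hk with h
  · left
    refine ⟨h, ?_⟩
    rcases Finset.mem_union.1 (Finsupp.support_add hk) with h2 | h2
    · exact .inl (Finset.mem_singleton.1 (Finsupp.support_single_subset h2))
    · exact .inr (Finset.mem_singleton.1 (Finsupp.support_single_subset h2))
  · exact .inr ⟨h, Finset.mem_singleton.1 (Finsupp.support_single_subset hk)⟩

theorem hMinus_mem_cut {N' : ℕ} {j} : σ.hMinus j ∈ σ.cut N' ↔ j ∉ I₂ (N₀ + N₁) N' := by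
  simp only [cut, Set.mem_ofPred_eq]
  constructor
  · rintro ⟨i, hi, h⟩
    have : j = i := by simpa using h
    exact this ▸ hi
  · exact fun h => ⟨j, h, rfl⟩

theorem hPlus_notMem_cut {N' : ℕ} {j} : σ.hPlus j ∉ σ.cut N' := by
  rintro ⟨i, -, h⟩
  simp at h

theorem loop_notMem_cut {N' : ℕ} {j} : σ.loop j ∉ σ.cut N' := by
  rintro ⟨i, -, h⟩
  simp at h

variable {σ} {N' : ℕ}

theorem isCut (hloop : ∀ k, k ∈ σ.loopVertices ↔
      k ∉ I₂ (N₀ + N₁) N' ∧ k - 1 ∉ I₂ (N₀ + N₁) N')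
    (hJ : ∀ k ∈ I₂ (N₀ + N₁) N', k + 1 ∉ I₂ (N₀ + N₁) N') :
    σ.quiver.IsCut σ.potential (σ.cut N') := by
  intro w hw
  obtain ⟨k, ⟨hk, rfl | rfl⟩ | ⟨hk, rfl⟩⟩ := σ.mem_support_potential hw
  · refine ⟨by simp, ⟨⟨2, by simp⟩, fun ⟨i, hi⟩ => ?_⟩, ?_⟩
    · simp only [List.length_cons, List.length_nil] at hi
      interval_cases i <;> simp [hMinus_mem_cut, hPlus_notMem_cut, loop_notMem_cut,
        ((hloop k).1 hk).2]
    · simp [Fin.forall_fin_succ, quiver]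
      exact fun a _ h => h.symm
  · refine ⟨by simp, ⟨⟨1, by simp⟩, fun ⟨i, hi⟩ => ?_⟩, ?_⟩
    · simp only [List.length_cons, List.length_nil] at hi
      interval_cases i <;> simp [hMinus_mem_cut, hPlus_notMem_cut, loop_notMem_cut,
        ((hloop k).1 hk).1]
    · simp [Fin.forall_fin_succ, quiver]
      exact fun a _ h => h.symm
  · refine ⟨by simp, ?_, ?_⟩
    · by_cases hk1 : k ∈ I₂ (N₀ + N₁) N'
      · have hk2 : k - 1 ∉ I₂ (N₀ + N₁) N' := fun h => hJ _ h (by simpa using hk1)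
        refine ⟨⟨1, by simp⟩, fun ⟨i, hi⟩ => ?_⟩
        simp only [List.length_cons, List.length_nil] at hi
        interval_cases i <;> simp [hMinus_mem_cut, hPlus_notMem_cut, hk1, hk2]
      · have hk2 : k - 1 ∈ I₂ (N₀ + N₁) N' := by
          by_contra h
          exact hk ((hloop k).2 ⟨hk1, h⟩)
        refine ⟨⟨2, by simp⟩, fun ⟨i, hi⟩ => ?_⟩
        simp only [List.length_cons, List.length_nil] at hi
        interval_cases i <;> simp [hMinus_mem_cut, hPlus_notMem_cut, hk1, hk2]
    · simp [Fin.forall_fin_succ, quiver]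

section Derivative

open ArrowQuiver

variable {α : ZMod (N₀ + N₁) → ℕ} (M : σ.quiver.Rep α)

/-- The cyclic derivative of a single word. -/
def wordDeriv (a : σ.Arrow) (w : List σ.Arrow) :
    Matrix ((v : ZMod (N₀ + N₁)) × Fin (α v)) ((v : ZMod (N₀ + N₁)) × Fin (α v)) ℂ :=
  ∑ j : Fin w.length, if w.get j = a then M.word (w.drop (j + 1) ++ w.take j) else 0

theorem cyclicDeriv_eq_linearCombination (W : Potential σ.Arrow) (a : σ.Arrow) :
    M.cyclicDeriv W a = Finsupp.linearCombination ℂ (wordDeriv M a) W := rfl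

open Classical in
/-- The endomorphism of the vertex `k` that enters through the arrow `h^+_{k+1/2}`. -/
def rhoOut (k : ZMod (N₀ + N₁)) :
    Matrix ((v : ZMod (N₀ + N₁)) × Fin (α v)) ((v : ZMod (N₀ + N₁)) × Fin (α v)) ℂ :=
  if hk : k ∈ σ.loopVertices then M.mat (σ.loop ⟨k, hk⟩) else
    M.mat (σ.hMinus k) * M.mat (σ.hPlus k)

open Classical in
/-- The endomorphism of the vertex `k` that enters through the arrow `h^+_{k-1/2}`. -/
def rhoIn (k : ZMod (N₀ + N₁)) :
    Matrix ((v : ZMod (N₀ + N₁)) × Fin (α v)) ((v : ZMod (N₀ + N₁)) × Fin (α v)) ℂ :=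
  if hk : k ∈ σ.loopVertices then M.mat (σ.loop ⟨k, hk⟩) else
    M.mat (σ.hPlus (k - 1)) * M.mat (σ.hMinus (k - 1))

theorem sign_of_loop {k} (hk : k ∈ σ.loopVertices) : σ.sign (k - 1) = σ.sign k := by
  have : σ.σy (k - 1) = σ.σy k := hk
  rw [sign, sign, this]

theorem sign_of_not_loop {k} (hk : k ∉ σ.loopVertices) : σ.sign (k - 1) = -σ.sign k := by
  have h : σ.σy (k - 1) ≠ σ.σy k := hk
  rw [sign, sign]
  rcases Fin.exists_fin_two.1 ⟨σ.σy (k - 1), rfl⟩ with h1 | h1 <;>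
  rcases Fin.exists_fin_two.1 ⟨σ.σy k, rfl⟩ with h2 | h2 <;>
  simp_all

theorem sign_ne_zero (k) : σ.sign k ≠ 0 := pow_ne_zero _ (by norm_num)

theorem wordDeriv_loop_hPlus_hMinus (j k i) :
    wordDeriv M (σ.hMinus j) [σ.loop k, σ.hPlus i, σ.hMinus i] =
      if i = j then M.mat (σ.loop k) * M.mat (σ.hPlus i) else 0 := by
  simp [wordDeriv, Fin.sum_univ_succ, Rep.word]

theorem wordDeriv_loop_hMinus_hPlus (j k i) :
    wordDeriv M (σ.hMinus j) [σ.loop k, σ.hMinus i, σ.hPlus i] =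
      if i = j then M.mat (σ.hPlus i) * M.mat (σ.loop k) else 0 := by
  simp [wordDeriv, Fin.sum_univ_succ, Rep.word]

theorem wordDeriv_hPlus_hMinus_hMinus_hPlus (j i k) :
    wordDeriv M (σ.hMinus j) [σ.hPlus i, σ.hMinus i, σ.hMinus k, σ.hPlus k] =
      (if i = j then M.mat (σ.hMinus k) * M.mat (σ.hPlus k) * M.mat (σ.hPlus i) else 0) +
      if k = j then M.mat (σ.hPlus k) * (M.mat (σ.hPlus i) * M.mat (σ.hMinus i)) else 0 := by
  simp [wordDeriv, Fin.sum_univ_succ, Rep.word, mul_assoc]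

theorem cyclicDeriv_hMinus (j : ZMod (N₀ + N₁)) : M.cyclicDeriv σ.potential (σ.hMinus j) =
    σ.sign j • (rhoOut M (j + 1) * M.mat (σ.hPlus j) - M.mat (σ.hPlus j) * rhoIn M j) := by
  rw [cyclicDeriv_eq_linearCombination, potential, map_sum]
  have h : ∀ k, Finsupp.linearCombination ℂ (wordDeriv M (σ.hMinus j))
      (if hk : k ∈ σ.loopVertices then
        Finsupp.single [σ.loop ⟨k, hk⟩, σ.hPlus (k - 1), σ.hMinus (k - 1)] (σ.sign (k - 1)) +
          Finsupp.single [σ.loop ⟨k, hk⟩, σ.hMinus k, σ.hPlus k] (-σ.sign k)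
      else
        Finsupp.single [σ.hPlus (k - 1), σ.hMinus (k - 1), σ.hMinus k, σ.hPlus k]
          (σ.sign (k - 1))) =
      (if k - 1 = j then σ.sign (k - 1) • (rhoOut M k * M.mat (σ.hPlus (k - 1))) else 0) -
      (if k = j then σ.sign k • (M.mat (σ.hPlus k) * rhoIn M k) else 0) := by
    intro k
    by_cases hk : k ∈ σ.loopVertices
    · simp only [dif_pos hk, map_add, Finsupp.linearCombination_single,
        wordDeriv_loop_hPlus_hMinus, wordDeriv_loop_hMinus_hPlus, rhoOut, rhoIn, smul_ite,
        smul_zero, neg_smul]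
      split_ifs <;> abel
    · simp only [dif_neg hk, Finsupp.linearCombination_single, smul_add,
        wordDeriv_hPlus_hMinus_hMinus_hPlus, rhoOut, rhoIn, smul_ite, smul_zero]
      rw [sign_of_not_loop hk]
      split_ifs <;> (try simp only [neg_smul]) <;> abel
  rw [Finset.sum_congr rfl fun k _ => h k, Finset.sum_sub_distrib, Finset.sum_ite_eq' _ j,
    if_pos (Finset.mem_univ j), Finset.sum_eq_single (j + 1)]
  · simp [smul_sub]
  · intro k _ hk
    rw [if_neg]
    rintro rfl
    simp at hk
  · simp

end Derivative

end TrapezoidPartition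

namespace TrapezoidPartition

open ArrowQuiver

variable {N₀ N₁ : ℕ} {σ : TrapezoidPartition N₀ N₁} [NeZero (N₀ + N₁)] {N' : ℕ}
variable {α : ZMod (N₀ + N₁) → ℕ} (M : σ.quiver.Rep α)

/-- The sum of all maps `h^-`. -/
def minusMap : Matrix ((v : ZMod (N₀ + N₁)) × Fin (α v)) ((v : ZMod (N₀ + N₁)) × Fin (α v)) ℂ :=
  ∑ j, M.mat (σ.hMinus j)

/-- The sum of all loops. -/
def loopMap : Matrix ((v : ZMod (N₀ + N₁)) × Fin (α v)) ((v : ZMod (N₀ + N₁)) × Fin (α v)) ℂ :=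
  ∑ k, M.mat (σ.loop k)

theorem mat_mul_mat_eq_zero {a b : σ.Arrow} (h : σ.quiver.src a ≠ σ.quiver.tgt b) :
    M.mat a * M.mat b = 0 := by
  ext x y
  rw [Matrix.mul_apply, Matrix.zero_apply]
  refine Finset.sum_eq_zero fun z _ => ?_
  by_contra h0
  exact h ((mat_apply_ne_zero (left_ne_zero_of_mul h0)).2.symm.trans
    (mat_apply_ne_zero (right_ne_zero_of_mul h0)).1)

theorem cyclicMap_mul_mat (a : σ.Arrow) :
    cyclicMap M * M.mat a = M.mat (σ.hPlus (σ.quiver.tgt a)) * M.mat a := by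
  rw [cyclicMap, Finset.sum_mul, Finset.sum_eq_single (σ.quiver.tgt a)]
  · exact fun j _ hj => mat_mul_mat_eq_zero M hj
  · simp

theorem mat_mul_cyclicMap (a : σ.Arrow) :
    M.mat a * cyclicMap M = M.mat a * M.mat (σ.hPlus (σ.quiver.src a - 1)) := by
  rw [cyclicMap, Finset.mul_sum, Finset.sum_eq_single (σ.quiver.src a - 1)]
  · intro j _ hj
    refine mat_mul_mat_eq_zero M fun h => hj ?_
    rw [h]
    simp [quiver]
  · simp

theorem minusMap_mul_mat (a : σ.Arrow) :
    minusMap M * M.mat a = M.mat (σ.hMinus (σ.quiver.tgt a - 1)) * M.mat a := by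
  rw [minusMap, Finset.sum_mul, Finset.sum_eq_single (σ.quiver.tgt a - 1)]
  · intro j _ hj
    refine mat_mul_mat_eq_zero M fun h => hj ?_
    rw [← h]
    simp [quiver]
  · simp

theorem mat_mul_minusMap (a : σ.Arrow) :
    M.mat a * minusMap M = M.mat a * M.mat (σ.hMinus (σ.quiver.src a)) := by
  rw [minusMap, Finset.mul_sum, Finset.sum_eq_single (σ.quiver.src a)]
  · intro j _ hj
    refine mat_mul_mat_eq_zero M fun h => hj ?_
    rw [h]
    simp [quiver]
  · simp

open Classical in
theorem loopMap_mul_mat (a : σ.Arrow) :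
    loopMap M * M.mat a = (if h : σ.quiver.tgt a ∈ σ.loopVertices then
      M.mat (σ.loop ⟨σ.quiver.tgt a, h⟩) else 0) * M.mat a := by
  rw [loopMap, Finset.sum_mul]
  split_ifs with h
  · rw [Finset.sum_eq_single ⟨_, h⟩]
    · intro j _ hj
      exact mat_mul_mat_eq_zero M fun h' => hj (Subtype.ext h')
    · simp
  · rw [zero_mul]
    refine Finset.sum_eq_zero fun j _ => mat_mul_mat_eq_zero M fun h' => h ?_
    rw [← h']
    exact j.2

open Classical in
theorem mat_mul_loopMap (a : σ.Arrow) :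
    M.mat a * loopMap M = M.mat a * (if h : σ.quiver.src a ∈ σ.loopVertices then
      M.mat (σ.loop ⟨σ.quiver.src a, h⟩) else 0) := by
  rw [loopMap, Finset.mul_sum]
  split_ifs with h
  · rw [Finset.sum_eq_single ⟨_, h⟩]
    · intro j _ hj
      exact mat_mul_mat_eq_zero M fun h' => hj (Subtype.ext h'.symm)
    · simp
  · rw [mul_zero]
    refine Finset.sum_eq_zero fun j _ => mat_mul_mat_eq_zero M fun h' => h ?_
    rw [h']
    exact j.2

variable {M}

theorem rho_commutator (hloop : ∀ k, k ∈ σ.loopVertices ↔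
      k ∉ I₂ (N₀ + N₁) N' ∧ k - 1 ∉ I₂ (N₀ + N₁) N')
    (hM : ∀ a ∈ σ.cut N', M.mat a = 0) (j : ZMod (N₀ + N₁)) :
    rho (cyclicMap M) (minusMap M, loopMap M) * M.mat (σ.hPlus j) -
      M.mat (σ.hPlus j) * rho (cyclicMap M) (minusMap M, loopMap M) =
    rhoOut M (j + 1) * M.mat (σ.hPlus j) - M.mat (σ.hPlus j) * rhoIn M j := by
  have hm : ∀ i ∉ I₂ (N₀ + N₁) N', M.mat (σ.hMinus i) = 0 := fun i hi => hM _ ⟨i, hi, rfl⟩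
  have h1 : rho (cyclicMap M) (minusMap M, loopMap M) * M.mat (σ.hPlus j) =
      M.mat (σ.hPlus j) * M.mat (σ.hMinus j) * M.mat (σ.hPlus j) +
        rhoOut M (j + 1) * M.mat (σ.hPlus j) := by
    have e1 : cyclicMap M * (minusMap M * M.mat (σ.hPlus j)) =
        M.mat (σ.hPlus j) * M.mat (σ.hMinus j) * M.mat (σ.hPlus j) := by
      rw [minusMap_mul_mat, ← mul_assoc, cyclicMap_mul_mat]
      simp [quiver]
    have e2 : minusMap M * (cyclicMap M * M.mat (σ.hPlus j)) =
        M.mat (σ.hMinus (j + 1)) * M.mat (σ.hPlus (j + 1)) * M.mat (σ.hPlus j) := by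
      rw [cyclicMap_mul_mat, ← mul_assoc, minusMap_mul_mat]
      simp [quiver]
    simp only [rho, add_mul]
    rw [mul_assoc (cyclicMap M), e1, mul_assoc (minusMap M), e2, add_assoc, loopMap_mul_mat, rhoOut]
    congr 1
    by_cases h : j + 1 ∈ σ.loopVertices
    · have : σ.quiver.tgt (σ.hPlus j) ∈ σ.loopVertices := h
      rw [dif_pos h, dif_pos this, hm _ ((hloop _).1 h).1]
      simp [quiver]
    · have : σ.quiver.tgt (σ.hPlus j) ∉ σ.loopVertices := h
      rw [dif_neg h, dif_neg this]
      simp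
  have h2 : M.mat (σ.hPlus j) * rho (cyclicMap M) (minusMap M, loopMap M) =
      M.mat (σ.hPlus j) * M.mat (σ.hMinus j) * M.mat (σ.hPlus j) +
        M.mat (σ.hPlus j) * rhoIn M j := by
    have e1 : M.mat (σ.hPlus j) * minusMap M * cyclicMap M =
        M.mat (σ.hPlus j) * M.mat (σ.hMinus j) * M.mat (σ.hPlus j) := by
      rw [mat_mul_minusMap, mul_assoc, mat_mul_cyclicMap, mul_assoc]
      simp [quiver]
    have e2 : M.mat (σ.hPlus j) * cyclicMap M * minusMap M =
        M.mat (σ.hPlus j) * (M.mat (σ.hPlus (j - 1)) * M.mat (σ.hMinus (j - 1))) := by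
      rw [mat_mul_cyclicMap, mul_assoc, mat_mul_minusMap]
      simp [quiver]
    simp only [rho, mul_add]
    rw [← mul_assoc _ (cyclicMap M), e2, ← mul_assoc _ (minusMap M), e1,
      add_comm (M.mat (σ.hPlus j) * (_ * _)), add_assoc,
      mat_mul_loopMap, rhoIn]
    congr 1
    by_cases h : j ∈ σ.loopVertices
    · have : σ.quiver.src (σ.hPlus j) ∈ σ.loopVertices := h
      rw [dif_pos h, dif_pos this, hm _ ((hloop _).1 h).2]
      simp [quiver]
    · have : σ.quiver.src (σ.hPlus j) ∉ σ.loopVertices := h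
      rw [dif_neg h, dif_neg this]
      simp
  rw [h1, h2]
  abel

theorem rho_comm_iff (hloop : ∀ k, k ∈ σ.loopVertices ↔
      k ∉ I₂ (N₀ + N₁) N' ∧ k - 1 ∉ I₂ (N₀ + N₁) N')
    (hM : ∀ a ∈ σ.cut N', M.mat a = 0) :
    rho (cyclicMap M) (minusMap M, loopMap M) * cyclicMap M =
      cyclicMap M * rho (cyclicMap M) (minusMap M, loopMap M) ↔
    ∀ j, M.cyclicDeriv σ.potential (σ.hMinus j) = 0 := by
  have hm : ∀ i ∉ I₂ (N₀ + N₁) N', M.mat (σ.hMinus i) = 0 := fun i hi => hM _ ⟨i, hi, rfl⟩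
  set D : ZMod (N₀ + N₁) → Matrix ((v : ZMod (N₀ + N₁)) × Fin (α v))
    ((v : ZMod (N₀ + N₁)) × Fin (α v)) ℂ := fun j =>
    rhoOut M (j + 1) * M.mat (σ.hPlus j) - M.mat (σ.hPlus j) * rhoIn M j with hD
  have hsum : rho (cyclicMap M) (minusMap M, loopMap M) * cyclicMap M -
      cyclicMap M * rho (cyclicMap M) (minusMap M, loopMap M) = ∑ j, D j := by
    conv_lhs => rw [show cyclicMap M = ∑ j, M.mat (σ.hPlus j) from rfl]
    change rho (cyclicMap M) _ * _ - _ * rho (cyclicMap M) _ = _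
    rw [Finset.mul_sum, Finset.sum_mul, ← Finset.sum_sub_distrib]
    exact Finset.sum_congr rfl fun j _ => rho_commutator hloop hM j
  have hder : ∀ j, M.cyclicDeriv σ.potential (σ.hMinus j) = 0 ↔ D j = 0 := by
    intro j
    rw [cyclicDeriv_hMinus, smul_eq_zero_iff_right (sign_ne_zero j)]
  have hsupp : ∀ j x y, D j x y ≠ 0 → y.1 = j := by
    intro j x y h
    by_contra hy
    refine h ?_
    have h1 : ∀ z, M.mat (σ.hPlus j) z y = 0 := by
      intro z
      by_contra h0
      exact hy (mat_apply_ne_zero h0).2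
    have h2 : ∀ z, rhoIn M j z y = 0 := by
      intro z
      rw [rhoIn]
      split_ifs with hl
      · by_contra h0
        exact hy (mat_apply_ne_zero h0).2
      · rw [Matrix.mul_apply]
        refine Finset.sum_eq_zero fun u _ => ?_
        have : M.mat (σ.hMinus (j - 1)) u y = 0 := by
          by_contra h0
          refine hy ((mat_apply_ne_zero h0).2.trans ?_)
          simp [quiver]
        rw [this, mul_zero]
    simp [hD, Matrix.mul_apply, h1, h2]
  rw [← sub_eq_zero, hsum]
  constructor
  · intro h j
    rw [hder]
    ext x y
    by_cases hy : y.1 = j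
    · have h3 := congrFun (congrFun h x) y
      rw [Matrix.sum_apply, Finset.sum_eq_single j] at h3
      · exact h3
      · intro i _ hi
        by_contra h0
        exact hi ((hsupp i x y h0).symm.trans hy)
      · simp
    · by_contra h0
      exact hy (hsupp j x y h0)
  · intro h
    exact Finset.sum_eq_zero fun j _ => (hder j).1 (h j)

/-- The representation with given total matrices. -/
def ofMats (z : Matrix ((v : ZMod (N₀ + N₁)) × Fin (α v)) ((v : ZMod (N₀ + N₁)) × Fin (α v)) ℂ ×
    (Matrix ((v : ZMod (N₀ + N₁)) × Fin (α v)) ((v : ZMod (N₀ + N₁)) × Fin (α v)) ℂ ×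
    Matrix ((v : ZMod (N₀ + N₁)) × Fin (α v)) ((v : ZMod (N₀ + N₁)) × Fin (α v)) ℂ)) :
    σ.quiver.Rep α := fun x =>
  (match x.1 with
    | .inl _ => z.1
    | .inr (.inl _) => z.2.1
    | .inr (.inr _) => z.2.2) ⟨σ.quiver.tgt x.1, x.2.1⟩ ⟨σ.quiver.src x.1, x.2.2⟩

theorem mat_of_entries {T : Matrix ((v : ZMod (N₀ + N₁)) × Fin (α v))
    ((v : ZMod (N₀ + N₁)) × Fin (α v)) ℂ} {a : σ.Arrow}
    (h : ∀ y, M ⟨a, y⟩ = T ⟨σ.quiver.tgt a, y.1⟩ ⟨σ.quiver.src a, y.2⟩) (x y) :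
    M.mat a x y = if x.1 = σ.quiver.tgt a ∧ y.1 = σ.quiver.src a then T x y else 0 := by
  obtain ⟨v, i⟩ := x
  obtain ⟨u, j⟩ := y
  rw [Rep.mat]
  split_ifs with h1
  · obtain ⟨h2, h3⟩ := h1
    simp only at h2 h3
    subst h2 h3
    rw [h]
    rfl
  · rfl

theorem cyclicMap_ofMats {z} (hz : IsDeg (Sigma.fst (β := fun v => Fin (α v))) Sigma.fst 1 z.1) :
    cyclicMap (ofMats z : σ.quiver.Rep α) = z.1 := by
  ext x y
  rw [cyclicMap, Matrix.sum_apply, Finset.sum_congr rfl fun j _ =>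
    mat_of_entries (T := z.1) (fun y => rfl) x y, Finset.sum_eq_single y.1]
  · by_cases h : z.1 x y = 0
    · simp [h]
    · rw [if_pos ⟨hz x y h, rfl⟩]
  · intro j _ hj
    exact if_neg fun h => hj h.2.symm
  · simp

theorem minusMap_ofMats {J} {z} (hz : z.2 ∈ jSpace J (Sigma.fst (β := fun v => Fin (α v)))) :
    minusMap (ofMats z : σ.quiver.Rep α) = z.2.1 := by
  ext x y
  rw [minusMap, Matrix.sum_apply, Finset.sum_congr rfl fun j _ =>
    mat_of_entries (T := z.2.1) (fun y => rfl) x y, Finset.sum_eq_single x.1]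
  · by_cases h : z.2.1 x y = 0
    · simp [h]
    · rw [if_pos ⟨rfl, (hz.1 x y h).1⟩]
  · intro j _ hj
    exact if_neg fun h => hj h.1.symm
  · simp

theorem loopMap_ofMats {z} (hz : z.2 ∈ jSpace (I₂ (N₀ + N₁) N') (Sigma.fst (β := fun v => Fin (α v))))
    (hloop : ∀ k, k ∈ σ.loopVertices ↔ k ∉ I₂ (N₀ + N₁) N' ∧ k - 1 ∉ I₂ (N₀ + N₁) N') :
    loopMap (ofMats z : σ.quiver.Rep α) = z.2.2 := by
  ext x y
  rw [loopMap, Matrix.sum_apply, Finset.sum_congr rfl fun j _ =>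
    mat_of_entries (T := z.2.2) (fun y => rfl) x y]
  by_cases h : z.2.2 x y = 0
  · simp [h]
  · obtain ⟨h1, h2⟩ := hz.2 x y h
    rw [Finset.sum_eq_single ⟨x.1, (hloop _).2 h2⟩]
    · rw [if_pos ⟨rfl, h1.symm⟩]
    · intro j _ hj
      exact if_neg fun h => hj (Subtype.ext h.1.symm)
    · simp

theorem tame_cyclicMap : Tame fun M : σ.quiver.Rep α => cyclicMap M :=
  Tame.sum _ fun _ => tame_mat _

theorem tame_minusMap : Tame fun M : σ.quiver.Rep α => minusMap M :=
  Tame.sum _ fun _ => tame_mat _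

theorem tame_loopMap : Tame fun M : σ.quiver.Rep α => loopMap M :=
  Tame.sum _ fun _ => tame_mat _

theorem tame_ofMats : Tame (ofMats : _ → σ.quiver.Rep α) := by
  refine Tame.pi fun x => ?_
  rcases x with ⟨a | a | a, x⟩
  · exact tame_id.fst.entry _ _
  · exact tame_id.snd.fst.entry _ _
  · exact tame_id.snd.snd.entry _ _

/-- The truncated Jacobian algebra in the matrix model. -/
theorem mu_truncatedReps (hloop : ∀ k, k ∈ σ.loopVertices ↔
      k ∉ I₂ (N₀ + N₁) N' ∧ k - 1 ∉ I₂ (N₀ + N₁) N')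
    (hJ : ∀ k ∈ I₂ (N₀ + N₁) N', k + 1 ∉ I₂ (N₀ + N₁) N')
    (S : Set (Matrix ((v : ZMod (N₀ + N₁)) × Fin (α v)) ((v : ZMod (N₀ + N₁)) × Fin (α v)) ℂ)) :
    mu (σ.quiver.truncatedReps σ.potential (σ.cut N') α ∩ {M | cyclicMap M ∈ S}) =
      mu {z | z ∈ jReps (I₂ (N₀ + N₁) N') (Sigma.fst (β := fun v => Fin (α v))) ∧ z.1 ∈ S} := by
  have hC := isCut hloop hJ
  refine mu_congr (fun M => (cyclicMap M, minusMap M, loopMap M)) ofMats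
    (tame_cyclicMap.prodMk (tame_minusMap.prodMk tame_loopMap)) tame_ofMats ?_ ?_
  · rintro M ⟨⟨hM, hM'⟩, hS⟩
    have hm : ∀ i ∉ I₂ (N₀ + N₁) N', M.mat (σ.hMinus i) = 0 := fun i hi => hM _ ⟨i, hi, rfl⟩
    refine ⟨⟨⟨?_, ⟨?_, ?_⟩, (rho_comm_iff hloop hM).2 fun j => hM' _⟩, hS⟩, ?_⟩
    · intro x y h
      simp only [cyclicMap, Matrix.sum_apply] at h
      obtain ⟨j, -, hj⟩ := Finset.exists_ne_zero_of_sum_ne_zero h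
      have := mat_apply_ne_zero hj
      rw [this.1, this.2]
      simp [quiver]
    · intro x y h
      simp only [minusMap, Matrix.sum_apply] at h
      obtain ⟨j, -, hj⟩ := Finset.exists_ne_zero_of_sum_ne_zero h
      have := mat_apply_ne_zero hj
      rw [this.1, this.2]
      refine ⟨by simp [quiver], ?_⟩
      by_contra hj'
      rw [hm j hj'] at hj
      exact hj rfl
    · intro x y h
      simp only [loopMap, Matrix.sum_apply] at h
      obtain ⟨j, -, hj⟩ := Finset.exists_ne_zero_of_sum_ne_zero h
      have := mat_apply_ne_zero hj
      rw [this.1, this.2]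
      exact ⟨by simp [quiver], (hloop _).1 j.2⟩
    · funext x
      obtain ⟨a | a | a, i, i'⟩ := x
      · change cyclicMap M ⟨a + 1, i⟩ ⟨a, i'⟩ = _
        rw [cyclicMap, Matrix.sum_apply, Finset.sum_eq_single a]
        · exact mat_apply_mk M (σ.hPlus a) i i'
        · intro j _ hj
          by_contra h
          exact hj (mat_apply_ne_zero h).2.symm
        · simp
      · change minusMap M ⟨a, i⟩ ⟨a + 1, i'⟩ = _
        rw [minusMap, Matrix.sum_apply, Finset.sum_eq_single a]
        · exact mat_apply_mk M (σ.hMinus a) i i'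
        · intro j _ hj
          by_contra h
          exact hj (mat_apply_ne_zero h).1.symm
        · simp
      · change loopMap M ⟨a, i⟩ ⟨a, i'⟩ = _
        rw [loopMap, Matrix.sum_apply, Finset.sum_eq_single a]
        · exact mat_apply_mk M (σ.loop a) i i'
        · intro j _ hj
          by_contra h
          exact hj (Subtype.ext (mat_apply_ne_zero h).1.symm)
        · simp
  · rintro z ⟨⟨h1, h2, h3⟩, hS⟩
    have e1 := cyclicMap_ofMats (σ := σ) h1
    have e2 := minusMap_ofMats (σ := σ) h2
    have e3 := loopMap_ofMats (σ := σ) h2 hloop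
    have hM : ∀ a ∈ σ.cut N', (ofMats z : σ.quiver.Rep α).mat a = 0 := by
      rintro _ ⟨j, hj, rfl⟩
      refine mat_eq_zero_iff.2 fun y => ?_
      change z.2.1 _ _ = 0
      by_contra h0
      exact hj (h2.1 _ _ h0).2
    refine ⟨⟨⟨hM, fun a => ?_⟩, ?_⟩, ?_⟩
    · by_cases ha : a ∈ σ.cut N'
      · obtain ⟨j, hj, rfl⟩ := ha
        refine (rho_comm_iff hloop hM).1 ?_ j
        rw [e1, e2, e3]
        exact h3
      · exact cyclicDeriv_eq_zero hC hM ha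
    · change cyclicMap (ofMats z) ∈ S
      rwa [e1]
    · rw [e1, e2, e3]

end TrapezoidPartition

/-! ### Combinatorics of the special partition -/

section Special

variable {N₀ N₁ : ℕ} {σ : TrapezoidPartition N₀ N₁} [NeZero (N₀ + N₁)] {N' : ℕ}

theorem even_sub_of_loopVertices (hN' : N' ≤ N₀ + N₁)
    (hσ : σ.loopVertices = {k : ZMod (N₀ + N₁) | k.val < N'}) : Even (N₀ + N₁ - N') := by
  have h1 : ∀ k, σ.sign k = σ.sign (k - 1) * (if k.val < N' then 1 else -1) := by
    intro k
    have hk : k ∈ σ.loopVertices ↔ k.val < N' := by rw [hσ]; rfl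
    split_ifs with h
    · rw [TrapezoidPartition.sign_of_loop (hk.2 h), mul_one]
    · rw [TrapezoidPartition.sign_of_not_loop (fun h' => h (hk.1 h'))]
      ring
  have h2 : ∏ k, σ.sign k = (∏ k, σ.sign k) *
      ∏ k : ZMod (N₀ + N₁), (if k.val < N' then (1 : ℂ) else -1) := by
    conv_lhs => rw [Finset.prod_congr rfl fun k _ => h1 k, Finset.prod_mul_distrib]
    congr 1
    exact Equiv.prod_comp (Equiv.subRight (1 : ZMod (N₀ + N₁))) σ.sign
  have h3 : ∏ k : ZMod (N₀ + N₁), (if k.val < N' then (1 : ℂ) else -1) = 1 := by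
    have h0 : ∏ k, σ.sign k ≠ 0 :=
      Finset.prod_ne_zero_iff.2 fun k _ => TrapezoidPartition.sign_ne_zero k
    exact mul_left_cancel₀ h0 (by rw [← h2, mul_one])
  have h4 : ∏ k : ZMod (N₀ + N₁), (if k.val < N' then (1 : ℂ) else -1) =
      ∏ i ∈ Finset.range (N₀ + N₁), (if i < N' then (1 : ℂ) else -1) := by
    refine Finset.prod_bij (fun k _ => k.val) ?_ ?_ ?_ ?_
    · exact fun k _ => Finset.mem_range.2 (ZMod.val_lt k)
    · exact fun a _ b _ h => ZMod.val_injective _ h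
    · exact fun i hi => ⟨(i : ZMod (N₀ + N₁)), Finset.mem_univ _,
        ZMod.val_cast_of_lt (Finset.mem_range.1 hi)⟩
    · exact fun _ _ => rfl
  obtain ⟨m, hm⟩ := Nat.exists_eq_add_of_le hN'
  rw [h4, hm, Finset.prod_range_add, Finset.prod_congr rfl fun i hi =>
    if_pos (Finset.mem_range.1 hi)] at h3
  simp only [Finset.prod_const_one, one_mul, not_lt.2 (Nat.le_add_right _ _), if_false,
    Finset.prod_const, Finset.card_range] at h3
  rw [hm, Nat.add_sub_cancel_left]
  by_contra hodd
  rw [Nat.not_even_iff_odd] at hodd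
  rw [hodd.neg_one_pow] at h3
  norm_num at h3

theorem val_add_one_of_lt' {N : ℕ} [NeZero N] {k : ZMod N} (h : k.val + 1 < N) :
    (k + 1).val = k.val + 1 := by
  rw [ZMod.val_add, ZMod.val_one_eq_one_mod, Nat.add_mod_mod, Nat.mod_eq_of_lt h]

theorem I₃_iff {N N' : ℕ} [NeZero N] (hN' : N' ≤ N) (he : Even (N - N')) (k : ZMod N) :
    k ∈ I₃ N N' ↔ k - 1 ∈ I₂ N N' := by
  simp only [I₂, I₃, Set.mem_ofPred_eq]
  constructor
  · rintro ⟨h1, h2⟩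
    have h0 : k.val - N' ≠ 0 := fun h => by simp [h] at h2
    obtain ⟨j, hj⟩ : ∃ j : ZMod N, k = j + 1 := ⟨k - 1, by ring⟩
    have hval : (k - 1).val = k.val - 1 := by
      have : 1 ≤ k.val := by omega
      have h3 : ((k.val - 1 : ℕ) : ZMod N) = k - 1 := by
        rw [Nat.cast_sub this, ZMod.natCast_zmod_val, Nat.cast_one]
      rw [← h3, ZMod.val_cast_of_lt (by have := ZMod.val_lt k; omega)]
    rw [hval]
    refine ⟨by omega, ?_⟩
    obtain ⟨m, hm⟩ := h2
    exact ⟨m, by omega⟩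
  · rintro ⟨h1, h2⟩
    have hlt := ZMod.val_lt (k - 1)
    obtain ⟨m, hm⟩ := h2
    obtain ⟨n, hn⟩ := he
    have hval : k.val = (k - 1).val + 1 := by
      conv_lhs => rw [← sub_add_cancel k 1]
      exact val_add_one_of_lt' (by omega)
    rw [hval]
    exact ⟨by omega, m, by omega⟩

theorem special_hJ {N N' : ℕ} [NeZero N] (hN' : N' ≤ N) (he : Even (N - N')) :
    ∀ k ∈ I₂ N N', k + 1 ∉ I₂ N N' := by
  intro k hk hk'
  have h3 := (I₃_iff hN' he (k + 1)).2 (by simpa using hk)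
  exact (Nat.not_even_iff_odd.2 h3.2) hk'.2

theorem special_hloop (hN' : N' ≤ N₀ + N₁)
    (hσ : σ.loopVertices = {k : ZMod (N₀ + N₁) | k.val < N'}) (k : ZMod (N₀ + N₁)) :
    k ∈ σ.loopVertices ↔ k ∉ I₂ (N₀ + N₁) N' ∧ k - 1 ∉ I₂ (N₀ + N₁) N' := by
  rw [← I₃_iff hN' (even_sub_of_loopVertices hN' hσ), hσ]
  simp only [I₂, I₃, Set.mem_ofPred_eq, not_and, Nat.not_even_iff_odd, Nat.not_odd_iff_even]
  constructor
  · exact fun h => ⟨fun h' => absurd h' (by omega), fun h' => absurd h' (by omega)⟩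
  · rintro ⟨h1, h2⟩
    by_contra h
    exact (Nat.not_even_iff_odd.2 (h1 (by omega))) (h2 (by omega))

end Special

/-! ## Slices of group actions -/

theorem mu_slice {n : Type} [Fintype n] [DecidableEq n] {E : Type} [AddCommGroup E] [Module ℂ E]
    [FiniteDimensional ℂ E] (act : Matrix n n ℂ → E → E)
    (hact : Tame fun z : Matrix n n ℂ × E => act z.1 z.2) {G H : Set (Matrix n n ℂ)} {T S : Set E}
    (hG : Cons G) (hH : Cons H) (hT : Cons T) (hu : ∀ g ∈ G, IsUnit g)
    (hmul : ∀ g ∈ G, ∀ h ∈ G, g * h ∈ G) (hinv : ∀ g ∈ G, g⁻¹ ∈ G) (hHG : H ⊆ G)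
    (hact_mul : ∀ g ∈ G, ∀ h ∈ G, ∀ x, act g (act h x) = act (g * h) x)
    (hact_one : ∀ x, act 1 x = x) (hS : ∀ g ∈ G, ∀ t ∈ T, act g t ∈ S)
    (hTH : ∀ g ∈ G, ∀ t ∈ T, act g t ∈ T ↔ g ∈ H) (s : E → Matrix n n ℂ) (hs : Tame s)
    (hsS : ∀ x ∈ S, s x ∈ G ∧ act (s x)⁻¹ x ∈ T) :
    Cons S ∧ mu G * mu T = mu S * mu H := by
  have hiu : ∀ g ∈ G, g⁻¹ * g = 1 ∧ g * g⁻¹ = 1 := fun g hg =>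
    have := (Matrix.isUnit_iff_isUnit_det g).1 (hu g hg)
    ⟨Matrix.nonsing_inv_mul g this, Matrix.mul_nonsing_inv g this⟩
  have hact' : ∀ {E' : Type} [AddCommGroup E'] [Module ℂ E'] {a : E' → Matrix n n ℂ} {b : E' → E},
      Tame a → Tame b → Tame fun x => act (a x) (b x) := fun ha hb => hact.comp (ha.prodMk hb)
  have hSc : Cons S := by
    have := (hG.preimage hs).and (hT.preimage (hact' hs.matrixInv tame_id))
    convert this using 1
    ext x
    refine ⟨fun hx => hsS x hx, fun ⟨h1, h2⟩ => ?_⟩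
    have := hS _ h1 _ h2
    rwa [hact_mul _ h1 _ (hinv _ h1), (hiu _ h1).2, hact_one] at this
  refine ⟨hSc, ?_⟩
  rw [← mu_prod hG hT, ← mu_prod hSc hH]
  refine mu_congr (fun z => (act z.1 z.2, (s (act z.1 z.2))⁻¹ * z.1))
    (fun z => (s z.1 * z.2, act z.2⁻¹ (act (s z.1)⁻¹ z.1))) ?_ ?_ ?_ ?_
  · exact hact.prodMk ((hs.comp hact).matrixInv.matrixMul tame_id.fst)
  · exact ((hs.comp tame_id.fst).matrixMul tame_id.snd).prodMk
      (hact' tame_id.snd.matrixInv (hact' (hs.comp tame_id.fst).matrixInv tame_id.fst))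
  · rintro ⟨g, t⟩ ⟨hg, ht⟩
    simp only at hg ht ⊢
    have hgt := hS g hg t ht
    obtain ⟨h1, h2⟩ := hsS _ hgt
    have h3 := hmul _ (hinv _ h1) _ hg
    rw [hact_mul _ (hinv _ h1) _ hg] at h2
    refine ⟨⟨hgt, (hTH _ h3 t ht).1 h2⟩, ?_⟩
    rw [← mul_assoc, (hiu _ h1).2, one_mul, hact_mul _ (hinv _ h1) _ hg,
      hact_mul _ (hinv _ h3) _ h3, (hiu _ h3).1, hact_one]
  · rintro ⟨x, h⟩ ⟨hx, hh⟩
    simp only at hx hh ⊢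
    obtain ⟨h1, h2⟩ := hsS x hx
    have hhG := hHG hh
    have h3 := hinv _ hhG
    have h4 : h⁻¹ ∈ H := by
      have h5 := (hTH h hhG _ h2).2 hh
      refine (hTH _ h3 _ h5).1 ?_
      rwa [hact_mul _ h3 _ hhG, (hiu _ hhG).1, hact_one]
    have h5 : act (s x * h) (act h⁻¹ (act (s x)⁻¹ x)) = x := by
      rw [hact_mul _ h3 _ (hinv _ h1), hact_mul _ (hmul _ h1 _ hhG) _ (hmul _ h3 _ (hinv _ h1)),
        mul_assoc, ← mul_assoc h, (hiu _ hhG).2, one_mul, (hiu _ h1).2, hact_one]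
    refine ⟨⟨hmul _ h1 _ hhG, (hTH _ h3 _ h2).2 h4⟩, ?_⟩
    rw [h5, ← mul_assoc, (hiu _ h1).1, one_mul]

/-! ## Graded matrices -/

section Graded

variable {N : ℕ} {A B C : Type} {dA : A → ZMod N} {dB : B → ZMod N} {dC : C → ZMod N}

open Classical in
/-- The projection onto the degrees in `X`. -/
def degProj (d : B → ZMod N) (X : Set (ZMod N)) : Matrix B B ℂ :=
  Matrix.diagonal fun b => if d b ∈ X then 1 else 0

open Classical in
theorem degProj_mul_apply [Fintype C] (X : Set (ZMod N)) (M : Matrix C B ℂ) (c b) :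
    (degProj dC X * M) c b = if dC c ∈ X then M c b else 0 := by
  rw [degProj, Matrix.diagonal_mul]
  split_ifs <;> simp

open Classical in
theorem mul_degProj_apply [Fintype B] (X : Set (ZMod N)) (M : Matrix C B ℂ) (c b) :
    (M * degProj dB X) c b = if dB b ∈ X then M c b else 0 := by
  rw [degProj, Matrix.mul_diagonal]
  split_ifs <;> simp

theorem degProj_mul_eq_iff [Fintype C] {X : Set (ZMod N)} {M : Matrix C B ℂ} :
    degProj dC X * M = M ↔ ∀ c b, M c b ≠ 0 → dC c ∈ X := by
  rw [← Matrix.ext_iff]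
  refine forall_congr' fun c => forall_congr' fun b => ?_
  rw [degProj_mul_apply]
  split_ifs with h
  · simp [h]
  · simp [h, eq_comm]

theorem isDeg_iff [Fintype B] [Fintype C] {e : ZMod N} {M : Matrix C B ℂ} :
    IsDeg dC dB e M ↔ ∀ k, degProj dC {k + e} * M = M * degProj dB {k} := by
  constructor
  · intro h k
    ext c b
    rw [degProj_mul_apply, mul_degProj_apply]
    by_cases h0 : M c b = 0
    · simp [h0]
    · simp [h c b h0]
  · intro h c b h0
    have := congrFun (congrFun (h (dB b)) c) b
    rw [degProj_mul_apply, mul_degProj_apply] at this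
    by_contra h1
    rw [if_neg (by simpa using h1), if_pos (by simp)] at this
    exact h0 this.symm

theorem IsDeg.degProj_mul [Fintype B] [Fintype C] {M : Matrix C B ℂ} (h : IsDeg dC dB 0 M)
    (X : Set (ZMod N)) : degProj dC X * M = M * degProj dB X := by
  ext c b
  rw [degProj_mul_apply, mul_degProj_apply]
  by_cases h0 : M c b = 0
  · simp [h0]
  · rw [h c b h0, add_zero]

theorem IsDeg.mul [Fintype B] {e f : ZMod N} {M : Matrix C B ℂ} {M' : Matrix B A ℂ}
    (h : IsDeg dC dB e M) (h' : IsDeg dB dA f M') : IsDeg dC dA (e + f) (M * M') := by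
  intro c a hca
  rw [Matrix.mul_apply] at hca
  obtain ⟨b, -, hb⟩ := Finset.exists_ne_zero_of_sum_ne_zero hca
  rw [h c b (left_ne_zero_of_mul hb), h' b a (right_ne_zero_of_mul hb)]
  ring

theorem IsDeg.mul_zero_left [Fintype B] {e : ZMod N} {M : Matrix C B ℂ} {M' : Matrix B A ℂ}
    (h : IsDeg dC dB 0 M) (h' : IsDeg dB dA e M') : IsDeg dC dA e (M * M') := by
  simpa using h.mul h'

theorem IsDeg.mul_zero_right [Fintype B] {e : ZMod N} {M : Matrix C B ℂ} {M' : Matrix B A ℂ}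
    (h : IsDeg dC dB e M) (h' : IsDeg dB dA 0 M') : IsDeg dC dA e (M * M') := by
  simpa using h.mul h'

theorem IsDeg.add {e : ZMod N} {M M' : Matrix C B ℂ} (h : IsDeg dC dB e M)
    (h' : IsDeg dC dB e M') : IsDeg dC dB e (M + M') := by
  intro c b hcb
  by_cases h0 : M c b = 0
  · exact h' c b fun h1 => hcb (by simp [h0, h1])
  · exact h c b h0

theorem isDeg_one [DecidableEq B] : IsDeg dB dB 0 (1 : Matrix B B ℂ) := by
  intro c b h
  by_cases hcb : c = b
  · simp [hcb]
  · simp [hcb] at h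

theorem isDeg_degProj (X : Set (ZMod N)) : IsDeg dB dB 0 (degProj dB X) := by
  intro c b h
  by_cases hcb : c = b
  · simp [hcb]
  · simp [degProj, hcb] at h

theorem IsDeg.pow [Fintype B] [DecidableEq B] {M : Matrix B B ℂ} (h : IsDeg dB dB 1 M) (n : ℕ) :
    IsDeg dB dB n (M ^ n) := by
  induction n with
  | zero => simpa using isDeg_one
  | succ n ih =>
    rw [pow_succ, Nat.cast_succ]
    exact ih.mul h

theorem IsDeg.of_inverse [Fintype B] [Fintype C] [DecidableEq B] [DecidableEq C] {e : ZMod N}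
    {M : Matrix C B ℂ} {M' : Matrix B C ℂ} (h : IsDeg dC dB e M) (h1 : M * M' = 1)
    (h2 : M' * M = 1) : IsDeg dB dC (-e) M' := by
  rw [isDeg_iff] at h ⊢
  intro k
  have h3 := h (k + -e)
  rw [neg_add_cancel_right] at h3
  calc degProj dB {k + -e} * M' = M' * (M * degProj dB {k + -e}) * M' := by
        rw [← Matrix.mul_assoc, h2, Matrix.one_mul]
    _ = M' * degProj dC {k} := by
        rw [← h3, Matrix.mul_assoc, Matrix.mul_assoc, h1, Matrix.mul_one]

/-- An invertible homogeneous matrix gives a bijection of the index sets. -/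
theorem exists_equiv_of_isDeg [Fintype B] [Fintype C] [DecidableEq B] [DecidableEq C] {e : ZMod N}
    {M : Matrix C B ℂ} {M' : Matrix B C ℂ} (h : IsDeg dC dB e M) (h1 : M * M' = 1)
    (h2 : M' * M = 1) : ∃ σ : B ≃ C, ∀ b, dC (σ b) = dB b + e := by
  have hcard : Fintype.card B = Fintype.card C := by
    have e1 := Matrix.rank_mul_le_left M M'
    have e2 := Matrix.rank_mul_le_left M' M
    rw [h1, Matrix.rank_one] at e1
    rw [h2, Matrix.rank_one] at e2
    exact le_antisymm (e2.trans (Matrix.rank_le_card_width M'))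
      (e1.trans (Matrix.rank_le_card_width M))
  let τ : B ≃ C := Fintype.equivOfCardEq hcard
  have hdet : (M.submatrix τ id).det ≠ 0 := by
    have : M.submatrix τ id * M'.submatrix id τ = 1 := by
      rw [← Matrix.submatrix_mul _ _ _ _ _ Function.bijective_id, h1]
      exact Matrix.submatrix_one_equiv τ
    exact fun h0 => by simpa [h0] using congrArg Matrix.det this
  rw [Matrix.det_apply] at hdet
  obtain ⟨π, -, hπ⟩ := Finset.exists_ne_zero_of_sum_ne_zero hdet
  refine ⟨π.trans τ, fun b => ?_⟩
  have h3 : ∏ i, (M.submatrix τ id) (π i) i ≠ 0 := fun h0 => hπ (by rw [h0, smul_zero])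
  exact h _ _ (Finset.prod_ne_zero_iff.1 h3 b (Finset.mem_univ b))

theorem exists_equiv_sigma [Fintype B] (d : B → ZMod N) {α : ZMod N → ℕ}
    (h : ∀ k, Nat.card {b // d b = k} = α k) :
    ∃ σ : ((k : ZMod N) × Fin (α k)) ≃ B, ∀ x, d (σ x) = x.1 := by
  refine ⟨(Equiv.sigmaCongrRight fun k => (Finite.equivFinOfCardEq (h k)).symm).trans
    (Equiv.sigmaFiberEquiv d), fun x => ?_⟩
  exact ((Finite.equivFinOfCardEq (h x.1)).symm x.2).2

end Graded

section Conj

variable {N : ℕ} {B C : Type} [Fintype B] [Fintype C] {dB : B → ZMod N} {dC : C → ZMod N}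

/-- Transport of the structure along `g`, with inverse `h`. -/
def conj (g : Matrix C B ℂ) (h : Matrix B C ℂ) (z : MatTriple B) :
    MatTriple C :=
  (g * z.1 * h, (g * z.2.1 * h, g * z.2.2 * h))

theorem mem_jSpace_iff {J : Set (ZMod N)} {y : MatPair B} :
    y ∈ jSpace J dB ↔ (IsDeg dB dB (-1) y.1 ∧ degProj dB J * y.1 = y.1) ∧
      IsDeg dB dB 0 y.2 ∧ degProj dB {k | k ∉ J ∧ k - 1 ∉ J} * y.2 = y.2 := by
  have h1 : (IsDeg dB dB (-1) y.1 ∧ degProj dB J * y.1 = y.1) ↔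
      ∀ c b, y.1 c b ≠ 0 → dB b = dB c + 1 ∧ dB c ∈ J := by
    rw [degProj_mul_eq_iff]
    refine ⟨fun h c b h0 => ⟨by rw [h.1 c b h0]; ring, h.2 c b h0⟩, fun h => ⟨fun c b h0 => ?_,
      fun c b h0 => (h c b h0).2⟩⟩
    rw [(h c b h0).1]
    ring
  have h2 : (IsDeg dB dB 0 y.2 ∧ degProj dB {k | k ∉ J ∧ k - 1 ∉ J} * y.2 = y.2) ↔
      ∀ c b, y.2 c b ≠ 0 → dB c = dB b ∧ dB c ∉ J ∧ dB c - 1 ∉ J := by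
    rw [degProj_mul_eq_iff]
    exact ⟨fun h c b h0 => ⟨by simpa using h.1 c b h0, h.2 c b h0⟩, fun h =>
      ⟨fun c b h0 => by simpa using (h c b h0).1, fun c b h0 => (h c b h0).2⟩⟩
  rw [h1, h2]
  rfl

theorem rho_conj [DecidableEq B] {g : Matrix C B ℂ} {h : Matrix B C ℂ} (hhg : h * g = 1)
    (H : Matrix B B ℂ) (y : MatPair B) :
    rho (g * H * h) (g * y.1 * h, g * y.2 * h) = g * rho H y * h := by
  have e : ∀ X Y : Matrix B B ℂ, g * X * h * (g * Y * h) = g * (X * Y) * h := by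
    intro X Y
    rw [Matrix.mul_assoc, ← Matrix.mul_assoc h, ← Matrix.mul_assoc h, hhg, Matrix.one_mul,
      Matrix.mul_assoc, Matrix.mul_assoc, ← Matrix.mul_assoc X, Matrix.mul_assoc]
  simp only [rho, e, Matrix.mul_add, Matrix.add_mul]

theorem conj_mem_jReps [DecidableEq B] {J : Set (ZMod N)} {g : Matrix C B ℂ} {h : Matrix B C ℂ}
    (hg : IsDeg dC dB 0 g) (hh : IsDeg dB dC 0 h) (hhg : h * g = 1) {z} (hz : z ∈ jReps J dB) :
    conj g h z ∈ jReps J dC := by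
  obtain ⟨h1, h2, h3⟩ := hz
  obtain ⟨⟨h4, h5⟩, h6, h7⟩ := mem_jSpace_iff.1 h2
  have hd : ∀ {e : ZMod N} {X : Matrix B B ℂ}, IsDeg dB dB e X → IsDeg dC dC e (g * X * h) :=
    fun hX => (hg.mul_zero_left hX).mul_zero_right hh
  have hp : ∀ {X} {M : Matrix B B ℂ}, degProj dB X * M = M →
      degProj dC X * (g * M * h) = g * M * h := by
    intro X M hM
    rw [← Matrix.mul_assoc, ← Matrix.mul_assoc, hg.degProj_mul, Matrix.mul_assoc g, hM]
  refine ⟨hd h1, mem_jSpace_iff.2 ⟨⟨hd h4, hp h5⟩, hd h6, hp h7⟩, ?_⟩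
  have e : ∀ X Y : Matrix B B ℂ, g * X * h * (g * Y * h) = g * (X * Y) * h := by
    intro X Y
    rw [Matrix.mul_assoc, ← Matrix.mul_assoc h, ← Matrix.mul_assoc h, hhg, Matrix.one_mul,
      Matrix.mul_assoc, Matrix.mul_assoc, ← Matrix.mul_assoc X, Matrix.mul_assoc]
  change rho (g * z.1 * h) (g * z.2.1 * h, g * z.2.2 * h) * (g * z.1 * h) =
    g * z.1 * h * rho (g * z.1 * h) (g * z.2.1 * h, g * z.2.2 * h)
  rw [rho_conj hhg, e, e, h3]

theorem conj_conj {A : Type} [Fintype A] (g : Matrix C B ℂ) (h : Matrix B C ℂ) (g' : Matrix B A ℂ)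
    (h' : Matrix A B ℂ) (z) : conj g h (conj g' h' z) = conj (g * g') (h' * h) z := by
  simp only [conj, Matrix.mul_assoc]

theorem conj_one [DecidableEq B] (z : MatTriple B) :
    conj 1 1 z = z := by
  simp [conj]

@[fun_prop]
theorem Tame.conj {E : Type} [AddCommGroup E] [Module ℂ E] {g : E → Matrix C B ℂ}
    {h : E → Matrix B C ℂ} {z : E → MatTriple B} (hg : Tame g)
    (hh : Tame h) (hz : Tame z) : Tame fun x => conj (g x) (h x) (z x) := by
  unfold MotivicDT.conj
  fun_prop

/-- Invertible matrices of degree zero. -/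
def gradedUnits [DecidableEq B] (d : B → ZMod N) : Set (Matrix B B ℂ) :=
  {g | IsDeg d d 0 g ∧ IsUnit g}

theorem gradedUnits_inv [DecidableEq B] {g : Matrix B B ℂ} (hg : g ∈ gradedUnits dB) :
    g⁻¹ ∈ gradedUnits dB ∧ g⁻¹ * g = 1 ∧ g * g⁻¹ = 1 := by
  have h := (Matrix.isUnit_iff_isUnit_det g).1 hg.2
  have h1 := Matrix.nonsing_inv_mul g h
  have h2 := Matrix.mul_nonsing_inv g h
  refine ⟨⟨?_, IsUnit.of_mul_eq_one _ h1⟩, h1, h2⟩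
  simpa using hg.1.of_inverse h2 h1

theorem gradedUnits_mul [DecidableEq B] {g h : Matrix B B ℂ} (hg : g ∈ gradedUnits dB)
    (hh : h ∈ gradedUnits dB) : g * h ∈ gradedUnits dB :=
  ⟨hg.1.mul_zero_left hh.1, hg.2.mul hh.2⟩

theorem cons_gradedUnits [DecidableEq B] : Cons (gradedUnits dB) :=
  (cons_isDeg dB dB 0 tame_id).and (Cons.isUnit tame_id)

open Classical in
/-- A bijection of the index sets as a matrix. -/
def equivMatrix (σ : B ≃ C) : Matrix C B ℂ := fun c b => if σ b = c then 1 else 0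

theorem isDeg_equivMatrix {σ : B ≃ C} (hσ : ∀ b, dC (σ b) = dB b) :
    IsDeg dC dB 0 (equivMatrix σ) := by
  intro c b h
  by_cases h1 : σ b = c
  · simp [← h1, hσ]
  · simp [equivMatrix, h1] at h

theorem equivMatrix_mul_symm [DecidableEq C] (σ : B ≃ C) :
    equivMatrix σ * equivMatrix σ.symm = 1 := by
  ext c c'
  simp only [equivMatrix, Matrix.mul_apply, Matrix.one_apply, mul_ite, mul_one, mul_zero]
  rw [Finset.sum_eq_single (σ.symm c'), if_pos rfl, Equiv.apply_symm_apply]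
  · simp only [eq_comm]
  · exact fun b _ hb => if_neg hb.symm
  · simp

/-- A set of structures on `B` and the corresponding set of structures on `C`. -/
theorem mu_equiv [DecidableEq B] [DecidableEq C] (σ : B ≃ C)
    (S : Set (MatTriple B)) :
    mu {z | conj (equivMatrix σ.symm) (equivMatrix σ) z ∈ S} = mu S := by
  have e1 := equivMatrix_mul_symm σ
  have e2 := equivMatrix_mul_symm σ.symm
  rw [Equiv.symm_symm] at e2
  refine mu_congr (fun z => conj (equivMatrix σ.symm) (equivMatrix σ) z)
    (fun z => conj (equivMatrix σ) (equivMatrix σ.symm) z) (by fun_prop) (by fun_prop) ?_ ?_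
  · intro x hx
    exact ⟨hx, by rw [conj_conj, e1, conj_one]⟩
  · intro y hy
    have : conj (equivMatrix σ.symm) (equivMatrix σ) (conj (equivMatrix σ) (equivMatrix σ.symm) y)
        = y := by rw [conj_conj, e2, conj_one]
    refine ⟨?_, this⟩
    change conj _ _ _ ∈ S
    rwa [this]

end Conj

theorem mu_gradedUnits_sigma {N : ℕ} [NeZero N] (α : ZMod N → ℕ) :
    mu (gradedUnits (Sigma.fst : ((k : ZMod N) × Fin (α k)) → ZMod N)) = motiveG α := by
  have h : ∀ M : Matrix ((k : ZMod N) × Fin (α k)) ((k : ZMod N) × Fin (α k)) ℂ,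
      IsDeg Sigma.fst Sigma.fst 0 M → Matrix.blockDiagonal' (Matrix.blockDiag' M) = M := by
    rintro M hM
    ext ⟨k, i⟩ ⟨l, j⟩
    by_cases hkl : k = l
    · subst hkl
      rw [Matrix.blockDiagonal'_apply_eq, Matrix.blockDiag'_apply]
    · rw [Matrix.blockDiagonal'_apply_ne _ _ _ hkl]
      by_contra h0
      exact hkl (by simpa using hM _ _ (Ne.symm h0))
  have h' : ∀ X : ∀ k : ZMod N, Matrix (Fin (α k)) (Fin (α k)) ℂ,
      IsDeg Sigma.fst Sigma.fst 0 (Matrix.blockDiagonal' X) := by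
    rintro X ⟨k, i⟩ ⟨l, j⟩ h0
    by_contra hkl
    exact h0 (Matrix.blockDiagonal'_apply_ne _ _ _ (by simpa using hkl))
  have hu : ∀ k, Cons {A : Matrix (Fin (α k)) (Fin (α k)) ℂ | IsUnit A} :=
    fun k => Cons.isUnit tame_id
  rw [motiveG, Finset.prod_congr rfl fun k _ => motiveGL_eq_mu (α k),
    ← finprod_eq_prod_of_fintype, ← mu_pi hu]
  refine mu_congr (fun M k => Matrix.blockDiag' M k) (fun X => Matrix.blockDiagonal' X) ?_ ?_ ?_ ?_
  · exact Tame.pi fun k => Tame.matrix fun i j => tame_id.entry _ _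
  · refine Tame.matrix fun x y => ?_
    obtain ⟨k, i⟩ := x
    obtain ⟨l, j⟩ := y
    by_cases hkl : k = l
    · subst hkl
      simp only [Matrix.blockDiagonal'_apply_eq]
      exact (tame_apply k).entry _ _
    · simp only [Matrix.blockDiagonal'_apply_ne _ _ _ hkl]
      exact tame_const _
  · intro M hM
    refine ⟨fun k => ?_, h M hM.1⟩
    obtain ⟨h1, h2, h3⟩ := gradedUnits_inv hM
    rw [← h _ h1.1, ← h _ hM.1, ← Matrix.blockDiagonal'_mul, ← Matrix.blockDiagonal'_one] at h2
    exact IsUnit.of_mul_eq_one _ (mul_eq_one_comm.1 (congrFun (Matrix.blockDiagonal'_injective h2) k))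
  · intro X hX
    refine ⟨⟨h' X, ?_⟩, Matrix.blockDiag'_blockDiagonal' X⟩
    refine IsUnit.of_mul_eq_one (Matrix.blockDiagonal' fun k => (X k)⁻¹) ?_
    rw [← Matrix.blockDiagonal'_mul, ← Matrix.blockDiagonal'_one]
    congr 1
    funext k
    exact Matrix.mul_nonsing_inv _ ((Matrix.isUnit_iff_isUnit_det _).1 (hX k))

/-! ## The Fitting decomposition -/

theorem isNilpotent_iff_pow_eq_zero {B : Type} [Fintype B] [DecidableEq B] {M : Matrix B B ℂ}
    {n : ℕ} (hn : Fintype.card B ≤ n) : IsNilpotent M ↔ M ^ n = 0 := by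
  refine ⟨fun h => ?_, fun h => ⟨_, h⟩⟩
  have h3 := (Matrix.isNilpotent_charpoly_sub_pow_of_isNilpotent h).eq_zero
  have h4 := Matrix.aeval_self_charpoly M
  rw [sub_eq_zero.1 h3] at h4
  exact pow_eq_zero_of_le hn (by simpa using h4)

section Support

variable {N : ℕ} {A B C : Type} [Fintype B] {d : B → ZMod N}

theorem degProj_mul_degProj (X Y : Set (ZMod N)) :
    degProj d X * degProj d Y = degProj d (X ∩ Y) := by
  classical
  ext b c
  rw [degProj_mul_apply]
  by_cases hbc : b = c
  · subst hbc
    by_cases h : d b ∈ X <;> simp [degProj, h]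
  · simp [degProj, hbc]

theorem degProj_mul_of_disjoint {X Y : Set (ZMod N)} (h : Disjoint X Y) {M : Matrix B A ℂ}
    (hM : degProj d Y * M = M) : degProj d X * M = 0 := by
  rw [← hM, ← Matrix.mul_assoc, degProj_mul_degProj, h.inter_eq]
  simp [degProj]

variable {J : Set (ZMod N)} {H : Matrix B B ℂ} {y : MatPair B}

/-- The endomorphism `rho H y` determines `H * y.1`, `y.1 * H` and `y.2`. -/
theorem degProj_rho (hJ : ∀ k ∈ J, k + 1 ∉ J) (hH : IsDeg d d 1 H) (hy : y ∈ jSpace J d) :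
    degProj d {k | k - 1 ∈ J} * rho H y = H * y.1 ∧ degProj d J * rho H y = y.1 * H ∧
      degProj d {k | k ∉ J ∧ k - 1 ∉ J} * rho H y = y.2 := by
  obtain ⟨⟨-, h1⟩, -, h3⟩ := mem_jSpace_iff.1 hy
  have h2 : degProj d J * (y.1 * H) = y.1 * H := by rw [← Matrix.mul_assoc, h1]
  have h0 : degProj d {k | k - 1 ∈ J} * (H * y.1) = H * y.1 := by
    rw [degProj_mul_eq_iff]
    intro c b h
    rw [Matrix.mul_apply] at h
    obtain ⟨x, -, hx⟩ := Finset.exists_ne_zero_of_sum_ne_zero h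
    have e := hH c x (left_ne_zero_of_mul hx)
    have e' := (hy.1 x b (right_ne_zero_of_mul hx)).2
    change d c - 1 ∈ J
    rwa [e, add_sub_cancel_right]
  have d1 : Disjoint {k | k - 1 ∈ J} J := by
    refine Set.disjoint_left.2 fun k hk hk' => hJ _ hk ?_
    rwa [sub_add_cancel]
  have d2 : Disjoint {k | k - 1 ∈ J} {k | k ∉ J ∧ k - 1 ∉ J} :=
    Set.disjoint_left.2 fun k hk hk' => hk'.2 hk
  have d3 : Disjoint J {k | k ∉ J ∧ k - 1 ∉ J} :=
    Set.disjoint_left.2 fun k hk hk' => hk'.1 hk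
  refine ⟨?_, ?_, ?_⟩
  · rw [rho, Matrix.mul_add, Matrix.mul_add, h0, degProj_mul_of_disjoint d1 h2,
      degProj_mul_of_disjoint d2 h3, add_zero, add_zero]
  · rw [rho, Matrix.mul_add, Matrix.mul_add, h2, degProj_mul_of_disjoint d1.symm h0,
      degProj_mul_of_disjoint d3 h3, add_zero, zero_add]
  · rw [rho, Matrix.mul_add, Matrix.mul_add, h3, degProj_mul_of_disjoint d2.symm h0,
      degProj_mul_of_disjoint d3.symm h2, zero_add, zero_add]

end Support

section Blocks

variable {N : ℕ} {B₁ B₂ : Type} {d₁ : B₁ → ZMod N} {d₂ : B₂ → ZMod N} {J : Set (ZMod N)}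

theorem isDeg_fromBlocks {e : ZMod N} {A : Matrix B₁ B₁ ℂ} {D : Matrix B₂ B₂ ℂ} :
    IsDeg (Sum.elim d₁ d₂) (Sum.elim d₁ d₂) e (Matrix.fromBlocks A 0 0 D) ↔
      IsDeg d₁ d₁ e A ∧ IsDeg d₂ d₂ e D := by
  constructor
  · exact fun h => ⟨fun c b h0 => h (.inl c) (.inl b) h0, fun c b h0 => h (.inr c) (.inr b) h0⟩
  · rintro ⟨h1, h2⟩ (c | c) (b | b) h0
    · exact h1 c b h0
    · exact absurd rfl h0
    · exact absurd rfl h0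
    · exact h2 c b h0

theorem isUnit_fromBlocks_zero [Fintype B₁] [Fintype B₂] [DecidableEq B₁] [DecidableEq B₂]
    {A : Matrix B₁ B₁ ℂ} {D : Matrix B₂ B₂ ℂ} :
    IsUnit (Matrix.fromBlocks A 0 0 D) ↔ IsUnit A ∧ IsUnit D := by
  simp only [Matrix.isUnit_iff_isUnit_det, Matrix.det_fromBlocks_zero₂₁, IsUnit.mul_iff]

/-- The direct sum of two structures. -/
def blockSum (z₁ : MatTriple B₁)
    (z₂ : MatTriple B₂) :
    MatTriple (B₁ ⊕ B₂) :=
  (Matrix.fromBlocks z₁.1 0 0 z₂.1,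
    (Matrix.fromBlocks z₁.2.1 0 0 z₂.2.1, Matrix.fromBlocks z₁.2.2 0 0 z₂.2.2))

theorem mem_jSpace_fromBlocks {K₁ R₁ : Matrix B₁ B₁ ℂ} {K₂ R₂ : Matrix B₂ B₂ ℂ} :
    (Matrix.fromBlocks K₁ 0 0 K₂, Matrix.fromBlocks R₁ 0 0 R₂) ∈ jSpace J (Sum.elim d₁ d₂) ↔
      (K₁, R₁) ∈ jSpace J d₁ ∧ (K₂, R₂) ∈ jSpace J d₂ := by
  constructor
  · exact fun h => ⟨⟨fun c b h0 => h.1 (.inl c) (.inl b) h0, fun c b h0 => h.2 (.inl c) (.inl b) h0⟩,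
      ⟨fun c b h0 => h.1 (.inr c) (.inr b) h0, fun c b h0 => h.2 (.inr c) (.inr b) h0⟩⟩
  · rintro ⟨h1, h2⟩
    constructor
    · rintro (c | c) (b | b) h0
      · exact h1.1 c b h0
      · exact absurd rfl h0
      · exact absurd rfl h0
      · exact h2.1 c b h0
    · rintro (c | c) (b | b) h0
      · exact h1.2 c b h0
      · exact absurd rfl h0
      · exact absurd rfl h0
      · exact h2.2 c b h0

variable [Fintype B₁] [Fintype B₂]

theorem blockSum_mem_jReps {z₁ : MatTriple B₁}
    {z₂ : MatTriple B₂} :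
    blockSum z₁ z₂ ∈ jReps J (Sum.elim d₁ d₂) ↔ z₁ ∈ jReps J d₁ ∧ z₂ ∈ jReps J d₂ := by
  have e : rho (blockSum z₁ z₂).1 (blockSum z₁ z₂).2 =
      Matrix.fromBlocks (rho z₁.1 z₁.2) 0 0 (rho z₂.1 z₂.2) := by
    simp [rho, blockSum, Matrix.fromBlocks_multiply, Matrix.fromBlocks_add]
  have e2 : rho (blockSum z₁ z₂).1 (blockSum z₁ z₂).2 * (blockSum z₁ z₂).1 =
      (blockSum z₁ z₂).1 * rho (blockSum z₁ z₂).1 (blockSum z₁ z₂).2 ↔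
      rho z₁.1 z₁.2 * z₁.1 = z₁.1 * rho z₁.1 z₁.2 ∧
      rho z₂.1 z₂.2 * z₂.1 = z₂.1 * rho z₂.1 z₂.2 := by
    rw [e]
    simp [blockSum, Matrix.fromBlocks_multiply, Matrix.fromBlocks_inj]
  simp only [jReps, Set.mem_ofPred_eq]
  rw [e2, blockSum, isDeg_fromBlocks, mem_jSpace_fromBlocks]
  tauto

theorem intertwiner_eq_zero [DecidableEq B₁] [DecidableEq B₂] {H₁ : Matrix B₁ B₁ ℂ}
    {H₂ : Matrix B₂ B₂ ℂ} (h1 : IsUnit H₁) (h2 : IsNilpotent H₂) {X : Matrix B₁ B₂ ℂ}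
    (h : X * H₂ = H₁ * X) : X = 0 := by
  obtain ⟨n, hn⟩ := h2
  have key : ∀ n, X * H₂ ^ n = H₁ ^ n * X := by
    intro n
    induction n with
    | zero => simp
    | succ n ih => rw [pow_succ, ← Matrix.mul_assoc, ih, Matrix.mul_assoc, h, pow_succ, Matrix.mul_assoc]
  have h3 := key n
  rw [hn, Matrix.mul_zero] at h3
  obtain ⟨u, hu⟩ := h1.pow n
  rw [← Matrix.one_mul X, ← Units.inv_mul u, Matrix.mul_assoc, hu, ← h3, Matrix.mul_zero]

theorem intertwiner_eq_zero' [DecidableEq B₁] [DecidableEq B₂] {H₁ : Matrix B₁ B₁ ℂ}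
    {H₂ : Matrix B₂ B₂ ℂ} (h1 : IsUnit H₁) (h2 : IsNilpotent H₂) {X : Matrix B₂ B₁ ℂ}
    (h : X * H₁ = H₂ * X) : X = 0 := by
  have h1' : IsUnit H₁.transpose := by
    rw [Matrix.isUnit_iff_isUnit_det, Matrix.det_transpose]
    exact (Matrix.isUnit_iff_isUnit_det _).1 h1
  have h2' : IsNilpotent H₂.transpose := by
    obtain ⟨n, hn⟩ := h2
    exact ⟨n, by rw [← Matrix.transpose_pow, hn, Matrix.transpose_zero]⟩
  have := intertwiner_eq_zero h1' h2' (X := X.transpose) (by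
    rw [← Matrix.transpose_mul, ← Matrix.transpose_mul, h])
  simpa using this

/-- If `H` is block diagonal with an invertible and a nilpotent block, then the whole structure is
block diagonal. -/
theorem exists_eq_blockSum [DecidableEq B₁] [DecidableEq B₂] (hJ : ∀ k ∈ J, k + 1 ∉ J)
    {H₁ : Matrix B₁ B₁ ℂ} {H₂ : Matrix B₂ B₂ ℂ} (h1 : IsUnit H₁) (h2 : IsNilpotent H₂) {y}
    (hz : (Matrix.fromBlocks H₁ 0 0 H₂, y) ∈ jReps J (Sum.elim d₁ d₂)) :
    ∃ y₁ y₂, (Matrix.fromBlocks H₁ 0 0 H₂, y) = blockSum (H₁, y₁) (H₂, y₂) := by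
  obtain ⟨hd, hy, hc⟩ := hz
  simp only at hd hy hc
  obtain ⟨e1, e2, e3⟩ := degProj_rho hJ hd hy
  set r := rho (Matrix.fromBlocks H₁ 0 0 H₂) y with hr
  obtain ⟨K, R⟩ := y
  simp only at e1 e2 e3
  rw [← Matrix.fromBlocks_toBlocks r, Matrix.fromBlocks_multiply, Matrix.fromBlocks_multiply,
    Matrix.fromBlocks_inj] at hc
  simp only [Matrix.mul_zero, Matrix.zero_mul, add_zero, zero_add] at hc
  have r12 := intertwiner_eq_zero h1 h2 hc.2.1
  have r21 := intertwiner_eq_zero' h1 h2 hc.2.2.1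
  have hD : ∀ X : Set (ZMod N), ∃ D₁ D₂, degProj (Sum.elim d₁ d₂) X * r =
      Matrix.fromBlocks D₁ 0 0 D₂ := by
    intro X
    refine ⟨(degProj (Sum.elim d₁ d₂) X * r).toBlocks₁₁, (degProj (Sum.elim d₁ d₂) X * r).toBlocks₂₂,
      ?_⟩
    ext (c | c) (b | b)
    · rfl
    · rw [degProj_mul_apply, show r (.inl c) (.inr b) = 0 from congrFun (congrFun r12 c) b, ite_self]
      rfl
    · rw [degProj_mul_apply, show r (.inr c) (.inl b) = 0 from congrFun (congrFun r21 c) b, ite_self]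
      rfl
    · rfl
  obtain ⟨A₁, A₂, hA⟩ := hD {k | k - 1 ∈ J}
  obtain ⟨D₁, D₂, hDD⟩ := hD J
  obtain ⟨F₁, F₂, hF⟩ := hD {k | k ∉ J ∧ k - 1 ∉ J}
  rw [e1] at hA
  rw [e2] at hDD
  rw [e3] at hF
  rw [← Matrix.fromBlocks_toBlocks K, Matrix.fromBlocks_multiply, Matrix.fromBlocks_inj] at hA hDD
  simp only [Matrix.mul_zero, Matrix.zero_mul, add_zero, zero_add] at hA hDD
  obtain ⟨u, hu⟩ := h1
  have k12 : K.toBlocks₁₂ = 0 := by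
    rw [← Matrix.one_mul K.toBlocks₁₂, ← Units.inv_mul u, Matrix.mul_assoc, hu, hA.2.1,
      Matrix.mul_zero]
  have k21 : K.toBlocks₂₁ = 0 := by
    rw [← Matrix.mul_one K.toBlocks₂₁, ← Units.mul_inv u, ← Matrix.mul_assoc, hu, hDD.2.2.1,
      Matrix.zero_mul]
  refine ⟨(K.toBlocks₁₁, F₁), (K.toBlocks₂₂, F₂), ?_⟩
  simp only [blockSum, ← hF]
  rw [← Matrix.fromBlocks_toBlocks K, k12, k21]
  simp

/-- The structures with invertible `H`. -/
def invReps [DecidableEq B₁] (J : Set (ZMod N)) (d : B₁ → ZMod N) :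
    Set (MatTriple B₁) :=
  {z | z ∈ jReps J d ∧ IsUnit z.1}

/-- The structures with nilpotent `H`. -/
def nilReps [DecidableEq B₁] (J : Set (ZMod N)) (d : B₁ → ZMod N) :
    Set (MatTriple B₁) :=
  {z | z ∈ jReps J d ∧ IsNilpotent z.1}

theorem cons_invReps [DecidableEq B₁] : Cons (invReps J d₁) :=
  (cons_jReps J d₁).and (Cons.isUnit tame_id.fst)

theorem cons_nilReps [DecidableEq B₁] : Cons (nilReps J d₁) := by
  refine (cons_jReps J d₁).and ?_
  simp only [isNilpotent_iff_pow_eq_zero le_rfl]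
  exact Cons.eq (tame_id.fst.matrixPow _) (tame_const 0)

variable [DecidableEq B₁] [DecidableEq B₂]

theorem conj_mem_invReps {g : Matrix B₁ B₁ ℂ} (hg : g ∈ gradedUnits d₁) {z}
    (hz : z ∈ invReps J d₁) : conj g g⁻¹ z ∈ invReps J d₁ := by
  obtain ⟨h1, h2, h3⟩ := gradedUnits_inv hg
  exact ⟨conj_mem_jReps hg.1 h1.1 h2 hz.1, (hg.2.mul hz.2).mul h1.2⟩

theorem conj_pow {B C : Type} [Fintype B] [DecidableEq B] [Fintype C] [DecidableEq C]
    {g : Matrix C B ℂ} {h : Matrix B C ℂ} (hgh : g * h = 1) (hhg : h * g = 1)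
    (M : Matrix B B ℂ) (n : ℕ) : (g * M * h) ^ n = g * M ^ n * h := by
  induction n with
  | zero => simp [hgh]
  | succ n ih =>
    rw [pow_succ, ih, pow_succ, Matrix.mul_assoc (g * M ^ n), Matrix.mul_assoc g M,
      ← Matrix.mul_assoc h, hhg, Matrix.one_mul]
    simp only [Matrix.mul_assoc]

theorem conj_mem_nilReps {g : Matrix B₁ B₁ ℂ} (hg : g ∈ gradedUnits d₁) {z}
    (hz : z ∈ nilReps J d₁) : conj g g⁻¹ z ∈ nilReps J d₁ := by
  obtain ⟨h1, h2, h3⟩ := gradedUnits_inv hg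
  refine ⟨conj_mem_jReps hg.1 h1.1 h2 hz.1, ?_⟩
  obtain ⟨n, hn⟩ := hz.2
  exact ⟨n, by rw [conj, conj_pow (mul_eq_one_comm.1 h2) h2, hn, mul_zero, zero_mul]⟩

/-- The structures that are isomorphic to the direct sum of an invertible one on `B₁` and a
nilpotent one on `B₂`. -/
def fittingStratum (J : Set (ZMod N)) (d₁ : B₁ → ZMod N) (d₂ : B₂ → ZMod N) :
    Set (MatTriple (B₁ ⊕ B₂)) :=
  {z | ∃ g ∈ gradedUnits (Sum.elim d₁ d₂), ∃ z₁ ∈ invReps J d₁, ∃ z₂ ∈ nilReps J d₂,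
    z = conj g g⁻¹ (blockSum z₁ z₂)}

open Classical in
/-- The part of degree zero of a matrix. -/
def degZeroPart {B : Type} (d : B → ZMod N) : Matrix B B ℂ →ₗ[ℂ] Matrix B B ℂ where
  toFun M := Matrix.of fun c b => if d c = d b then M c b else 0
  map_add' M M' := by
    ext c b
    by_cases h : d c = d b <;> simp [h]
  map_smul' a M := by
    ext c b
    by_cases h : d c = d b <;> simp [h]

theorem isDeg_degZeroPart {B : Type} (d : B → ZMod N) (M : Matrix B B ℂ) :
    IsDeg d d 0 (degZeroPart d M) := by
  intro c b h
  by_contra h1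
  exact h (if_neg (by simpa using h1))

theorem degZeroPart_eq {B : Type} {d : B → ZMod N} {M : Matrix B B ℂ} (h : IsDeg d d 0 M) :
    degZeroPart d M = M := by
  ext c b
  change (if d c = d b then M c b else 0) = M c b
  split_ifs with h1
  · rfl
  · by_contra h2
    exact h1 (by simpa using h c b (Ne.symm h2))

theorem blockSum_pow {z₁ : MatTriple B₁}
    {z₂ : MatTriple B₂} (hz : IsNilpotent z₂.1) {n : ℕ}
    (hn : Fintype.card (B₁ ⊕ B₂) ≤ n) :
    (blockSum z₁ z₂).1 ^ n = Matrix.fromBlocks (z₁.1 ^ n) 0 0 0 := by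
  rw [blockSum, Matrix.fromBlocks_diagonal_pow,
    (isNilpotent_iff_pow_eq_zero (le_trans (by simp) hn)).1 hz]

theorem mu_blockDiagonal {X : Set (Matrix B₁ B₁ ℂ)} {Y : Set (Matrix B₂ B₂ ℂ)} (hX : Cons X)
    (hY : Cons Y) : Cons {g | ∃ x ∈ X, ∃ y ∈ Y, g = Matrix.fromBlocks x 0 0 y} ∧
      mu {g | ∃ x ∈ X, ∃ y ∈ Y, g = Matrix.fromBlocks x 0 0 y} = mu X * mu Y := by
  have h1 : Tame fun p : Matrix B₁ B₁ ℂ × Matrix B₂ B₂ ℂ => Matrix.fromBlocks p.1 0 0 p.2 :=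
    tame_id.fst.fromBlocks (tame_const _) (tame_const _) tame_id.snd
  have h2 : Tame fun g : Matrix (B₁ ⊕ B₂) (B₁ ⊕ B₂) ℂ => (g.toBlocks₁₁, g.toBlocks₂₂) :=
    (Tame.matrix fun i j => tame_id.entry _ _).prodMk (Tame.matrix fun i j => tame_id.entry _ _)
  have h3 : ∀ p ∈ X ×ˢ Y, (Matrix.fromBlocks p.1 0 0 p.2) ∈
      {g | ∃ x ∈ X, ∃ y ∈ Y, g = Matrix.fromBlocks x 0 0 y} ∧
      ((Matrix.fromBlocks p.1 0 0 p.2).toBlocks₁₁, (Matrix.fromBlocks p.1 0 0 p.2).toBlocks₂₂) = p :=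
    fun p hp => ⟨⟨p.1, hp.1, p.2, hp.2, rfl⟩, rfl⟩
  have h4 : ∀ g ∈ {g | ∃ x ∈ X, ∃ y ∈ Y, g = Matrix.fromBlocks x 0 0 y},
      (g.toBlocks₁₁, g.toBlocks₂₂) ∈ X ×ˢ Y ∧
        Matrix.fromBlocks g.toBlocks₁₁ 0 0 g.toBlocks₂₂ = g := by
    rintro g ⟨x, hx, y, hy, rfl⟩
    simp only [Matrix.toBlocks_fromBlocks₁₁, Matrix.toBlocks_fromBlocks₂₂]
    exact ⟨⟨hx, hy⟩, trivial⟩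
  refine ⟨cons_of_bij (hX.prodSet hY) h1 h2 h3 h4, ?_⟩
  rw [← mu_prod hX hY]
  exact (mu_congr _ _ h1 h2 h3 h4).symm

theorem mu_blockSums {X : Set (MatTriple B₁)}
    {Y : Set (MatTriple B₂)} (hX : Cons X) (hY : Cons Y) :
    Cons {g | ∃ x ∈ X, ∃ y ∈ Y, g = blockSum x y} ∧
      mu {g | ∃ x ∈ X, ∃ y ∈ Y, g = blockSum x y} = mu X * mu Y := by
  let f : (MatTriple (B₁ ⊕ B₂)) → (MatTriple B₁) ×
      (MatTriple B₂) := fun g =>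
    ((g.1.toBlocks₁₁, (g.2.1.toBlocks₁₁, g.2.2.toBlocks₁₁)),
      (g.1.toBlocks₂₂, (g.2.1.toBlocks₂₂, g.2.2.toBlocks₂₂)))
  have h1 : Tame fun p : (MatTriple B₁) ×
      (MatTriple B₂) => blockSum p.1 p.2 := by
    unfold blockSum
    fun_prop
  have hb : ∀ {E : Type} [AddCommGroup E] [Module ℂ E] {M : E → Matrix (B₁ ⊕ B₂) (B₁ ⊕ B₂) ℂ},
      Tame M → Tame (fun x => (M x).toBlocks₁₁) ∧ Tame (fun x => (M x).toBlocks₂₂) := fun hM =>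
    ⟨Tame.matrix fun i j => hM.entry _ _, Tame.matrix fun i j => hM.entry _ _⟩
  have h2 : Tame f :=
    ((hb tame_id.fst).1.prodMk ((hb tame_id.snd.fst).1.prodMk (hb tame_id.snd.snd).1)).prodMk
      ((hb tame_id.fst).2.prodMk ((hb tame_id.snd.fst).2.prodMk (hb tame_id.snd.snd).2))
  have hf : ∀ x y, f (blockSum x y) = (x, y) := fun x y => by simp [f, blockSum]
  have h3 : ∀ p ∈ X ×ˢ Y, blockSum p.1 p.2 ∈ {g | ∃ x ∈ X, ∃ y ∈ Y, g = blockSum x y} ∧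
      f (blockSum p.1 p.2) = p := fun p hp => ⟨⟨p.1, hp.1, p.2, hp.2, rfl⟩, hf _ _⟩
  have h4 : ∀ g ∈ {g | ∃ x ∈ X, ∃ y ∈ Y, g = blockSum x y},
      f g ∈ X ×ˢ Y ∧ blockSum (f g).1 (f g).2 = g := by
    rintro g ⟨x, hx, y, hy, rfl⟩
    rw [hf]
    exact ⟨⟨hx, hy⟩, rfl⟩
  refine ⟨cons_of_bij (hX.prodSet hY) h1 h2 h3 h4, ?_⟩
  rw [← mu_prod hX hY]
  exact (mu_congr _ _ h1 h2 h3 h4).symm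

theorem fromBlocks_mem_gradedUnits {x : Matrix B₁ B₁ ℂ} {y : Matrix B₂ B₂ ℂ} :
    Matrix.fromBlocks x 0 0 y ∈ gradedUnits (Sum.elim d₁ d₂) ↔
      x ∈ gradedUnits d₁ ∧ y ∈ gradedUnits d₂ := by
  simp only [gradedUnits, Set.mem_ofPred_eq, isDeg_fromBlocks, isUnit_fromBlocks_zero]
  tauto

theorem mu_fittingStratum [NeZero N] : Cons (fittingStratum J d₁ d₂) ∧
    mu (gradedUnits (Sum.elim d₁ d₂)) * (mu (invReps J d₁) * mu (nilReps J d₂)) =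
      mu (fittingStratum J d₁ d₂) * (mu (gradedUnits d₁) * mu (gradedUnits d₂)) := by
  obtain ⟨hT, hT'⟩ := mu_blockSums (cons_invReps (J := J) (d₁ := d₁))
    (cons_nilReps (J := J) (d₁ := d₂))
  obtain ⟨hH, hH'⟩ := mu_blockDiagonal (cons_gradedUnits (dB := d₁)) (cons_gradedUnits (dB := d₂))
  rw [← hT', ← hH']
  set T := {g | ∃ x ∈ invReps J d₁, ∃ y ∈ nilReps J d₂, g = blockSum x y} with hTdef
  set d := Sum.elim d₁ d₂ with hd
  set n := N * Fintype.card (B₁ ⊕ B₂) with hn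
  have hcard : Fintype.card (B₁ ⊕ B₂) ≤ n := Nat.le_mul_of_pos_left _ (NeZero.pos N)
  let E₁ : Matrix (B₁ ⊕ B₂) (B₁ ⊕ B₂) ℂ := Matrix.fromBlocks 1 0 0 0
  let E₂ : Matrix (B₁ ⊕ B₂) (B₁ ⊕ B₂) ℂ := Matrix.fromBlocks 0 0 0 1
  let A : (MatTriple (B₁ ⊕ B₂)) → Matrix (B₁ ⊕ B₂) (B₁ ⊕ B₂) ℂ →ₗ[ℂ] _ := fun z =>
    (LinearMap.mulRight ℂ E₂ ∘ₗ LinearMap.mulLeft ℂ (z.1 ^ n)) ∘ₗ degZeroPart d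
  let L : (MatTriple (B₁ ⊕ B₂)) → Matrix (B₁ ⊕ B₂) (B₁ ⊕ B₂) ℂ →ₗ[ℂ] _ := fun z =>
    (LinearMap.mulRight ℂ E₁ ∘ₗ LinearMap.mulLeft ℂ (z.1 ^ n) + LinearMap.mulRight ℂ E₂) ∘ₗ
      degZeroPart d
  have hA : Tame A := tame_hom fun v => by
    simp only [A, LinearMap.comp_apply, LinearMap.mulRight_apply, LinearMap.mulLeft_apply]
    fun_prop
  have hL : Tame L := tame_hom fun v => by
    simp only [L, LinearMap.comp_apply, LinearMap.mulRight_apply, LinearMap.mulLeft_apply,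
      LinearMap.add_apply]
    fun_prop
  obtain ⟨s, hs, hsp⟩ := exists_tame_isUnit_section hA hL
  have hLs : Tame fun z => L z (s z) := hL.homApply hs
  refine mu_slice (fun g z => conj g g⁻¹ z) (by fun_prop) cons_gradedUnits hH hT
    (fun g hg => hg.2) (fun g hg h hh => gradedUnits_mul hg hh) (fun g hg => (gradedUnits_inv hg).1)
    ?_ ?_ ?_ ?_ ?_ (fun z => L z (s z)) hLs ?_
  · rintro g ⟨x, hx, y, hy, rfl⟩
    exact fromBlocks_mem_gradedUnits.2 ⟨hx, hy⟩
  · intro g hg h hh x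
    rw [conj_conj, Matrix.mul_inv_rev]
  · intro x
    rw [inv_one, conj_one]
  · rintro g hg _ ⟨x, hx, y, hy, rfl⟩
    exact ⟨g, hg, x, hx, y, hy, rfl⟩
  · rintro g hg _ ⟨x, hx, y, hy, rfl⟩
    constructor
    · rintro ⟨x', hx', y', hy', h⟩
      have h1 : (blockSum x' y').1 ^ n * g = g * (blockSum x y).1 ^ n := by
        have h2 : (blockSum x' y').1 = g * (blockSum x y).1 * g⁻¹ := by rw [← h]; rfl
        obtain ⟨-, h3, -⟩ := gradedUnits_inv hg
        rw [h2, conj_pow (mul_eq_one_comm.1 h3) h3, mul_assoc, h3, mul_one]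
      rw [blockSum_pow hy'.2 hcard, blockSum_pow hy.2 hcard, ← Matrix.fromBlocks_toBlocks g,
        Matrix.fromBlocks_multiply, Matrix.fromBlocks_multiply, Matrix.fromBlocks_inj] at h1
      simp only [Matrix.mul_zero, Matrix.zero_mul, add_zero] at h1
      obtain ⟨u', hu'⟩ := hx'.2.pow n
      obtain ⟨u, hu⟩ := hx.2.pow n
      have g12 : g.toBlocks₁₂ = 0 := by
        rw [← Matrix.one_mul g.toBlocks₁₂, ← Units.inv_mul u', Matrix.mul_assoc, hu', h1.2.1,
          Matrix.mul_zero]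
      have g21 : g.toBlocks₂₁ = 0 := by
        rw [← Matrix.mul_one g.toBlocks₂₁, ← Units.mul_inv u, ← Matrix.mul_assoc, hu, ← h1.2.2.1,
          Matrix.zero_mul]
      have h5 : g = Matrix.fromBlocks g.toBlocks₁₁ 0 0 g.toBlocks₂₂ := by
        conv_lhs => rw [← Matrix.fromBlocks_toBlocks g, g12, g21]
      rw [h5] at hg
      obtain ⟨h6, h7⟩ := fromBlocks_mem_gradedUnits.1 hg
      exact ⟨_, h6, _, h7, h5⟩
    · rintro ⟨a, ha, b, hb, rfl⟩
      obtain ⟨-, ha', -⟩ := gradedUnits_inv ha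
      obtain ⟨-, hb', -⟩ := gradedUnits_inv hb
      refine ⟨conj a a⁻¹ x, conj_mem_invReps ha hx, conj b b⁻¹ y, conj_mem_nilReps hb hy, ?_⟩
      have h1 : (Matrix.fromBlocks a 0 0 b)⁻¹ = Matrix.fromBlocks a⁻¹ 0 0 b⁻¹ := by
        refine Matrix.inv_eq_left_inv ?_
        simp [Matrix.fromBlocks_multiply, ha', hb']
      rw [h1]
      simp [conj, blockSum, Matrix.fromBlocks_multiply]
  · rintro _ ⟨g, hg, x, hx, y, hy, rfl⟩
    obtain ⟨hg1, hg2, hg3⟩ := gradedUnits_inv hg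
    set z := conj g g⁻¹ (blockSum x y) with hz
    have hP : z.1 ^ n = g * Matrix.fromBlocks (x.1 ^ n) 0 0 0 * g⁻¹ := by
      rw [← blockSum_pow hy.2 hcard, ← conj_pow (mul_eq_one_comm.1 hg2) hg2]
      rfl
    have hxn : (x.1 ^ n)⁻¹ * x.1 ^ n = 1 ∧ x.1 ^ n * (x.1 ^ n)⁻¹ = 1 := by
      have h0 := (Matrix.isUnit_iff_isUnit_det _).1 (hx.2.pow n)
      exact ⟨Matrix.nonsing_inv_mul _ h0, Matrix.mul_nonsing_inv _ h0⟩
    have hPdeg : ∀ {B : Type} [Fintype B] [DecidableEq B] {dB : B → ZMod N} {M : Matrix B B ℂ},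
        IsDeg dB dB 1 M → IsDeg dB dB 0 (M ^ n) := fun {B} _ _ {dB} {M} h => by
      have h0 := h.pow n
      rwa [show (n : ZMod N) = 0 by simp [hn]] at h0
    have hex : ∃ v, A z v = 0 ∧ IsUnit (L z v) := by
      have h0 : IsDeg d d 0 (g * Matrix.fromBlocks (x.1 ^ n)⁻¹ 0 0 1) := by
        refine hg.1.mul_zero_left (isDeg_fromBlocks.2 ⟨?_, isDeg_one⟩)
        simpa using (hPdeg hx.1.1).of_inverse hxn.2 hxn.1
      refine ⟨g * Matrix.fromBlocks (x.1 ^ n)⁻¹ 0 0 1, ?_, ?_⟩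
      · change z.1 ^ n * degZeroPart d _ * E₂ = 0
        rw [degZeroPart_eq h0, hP]
        simp only [mul_assoc]
        rw [← mul_assoc g⁻¹ g, hg2]
        simp [E₂, Matrix.fromBlocks_multiply]
      · change IsUnit (z.1 ^ n * degZeroPart d _ * E₁ + degZeroPart d _ * E₂)
        rw [degZeroPart_eq h0, hP]
        simp only [mul_assoc]
        rw [← mul_assoc g⁻¹ g, hg2, ← mul_add]
        simp only [E₁, E₂, one_mul, Matrix.fromBlocks_multiply, Matrix.fromBlocks_add,
          Matrix.mul_zero, Matrix.zero_mul, add_zero, zero_add, Matrix.mul_one, hxn.2,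
          Matrix.fromBlocks_one]
        exact hg.2
    obtain ⟨hs1, hs2⟩ := hsp z hex
    set u := g⁻¹ * degZeroPart d (s z) with hu
    have hgu : degZeroPart d (s z) = g * u := by rw [hu, ← mul_assoc, hg3, one_mul]
    have hud : IsDeg d d 0 u := hg1.1.mul_zero_left (isDeg_degZeroPart d _)
    have e1 : Matrix.fromBlocks (x.1 ^ n) 0 0 0 * u * E₂ = 0 := by
      change z.1 ^ n * degZeroPart d _ * E₂ = 0 at hs1
      rw [hgu, hP] at hs1
      calc _ = g⁻¹ * g * (Matrix.fromBlocks (x.1 ^ n) 0 0 0) * (g⁻¹ * g) * u * E₂ := by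
            rw [hg2]; simp
        _ = g⁻¹ * (g * Matrix.fromBlocks (x.1 ^ n) 0 0 0 * g⁻¹ * (g * u) * E₂) := by
            simp only [mul_assoc]
        _ = 0 := by rw [hs1, mul_zero]
    have e2 : L z (s z) = g * (Matrix.fromBlocks (x.1 ^ n) 0 0 0 * u * E₁ + u * E₂) := by
      change z.1 ^ n * degZeroPart d _ * E₁ + degZeroPart d _ * E₂ = _
      rw [hgu, hP, mul_add]
      congr 1
      · calc _ = g * Matrix.fromBlocks (x.1 ^ n) 0 0 0 * (g⁻¹ * g) * u * E₁ := by
              simp only [mul_assoc]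
          _ = _ := by rw [hg2]; simp only [mul_assoc, one_mul]
      · rw [mul_assoc]
    have hk : ∃ a ∈ gradedUnits d₁, ∃ b ∈ gradedUnits d₂,
        Matrix.fromBlocks (x.1 ^ n) 0 0 0 * u * E₁ + u * E₂ = Matrix.fromBlocks a 0 0 b := by
      have h3 : Matrix.fromBlocks (x.1 ^ n) 0 0 0 * u * E₁ + u * E₂ ∈ gradedUnits d := by
        have h4 : g⁻¹ * L z (s z) ∈ gradedUnits d := by
          refine gradedUnits_mul hg1 ⟨?_, hs2⟩
          change IsDeg d d 0 (z.1 ^ n * degZeroPart d _ * E₁ + degZeroPart d _ * E₂)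
          have hE : IsDeg d d 0 E₁ ∧ IsDeg d d 0 E₂ :=
            ⟨isDeg_fromBlocks.2 ⟨isDeg_one, fun _ _ h => absurd rfl h⟩,
              isDeg_fromBlocks.2 ⟨fun _ _ h => absurd rfl h, isDeg_one⟩⟩
          have hz1 : IsDeg d d 1 z.1 :=
            (hg.1.mul_zero_left (isDeg_fromBlocks.2 ⟨hx.1.1, hy.1.1⟩)).mul_zero_right hg1.1
          exact (((hPdeg hz1).mul_zero_left (isDeg_degZeroPart d _)).mul_zero_left hE.1).add
            ((isDeg_degZeroPart d _).mul_zero_left hE.2)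
        rwa [e2, ← mul_assoc, hg2, one_mul] at h4
      rw [← Matrix.fromBlocks_toBlocks u] at h3 e1 ⊢
      simp only [E₁, E₂, Matrix.fromBlocks_multiply, Matrix.fromBlocks_add, Matrix.mul_zero,
        Matrix.zero_mul, add_zero, zero_add, Matrix.mul_one] at h3 e1 ⊢
      have h5 : x.1 ^ n * u.toBlocks₁₂ = 0 := by
        have := congrArg Matrix.toBlocks₁₂ e1
        rwa [Matrix.toBlocks_fromBlocks₁₂] at this
      have h6 : u.toBlocks₁₂ = 0 := by
        rw [← Matrix.one_mul u.toBlocks₁₂, ← hxn.1, Matrix.mul_assoc, h5, Matrix.mul_zero]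
      rw [h6] at h3 ⊢
      obtain ⟨h7, h8⟩ := fromBlocks_mem_gradedUnits.1 h3
      exact ⟨_, h7, _, h8, rfl⟩
    obtain ⟨a, ha, b, hb, hab⟩ := hk
    rw [hab] at e2
    have hk' : Matrix.fromBlocks a 0 0 b ∈ gradedUnits d := fromBlocks_mem_gradedUnits.2 ⟨ha, hb⟩
    refine ⟨e2 ▸ gradedUnits_mul hg hk', ?_⟩
    obtain ⟨ha0, ha1, ha2⟩ := gradedUnits_inv ha
    obtain ⟨hb0, hb1, hb2⟩ := gradedUnits_inv hb
    have h1 : (Matrix.fromBlocks a 0 0 b)⁻¹ = Matrix.fromBlocks a⁻¹ 0 0 b⁻¹ := by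
      refine Matrix.inv_eq_left_inv ?_
      simp [Matrix.fromBlocks_multiply, ha1, hb1]
    have hai : a⁻¹⁻¹ = a := Matrix.nonsing_inv_nonsing_inv _ ((Matrix.isUnit_iff_isUnit_det _).1 ha.2)
    have hbi : b⁻¹⁻¹ = b := Matrix.nonsing_inv_nonsing_inv _ ((Matrix.isUnit_iff_isUnit_det _).1 hb.2)
    refine ⟨conj a⁻¹ a x, ?_, conj b⁻¹ b y, ?_, ?_⟩
    · simpa only [hai] using conj_mem_invReps ha0 hx
    · simpa only [hbi] using conj_mem_nilReps hb0 hy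
    · rw [Matrix.nonsing_inv_nonsing_inv _ ((Matrix.isUnit_iff_isUnit_det _).1 hs2), e2,
        Matrix.mul_inv_rev, hz, conj_conj, mul_assoc, hg2, ← mul_assoc, hg2, h1]
      simp [conj, blockSum, Matrix.fromBlocks_multiply]

end Blocks

/-! ## Existence of the Fitting decomposition -/

theorem exists_mul_eq_one_of_injective {B C : Type} [Fintype B] [Fintype C] [DecidableEq B]
    {g : Matrix C B ℂ} (h : ∀ c, g.mulVec c = 0 → c = 0) : ∃ X : Matrix B C ℂ, X * g = 1 := by
  classical
  obtain ⟨f, hf⟩ := (Matrix.toLin' g).exists_leftInverse_of_injective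
    (LinearMap.ker_eq_bot'.2 fun c hc => h c (by simpa using hc))
  refine ⟨LinearMap.toMatrix' f, ?_⟩
  have := congrArg LinearMap.toMatrix' hf
  rwa [LinearMap.toMatrix'_comp, LinearMap.toMatrix'_toLin', LinearMap.toMatrix'_id] at this

theorem exists_mul_eq_one_of_surjective {B C : Type} [Fintype B] [DecidableEq C]
    {g : Matrix C B ℂ} (h : ∀ w, ∃ c, g.mulVec c = w) : ∃ Y : Matrix B C ℂ, g * Y = 1 := by
  choose f hf using h
  refine ⟨Matrix.of fun b c => f (Pi.single c 1) b, ?_⟩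
  ext c c'
  have := congrFun (hf (Pi.single c' 1)) c
  rw [Matrix.mul_apply, Matrix.one_apply]
  rw [Matrix.mulVec, dotProduct, Pi.single_apply] at this
  exact this

theorem exists_inverse {B C : Type} [Fintype B] [Fintype C] [DecidableEq B] [DecidableEq C]
    {g : Matrix C B ℂ} (h : ∀ c, g.mulVec c = 0 → c = 0) (h' : ∀ w, ∃ c, g.mulVec c = w) :
    ∃ X : Matrix B C ℂ, g * X = 1 ∧ X * g = 1 := by
  obtain ⟨X, hX⟩ := exists_mul_eq_one_of_injective h
  obtain ⟨Y, hY⟩ := exists_mul_eq_one_of_surjective h'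
  have : X = Y := by
    rw [← Matrix.mul_one X, ← hY, ← Matrix.mul_assoc, hX, Matrix.one_mul]
  exact ⟨X, this ▸ hY, hX⟩

section Homogeneous

variable {N : ℕ} [NeZero N] {B : Type} [Fintype B] {d : B → ZMod N}

theorem sum_degProj (w : B → ℂ) : ∑ k, (degProj d {k}).mulVec w = w := by
  classical
  funext b
  rw [Finset.sum_apply, Finset.sum_eq_single (d b)]
  · simp [degProj, Matrix.mulVec_diagonal]
  · intro k _ hk
    simp [degProj, Matrix.mulVec_diagonal, hk.symm]
  · simp

theorem exists_homogeneous_basis (W : Submodule ℂ (B → ℂ))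
    (hW : ∀ k, ∀ w ∈ W, (degProj d {k}).mulVec w ∈ W) :
    ∃ (m : ZMod N → ℕ) (g : Matrix B ((k : ZMod N) × Fin (m k)) ℂ), IsDeg d Sigma.fst 0 g ∧
      (∀ c, g.mulVec c = 0 → c = 0) ∧ ∀ w, w ∈ W ↔ ∃ c, g.mulVec c = w := by
  classical
  let V : ZMod N → Submodule ℂ (B → ℂ) := fun k => LinearMap.ker (Matrix.toLin' (degProj d {j | j ≠ k}))
  have hV : ∀ k w, w ∈ V k ↔ ∀ b, d b ≠ k → w b = 0 := by
    intro k w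
    simp only [V, LinearMap.mem_ker, Matrix.toLin'_apply, funext_iff, degProj,
      Matrix.mulVec_diagonal, Set.mem_ofPred_eq, Pi.zero_apply]
    refine forall_congr' fun b => ?_
    by_cases h : d b = k <;> simp [h]
  let e : ∀ k, Module.Basis (Fin (Module.finrank ℂ (W ⊓ V k : Submodule ℂ (B → ℂ)))) ℂ _ :=
    fun k => Module.finBasis ℂ (W ⊓ V k : Submodule ℂ (B → ℂ))
  have hsum : ∀ c : ((k : ZMod N) × Fin (Module.finrank ℂ (W ⊓ V k : Submodule ℂ (B → ℂ)))) → ℂ,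
      (Matrix.of fun b x => (e x.1 x.2 : B → ℂ) b).mulVec c =
        ∑ k, ((∑ i, c ⟨k, i⟩ • e k i : (W ⊓ V k : Submodule ℂ (B → ℂ))) : B → ℂ) := by
    intro c
    funext b
    rw [Matrix.mulVec, dotProduct, Fintype.sum_sigma, Finset.sum_apply]
    refine Finset.sum_congr rfl fun k _ => ?_
    rw [Submodule.coe_sum, Finset.sum_apply]
    refine Finset.sum_congr rfl fun i _ => ?_
    simp [mul_comm]
  refine ⟨fun k => Module.finrank ℂ (W ⊓ V k : Submodule ℂ (B → ℂ)),
    Matrix.of fun b x => (e x.1 x.2 : B → ℂ) b, ?_, ?_, ?_⟩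
  · intro b x h
    by_contra h1
    exact h ((hV _ _).1 (e x.1 x.2).2.2 b (by simpa using h1))
  · intro c hc
    rw [hsum] at hc
    have h0 : ∀ k, (∑ i, c ⟨k, i⟩ • e k i : (W ⊓ V k : Submodule ℂ (B → ℂ))) = 0 := by
      intro k
      refine Subtype.ext (funext fun b => ?_)
      by_cases hb : d b = k
      · have := congrFun hc b
        rw [Finset.sum_apply, Finset.sum_eq_single k] at this
        · exact this
        · intro j _ hj
          exact (hV _ _).1 (Subtype.mem _ : _ ∈ W ⊓ V j).2 b (by rw [hb]; exact hj.symm)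
        · simp
      · exact (hV _ _).1 (Subtype.mem _ : _ ∈ W ⊓ V k).2 b hb
    funext x
    exact Fintype.linearIndependent_iff.1 (e x.1).linearIndependent (fun i => c ⟨x.1, i⟩) (h0 x.1) x.2
  · intro w
    constructor
    · intro hw
      have hk : ∀ k, (degProj d {k}).mulVec w ∈ W ⊓ V k := fun k => ⟨hW k w hw, (hV _ _).2 fun b hb => by
        simp [degProj, Matrix.mulVec_diagonal, hb]⟩
      refine ⟨fun x => (e x.1).repr ⟨_, hk x.1⟩ x.2, ?_⟩
      rw [hsum]
      refine Eq.trans (Finset.sum_congr rfl fun k _ => ?_) (sum_degProj (d := d) w)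
      exact congrArg Subtype.val ((e k).sum_repr ⟨_, hk k⟩)
    · rintro ⟨c, rfl⟩
      rw [hsum]
      exact W.sum_mem fun k _ => (Subtype.mem _ : _ ∈ W ⊓ V k).1

theorem exists_inverse_fromCols {B₁ B₂ : Type} [Fintype B₁] [Fintype B₂] [DecidableEq B]
    [DecidableEq B₁] [DecidableEq B₂] {W₁ W₂ : Submodule ℂ (B → ℂ)} (hW : IsCompl W₁ W₂)
    {g₁ : Matrix B B₁ ℂ} {g₂ : Matrix B B₂ ℂ} (h₁ : ∀ c, g₁.mulVec c = 0 → c = 0)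
    (h₂ : ∀ c, g₂.mulVec c = 0 → c = 0) (hW₁ : ∀ w, w ∈ W₁ ↔ ∃ c, g₁.mulVec c = w)
    (hW₂ : ∀ w, w ∈ W₂ ↔ ∃ c, g₂.mulVec c = w) :
    ∃ h : Matrix (B₁ ⊕ B₂) B ℂ, Matrix.fromCols g₁ g₂ * h = 1 ∧ h * Matrix.fromCols g₁ g₂ = 1 := by
  refine exists_inverse ?_ ?_
  · intro c hc
    rw [Matrix.fromCols_mulVec] at hc
    have m1 : g₁.mulVec (c ∘ Sum.inl) ∈ W₁ := (hW₁ _).2 ⟨_, rfl⟩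
    have m2 : g₂.mulVec (c ∘ Sum.inr) ∈ W₂ := (hW₂ _).2 ⟨_, rfl⟩
    have h0 : g₁.mulVec (c ∘ Sum.inl) = 0 := by
      refine Submodule.disjoint_def.1 hW.disjoint _ m1 ?_
      rw [eq_neg_of_add_eq_zero_left hc]
      exact W₂.neg_mem m2
    rw [h0, zero_add] at hc
    have e1 := h₁ _ h0
    have e2 := h₂ _ hc
    funext x
    rcases x with x | x
    · exact congrFun e1 x
    · exact congrFun e2 x
  · intro w
    obtain ⟨w₁, hw₁, w₂, hw₂, rfl⟩ := Submodule.mem_sup.1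
      (hW.sup_eq_top ▸ Submodule.mem_top : w ∈ W₁ ⊔ W₂)
    obtain ⟨c₁, rfl⟩ := (hW₁ _).1 hw₁
    obtain ⟨c₂, rfl⟩ := (hW₂ _).1 hw₂
    exact ⟨Sum.elim c₁ c₂, by rw [Matrix.fromCols_mulVec]; rfl⟩

/-- If the range of `g` is stable under `H`, then `H` restricts to it. -/
theorem exists_mul_eq_mul_of_stable {B₁ : Type} [Fintype B₁] {H : Matrix B B ℂ}
    {W : Submodule ℂ (B → ℂ)} (hH : ∀ w ∈ W, H.mulVec w ∈ W) {g : Matrix B B₁ ℂ}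
    (hW : ∀ w, w ∈ W ↔ ∃ c, g.mulVec c = w) : ∃ X : Matrix B₁ B₁ ℂ, H * g = g * X := by
  classical
  have h : ∀ x, ∃ c, g.mulVec c = H.mulVec (g.col x) := fun x => (hW _).1
    (hH _ ((hW _).2 ⟨Pi.single x 1, by simp⟩))
  choose f hf using h
  refine ⟨Matrix.of fun x y => f y x, ?_⟩
  ext b y
  exact (congrFun (hf y) b).symm

theorem isDeg_fromCols {B₁ B₂ : Type} {d₁ : B₁ → ZMod N} {d₂ : B₂ → ZMod N} {e : ZMod N}
    {g₁ : Matrix B B₁ ℂ} {g₂ : Matrix B B₂ ℂ} (h₁ : IsDeg d d₁ e g₁) (h₂ : IsDeg d d₂ e g₂) :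
    IsDeg d (Sum.elim d₁ d₂) e (Matrix.fromCols g₁ g₂) := by
  rintro b (x | x) h
  · exact h₁ b x h
  · exact h₂ b x h

theorem exists_fitting [DecidableEq B] {H : Matrix B B ℂ} (hH : IsDeg d d 1 H) :
    ∃ m₁ m₂ : ZMod N → ℕ, ∃ (g : Matrix B (((k : ZMod N) × Fin (m₁ k)) ⊕ ((k : ZMod N) × Fin (m₂ k))) ℂ)
      (h : Matrix (((k : ZMod N) × Fin (m₁ k)) ⊕ ((k : ZMod N) × Fin (m₂ k))) B ℂ), ∃ X Y,
      g * h = 1 ∧ h * g = 1 ∧ IsDeg d (Sum.elim Sigma.fst Sigma.fst) 0 g ∧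
      h * H * g = Matrix.fromBlocks X 0 0 Y ∧ IsUnit X ∧ IsNilpotent Y := by
  obtain ⟨n₀, hn₀⟩ := Filter.eventually_atTop.1
    (Matrix.toLin' H).eventually_isCompl_ker_pow_range_pow
  set n := N * (n₀ + 1) with hn
  have hcompl := (hn₀ n (by nlinarith [NeZero.pos N])).symm
  have hn1 : 1 ≤ n := Nat.mul_pos (NeZero.pos N) (Nat.succ_pos _)
  rw [← Matrix.toLin'_pow] at hcompl
  set P := H ^ n with hP
  have hPd : IsDeg d d 0 P := by
    have := hH.pow n
    rwa [show (n : ZMod N) = 0 by simp [hn]] at this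
  have hPH : P * H = H * P := by rw [hP, ← pow_succ, ← pow_succ']
  have mW₁ : ∀ w, w ∈ LinearMap.range (Matrix.toLin' P) ↔ ∃ v, P.mulVec v = w := fun w => Iff.rfl
  have mW₂ : ∀ w, w ∈ LinearMap.ker (Matrix.toLin' P) ↔ P.mulVec w = 0 := fun w => Iff.rfl
  set W₁ := LinearMap.range (Matrix.toLin' P)
  set W₂ := LinearMap.ker (Matrix.toLin' P)
  have stab : ∀ M : Matrix B B ℂ, P * M = M * P →
      (∀ w ∈ W₁, M.mulVec w ∈ W₁) ∧ ∀ w ∈ W₂, M.mulVec w ∈ W₂ := by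
    intro M hM
    constructor
    · intro w hw
      obtain ⟨v, rfl⟩ := (mW₁ _).1 hw
      exact (mW₁ _).2 ⟨M.mulVec v, by rw [Matrix.mulVec_mulVec, hM, ← Matrix.mulVec_mulVec]⟩
    · intro w hw
      rw [mW₂] at hw ⊢
      rw [Matrix.mulVec_mulVec, hM, ← Matrix.mulVec_mulVec, hw, Matrix.mulVec_zero]
  have hk : ∀ k, P * degProj d {k} = degProj d {k} * P := fun k => (hPd.degProj_mul {k}).symm
  obtain ⟨m₁, g₁, hd₁, hi₁, hr₁⟩ := exists_homogeneous_basis (d := d) W₁ fun k => (stab _ (hk k)).1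
  obtain ⟨m₂, g₂, hd₂, hi₂, hr₂⟩ := exists_homogeneous_basis (d := d) W₂ fun k => (stab _ (hk k)).2
  obtain ⟨h, hgh, hhg⟩ := exists_inverse_fromCols hcompl hi₁ hi₂ hr₁ hr₂
  obtain ⟨X, hX⟩ := exists_mul_eq_mul_of_stable (stab H hPH).1 hr₁
  obtain ⟨Y, hY⟩ := exists_mul_eq_mul_of_stable (stab H hPH).2 hr₂
  refine ⟨m₁, m₂, Matrix.fromCols g₁ g₂, h, X, Y, hgh, hhg, isDeg_fromCols hd₁ hd₂, ?_, ?_, ?_⟩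
  · have : H * Matrix.fromCols g₁ g₂ = Matrix.fromCols g₁ g₂ * Matrix.fromBlocks X 0 0 Y := by
      rw [Matrix.mul_fromCols, hX, hY, Matrix.fromCols_mul_fromBlocks]
      simp
    rw [Matrix.mul_assoc, this, ← Matrix.mul_assoc, hhg, Matrix.one_mul]
  · obtain ⟨X', hX'⟩ := exists_mul_eq_one_of_injective (g := X) fun c hc => by
      have h1 : H.mulVec (g₁.mulVec c) = 0 := by
        rw [Matrix.mulVec_mulVec, hX, ← Matrix.mulVec_mulVec, hc, Matrix.mulVec_zero]
      refine hi₁ c (Submodule.disjoint_def.1 hcompl.disjoint _ ((hr₁ _).2 ⟨c, rfl⟩) ((mW₂ _).2 ?_))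
      obtain ⟨k, hk⟩ := Nat.exists_eq_add_of_le' hn1
      rw [hP, hk, pow_succ, ← Matrix.mulVec_mulVec, h1, Matrix.mulVec_zero]
    exact IsUnit.of_mul_eq_one X' (mul_eq_one_comm.1 hX')
  · refine ⟨n, ?_⟩
    have h1 : ∀ j, H ^ j * g₂ = g₂ * Y ^ j := by
      intro j
      induction j with
      | zero => simp
      | succ j ih => rw [pow_succ, Matrix.mul_assoc, hY, ← Matrix.mul_assoc, ih, pow_succ, Matrix.mul_assoc]
    obtain ⟨X', hX'⟩ := exists_mul_eq_one_of_injective hi₂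
    have h2 : P * g₂ = 0 := by
      ext b y
      have := (mW₂ _).1 ((hr₂ _).2 ⟨Pi.single y 1, rfl⟩)
      rw [Matrix.mulVec_mulVec, Matrix.mulVec_single_one] at this
      exact congrFun this b
    rw [← Matrix.one_mul (Y ^ n), ← hX', Matrix.mul_assoc, ← h1, ← hP, h2, Matrix.mul_zero]

end Homogeneous

/-! ## The Fitting stratification -/

theorem mu_gradedUnits_equiv {N : ℕ} {B C : Type} [Fintype B] [Fintype C] [DecidableEq B]
    [DecidableEq C] {dB : B → ZMod N} {dC : C → ZMod N} (σ : B ≃ C)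
    (hσ : ∀ b, dC (σ b) = dB b) : mu (gradedUnits dB) = mu (gradedUnits dC) := by
  have key : ∀ {B C : Type} [Fintype B] [Fintype C] [DecidableEq B] [DecidableEq C]
      {dB : B → ZMod N} {dC : C → ZMod N} (σ : B ≃ C) (hσ : ∀ b, dC (σ b) = dB b),
      ∀ M ∈ gradedUnits dB, M.submatrix σ.symm σ.symm ∈ gradedUnits dC ∧
        (M.submatrix σ.symm σ.symm).submatrix σ σ = M := by
    intro B C _ _ _ _ dB dC σ hσ M hM
    refine ⟨⟨fun c b h => ?_, ?_⟩, by simp⟩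
    · have := hM.1 _ _ h
      rwa [← hσ, ← hσ, Equiv.apply_symm_apply, Equiv.apply_symm_apply] at this
    · rw [Matrix.isUnit_iff_isUnit_det, Matrix.det_submatrix_equiv_self]
      exact (Matrix.isUnit_iff_isUnit_det _).1 hM.2
  refine mu_congr (fun M => M.submatrix σ.symm σ.symm) (fun M => M.submatrix σ σ)
    (tame_id.submatrix _ _) (tame_id.submatrix _ _) (key σ hσ) fun M hM => ?_
  exact key σ.symm (fun c => by rw [← hσ, Equiv.apply_symm_apply]) M hM

section Strata

variable {N : ℕ} [NeZero N] {J : Set (ZMod N)} {B B₁ B₂ : Type} [Fintype B] [Fintype B₁]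
  [Fintype B₂] [DecidableEq B] [DecidableEq B₁] [DecidableEq B₂] {d : B → ZMod N}
  {d₁ : B₁ → ZMod N} {d₂ : B₂ → ZMod N}

theorem rank_pow_of_fittingStratum {z} (hz : z ∈ fittingStratum J d₁ d₂) {n : ℕ}
    (hn : Fintype.card (B₁ ⊕ B₂) ≤ n) : (z.1 ^ n).rank = Fintype.card B₁ := by
  obtain ⟨g, hg, x, hx, y, hy, rfl⟩ := hz
  obtain ⟨hg1, hg2, hg3⟩ := gradedUnits_inv hg
  have h1 : (conj g g⁻¹ (blockSum x y)).1 ^ n = g * Matrix.fromBlocks (x.1 ^ n) 0 0 0 * g⁻¹ := by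
    rw [← blockSum_pow hy.2 hn, ← conj_pow (mul_eq_one_comm.1 hg2) hg2]
    rfl
  have hdet : ∀ {g}, g ∈ gradedUnits (Sum.elim d₁ d₂) → IsUnit g.det :=
    fun hg => (Matrix.isUnit_iff_isUnit_det _).1 hg.2
  rw [h1, Matrix.rank_mul_eq_left_of_isUnit_det _ _ (hdet hg1),
    Matrix.rank_mul_eq_right_of_isUnit_det _ _ (hdet hg), ← Matrix.rank_of_isUnit _ (hx.2.pow n)]
  set X := x.1 ^ n
  let U : Matrix (B₁ ⊕ B₂) B₁ ℂ := Matrix.fromRows 1 0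
  let V : Matrix B₁ (B₁ ⊕ B₂) ℂ := Matrix.fromCols 1 0
  have e1 : Matrix.fromBlocks X 0 0 (0 : Matrix B₂ B₂ ℂ) = U * (X * V) := by
    simp [U, V, Matrix.mul_fromCols, Matrix.fromRows_mul, ← Matrix.fromRows_fromCols_eq_fromBlocks]
    ext (i | i) (j | j) <;> simp
  have e2 : X = V * (Matrix.fromBlocks X 0 0 (0 : Matrix B₂ B₂ ℂ) * U) := by
    simp [U, V, ← Matrix.fromRows_fromCols_eq_fromBlocks, Matrix.fromRows_mul,
      Matrix.fromCols_mul_fromRows]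
  refine le_antisymm ?_ ?_
  · rw [e1]
    exact (Matrix.rank_mul_le_right _ _).trans (Matrix.rank_mul_le_left _ _)
  · conv_lhs => rw [e2]
    exact (Matrix.rank_mul_le_right _ _).trans (Matrix.rank_mul_le_left _ _)

theorem rank_conj {C : Type} [Fintype C] [DecidableEq C] {g : Matrix C B ℂ} {h : Matrix B C ℂ}
    (hhg : h * g = 1) (M : Matrix B B ℂ) : (g * M * h).rank = M.rank := by
  refine le_antisymm ?_ ?_
  · exact (Matrix.rank_mul_le_left _ _).trans (Matrix.rank_mul_le_right _ _)
  · have : M = h * (g * M * h * g) := by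
      rw [Matrix.mul_assoc (g * M), hhg, Matrix.mul_one, ← Matrix.mul_assoc, hhg, Matrix.one_mul]
    conv_lhs => rw [this]
    exact (Matrix.rank_mul_le_right _ _).trans (Matrix.rank_mul_le_left _ _)

/-- The Fitting stratum transported along a bijection of the index sets. -/
def fittingStratum' (J : Set (ZMod N)) (d₁ : B₁ → ZMod N) (d₂ : B₂ → ZMod N) (σ : B₁ ⊕ B₂ ≃ B) :
    Set (MatTriple B) :=
  {z | conj (equivMatrix σ.symm) (equivMatrix σ) z ∈ fittingStratum J d₁ d₂}

theorem rank_pow_of_fittingStratum' {σ : B₁ ⊕ B₂ ≃ B} {z} (hz : z ∈ fittingStratum' J d₁ d₂ σ) :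
    (z.1 ^ Fintype.card B).rank = Fintype.card B₁ := by
  have h := rank_pow_of_fittingStratum hz (n := Fintype.card B) (Fintype.card_congr σ).le
  have e1 := equivMatrix_mul_symm σ
  have e2 := equivMatrix_mul_symm σ.symm
  rw [Equiv.symm_symm] at e2
  rw [← h, conj, conj_pow e2 e1, rank_conj e1]

theorem fittingStratum'_subset {σ : B₁ ⊕ B₂ ≃ B} (hσ : ∀ x, d (σ x) = Sum.elim d₁ d₂ x) {z}
    (hz : z ∈ fittingStratum' J d₁ d₂ σ) : z ∈ jReps J d := by
  obtain ⟨g, hg, x, hx, y, hy, hxy⟩ := hz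
  have h1 : conj g g⁻¹ (blockSum x y) ∈ jReps J (Sum.elim d₁ d₂) :=
    conj_mem_jReps hg.1 (gradedUnits_inv hg).1.1 (gradedUnits_inv hg).2.1
      (blockSum_mem_jReps.2 ⟨hx.1, hy.1⟩)
  rw [← hxy] at h1
  have e1 := equivMatrix_mul_symm σ
  have e2 := equivMatrix_mul_symm σ.symm
  rw [Equiv.symm_symm] at e2
  have h2 := conj_mem_jReps (isDeg_equivMatrix hσ) (isDeg_equivMatrix (σ := σ.symm) (dB := d)
    fun b => by rw [← hσ, Equiv.apply_symm_apply]) e2 h1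
  rwa [conj_conj, e1, conj_one] at h2

theorem exists_mem_fittingStratum' {α : ZMod N → ℕ} (hJ : ∀ k ∈ J, k + 1 ∉ J)
    (σ : ∀ a, (∀ k, a ≤ α k) → (((_ : ZMod N) × Fin a) ⊕ ((k : ZMod N) × Fin (α k - a))) ≃
      ((k : ZMod N) × Fin (α k)))
    (hσ : ∀ a ha x, (σ a ha x).1 = Sum.elim Sigma.fst Sigma.fst x) {z}
    (hz : z ∈ jReps J (Sigma.fst : ((k : ZMod N) × Fin (α k)) → ZMod N)) :
    ∃ a, ∃ ha : ∀ k, a ≤ α k, z ∈ fittingStratum' J Sigma.fst Sigma.fst (σ a ha) := by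
  obtain ⟨m₁, m₂, g, h, X, Y, hgh, hhg, hg, hXY, hX, hY⟩ := exists_fitting hz.1
  have hh : IsDeg (Sum.elim Sigma.fst Sigma.fst) Sigma.fst (0 : ZMod N) h := by
    simpa using hg.of_inverse hgh hhg
  have hXd : IsDeg (Sigma.fst : ((k : ZMod N) × Fin (m₁ k)) → ZMod N) Sigma.fst 1 X := by
    have h1 := (hh.mul_zero_left hz.1).mul_zero_right hg
    rw [hXY, isDeg_fromBlocks] at h1
    exact h1.1
  obtain ⟨τ, hτ⟩ := exists_equiv_of_isDeg hg hgh hhg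
  have hcard : ∀ (m : ZMod N → ℕ) (k : ZMod N),
      Nat.card {x : (k : ZMod N) × Fin (m k) // x.1 = k} = m k := by
    intro m k
    rw [Nat.card_congr (Equiv.sigmaSubtype k), Nat.card_fin]
  have hm₁ : ∃ a, m₁ = fun _ => a := by
    obtain ⟨π, hπ⟩ := exists_equiv_of_isDeg hXd
      (Matrix.mul_nonsing_inv X ((Matrix.isUnit_iff_isUnit_det _).1 hX))
      (Matrix.nonsing_inv_mul X ((Matrix.isUnit_iff_isUnit_det _).1 hX))
    have h1 : ∀ k, m₁ (k + 1) = m₁ k := by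
      intro k
      rw [← hcard m₁ k, ← hcard m₁ (k + 1)]
      refine (Nat.card_congr (π.subtypeEquiv fun x => ?_)).symm
      rw [hπ, add_left_inj]
    have h2 : ∀ n : ℕ, m₁ n = m₁ 0 := by
      intro n
      induction n with
      | zero => simp
      | succ n ih => rw [Nat.cast_succ, h1, ih]
    exact ⟨m₁ 0, funext fun k => by rw [← h2 k.val, ZMod.natCast_zmod_val]⟩
  obtain ⟨a, rfl⟩ := hm₁
  have hα : ∀ k, α k = a + m₂ k := by
    intro k
    rw [← hcard α k, ← Nat.card_congr (τ.subtypeEquiv (p := fun x => Sum.elim Sigma.fst Sigma.fst x = k)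
      fun x => by rw [hτ, add_zero]), Nat.card_congr Equiv.subtypeSum, Nat.card_sum]
    exact congrArg₂ _ (hcard (fun _ => a) k) (hcard m₂ k)
  have ha : ∀ k, a ≤ α k := fun k => (hα k).symm ▸ Nat.le_add_right _ _
  obtain rfl : m₂ = fun k => α k - a := funext fun k => by rw [hα, Nat.add_sub_cancel_left]
  refine ⟨a, ha, ?_⟩
  have e1 := equivMatrix_mul_symm (σ a ha)
  have e2 := equivMatrix_mul_symm (σ a ha).symm
  rw [Equiv.symm_symm] at e2
  have hw : conj h g z ∈ jReps J (Sum.elim Sigma.fst Sigma.fst) := conj_mem_jReps hh hg hgh hz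
  obtain ⟨y₁, y₂, hy⟩ := exists_eq_blockSum hJ hX hY (y := (conj h g z).2) (by
    rw [← hXY]; exact hw)
  have hy' : conj h g z = blockSum (X, y₁) (Y, y₂) := by
    rw [← hy, ← hXY]
    rfl
  rw [hy', blockSum_mem_jReps] at hw
  set s : Matrix _ _ ℂ := equivMatrix (σ a ha) with hs
  set s' : Matrix _ _ ℂ := equivMatrix (σ a ha).symm with hs'
  have hs'd : IsDeg (Sum.elim Sigma.fst Sigma.fst) Sigma.fst 0 s' :=
    isDeg_equivMatrix fun b => by rw [← hσ a ha, Equiv.apply_symm_apply]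
  have hinv : (s' * g)⁻¹ = h * s := Matrix.inv_eq_left_inv (by
    rw [Matrix.mul_assoc, ← Matrix.mul_assoc s, e1, Matrix.one_mul, hhg])
  refine ⟨s' * g, ⟨hs'd.mul_zero_left hg, ?_⟩, (X, y₁), ⟨hw.1, hX⟩, (Y, y₂), ⟨hw.2, hY⟩, ?_⟩
  · refine IsUnit.of_mul_eq_one (h * s) ?_
    rw [Matrix.mul_assoc, ← Matrix.mul_assoc g, hgh, Matrix.one_mul, e2]
  · rw [hinv, ← hy', conj_conj, Matrix.mul_assoc, hgh, Matrix.mul_one, ← Matrix.mul_assoc, hgh,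
      Matrix.one_mul]

theorem isUnit_motiveG {V : Type} [Fintype V] [DecidableEq V] (α : V → ℕ) : IsUnit (motiveG α) :=
  IsUnit.prod_iff.2 fun _ _ => isUnit_motiveGL _

/-- The Fitting decomposition of the motives. -/
theorem mu_jReps_eq_sum (hJ : ∀ k ∈ J, k + 1 ∉ J) (α : ZMod N → ℕ) :
    mu (jReps J (Sigma.fst : ((k : ZMod N) × Fin (α k)) → ZMod N)) * Ring.inverse (motiveG α) =
      ∑ a ∈ Finset.range (α 0 + 1) with ∀ k, a ≤ α k,
        mu (invReps J (Sigma.fst : ((_ : ZMod N) × Fin a) → ZMod N)) *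
          Ring.inverse (motiveG fun _ : ZMod N => a) *
        (mu (nilReps J (Sigma.fst : ((k : ZMod N) × Fin (α k - a)) → ZMod N)) *
          Ring.inverse (motiveG fun k => α k - a)) := by
  have hex : ∀ a, (∀ k, a ≤ α k) → ∃ σ : (((_ : ZMod N) × Fin a) ⊕
      ((k : ZMod N) × Fin (α k - a))) ≃ ((k : ZMod N) × Fin (α k)),
      ∀ x, (σ x).1 = Sum.elim Sigma.fst Sigma.fst x := by
    intro a ha
    refine ⟨(Equiv.sigmaSumDistrib _ _).symm.trans (Equiv.sigmaCongrRight fun k =>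
      finSumFinEquiv.trans (finCongr (Nat.add_sub_cancel' (ha k)))), ?_⟩
    rintro (x | x) <;> rfl
  choose σ hσ using hex
  rw [mu_eq_sum (Finset.filter (fun a => ∀ k, a ≤ α k) (Finset.range (α 0 + 1)))
    (X := fun a => {z | ∃ ha : ∀ k, a ≤ α k, z ∈ fittingStratum' J Sigma.fst Sigma.fst (σ a ha)}),
    Finset.sum_mul]
  · refine Finset.sum_congr rfl fun a ha => ?_
    have ha := (Finset.mem_filter.1 ha).2
    have h1 : {z | ∃ ha : ∀ k, a ≤ α k, z ∈ fittingStratum' J Sigma.fst Sigma.fst (σ a ha)} =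
        fittingStratum' J Sigma.fst Sigma.fst (σ a ha) := by
      ext z
      exact ⟨fun ⟨_, h⟩ => h, fun h => ⟨ha, h⟩⟩
    have h2 := (mu_fittingStratum (J := J) (d₁ := (Sigma.fst : ((_ : ZMod N) × Fin a) → ZMod N))
      (d₂ := (Sigma.fst : ((k : ZMod N) × Fin (α k - a)) → ZMod N))).2
    rw [mu_gradedUnits_equiv (σ a ha) (hσ a ha), mu_gradedUnits_sigma, mu_gradedUnits_sigma,
      mu_gradedUnits_sigma] at h2
    rw [h1, fittingStratum', mu_equiv]
    have e0 := Ring.mul_inverse_cancel _ (isUnit_motiveG α)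
    have e1 := Ring.mul_inverse_cancel _ (isUnit_motiveG fun _ : ZMod N => a)
    have e2 := Ring.mul_inverse_cancel _ (isUnit_motiveG fun k => α k - a)
    set M := mu (fittingStratum J (Sigma.fst : ((_ : ZMod N) × Fin a) → ZMod N)
      (Sigma.fst : ((k : ZMod N) × Fin (α k - a)) → ZMod N))
    set u := motiveG α
    set u₁ := motiveG fun _ : ZMod N => a
    set u₂ := motiveG fun k => α k - a
    set RI := mu (invReps J (Sigma.fst : ((_ : ZMod N) × Fin a) → ZMod N))
    set RN := mu (nilReps J (Sigma.fst : ((k : ZMod N) × Fin (α k - a)) → ZMod N))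
    linear_combination (-(Ring.inverse u * Ring.inverse u₁ * Ring.inverse u₂)) * h2 +
      RI * RN * Ring.inverse u₁ * Ring.inverse u₂ * e0 -
      M * Ring.inverse u * u₂ * Ring.inverse u₂ * e1 - M * Ring.inverse u * e2
  · intro a ha
    have ha := (Finset.mem_filter.1 ha).2
    have h1 : {z | ∃ ha : ∀ k, a ≤ α k, z ∈ fittingStratum' J Sigma.fst Sigma.fst (σ a ha)} =
        fittingStratum' J Sigma.fst Sigma.fst (σ a ha) := by
      ext z
      exact ⟨fun ⟨_, h⟩ => h, fun h => ⟨ha, h⟩⟩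
    rw [h1]
    exact mu_fittingStratum.1.preimage (by fun_prop)
  · intro z
    constructor
    · intro hz
      obtain ⟨a, ha, h⟩ := exists_mem_fittingStratum' hJ σ hσ hz
      exact ⟨a, Finset.mem_filter.2 ⟨Finset.mem_range.2 (Nat.lt_succ_of_le (ha 0)), ha⟩, ha, h⟩
    · rintro ⟨a, -, ha, h⟩
      exact fittingStratum'_subset (hσ a ha) h
  · rintro a - b - z ⟨ha, hza⟩ ⟨hb, hzb⟩
    have h1 := (rank_pow_of_fittingStratum' hza).symm.trans (rank_pow_of_fittingStratum' hzb)
    simp only [Fintype.card_sigma, Fintype.card_fin, Finset.sum_const, Finset.card_univ,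
      ZMod.card, smul_eq_mul] at h1
    exact Nat.eq_of_mul_eq_mul_left (NeZero.pos N) h1

end Strata

/-! ## Structures with invertible `H` -/

section Cyclic

variable {N a : ℕ}

/-- A block of a matrix. -/
def blk (M : Matrix ((_ : ZMod N) × Fin a) ((_ : ZMod N) × Fin a) ℂ) (k l : ZMod N) :
    Matrix (Fin a) (Fin a) ℂ :=
  M.submatrix (fun i => ⟨k, i⟩) (fun i => ⟨l, i⟩)

open Classical in
/-- The matrix of degree `e` with given blocks. -/
def ofBlk (e : ZMod N) (f : ZMod N → Matrix (Fin a) (Fin a) ℂ) :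
    Matrix ((_ : ZMod N) × Fin a) ((_ : ZMod N) × Fin a) ℂ :=
  Matrix.of fun x y => if x.1 = y.1 + e then f y.1 x.2 y.2 else 0

theorem isDeg_ofBlk (e : ZMod N) (f : ZMod N → Matrix (Fin a) (Fin a) ℂ) :
    IsDeg Sigma.fst Sigma.fst e (ofBlk e f) := by
  intro x y h
  by_contra h1
  exact h (if_neg h1)

theorem blk_ofBlk (e : ZMod N) (f : ZMod N → Matrix (Fin a) (Fin a) ℂ) (l : ZMod N) :
    blk (ofBlk e f) (l + e) l = f l := by
  ext i j
  exact if_pos rfl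

theorem blk_one_self (l : ZMod N) :
    blk (1 : Matrix ((_ : ZMod N) × Fin a) ((_ : ZMod N) × Fin a) ℂ) l l = 1 := by
  ext i j
  simp [blk, Matrix.one_apply]

theorem ext_blk {e : ZMod N} {M M' : Matrix ((_ : ZMod N) × Fin a) ((_ : ZMod N) × Fin a) ℂ}
    (h : IsDeg Sigma.fst Sigma.fst e M) (h' : IsDeg Sigma.fst Sigma.fst e M')
    (hb : ∀ l, blk M (l + e) l = blk M' (l + e) l) : M = M' := by
  ext ⟨k, i⟩ ⟨l, j⟩
  by_cases hk : k = l + e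
  · subst hk
    exact congrFun (congrFun (hb l) i) j
  · have h1 : M ⟨k, i⟩ ⟨l, j⟩ = 0 := by
      by_contra h0
      exact hk (h _ _ h0)
    have h2 : M' ⟨k, i⟩ ⟨l, j⟩ = 0 := by
      by_contra h0
      exact hk (h' _ _ h0)
    rw [h1, h2]

variable [NeZero N]

theorem blk_mul {e : ZMod N} {M M' : Matrix ((_ : ZMod N) × Fin a) ((_ : ZMod N) × Fin a) ℂ}
    (h : IsDeg Sigma.fst Sigma.fst e M') (k l : ZMod N) :
    blk (M * M') k l = blk M k (l + e) * blk M' (l + e) l := by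
  ext i j
  change (M * M') ⟨k, i⟩ ⟨l, j⟩ = _
  rw [Matrix.mul_apply, Fintype.sum_sigma, Finset.sum_eq_single (l + e)]
  · rfl
  · intro b _ hb
    refine Finset.sum_eq_zero fun x _ => ?_
    have : M' ⟨b, x⟩ ⟨l, j⟩ = 0 := by
      by_contra h0
      exact hb (h _ _ h0)
    rw [this, mul_zero]
  · simp

theorem isUnit_blk {e : ZMod N} {M : Matrix ((_ : ZMod N) × Fin a) ((_ : ZMod N) × Fin a) ℂ}
    (h : IsDeg Sigma.fst Sigma.fst e M) (hM : IsUnit M) (l : ZMod N) :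
    IsUnit (blk M (l + e) l) := by
  have h1 := Matrix.nonsing_inv_mul M ((Matrix.isUnit_iff_isUnit_det _).1 hM)
  have h2 := congrArg (blk · l l) h1
  simp only [blk_mul h, blk_one_self] at h2
  exact IsUnit.of_mul_eq_one _ (mul_eq_one_comm.1 h2)

theorem isUnit_ofBlk {e : ZMod N} {f : ZMod N → Matrix (Fin a) (Fin a) ℂ}
    (hf : ∀ k, IsUnit (f k)) : IsUnit (ofBlk e f) := by
  refine IsUnit.of_mul_eq_one (ofBlk (-e) fun k => (f (k - e))⁻¹) ?_
  have h := (isDeg_ofBlk e f).mul (isDeg_ofBlk (-e) fun k => (f (k - e))⁻¹)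
  rw [add_neg_cancel] at h
  refine ext_blk h isDeg_one fun l => ?_
  rw [add_zero, blk_mul (isDeg_ofBlk _ _), blk_ofBlk, blk_one_self, ← sub_eq_add_neg]
  have := blk_ofBlk e f (l - e)
  rw [sub_add_cancel] at this
  rw [this, Matrix.mul_nonsing_inv _ ((Matrix.isUnit_iff_isUnit_det _).1 (hf _))]

theorem Tame.blk {E : Type} [AddCommGroup E] [Module ℂ E]
    {M : E → Matrix ((_ : ZMod N) × Fin a) ((_ : ZMod N) × Fin a) ℂ} (hM : Tame M) (k l : ZMod N) :
    Tame fun x => blk (M x) k l :=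
  hM.submatrix _ _

theorem Tame.ofBlk {E : Type} [AddCommGroup E] [Module ℂ E] (e : ZMod N)
    {f : E → ZMod N → Matrix (Fin a) (Fin a) ℂ} (hf : ∀ k, Tame fun x => f x k) :
    Tame fun x => ofBlk e (f x) := by
  refine Tame.matrix fun x y => ?_
  by_cases h : x.1 = y.1 + e
  · simp only [MotivicDT.ofBlk, Matrix.of_apply, if_pos h]
    exact (hf y.1).entry _ _
  · simp only [MotivicDT.ofBlk, Matrix.of_apply, if_neg h]
    exact tame_const 0

open Classical in
/-- The product `h_{k-1} ⋯ h_0` in terms of the products `t_k = h_k ⋯ h_0`. -/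
def prevProd (t : ZMod N → Matrix (Fin a) (Fin a) ℂ) (k : ZMod N) : Matrix (Fin a) (Fin a) ℂ :=
  if k = 0 then 1 else t (k - 1)

theorem prevProd_succ {t : ZMod N → Matrix (Fin a) (Fin a) ℂ} {k : ZMod N} (h : k + 1 ≠ 0) :
    prevProd t (k + 1) = t k := by
  rw [prevProd, if_neg h, add_sub_cancel_right]

theorem isUnit_prevProd {t : ZMod N → Matrix (Fin a) (Fin a) ℂ} (ht : ∀ k, IsUnit (t k))
    (k : ZMod N) : IsUnit (prevProd t k) := by
  rw [prevProd]
  split_ifs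
  · exact isUnit_one
  · exact ht _

/-- The cyclic map with given partial products. -/
def ofProds (t : ZMod N → Matrix (Fin a) (Fin a) ℂ) :
    Matrix ((_ : ZMod N) × Fin a) ((_ : ZMod N) × Fin a) ℂ :=
  ofBlk 1 fun k => t k * (prevProd t k)⁻¹

/-- The partial products of a cyclic map. -/
def toProds (H : Matrix ((_ : ZMod N) × Fin a) ((_ : ZMod N) × Fin a) ℂ) (k : ZMod N) :
    Matrix (Fin a) (Fin a) ℂ :=
  blk (H ^ (k.val + 1)) (k + 1) 0

theorem blk_pow {H : Matrix ((_ : ZMod N) × Fin a) ((_ : ZMod N) × Fin a) ℂ} (k : ZMod N) :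
    blk (H ^ k.val) k 0 = prevProd (toProds H) k := by
  rw [prevProd]
  split_ifs with h
  · subst h
    rw [ZMod.val_zero, pow_zero, blk_one_self]
  · have h1 : (k - 1).val + 1 = k.val := by
      have h2 : k.val ≠ 0 := fun h0 => h ((ZMod.val_eq_zero k).1 h0)
      have h3 : ((k.val - 1 : ℕ) : ZMod N) = k - 1 := by
        rw [Nat.cast_sub (by omega), ZMod.natCast_zmod_val, Nat.cast_one]
      rw [← h3, ZMod.val_cast_of_lt (by have := ZMod.val_lt k; omega)]
      omega
    rw [toProds, h1, sub_add_cancel]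

theorem toProds_eq {H : Matrix ((_ : ZMod N) × Fin a) ((_ : ZMod N) × Fin a) ℂ}
    (hH : IsDeg Sigma.fst Sigma.fst 1 H) (k : ZMod N) :
    toProds H k = blk H (k + 1) k * prevProd (toProds H) k := by
  rw [toProds, pow_succ', blk_mul (hH.pow k.val), zero_add, ZMod.natCast_zmod_val, blk_pow]

theorem isUnit_toProds {H : Matrix ((_ : ZMod N) × Fin a) ((_ : ZMod N) × Fin a) ℂ}
    (hH : IsDeg Sigma.fst Sigma.fst 1 H) (hu : IsUnit H) (k : ZMod N) : IsUnit (toProds H k) := by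
  have h := isUnit_blk (hH.pow (k.val + 1)) (hu.pow _) 0
  rwa [zero_add, Nat.cast_succ, ZMod.natCast_zmod_val] at h

theorem ofProds_toProds {H : Matrix ((_ : ZMod N) × Fin a) ((_ : ZMod N) × Fin a) ℂ}
    (hH : IsDeg Sigma.fst Sigma.fst 1 H) (hu : IsUnit H) : ofProds (toProds H) = H := by
  refine ext_blk (isDeg_ofBlk _ _) hH fun k => ?_
  rw [ofProds, blk_ofBlk, toProds_eq hH, mul_assoc, Matrix.mul_nonsing_inv, mul_one]
  exact (Matrix.isUnit_iff_isUnit_det _).1 (isUnit_prevProd (isUnit_toProds hH hu) k)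

theorem toProds_ofProds {t : ZMod N → Matrix (Fin a) (Fin a) ℂ} (ht : ∀ k, IsUnit (t k)) :
    toProds (ofProds t) = t := by
  have hd : IsDeg Sigma.fst Sigma.fst 1 (ofProds t) := isDeg_ofBlk _ _
  have key : ∀ k, prevProd (toProds (ofProds t)) k = prevProd t k → toProds (ofProds t) k = t k := by
    intro k hk
    rw [toProds_eq hd, hk, ofProds, blk_ofBlk, mul_assoc, Matrix.nonsing_inv_mul, mul_one]
    exact (Matrix.isUnit_iff_isUnit_det _).1 (isUnit_prevProd ht k)
  have h : ∀ n : ℕ, toProds (ofProds t) (n : ZMod N) = t n := by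
    intro n
    induction n with
    | zero => exact key _ (by simp [prevProd])
    | succ n ih =>
      refine key _ ?_
      by_cases h0 : ((n + 1 : ℕ) : ZMod N) = 0
      · rw [prevProd, prevProd, if_pos h0, if_pos h0]
      · rw [Nat.cast_succ] at h0 ⊢
        rw [prevProd_succ h0, prevProd_succ h0, ih]
  funext k
  rw [← ZMod.natCast_zmod_val k]
  exact h _

/-- The commuting endomorphism with given block at `0`. -/
def spread (t : ZMod N → Matrix (Fin a) (Fin a) ℂ) (x : Matrix (Fin a) (Fin a) ℂ) :
    Matrix ((_ : ZMod N) × Fin a) ((_ : ZMod N) × Fin a) ℂ :=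
  ofBlk 0 fun k => prevProd t k * x * (prevProd t k)⁻¹

theorem spread_comm {t : ZMod N → Matrix (Fin a) (Fin a) ℂ} (ht : ∀ k, IsUnit (t k))
    {x : Matrix (Fin a) (Fin a) ℂ} (hx : t (-1) * x = x * t (-1)) :
    spread t x * ofProds t = ofProds t * spread t x := by
  refine ext_blk ((isDeg_ofBlk _ _).mul_zero_left (isDeg_ofBlk _ _))
    ((isDeg_ofBlk _ _).mul_zero_right (isDeg_ofBlk _ _)) fun k => ?_
  have h0 : ∀ k, blk (spread t x) k k = prevProd t k * x * (prevProd t k)⁻¹ := fun k => by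
    have := blk_ofBlk 0 (fun k => prevProd t k * x * (prevProd t k)⁻¹) k
    rwa [add_zero] at this
  have hp := Matrix.nonsing_inv_mul _ ((Matrix.isUnit_iff_isUnit_det _).1 (isUnit_prevProd ht k))
  have htk := Matrix.nonsing_inv_mul _ ((Matrix.isUnit_iff_isUnit_det _).1 (ht k))
  have hb : blk (ofProds t) (k + 1) k = t k * (prevProd t k)⁻¹ := blk_ofBlk _ _ _
  rw [blk_mul (show IsDeg Sigma.fst Sigma.fst 1 (ofProds t) from isDeg_ofBlk _ _),
    blk_mul (show IsDeg Sigma.fst Sigma.fst 0 (spread t x) from isDeg_ofBlk _ _), add_zero, h0, h0,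
    hb]
  have hR : t k * (prevProd t k)⁻¹ * (prevProd t k * x * (prevProd t k)⁻¹) =
      t k * x * (prevProd t k)⁻¹ := by
    rw [mul_assoc, ← mul_assoc _ (prevProd t k * x), ← mul_assoc _ (prevProd t k), hp, one_mul,
      mul_assoc]
  rw [hR]
  by_cases h1 : k + 1 = 0
  · obtain rfl : k = -1 := eq_neg_of_add_eq_zero_left h1
    have h2 : prevProd t (-1 + 1) = 1 := if_pos h1
    rw [h2, hx, inv_one, one_mul, mul_one, mul_assoc]
  · rw [prevProd_succ h1, mul_assoc, ← mul_assoc _ (t k), htk, one_mul]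

theorem eq_spread {H ρ : Matrix ((_ : ZMod N) × Fin a) ((_ : ZMod N) × Fin a) ℂ}
    (hH : IsDeg Sigma.fst Sigma.fst 1 H) (hu : IsUnit H) (hρ : IsDeg Sigma.fst Sigma.fst 0 ρ)
    (hc : ρ * H = H * ρ) : spread (toProds H) (blk ρ 0 0) = ρ ∧
      toProds H (-1) * blk ρ 0 0 = blk ρ 0 0 * toProds H (-1) := by
  have h1 : ∀ n, ρ * H ^ n = H ^ n * ρ := fun n => (show Commute ρ H from hc).pow_right n
  constructor
  · refine ext_blk (isDeg_ofBlk _ _) hρ fun k => ?_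
    rw [spread, blk_ofBlk, add_zero, ← blk_pow]
    have h2 := congrArg (blk · k 0) (h1 k.val)
    simp only [blk_mul hρ, blk_mul (hH.pow k.val), zero_add, add_zero, ZMod.natCast_zmod_val] at h2
    rw [← h2, mul_assoc, Matrix.mul_nonsing_inv, mul_one]
    rw [blk_pow]
    exact (Matrix.isUnit_iff_isUnit_det _).1 (isUnit_prevProd (isUnit_toProds hH hu) k)
  · have h2 := congrArg (blk · 0 0) (h1 ((-1 : ZMod N).val + 1))
    simp only [blk_mul hρ, blk_mul (hH.pow _), add_zero, ZMod.natCast_zmod_val,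
      Nat.cast_succ, neg_add_cancel] at h2
    rw [toProds, neg_add_cancel, h2]

theorem Tame.toProds {E : Type} [AddCommGroup E] [Module ℂ E]
    {H : E → Matrix ((_ : ZMod N) × Fin a) ((_ : ZMod N) × Fin a) ℂ} (hH : Tame H) :
    Tame fun x => toProds (H x) :=
  Tame.pi fun _ => (hH.matrixPow _).blk _ _

theorem Tame.prevProd {E : Type} [AddCommGroup E] [Module ℂ E]
    {t : E → ZMod N → Matrix (Fin a) (Fin a) ℂ} (ht : Tame t) (k : ZMod N) :
    Tame fun x => prevProd (t x) k := by
  unfold MotivicDT.prevProd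
  split_ifs
  · exact tame_const 1
  · exact ht.apply _

theorem Tame.ofProds {E : Type} [AddCommGroup E] [Module ℂ E]
    {t : E → ZMod N → Matrix (Fin a) (Fin a) ℂ} (ht : Tame t) : Tame fun x => ofProds (t x) :=
  Tame.ofBlk _ fun k => (ht.apply k).matrixMul (ht.prevProd k).matrixInv

theorem Tame.spread {E : Type} [AddCommGroup E] [Module ℂ E]
    {t : E → ZMod N → Matrix (Fin a) (Fin a) ℂ} {x : E → Matrix (Fin a) (Fin a) ℂ} (ht : Tame t)
    (hx : Tame x) : Tame fun z => spread (t z) (x z) :=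
  Tame.ofBlk _ fun k => ((ht.prevProd k).matrixMul hx).matrixMul (ht.prevProd k).matrixInv

/-- The class of the pairs of commuting matrices, the first of which is invertible. -/
def commMot (a : ℕ) : Mot :=
  mu {z : MatPair (Fin a) | IsUnit z.1 ∧ z.1 * z.2 = z.2 * z.1}

theorem cons_comm : Cons {z : MatPair (Fin a) |
    IsUnit z.1 ∧ z.1 * z.2 = z.2 * z.1} :=
  (Cons.isUnit tame_id.fst).and (Cons.eq (tame_id.fst.matrixMul tame_id.snd)
    (tame_id.snd.matrixMul tame_id.fst))

theorem mu_prods :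
    mu {z : (ZMod N → Matrix (Fin a) (Fin a) ℂ) × Matrix (Fin a) (Fin a) ℂ |
      (∀ k, IsUnit (z.1 k)) ∧ z.1 (-1) * z.2 = z.2 * z.1 (-1)} * motiveGL a =
      motiveGL a ^ N * commMot a := by
  have hu : Cons {A : Matrix (Fin a) (Fin a) ℂ | IsUnit A} := Cons.isUnit tame_id
  have hpi := mu_pi (ι := ZMod N) (V := fun _ => Matrix (Fin a) (Fin a) ℂ)
    (X := fun _ => {A | IsUnit A}) fun _ => hu
  rw [finprod_eq_prod_of_fintype, Finset.prod_const, Finset.card_univ, ZMod.card] at hpi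
  have hc : Cons {z : (ZMod N → Matrix (Fin a) (Fin a) ℂ) × Matrix (Fin a) (Fin a) ℂ |
      (∀ k, IsUnit (z.1 k)) ∧ z.1 (-1) * z.2 = z.2 * z.1 (-1)} :=
    (Cons.forall fun k => Cons.isUnit (tame_id.fst.apply k)).and
      (Cons.eq ((tame_id.fst.apply _).matrixMul tame_id.snd)
        (tame_id.snd.matrixMul (tame_id.fst.apply _)))
  rw [commMot, motiveGL_eq_mu, ← hpi, ← mu_prod hc hu, ← mu_prod (Cons.pi fun _ => hu) cons_comm]
  have hup : ∀ {E : Type} [AddCommGroup E] [Module ℂ E]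
      {t : E → ZMod N → Matrix (Fin a) (Fin a) ℂ} {g : E → Matrix (Fin a) (Fin a) ℂ}, Tame t →
      Tame g → Tame fun z => Function.update (t z) (-1) (g z) := by
    intro E _ _ t g ht hg
    refine Tame.pi fun k => ?_
    by_cases hk : k = -1
    · subst hk
      simpa using hg
    · simpa [hk] using ht.apply k
  refine mu_congr (fun z => (Function.update z.1.1 (-1) z.2, (z.1.1 (-1), z.1.2)))
    (fun z => ((Function.update z.1 (-1) z.2.1, z.2.2), z.1 (-1)))
    (Tame.prodMk (hup (by fun_prop) (by fun_prop)) (Tame.prodMk (Tame.apply (by fun_prop) _)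
      (by fun_prop))) (Tame.prodMk (Tame.prodMk (hup (by fun_prop) (by fun_prop)) (by fun_prop))
      (Tame.apply (by fun_prop) _)) ?_ ?_
  · rintro ⟨⟨t, x⟩, g⟩ ⟨⟨ht, hx⟩, hg⟩
    refine ⟨⟨fun k => ?_, ht _, hx⟩, by simp⟩
    by_cases hk : k = -1
    · subst hk
      simpa using hg
    · simpa [hk] using ht k
  · rintro ⟨t, ⟨g, x⟩⟩ ⟨ht, hg, hx⟩
    refine ⟨⟨⟨fun k => ?_, ?_⟩, ht _⟩, by simp⟩
    · by_cases hk : k = -1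
      · subst hk
        simpa using hg
      · simpa [hk] using ht k
    · simpa using hx

variable {J : Set (ZMod N)}

theorem mu_invReps (hJ : ∀ k ∈ J, k + 1 ∉ J) :
    mu (invReps J (Sigma.fst : ((_ : ZMod N) × Fin a) → ZMod N)) * motiveGL a =
      motiveGL a ^ N * commMot a := by
  rw [← mu_prods]
  congr 1
  let P : Set (ZMod N) → Matrix ((_ : ZMod N) × Fin a) ((_ : ZMod N) × Fin a) ℂ :=
    degProj Sigma.fst
  refine mu_congr (fun z => (toProds z.1, blk (rho z.1 z.2) 0 0))
    (fun z => (ofProds z.1, (P J * spread z.1 z.2 * (ofProds z.1)⁻¹,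
      P {k | k ∉ J ∧ k - 1 ∉ J} * spread z.1 z.2))) ?_ ?_ ?_ ?_
  · exact tame_id.fst.toProds.prodMk (tame_rho.blk 0 0)
  · have h1 := (tame_id (E := (ZMod N → Matrix (Fin a) (Fin a) ℂ) × Matrix (Fin a) (Fin a) ℂ)).fst.ofProds
    have h2 := Tame.spread
      (tame_id (E := (ZMod N → Matrix (Fin a) (Fin a) ℂ) × Matrix (Fin a) (Fin a) ℂ)).fst tame_id.snd
    exact h1.prodMk (((((tame_const _).matrixMul h2)).matrixMul h1.matrixInv).prodMk
      ((tame_const _).matrixMul h2))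
  · rintro ⟨H, y⟩ ⟨⟨hH, hy, hc⟩, hu⟩
    simp only at hH hy hc hu ⊢
    have hρ : IsDeg Sigma.fst Sigma.fst 0 (rho H y) := by
      obtain ⟨⟨h1, -⟩, h2, -⟩ := mem_jSpace_iff.1 hy
      have h3 := hH.mul h1
      have h4 := h1.mul hH
      rw [add_neg_cancel] at h3
      rw [neg_add_cancel] at h4
      exact (h3.add h4).add h2
    obtain ⟨h1, h2⟩ := eq_spread hH hu hρ hc
    refine ⟨⟨isUnit_toProds hH hu, h2⟩, ?_⟩
    obtain ⟨-, e2, e3⟩ := degProj_rho hJ hH hy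
    rw [ofProds_toProds hH hu, h1]
    change (H, (degProj Sigma.fst J * rho H y * H⁻¹, degProj Sigma.fst _ * rho H y)) = _
    rw [e2, e3, mul_assoc, Matrix.mul_nonsing_inv _ ((Matrix.isUnit_iff_isUnit_det _).1 hu), mul_one]
  · rintro ⟨t, x⟩ ⟨ht, hx⟩
    simp only at ht hx ⊢
    have hc := spread_comm ht hx
    have hH : IsDeg Sigma.fst Sigma.fst 1 (ofProds t) := isDeg_ofBlk _ _
    have hu : IsUnit (ofProds t) := isUnit_ofBlk fun k => (ht k).mul
      ((Matrix.isUnit_nonsing_inv_iff).2 (isUnit_prevProd ht k))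
    have hρ : IsDeg Sigma.fst Sigma.fst 0 (spread t x) := isDeg_ofBlk _ _
    have hi1 := Matrix.mul_nonsing_inv _ ((Matrix.isUnit_iff_isUnit_det _).1 hu)
    have hi2 := Matrix.nonsing_inv_mul _ ((Matrix.isUnit_iff_isUnit_det _).1 hu)
    set H := ofProds t
    set ρ := spread t x with hρdef
    have hHi : IsDeg Sigma.fst Sigma.fst (-1) H⁻¹ := hH.of_inverse hi1 hi2
    have hPH : H * P J = P {k | k - 1 ∈ J} * H := by
      ext c b
      simp only [P]
      rw [degProj_mul_apply, mul_degProj_apply]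
      by_cases h0 : H c b = 0
      · simp [h0]
      · have e : c.1 - 1 = b.1 := by rw [hH c b h0, add_sub_cancel_right]
        by_cases hb : b.1 ∈ J
        · rw [if_pos hb]
          exact (if_pos (show c.1 - 1 ∈ J by rwa [e])).symm
        · rw [if_neg hb]
          exact (if_neg (show ¬ c.1 - 1 ∈ J by rwa [e])).symm
    have hrho : rho H (P J * ρ * H⁻¹, P {k | k ∉ J ∧ k - 1 ∉ J} * ρ) = ρ := by
      have h1 : H * (P J * ρ * H⁻¹) = P {k | k - 1 ∈ J} * ρ := by
        rw [← mul_assoc, ← mul_assoc, hPH, mul_assoc _ H, ← hc, mul_assoc, mul_assoc, hi1, mul_one]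
      rw [rho, h1, mul_assoc _ H⁻¹, hi2, mul_one]
      ext c b
      simp only [P, Matrix.add_apply, degProj_mul_apply]
      by_cases h1 : c.1 ∈ J
      · have h2 : c.1 - 1 ∉ J := fun h => hJ _ h (by simpa using h1)
        simp [h1, h2]
      · by_cases h2 : c.1 - 1 ∈ J <;> simp [h1, h2]
    have hPP : ∀ X (M : Matrix ((_ : ZMod N) × Fin a) ((_ : ZMod N) × Fin a) ℂ),
        degProj Sigma.fst X * (P X * M) = P X * M := by
      intro X M
      rw [← mul_assoc, degProj_mul_degProj, Set.inter_self]
    refine ⟨⟨⟨hH, mem_jSpace_iff.2 ⟨⟨?_, ?_⟩, ?_, hPP _ _⟩, ?_⟩, hu⟩, ?_⟩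
    · exact ((isDeg_degProj J).mul_zero_left hρ).mul_zero_left hHi
    · simp only
      rw [mul_assoc (P J)]
      exact hPP _ _
    · exact (isDeg_degProj _).mul_zero_left hρ
    · simp only
      rw [hrho, hc]
    · rw [hrho, toProds_ofProds ht]
      have h1 := blk_ofBlk 0 (fun k => prevProd t k * x * (prevProd t k)⁻¹) 0
      rw [add_zero] at h1
      refine Prod.ext rfl (h1.trans ?_)
      simp [prevProd]

end Cyclic

/-! ## Similarity of matrices -/

section Similarity

open Polynomial

variable {B C D B' C' : Type} [Fintype B] [DecidableEq B] [Fintype C] [DecidableEq C]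
  [Fintype D] [DecidableEq D] [Fintype B'] [DecidableEq B'] [Fintype C'] [DecidableEq C']

/-- Similarity of square matrices with possibly different index types. -/
def Sim (x : Matrix B B ℂ) (y : Matrix C C ℂ) : Prop :=
  ∃ (g : Matrix B C ℂ) (h : Matrix C B ℂ), g * h = 1 ∧ h * g = 1 ∧ x * g = g * y

/-- All polynomials take values of equal rank at the two matrices. -/
def SameRank (x : Matrix B B ℂ) (y : Matrix C C ℂ) : Prop :=
  ∀ p : ℂ[X], (aeval x p).rank = (aeval y p).rank

variable {x : Matrix B B ℂ} {y : Matrix C C ℂ} {z : Matrix D D ℂ}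

theorem Sim.symm (h : Sim x y) : Sim y x := by
  obtain ⟨g, h, h1, h2, h3⟩ := h
  refine ⟨h, g, h2, h1, ?_⟩
  calc y * h = h * g * (y * h) := by rw [h2, Matrix.one_mul]
    _ = h * (g * y) * h := by simp only [Matrix.mul_assoc]
    _ = h * x * (g * h) := by rw [← h3]; simp only [Matrix.mul_assoc]
    _ = h * x := by rw [h1, Matrix.mul_one]

theorem Sim.trans (h : Sim x y) (h' : Sim y z) : Sim x z := by
  obtain ⟨g, h, h1, h2, h3⟩ := h
  obtain ⟨g', h', h1', h2', h3'⟩ := h'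
  refine ⟨g * g', h' * h, ?_, ?_, ?_⟩
  · rw [Matrix.mul_assoc, ← Matrix.mul_assoc g', h1', Matrix.one_mul, h1]
  · rw [Matrix.mul_assoc, ← Matrix.mul_assoc h, h2, Matrix.one_mul, h2']
  · rw [← Matrix.mul_assoc, h3, Matrix.mul_assoc, h3', Matrix.mul_assoc]

theorem sim_submatrix (e : C ≃ B) : Sim x (x.submatrix e e) := by
  refine ⟨(1 : Matrix B B ℂ).submatrix id e, (1 : Matrix B B ℂ).submatrix e id, ?_, ?_, ?_⟩
  · rw [Matrix.submatrix_mul_equiv]; simp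
  · rw [← Matrix.submatrix_mul _ _ e id e Function.bijective_id]; simp
  · rw [Matrix.submatrix_mul_equiv, Matrix.one_mul]
    have := Matrix.submatrix_mul x (1 : Matrix B B ℂ) id id e Function.bijective_id
    rw [Matrix.mul_one, Matrix.submatrix_id_id] at this
    exact this.symm

theorem Sim.fromBlocks {x' : Matrix B' B' ℂ} {y' : Matrix C' C' ℂ} (h : Sim x y)
    (h' : Sim x' y') : Sim (Matrix.fromBlocks x 0 0 x') (Matrix.fromBlocks y 0 0 y') := by
  obtain ⟨g, h, h1, h2, h3⟩ := h
  obtain ⟨g', h', h1', h2', h3'⟩ := h'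
  refine ⟨.fromBlocks g 0 0 g', .fromBlocks h 0 0 h', ?_, ?_, ?_⟩ <;>
    simp [Matrix.fromBlocks_multiply, *]

theorem aeval_mul_of_intertwine {g : Matrix B C ℂ} (h : x * g = g * y) (p : ℂ[X]) :
    aeval x p * g = g * aeval y p := by
  induction p using Polynomial.induction_on' with
  | add p q hp hq => rw [map_add, map_add, Matrix.add_mul, Matrix.mul_add, hp, hq]
  | monomial n a =>
    rw [aeval_monomial, aeval_monomial, ← Algebra.smul_def, ← Algebra.smul_def, Matrix.smul_mul,
      Matrix.mul_smul]
    congr 1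
    induction n with
    | zero => simp
    | succ n ih => rw [pow_succ', pow_succ', Matrix.mul_assoc, ih, ← Matrix.mul_assoc, h,
        Matrix.mul_assoc]

theorem Sim.sameRank (h : Sim x y) : SameRank x y := by
  obtain ⟨g, h, h1, h2, h3⟩ := h
  intro p
  rw [← rank_conj h2 (aeval y p), ← aeval_mul_of_intertwine h3, Matrix.mul_assoc, h1,
    Matrix.mul_one]

theorem SameRank.trans (h : SameRank x y) (h' : SameRank y z) : SameRank x z :=
  fun p => (h p).trans (h' p)

theorem rank_eq_zero_iff {M : Matrix B C ℂ} : M.rank = 0 ↔ M = 0 := by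
  refine ⟨fun h => ?_, fun h => h ▸ Matrix.rank_zero⟩
  rw [Matrix.rank, Submodule.finrank_eq_zero, LinearMap.range_eq_bot] at h
  ext i j
  have := congr_fun (LinearMap.congr_fun h (Pi.single j 1)) i
  simpa using this

theorem SameRank.aeval_eq_zero (h : SameRank x y) (p : ℂ[X]) : aeval x p = 0 ↔ aeval y p = 0 := by
  rw [← rank_eq_zero_iff, ← rank_eq_zero_iff, h p]

theorem aeval_fromBlocks (x : Matrix B B ℂ) (y : Matrix C C ℂ) (p : ℂ[X]) :
    aeval (Matrix.fromBlocks x 0 0 y) p = Matrix.fromBlocks (aeval x p) 0 0 (aeval y p) := by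
  induction p using Polynomial.induction_on' with
  | add p q hp hq => simp [hp, hq, Matrix.fromBlocks_add]
  | monomial n a =>
    simp only [aeval_monomial, ← Algebra.smul_def, Matrix.fromBlocks_diagonal_pow,
      Matrix.fromBlocks_smul, smul_zero]

theorem rank_fromBlocks_diagonal (M : Matrix B C ℂ) (M' : Matrix B' C' ℂ) :
    (Matrix.fromBlocks M 0 0 M').rank = M.rank + M'.rank := by
  let e := LinearEquiv.sumArrowLequivProdArrow B B' ℂ ℂ
  let e' := LinearEquiv.sumArrowLequivProdArrow C C' ℂ ℂ
  have h : (Matrix.fromBlocks M 0 0 M').mulVecLin =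
      e.symm.toLinearMap ∘ₗ (M.mulVecLin.prodMap M'.mulVecLin) ∘ₗ e'.toLinearMap := by
    refine LinearMap.ext fun v => ?_
    rw [← Sum.elim_comp_inl_inr v]
    funext i
    simp only [Matrix.mulVecLin_apply, Matrix.fromBlocks_mulVec]
    rcases i with i | i <;> simp [e, e'] <;> rfl
  rw [Matrix.rank, h, LinearMap.range_comp, LinearEquiv.finrank_map_eq,
    LinearMap.range_comp_of_range_eq_top _ (LinearEquiv.range _), LinearMap.range_prodMap,
    Matrix.rank, Matrix.rank,
    ← Module.finrank_prod]
  exact LinearEquiv.finrank_eq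
    { toFun := fun x => (⟨x.1.1, x.2.1⟩, ⟨x.1.2, x.2.2⟩)
      invFun := fun x => ⟨(x.1, x.2), x.1.2, x.2.2⟩
      map_add' := fun _ _ => rfl
      map_smul' := fun _ _ => rfl
      left_inv := fun _ => rfl
      right_inv := fun _ => rfl }

theorem SameRank.of_fromBlocks {x' : Matrix B' B' ℂ} {y' : Matrix C' C' ℂ}
    (h : SameRank (Matrix.fromBlocks x 0 0 x') (Matrix.fromBlocks y 0 0 y')) (h' : SameRank x y) :
    SameRank x' y' := by
  intro p
  have h1 := h p
  rw [aeval_fromBlocks, aeval_fromBlocks, rank_fromBlocks_diagonal, rank_fromBlocks_diagonal,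
    h' p] at h1
  omega

/-! ### Companion matrices and Krylov bases -/

/-- The companion matrix of a monic polynomial of degree `d`. -/
def comp (d : ℕ) (f : ℂ[X]) : Matrix (Fin d) (Fin d) ℂ :=
  Matrix.of fun i j => if (j : ℕ) + 1 = d then -f.coeff i else if (i : ℕ) = j + 1 then 1 else 0

/-- The matrix with columns `v, x v, …, x ^ (d - 1) v`. -/
def krylov (d : ℕ) (x : Matrix B B ℂ) (v : B → ℂ) : Matrix B (Fin d) ℂ :=
  Matrix.of fun b i => ((x ^ (i : ℕ)).mulVec v) b

theorem aeval_comp_eq_zero {f : ℂ[X]} (hf : f.Monic) (p : ℂ[X]) :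
    aeval (comp f.natDegree f) p = 0 ↔ f ∣ p := by
  have h := PowerBasis.leftMulMatrix (AdjoinRoot.powerBasis' hf)
  have hc : comp f.natDegree f =
      Algebra.leftMulMatrix (AdjoinRoot.powerBasis' hf).basis (AdjoinRoot.root f) := by
    rw [AdjoinRoot.powerBasis'_gen] at h
    rw [h, PowerBasis.minpolyGen_eq, AdjoinRoot.powerBasis'_gen, AdjoinRoot.minpoly_root hf.ne_zero,
      hf.leadingCoeff, inv_one, Polynomial.C_1, mul_one]
    rfl
  have h1 := aeval_algHom_apply (Algebra.leftMulMatrix (AdjoinRoot.powerBasis' hf).basis)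
    (AdjoinRoot.root f) p
  rw [← AdjoinRoot.mk_eq_zero, ← AdjoinRoot.aeval_eq,
    ← map_eq_zero_iff _ (Algebra.leftMulMatrix_injective (AdjoinRoot.powerBasis' hf).basis), ← h1,
    hc]
  rfl

variable {d : ℕ} {v : B → ℂ} {f : ℂ[X]}

theorem krylov_mulVec (x : Matrix B B ℂ) (v : B → ℂ) (c : Fin d → ℂ) :
    (krylov d x v).mulVec c = (aeval x (∑ i, Polynomial.C (c i) * X ^ (i : ℕ))).mulVec v := by
  funext b
  rw [map_sum (aeval x), Matrix.sum_mulVec, Finset.sum_apply]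
  change ∑ i, krylov d x v b i * c i = _
  refine Finset.sum_congr rfl fun i _ => ?_
  simp only [krylov, Matrix.of_apply, map_mul, aeval_C, map_pow, aeval_X, ← Algebra.smul_def,
    Matrix.smul_mulVec, Pi.smul_apply, smul_eq_mul]
  ring

theorem mul_krylov (hf : f.Monic) (hd : f.natDegree = d) (hv : (aeval x f).mulVec v = 0) :
    x * krylov d x v = krylov d x v * comp d f := by
  ext b j
  have h1 : (x * krylov d x v) b j = ((x ^ ((j : ℕ) + 1)).mulVec v) b := by
    rw [pow_succ', ← Matrix.mulVec_mulVec]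
    rfl
  rw [h1, Matrix.mul_apply]
  by_cases hj : (j : ℕ) + 1 = d
  · have h2 : (krylov d x v).mulVec (fun i => -f.coeff i) = (x ^ d).mulVec v := by
      rw [krylov_mulVec]
      have : ∑ i : Fin d, Polynomial.C (-f.coeff i) * X ^ (i : ℕ) = X ^ d - f := by
        conv_rhs => rw [hf.as_sum, hd]
        rw [Fin.sum_univ_eq_sum_range (fun i => Polynomial.C (-f.coeff i) * X ^ i)]
        simp
      rw [this, map_sub, Matrix.sub_mulVec, hv, sub_zero, map_pow, aeval_X]
    rw [hj, ← h2]
    simp only [comp, Matrix.of_apply, hj, if_true]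
    rfl
  · have hlt : (j : ℕ) + 1 < d := by omega
    rw [Finset.sum_eq_single ⟨j + 1, hlt⟩]
    · simp [comp, krylov, hj]
    · intro i _ hi
      have : (i : ℕ) ≠ j + 1 := fun h => hi (Fin.ext h)
      simp [comp, hj, this]
    · simp

theorem krylov_injective (hf : f.Monic) (hd : f.natDegree = d)
    (hv : ∀ p : ℂ[X], (aeval x p).mulVec v = 0 → f ∣ p) (c : Fin d → ℂ)
    (hc : (krylov d x v).mulVec c = 0) : c = 0 := by
  rw [krylov_mulVec] at hc
  have h1 := hv _ hc
  have h2 : ∑ i : Fin d, Polynomial.C (c i) * X ^ (i : ℕ) = 0 := by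
    refine eq_zero_of_dvd_of_degree_lt h1 ?_
    rw [degree_eq_natDegree hf.ne_zero, hd]
    exact degree_sum_fin_lt _
  funext i
  have h3 := congr_arg (fun p : ℂ[X] => p.coeff i) h2
  simpa [finsetSum_coeff, coeff_C_mul, coeff_X_pow, Fin.val_inj] using h3

theorem exists_cyclic_vector (x : Matrix B B ℂ) :
    ∃ v : B → ℂ, ∀ p : ℂ[X], (aeval x p).mulVec v = 0 → aeval x p = 0 := by
  obtain ⟨w, hw⟩ := Module.exists_ker_toSpanSingleton_eq_annihilator ℂ[X]
    (Module.AEval' (Matrix.toLin' x))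
  obtain ⟨v, rfl⟩ := (Module.AEval'.of _).surjective w
  refine ⟨v, fun p hp => ?_⟩
  have hx : ∀ q : ℂ[X], aeval (Matrix.toLin' x) q = Matrix.toLin' (aeval x q) := fun q =>
    aeval_algHom_apply Matrix.toLinAlgEquiv' x q
  have h1 : p ∈ Module.annihilator ℂ[X] (Module.AEval' (Matrix.toLin' x)) := by
    rw [← hw, LinearMap.mem_ker, LinearMap.toSpanSingleton_apply]
    have := Module.AEval.of_aeval_smul (Matrix.toLin' x) p v
    rw [hx] at this
    refine this.symm.trans ?_
    have h2 : Matrix.toLin' (aeval x p) • v = 0 := hp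
    rw [h2, map_zero]
  rw [← span_minpoly_eq_annihilator, Ideal.mem_span_singleton, Matrix.minpoly_toLin'] at h1
  obtain ⟨q, rfl⟩ := h1
  rw [map_mul, minpoly.aeval, zero_mul]

theorem comp_mul_apply (M : Matrix (Fin d) B ℂ) (i : Fin d) (b : B) :
    (comp d f * M) i b = (if h : 0 < (i : ℕ) then M ⟨i - 1, by have := i.2; omega⟩ b else 0) -
      f.coeff i * M ⟨d - 1, by have := i.2; omega⟩ b := by
  have h1 : ∀ j : Fin d, comp d f i j * M j b =
      (if (i : ℕ) = j + 1 then M j b else 0) -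
        if j = ⟨d - 1, by have := i.2; omega⟩ then f.coeff i * M j b else 0 := by
    intro j
    simp only [comp, Matrix.of_apply]
    by_cases hj : (j : ℕ) + 1 = d
    · rw [if_pos hj, if_neg (by omega), if_pos (Fin.ext (by simp; omega))]
      ring
    · rw [if_neg hj, if_neg (c := j = _) (fun h => hj (by
        have := i.2
        have h' := congr_arg Fin.val h
        simp only at h'
        omega))]
      split_ifs <;> simp
  rw [Matrix.mul_apply, Finset.sum_congr rfl fun j _ => h1 j, Finset.sum_sub_distrib,
    Finset.sum_ite_eq' Finset.univ, if_pos (Finset.mem_univ _)]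
  congr 1
  split_ifs with h
  · rw [Finset.sum_eq_single ⟨i - 1, by have := i.2; omega⟩]
    · rw [if_pos (by simp; omega)]
    · intro j _ hj
      rw [if_neg fun h' => hj (Fin.ext (by simp; omega))]
    · simp
  · exact Finset.sum_eq_zero fun j _ => if_neg (by omega)

theorem coeff_iterate_divX (f : ℂ[X]) (i j : ℕ) : (divX^[i] f).coeff j = f.coeff (j + i) := by
  induction i generalizing j with
  | zero => simp
  | succ i ih =>
    rw [Function.iterate_succ_apply', coeff_divX, ih]
    congr 1
    omega

/-- A Krylov subspace of full length has an invariant complement. -/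
theorem exists_retraction_krylov (hf : f.Monic) (hd : f.natDegree = d) (hx : aeval x f = 0)
    (hK : ∀ c, (krylov d x v).mulVec c = 0 → c = 0) :
    ∃ E : Matrix (Fin d) B ℂ, E * krylov d x v = 1 ∧ E * x = comp d f * E := by
  obtain ⟨Y, hY⟩ := exists_mul_eq_one_of_injective hK
  let ξ : B → ℂ := fun b => if h : 0 < d then Y ⟨d - 1, by omega⟩ b else 0
  let E : Matrix (Fin d) B ℂ := Matrix.of fun i => Matrix.vecMul ξ (aeval x (divX^[(i : ℕ) + 1] f))
  have hdiv : ∀ i, Matrix.vecMul (Matrix.vecMul ξ (aeval x (divX^[i + 1] f))) x =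
      Matrix.vecMul ξ (aeval x (divX^[i] f)) - f.coeff i • ξ := by
    intro i
    have h1 := divX_mul_X_add (divX^[i] f)
    rw [coeff_iterate_divX, zero_add, ← Function.iterate_succ_apply' divX] at h1
    rw [← h1, map_add, map_mul, aeval_X, aeval_C, Matrix.vecMul_add, ← Matrix.vecMul_vecMul,
      Algebra.algebraMap_eq_smul_one, Matrix.vecMul_smul, Matrix.vecMul_one]
    simp
  have hone : divX^[d] f = 1 := by
    ext j
    rw [coeff_iterate_divX, coeff_one]
    split_ifs with h
    · rw [h, zero_add, ← hd]
      exact hf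
    · exact coeff_eq_zero_of_natDegree_lt (by omega)
  have hlast : ∀ h : 0 < d, E ⟨d - 1, by omega⟩ = ξ := by
    intro h
    have h2 : d - 1 + 1 = d := by omega
    change Matrix.vecMul ξ (aeval x (divX^[d - 1 + 1] f)) = ξ
    rw [h2, hone, map_one, Matrix.vecMul_one]
  have hEx : E * x = comp d f * E := by
    ext i b
    rw [comp_mul_apply, hlast i.pos]
    have h1 : (E * x) i b = Matrix.vecMul (E i) x b := rfl
    have h2 := congr_fun (hdiv i) b
    rw [h1]
    refine h2.trans ?_
    rw [Pi.sub_apply, Pi.smul_apply, smul_eq_mul]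
    congr 1
    split_ifs with h
    · have h3 : (i : ℕ) - 1 + 1 = i := by omega
      simp only [E, Matrix.of_apply, h3]
    · have h3 : (i : ℕ) = 0 := by omega
      rw [h3, Function.iterate_zero_apply, hx, Matrix.vecMul_zero, Pi.zero_apply]
  refine ⟨E, ?_, hEx⟩
  set U := E * krylov d x v with hU
  have hUC : comp d f * U = U * comp d f := by
    rw [hU, ← Matrix.mul_assoc, ← hEx, Matrix.mul_assoc, Matrix.mul_assoc,
      mul_krylov hf hd (by rw [hx, Matrix.zero_mulVec])]
  have key : ∀ k : ℕ, ∀ i : Fin d, (i : ℕ) + k + 1 = d → U i = (1 : Matrix (Fin d) (Fin d) ℂ) i := by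
    have h0 : ∀ h : 0 < d, U ⟨d - 1, by omega⟩ = (1 : Matrix (Fin d) (Fin d) ℂ) ⟨d - 1, by omega⟩ := by
      intro h
      have h2 : U ⟨d - 1, by omega⟩ = Matrix.vecMul (E ⟨d - 1, by omega⟩) (krylov d x v) := rfl
      have h3 : ξ = Y ⟨d - 1, by omega⟩ := by
        funext b
        simp [ξ, h]
      rw [h2, hlast h, h3, ← hY]
      rfl
    intro k
    induction k with
    | zero =>
      intro i hi
      have : i = ⟨d - 1, by omega⟩ := Fin.ext (by simp; omega)
      rw [this, h0 (by omega)]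
    | succ k ih =>
      intro i hi
      funext b
      let i' : Fin d := ⟨i + 1, by omega⟩
      have h1 := ih i' (by simp [i']; omega)
      have h2 := congr_fun (congr_fun hUC i') b
      have h3 : (U * comp d f) i' b = (comp d f * (1 : Matrix (Fin d) (Fin d) ℂ)) i' b := by
        rw [Matrix.mul_one, ← Matrix.one_mul (comp d f), Matrix.mul_apply, Matrix.mul_apply, h1]
        simp
      rw [h3, comp_mul_apply, comp_mul_apply, h0 (by omega)] at h2
      have h4 : (⟨(i' : ℕ) - 1, by have := i'.2; omega⟩ : Fin d) = i := rfl
      rw [dif_pos (Nat.succ_pos _), dif_pos (Nat.succ_pos _), h4] at h2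
      exact sub_left_injective h2
  ext i b
  rw [key (d - 1 - i) i (by omega)]

theorem sim_fromBlocks_of_krylov (hf : f.Monic) (hd : f.natDegree = d) (hx : aeval x f = 0)
    (hK : ∀ c, (krylov d x v).mulVec c = 0 → c = 0) {W : Matrix B C ℂ}
    {h : Matrix (Fin d ⊕ C) B ℂ} (h1 : Matrix.fromCols (krylov d x v) W * h = 1)
    (h2 : h * Matrix.fromCols (krylov d x v) W = 1) :
    Sim x (Matrix.fromBlocks (comp d f) 0 0
      (h * x * Matrix.fromCols (krylov d x v) W).toBlocks₂₂) := by
  obtain ⟨E, hEK, hEx⟩ := exists_retraction_krylov hf hd hx hK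
  set K := krylov d x v with hKdef
  set M := h * x * Matrix.fromCols K W with hM
  have hxK : x * K = K * comp d f := mul_krylov hf hd (by rw [hx, Matrix.zero_mulVec])
  have hxM : x * Matrix.fromCols K W = Matrix.fromCols K W * M := by
    rw [hM, Matrix.mul_assoc h, ← Matrix.mul_assoc _ h, h1, Matrix.one_mul]
  have hxW : x * W = K * M.toBlocks₁₂ + W * M.toBlocks₂₂ := by
    rw [← Matrix.fromBlocks_toBlocks M, Matrix.mul_fromCols, Matrix.fromCols_mul_fromBlocks] at hxM
    simpa using (Matrix.fromCols_inj.eq_iff.1 hxM).2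
  have h3 : x * (W - K * (E * W)) = (W - K * (E * W)) * M.toBlocks₂₂ := by
    have e1 : comp d f * (E * W) = M.toBlocks₁₂ + E * W * M.toBlocks₂₂ := by
      rw [← Matrix.mul_assoc, ← hEx, Matrix.mul_assoc, hxW, Matrix.mul_add, ← Matrix.mul_assoc, hEK,
        Matrix.one_mul, ← Matrix.mul_assoc]
    rw [Matrix.mul_sub, ← Matrix.mul_assoc, hxK, Matrix.mul_assoc, e1, hxW, Matrix.sub_mul,
      Matrix.mul_add, Matrix.mul_assoc K]
    abel
  refine ⟨Matrix.fromCols K (W - K * (E * W)),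
    (Matrix.fromBlocks 1 (E * W) 0 1 : Matrix (Fin d ⊕ C) (Fin d ⊕ C) ℂ) * h, ?_, ?_, ?_⟩
  · rw [← Matrix.mul_assoc, Matrix.fromCols_mul_fromBlocks]
    simpa using h1
  · have h4 : Matrix.fromCols K (W - K * (E * W)) =
        Matrix.fromCols K W *
          (Matrix.fromBlocks 1 (-(E * W)) 0 1 : Matrix (Fin d ⊕ C) (Fin d ⊕ C) ℂ) := by
      rw [Matrix.fromCols_mul_fromBlocks]
      simp [sub_eq_neg_add]
    rw [h4, Matrix.mul_assoc, ← Matrix.mul_assoc h, h2, Matrix.one_mul, Matrix.fromBlocks_multiply]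
    simp
  · rw [Matrix.mul_fromCols, hxK, h3, Matrix.fromCols_mul_fromBlocks]
    simp

end Similarity

/-! ## Commuting matrices and the rational canonical form -/

section Canonical

open Polynomial

variable {B C : Type} [Fintype B] [DecidableEq B] [Fintype C] [DecidableEq C]
  {E : Type} [AddCommGroup E] [Module ℂ E]

theorem exists_isUnit_fromCols {d : ℕ} {K : Matrix (Fin d ⊕ C) (Fin d) ℂ}
    (hK : ∀ c, K.mulVec c = 0 → c = 0) :
    ∃ W : Matrix (Fin d ⊕ C) C ℂ, IsUnit (Matrix.fromCols K W) := by
  obtain ⟨W₂, hW⟩ := Submodule.exists_isCompl (LinearMap.range K.mulVecLin)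
  have hf : Module.finrank ℂ (C → ℂ) = Module.finrank ℂ W₂ := by
    have h1 := Submodule.finrank_add_eq_of_isCompl hW
    rw [LinearMap.finrank_range_of_inj (LinearMap.ker_eq_bot.1 (LinearMap.ker_eq_bot'.2 hK))] at h1
    simp only [Module.finrank_fintype_fun_eq_card, Fintype.card_sum, Fintype.card_fin] at h1 ⊢
    omega
  let e := LinearEquiv.ofFinrankEq (C → ℂ) W₂ hf
  let W : Matrix (Fin d ⊕ C) C ℂ := LinearMap.toMatrix' (W₂.subtype ∘ₗ e.toLinearMap)
  have hWv : ∀ c, W.mulVec c = e c := fun c => by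
    simp only [W, LinearMap.toMatrix'_mulVec]
    rfl
  obtain ⟨h, h1, h2⟩ := exists_inverse_fromCols (g₁ := K) (g₂ := W) hW hK
    (fun c hc => by
      rw [hWv] at hc
      exact e.map_eq_zero_iff.1 (Subtype.ext hc))
    (fun w => Iff.rfl)
    (fun w => ⟨fun hw => ⟨e.symm ⟨w, hw⟩, by rw [hWv]; simp⟩, fun ⟨c, hc⟩ => by
      rw [← hc, hWv]
      exact (e c).2⟩)
  exact ⟨W, ⟨⟨_, h, h1, h2⟩, rfl⟩⟩

@[fun_prop]
theorem Tame.krylov {d : ℕ} {x : E → Matrix B B ℂ} {v : E → B → ℂ} (hx : Tame x) (hv : Tame v) :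
    Tame fun e => krylov d (x e) (v e) :=
  Tame.matrix fun b i => ((hx.matrixPow (i : ℕ)).mulVec hv).apply b

/-- Splitting off a companion block of maximal size. -/
theorem exists_tame_split (d : ℕ) (C : Type) [Fintype C] [DecidableEq C] :
    ∃ t : Matrix (Fin d ⊕ C) (Fin d ⊕ C) ℂ → Matrix C C ℂ, Tame t ∧
      ∀ (x : Matrix (Fin d ⊕ C) (Fin d ⊕ C) ℂ) (f : ℂ[X]), f.Monic → f.natDegree = d →
        (∀ p, aeval x p = 0 ↔ f ∣ p) → Sim x (Matrix.fromBlocks (comp d f) 0 0 (t x)) := by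
  let L : Matrix (Fin d ⊕ C) (Fin d ⊕ C) ℂ → ((Fin d ⊕ C → ℂ) × Matrix (Fin d ⊕ C) C ℂ) →ₗ[ℂ]
      Matrix (Fin d ⊕ C) (Fin d ⊕ C) ℂ := fun x =>
    { toFun := fun w => Matrix.fromCols (krylov d x w.1) w.2
      map_add' := fun w w' => by
        ext i (j | j) <;> simp [krylov, Matrix.mulVec_add]
      map_smul' := fun c w => by
        ext i (j | j) <;> simp [krylov, Matrix.mulVec_smul] }
  have hcols : ∀ {E : Type} [AddCommGroup E] [Module ℂ E]
      {v : E → (Fin d ⊕ C → ℂ)} {W : E → Matrix (Fin d ⊕ C) C ℂ}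
      {x : E → Matrix (Fin d ⊕ C) (Fin d ⊕ C) ℂ}, Tame x → Tame v → Tame W →
      Tame fun e => Matrix.fromCols (krylov d (x e) (v e)) (W e) := by
    intro E _ _ v W x hx hv hW
    refine Tame.matrix fun i j => ?_
    rcases j with j | j
    · exact (hx.krylov hv).entry i j
    · exact hW.entry i j
  obtain ⟨s, hs, h⟩ := exists_tame_isUnit_section
    (A := fun _ : Matrix (Fin d ⊕ C) (Fin d ⊕ C) ℂ =>
      (0 : ((Fin d ⊕ C → ℂ) × Matrix (Fin d ⊕ C) C ℂ) →ₗ[ℂ] ℂ)) (L := L)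
    (tame_const _) (tame_hom fun w => hcols tame_id (tame_const _) (tame_const _))
  have hk : Tame fun x => L x (s x) := hcols tame_id hs.fst hs.snd
  refine ⟨fun x => ((L x (s x))⁻¹ * x * L x (s x)).toBlocks₂₂, ?_, fun x f hf hd hx => ?_⟩
  · exact ((hk.matrixInv.matrixMul tame_id).matrixMul hk).submatrix _ _
  · have hx0 : aeval x f = 0 := (hx f).2 dvd_rfl
    have hu : IsUnit (L x (s x)) := by
      obtain ⟨v, hv⟩ := exists_cyclic_vector x
      have hK := krylov_injective (d := d) hf hd fun p hp => (hx p).1 (hv p hp)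
      obtain ⟨W, hW⟩ := exists_isUnit_fromCols hK
      exact (h x ⟨(v, W), rfl, hW⟩).2
    have hdet := (Matrix.isUnit_iff_isUnit_det _).1 hu
    have h1 : L x (s x) * (L x (s x))⁻¹ = 1 := Matrix.mul_nonsing_inv _ hdet
    have h2 : (L x (s x))⁻¹ * L x (s x) = 1 := Matrix.nonsing_inv_mul _ hdet
    refine sim_fromBlocks_of_krylov hf hd hx0 (v := (s x).1) (fun c hc => ?_) h1 h2
    have h3 : (L x (s x)).mulVec (Sum.elim c 0) = 0 := by
      change (Matrix.fromCols (krylov d x (s x).1) (s x).2).mulVec _ = 0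
      rw [Matrix.fromCols_mulVec]
      simpa using hc
    have h4 : Sum.elim c 0 = (0 : Fin d ⊕ C → ℂ) := by
      rw [← Matrix.one_mulVec (Sum.elim c 0), ← h2, ← Matrix.mulVec_mulVec, h3, Matrix.mulVec_zero]
    funext i
    exact congr_fun h4 (Sum.inl i)

/-- The monic polynomial with given lower coefficients. -/
def monicPoly {m : ℕ} (c : Fin m → ℂ) : ℂ[X] :=
  X ^ m + ∑ i, Polynomial.C (c i) * X ^ (i : ℕ)

section monicPoly

variable {m : ℕ} (c : Fin m → ℂ)

theorem monic_monicPoly : (monicPoly c).Monic := monic_X_pow_add (degree_sum_fin_lt c)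

theorem natDegree_monicPoly : (monicPoly c).natDegree = m := by
  rw [monicPoly, natDegree_add_eq_left_of_degree_lt, natDegree_X_pow]
  rw [degree_X_pow]
  exact degree_sum_fin_lt c

theorem coeff_monicPoly (j : ℕ) : (monicPoly c).coeff j =
    (if j = m then 1 else 0) + ∑ i : Fin m, if j = i then c i else 0 := by
  simp [monicPoly, finsetSum_coeff, coeff_X_pow]

theorem monicPoly_injective : Function.Injective (monicPoly (m := m)) := by
  intro c c' h
  funext i
  have h1 := congr_arg (fun p : ℂ[X] => p.coeff i) h
  simpa [coeff_monicPoly, Fin.val_inj, i.2.ne] using h1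

theorem exists_monicPoly_eq {f : ℂ[X]} (hf : f.Monic) :
    monicPoly (fun i : Fin f.natDegree => f.coeff i) = f := by
  conv_rhs => rw [hf.as_sum]
  rw [monicPoly, Fin.sum_univ_eq_sum_range (fun i => Polynomial.C (f.coeff i) * X ^ i)]

theorem aeval_monicPoly (x : Matrix B B ℂ) : aeval x (monicPoly c) = x ^ m + ∑ i, c i • x ^ (i : ℕ) := by
  simp [monicPoly, Algebra.smul_def]

theorem tame_coeff_monicPoly (j : ℕ) : Tame fun c : Fin m → ℂ => (monicPoly c).coeff j := by
  simp only [coeff_monicPoly]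
  refine (tame_const _).add (Tame.sum _ fun i => ?_)
  split_ifs
  · exact tame_apply i
  · exact tame_const _

end monicPoly

variable {D : ℕ} {m : Fin D → ℕ}

theorem monic_prod_monicPoly (z : ∀ i, Fin (m i) → ℂ) : (∏ i, monicPoly (z i)).Monic :=
  monic_prod_of_monic _ _ fun _ _ => monic_monicPoly _

theorem natDegree_prod_monicPoly (z : ∀ i, Fin (m i) → ℂ) :
    (∏ i, monicPoly (z i)).natDegree = ∑ i, m i := by
  rw [natDegree_prod_of_monic _ _ fun i _ => monic_monicPoly _]
  exact Finset.sum_congr rfl fun i _ => natDegree_monicPoly _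

theorem tame_coeff_prod_monicPoly {ι : Type} (s : Finset ι) {m : ι → ℕ} (j : ℕ) :
    Tame fun z : ∀ i, Fin (m i) → ℂ => (∏ i ∈ s, monicPoly (z i)).coeff j := by
  classical
  induction s using Finset.induction_on generalizing j with
  | empty => simpa using tame_const _
  | insert i s hi ih =>
    simp only [Finset.prod_insert hi, coeff_mul]
    exact Tame.sum _ fun p => ((tame_coeff_monicPoly p.1).comp (tame_apply i)).mul (ih _)

theorem Tame.aeval_prod_monicPoly {x : E → Matrix B B ℂ} (hx : Tame x) {D : ℕ} {m : Fin D → ℕ}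
    {z : E → ∀ i, Fin (m i) → ℂ} (hz : Tame z) :
    Tame fun e => aeval (x e) (∏ i, monicPoly (z e i)) := by
  induction D with
  | zero => simpa using tame_const _
  | succ D ih =>
    simp only [Fin.prod_univ_succ, map_mul, aeval_monicPoly]
    refine Tame.matrixMul ((hx.matrixPow _).add (Tame.sum _ fun i => ?_))
      (ih (z := fun e i => z e i.succ) (Tame.pi fun i => hz.apply i.succ))
    exact ((hz.apply 0).apply i).smul (hx.matrixPow _)

/-- The size of a canonical form. -/
def canonDim : (D : ℕ) → (Fin D → ℕ) → ℕ
  | 0, _ => 0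
  | D + 1, m => ∑ i, m i + canonDim D fun i => m i.succ

/-- The rational canonical form whose invariant factors are the products
`∏ j ≥ i, monicPoly (z j)`. -/
def canon : (D : ℕ) → (m : Fin D → ℕ) → (∀ i, Fin (m i) → ℂ) →
    Matrix (Fin (canonDim D m)) (Fin (canonDim D m)) ℂ
  | 0, _, _ => 0
  | D + 1, m, z =>
    (Matrix.fromBlocks (comp (∑ i, m i) (∏ i, monicPoly (z i))) 0 0
      (canon D (fun i => m i.succ) fun i => z i.succ)).submatrix finSumFinEquiv.symm
      finSumFinEquiv.symm

theorem sim_canon_succ {m : Fin (D + 1) → ℕ} (z : ∀ i, Fin (m i) → ℂ) {d : ℕ}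
    (hd : ∑ i, m i = d) {f : ℂ[X]} (hf : ∏ i, monicPoly (z i) = f) :
    Sim (Matrix.fromBlocks (comp d f) 0 0 (canon D (fun i => m i.succ) fun i => z i.succ))
      (canon (D + 1) m z) := by
  subst hd hf
  exact sim_submatrix _

theorem canonDim_eq (D : ℕ) (m : Fin D → ℕ) : canonDim D m = ∑ i, (i + 1) * m i := by
  induction D with
  | zero => rfl
  | succ D ih =>
    rw [canonDim, ih, Fin.sum_univ_succ, Fin.sum_univ_succ, add_assoc, ← Finset.sum_add_distrib]
    simp only [Fin.val_zero, zero_add, one_mul, Fin.val_succ, add_right_inj]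
    exact Finset.sum_congr rfl fun i _ => by ring

theorem aeval_canon_eq_zero (D : ℕ) (m : Fin D → ℕ) (z : ∀ i, Fin (m i) → ℂ) (p : ℂ[X]) :
    aeval (canon D m z) p = 0 ↔ ∏ i, monicPoly (z i) ∣ p := by
  induction D with
  | zero =>
    simp only [Finset.univ_eq_empty, Finset.prod_empty, isUnit_one, IsUnit.dvd, iff_true]
    ext i
    exact i.elim0
  | succ D ih =>
    rw [← (sim_canon_succ z rfl rfl).sameRank.aeval_eq_zero, aeval_fromBlocks]
    have h1 : aeval (comp (∑ i, m i) (∏ i, monicPoly (z i))) p = 0 ↔ ∏ i, monicPoly (z i) ∣ p := by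
      rw [← natDegree_prod_monicPoly z]
      exact aeval_comp_eq_zero (monic_prod_monicPoly z) p
    rw [← Matrix.fromBlocks_zero, Matrix.fromBlocks_inj, h1, ih]
    refine ⟨fun h => h.1, fun h => ⟨h, rfl, rfl, ?_⟩⟩
    rw [Fin.prod_univ_succ] at h
    exact (dvd_mul_left _ _).trans h

theorem exists_sim_canon (D : ℕ) : ∀ n ≤ D, ∀ x : Matrix (Fin n) (Fin n) ℂ,
    ∃ m z, Sim x (canon D m z) := by
  induction D with
  | zero =>
    intro n hn x
    obtain rfl : n = 0 := by omega
    refine ⟨fun i => i.elim0, fun i => i.elim0, 0, 0, ?_, ?_, ?_⟩ <;> ext i <;> exact i.elim0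
  | succ D ih =>
    intro n hn x
    have hle : (minpoly ℂ x).natDegree ≤ n := by
      have h1 := natDegree_le_of_dvd (Matrix.minpoly_dvd_charpoly x) x.charpoly_monic.ne_zero
      rwa [Matrix.charpoly_natDegree_eq_dim, Fintype.card_fin] at h1
    have hpos : (minpoly ℂ x).natDegree = 0 → n = 0 := by
      intro h
      by_contra hn0
      have : Nonempty (Fin n) := ⟨⟨0, by omega⟩⟩
      exact (minpoly.natDegree_pos (Matrix.isIntegral x)).ne' h
    have hf := minpoly.monic (Matrix.isIntegral (R := ℂ) x)
    have hfp : ∀ p, aeval x p = 0 ↔ minpoly ℂ x ∣ p := fun p => (minpoly.dvd_iff).symm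
    generalize minpoly ℂ x = f at *
    obtain ⟨e, rfl⟩ := Nat.exists_eq_add_of_le hle
    obtain ⟨t, -, ht⟩ := exists_tame_split f.natDegree (Fin e)
    set x' := x.submatrix finSumFinEquiv finSumFinEquiv with hx'
    have hs : Sim x x' := sim_submatrix _
    have h1 := ht x' f hf rfl fun p => (hs.sameRank.aeval_eq_zero p).symm.trans (hfp p)
    obtain ⟨m, z, h2⟩ := ih e (by omega) (t x')
    have h3 : ∏ i, monicPoly (z i) ∣ f := by
      rw [← aeval_canon_eq_zero, ← h2.sameRank.aeval_eq_zero]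
      have h4 : aeval x f = 0 := (hfp f).2 dvd_rfl
      rw [(hs.trans h1).sameRank.aeval_eq_zero, aeval_fromBlocks, ← Matrix.fromBlocks_zero,
        Matrix.fromBlocks_inj] at h4
      exact h4.2.2.2
    obtain ⟨q, hq⟩ := h3
    have hqm : q.Monic := (monic_prod_monicPoly z).of_mul_monic_left (hq ▸ hf)
    let m' : Fin (D + 1) → ℕ := Fin.cons q.natDegree m
    let z' : ∀ i, Fin (m' i) → ℂ :=
      Fin.cons (α := fun i => Fin (m' i) → ℂ) (fun i : Fin q.natDegree => q.coeff i) z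
    have hz' : ∏ i, monicPoly (z' i) = f := by
      rw [Fin.prod_univ_succ, hq, mul_comm]
      congr 1
      exact exists_monicPoly_eq hqm
    refine ⟨m', z', (hs.trans h1).trans (Sim.trans ?_ (sim_canon_succ z' (d := f.natDegree) ?_ hz'))⟩
    · exact Sim.fromBlocks ⟨1, 1, by simp, by simp, by simp⟩ h2
    · rw [← hz', natDegree_prod_monicPoly]

theorem exists_tame_canon (D : ℕ) (m : Fin D → ℕ) :
    ∃ r : Matrix (Fin (canonDim D m)) (Fin (canonDim D m)) ℂ → ∀ i, Fin (m i) → ℂ, Tame r ∧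
      ∀ x z, SameRank x (canon D m z) → r x = z := by
  induction D with
  | zero => exact ⟨fun _ i => i.elim0, Tame.pi fun i => i.elim0, fun _ _ _ => funext fun i => i.elim0⟩
  | succ D ih =>
    obtain ⟨r, hr, h⟩ := ih (fun i : Fin D => m i.succ)
    obtain ⟨t, ht, hts⟩ := exists_tame_split (∑ i, m i) (Fin (canonDim D fun i : Fin D => m i.succ))
    let x' : Matrix (Fin (canonDim (D + 1) m)) (Fin (canonDim (D + 1) m)) ℂ → Matrix _ _ ℂ :=
      fun x => x.submatrix (finSumFinEquiv (m := ∑ i, m i) (n := canonDim D fun i : Fin D => m i.succ))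
        finSumFinEquiv
    have hx' : Tame x' := tame_id.submatrix _ _
    let P := fun x => aeval (x' x) (∏ i, monicPoly (r (t (x' x)) i))
    have hP : Tame P := Tame.aeval_prod_monicPoly hx' (hr.comp (ht.comp hx'))
    obtain ⟨q, hq, hqs⟩ := exists_tame_solve (F := Fin (m 0) → ℂ)
      (A := fun x => Fintype.linearCombination ℂ fun i : Fin (m 0) => x' x ^ (i : ℕ) * P x)
      (b := fun x => -(x' x ^ m 0 * P x)) (tame_hom fun v => by
        simp only [Fintype.linearCombination_apply]
        exact Tame.sum _ fun i => (tame_const _).smul ((hx'.matrixPow _).matrixMul hP))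
      ((hx'.matrixPow _).matrixMul hP).neg
    refine ⟨fun x => Fin.cons (α := fun i => Fin (m i) → ℂ) (q x) (r (t (x' x))), ?_, ?_⟩
    · refine Tame.pi fun i => ?_
      refine Fin.cases ?_ (fun i => ?_) i
      · exact hq
      · exact (hr.comp (ht.comp hx')).apply i
    intro x z hxz
    have hs : Sim x (x' x) := sim_submatrix _
    have hxp : ∀ p, aeval (x' x) p = 0 ↔ ∏ i, monicPoly (z i) ∣ p := fun p =>
      (hs.sameRank.aeval_eq_zero p).symm.trans
        ((hxz.aeval_eq_zero p).trans (aeval_canon_eq_zero _ _ _ _))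
    have h1 := hts (x' x) _ (monic_prod_monicPoly z) (natDegree_prod_monicPoly z) hxp
    have h2 : r (t (x' x)) = fun i : Fin D => z i.succ := by
      have h0 := ((h1.symm.trans hs.symm).sameRank.trans hxz).trans (sim_canon_succ z rfl rfl).symm.sameRank
      exact h _ _ (h0.of_fromBlocks fun _ => rfl)
    have key : ∀ c : Fin (m 0) → ℂ,
        Fintype.linearCombination ℂ (fun i : Fin (m 0) => x' x ^ (i : ℕ) * P x) c =
          -(x' x ^ m 0 * P x) ↔
        ∏ i, monicPoly (z i) ∣ monicPoly c * ∏ i : Fin D, monicPoly (z i.succ) := by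
      intro c
      rw [← hxp, map_mul, aeval_monicPoly]
      refine (eq_comm.trans neg_eq_iff_add_eq_zero).trans ?_
      rw [Fintype.linearCombination_apply]
      have : P x = aeval (x' x) (∏ i : Fin D, monicPoly (z i.succ)) := by
        simp only [P, h2]
      rw [this, Matrix.add_mul, Finset.sum_mul]
      simp only [smul_mul_assoc]
    have h3 := (key _).1 (hqs x ⟨z 0, (key _).2 (by rw [Fin.prod_univ_succ])⟩)
    have h4 : monicPoly (q x) = monicPoly (z 0) := by
      have h5 := eq_of_monic_of_dvd_of_natDegree_le (monic_prod_monicPoly z)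
        ((monic_monicPoly _).mul (monic_prod_monicPoly fun i => z i.succ)) h3 (by
          rw [Monic.natDegree_mul (monic_monicPoly _) (monic_prod_monicPoly fun i => z i.succ),
            natDegree_monicPoly, natDegree_prod_monicPoly, natDegree_prod_monicPoly,
            Fin.sum_univ_succ])
      rw [Fin.prod_univ_succ] at h5
      exact mul_right_cancel₀ (monic_prod_monicPoly fun i => z i.succ).ne_zero h5
    funext i
    refine Fin.cases ?_ (fun i => ?_) i
    · exact monicPoly_injective h4
    · exact congr_fun h2 i

theorem eq_of_sameRank_canon (D : ℕ) : ∀ (m m' : Fin D → ℕ) (z z'),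
    SameRank (canon D m z) (canon D m' z') → m = m' := by
  induction D with
  | zero => exact fun _ _ _ _ _ => funext fun i => i.elim0
  | succ D ih =>
    intro m m' z z' h
    have h1 : ∏ i, monicPoly (z i) = ∏ i, monicPoly (z' i) := by
      refine eq_of_monic_of_associated (monic_prod_monicPoly z) (monic_prod_monicPoly z')
        (associated_of_dvd_dvd ?_ ?_)
      · rw [← aeval_canon_eq_zero, h.aeval_eq_zero, aeval_canon_eq_zero]
      · rw [← aeval_canon_eq_zero, ← h.aeval_eq_zero, aeval_canon_eq_zero]
    have h2 : ∑ i, m i = ∑ i, m' i := by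
      rw [← natDegree_prod_monicPoly z, h1, natDegree_prod_monicPoly]
    have h3 := ih _ _ _ _ (SameRank.of_fromBlocks
      (((sim_canon_succ z h2 h1).sameRank.trans h).trans (sim_canon_succ z' rfl rfl).symm.sameRank)
      fun _ => rfl)
    funext i
    refine Fin.cases ?_ (fun i => congr_fun h3 i) i
    rw [Fin.sum_univ_succ, Fin.sum_univ_succ, Finset.sum_congr rfl fun i _ => congr_fun h3 i] at h2
    omega

theorem tame_canon (D : ℕ) (m : Fin D → ℕ) : Tame (canon D m) := by
  induction D with
  | zero => exact tame_const 0
  | succ D ih =>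
    refine Tame.submatrix (Tame.fromBlocks (Tame.matrix fun i j => ?_) (tame_const _) (tame_const _)
      ((ih _).comp (Tame.pi fun i => tame_apply i.succ))) _ _
    simp only [comp, Matrix.of_apply]
    split_ifs
    · exact (tame_coeff_prod_monicPoly _ _).neg
    · exact tame_const _
    · exact tame_const _

/-- The matrices with given degrees of the invariant factors, with their invertible centralizers. -/
def commStratum (n D : ℕ) (m : Fin D → ℕ) : Set (MatPair (Fin n)) :=
  {w | IsUnit w.1 ∧ w.1 * w.2 = w.2 * w.1 ∧ ∃ z, Sim w.2 (canon D m z)}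

theorem commStratum_spec {n D : ℕ} {m : Fin D → ℕ} (hn : canonDim D m = n) :
    Cons (commStratum n D m) ∧ mu (commStratum n D m) = motiveGL n * LL ^ ∑ i, m i := by
  subst hn
  obtain ⟨r, hr, hrs⟩ := exists_tame_canon D m
  let M := Matrix (Fin (canonDim D m)) (Fin (canonDim D m)) ℂ
  have hcr : Tame fun x : M => canon D m (r x) := (tame_canon D m).comp hr
  obtain ⟨k, hk, hks⟩ := exists_tame_isUnit_section (F := M) (F' := M)
    (A := fun x : M => LinearMap.mulLeft ℂ x - LinearMap.mulRight ℂ (canon D m (r x)))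
    (L := fun _ => LinearMap.id)
    (tame_hom fun v => (tame_id.matrixMul (tame_const _)).sub ((tame_const _).matrixMul hcr))
    (tame_const _)
  have hks' : ∀ x z, Sim x (canon D m z) →
      r x = z ∧ IsUnit (k x) ∧ x * k x = k x * canon D m z := by
    intro x z h
    have h1 := hrs x z h.sameRank
    obtain ⟨g, g', e1, e2, e3⟩ := h
    have h2 := hks x ⟨g, by simp [h1, e3], ⟨⟨g, g', e1, e2⟩, rfl⟩⟩
    refine ⟨h1, h2.2, ?_⟩
    have h3 := h2.1
    rw [h1] at h3
    exact sub_eq_zero.1 h3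
  have hsim : ∀ (x y k : M), IsUnit k → x * k = k * y → Sim x y := by
    intro x y k hk h
    have := (Matrix.isUnit_iff_isUnit_det _).1 hk
    exact ⟨k, k⁻¹, Matrix.mul_nonsing_inv _ this, Matrix.nonsing_inv_mul _ this, h⟩
  have hC : Cons (commStratum (canonDim D m) D m) := by
    have hk2 : Tame fun w : M × M => k w.2 := hk.comp tame_id.snd
    have := ((Cons.isUnit (tame_id (E := M × M)).fst).and
      (Cons.eq (tame_id.fst.matrixMul tame_id.snd) (tame_id.snd.matrixMul tame_id.fst))).and
      ((Cons.isUnit hk2).and (Cons.eq (tame_id.snd.matrixMul hk2)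
        (hk2.matrixMul (hcr.comp tame_id.snd))))
    convert this using 1
    ext w
    constructor
    · rintro ⟨h1, h2, z, h3⟩
      obtain ⟨rfl, h4⟩ := hks' _ _ h3
      exact ⟨⟨h1, h2⟩, h4⟩
    · rintro ⟨⟨h1, h2⟩, h3, h4⟩
      exact ⟨h1, h2, _, hsim _ _ _ h3 h4⟩
  refine ⟨hC, ?_⟩
  have hu : Cons {A : M | IsUnit A} := Cons.isUnit tame_id
  have hz : mu (Set.univ : Set (∀ i, Fin (m i) → ℂ)) = LL ^ ∑ i, m i := by
    rw [mu_univ, Module.finrank_pi_fintype]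
    simp
  rw [motiveGL_eq_mu, ← hz, ← mu_prod hu (by exact Cons.univ)]
  have hinv : ∀ g : M, IsUnit g → g * g⁻¹ = 1 ∧ g⁻¹ * g = 1 := fun g hg =>
    have := (Matrix.isUnit_iff_isUnit_det _).1 hg
    ⟨Matrix.mul_nonsing_inv _ this, Matrix.nonsing_inv_mul _ this⟩
  let Q : M × (∀ i, Fin (m i) → ℂ) → M := fun w => w.1 * canon D m w.2 * w.1⁻¹
  have hQ : Tame Q := (tame_id.fst.matrixMul ((tame_canon D m).comp tame_id.snd)).matrixMul
    tame_id.fst.matrixInv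
  refine mu_congr (fun w => (w.1 * k w.2, r w.2)) (fun w => (w.1 * (k (Q w))⁻¹, Q w))
    ((tame_id.fst.matrixMul (hk.comp tame_id.snd)).prodMk (hr.comp tame_id.snd))
    ((tame_id.fst.matrixMul (hk.comp hQ).matrixInv).prodMk hQ) ?_ ?_
  · rintro ⟨g, x⟩ ⟨h1, h2, z, h3⟩
    obtain ⟨e1, e2, e3⟩ := hks' _ _ h3
    obtain ⟨i1, i2⟩ := hinv _ e2
    obtain ⟨j1, j2⟩ := hinv _ h1
    dsimp only at *
    have hx : Q (g * k x, r x) = x := by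
      simp only [Q]
      rw [e1, Matrix.mul_assoc g, ← e3, ← Matrix.mul_assoc g, h2, Matrix.mul_assoc x,
        Matrix.mul_assoc x, (hinv _ (h1.mul e2)).1, Matrix.mul_one]
    refine ⟨⟨h1.mul e2, trivial⟩, Prod.ext ?_ hx⟩
    simp only [hx]
    rw [Matrix.mul_assoc, i1, Matrix.mul_one]
  · rintro ⟨g, z⟩ ⟨h1, -⟩
    obtain ⟨j1, j2⟩ := hinv _ h1
    dsimp only at *
    obtain ⟨x, hx⟩ : ∃ x, Q (g, z) = x := ⟨_, rfl⟩
    have h4 : x * g = g * canon D m z := by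
      rw [← hx]
      simp only [Q]
      rw [Matrix.mul_assoc, j2, Matrix.mul_one]
    have h3 : Sim x (canon D m z) := hsim _ _ g h1 h4
    obtain ⟨e1, e2, e3⟩ := hks' _ _ h3
    obtain ⟨i1, i2⟩ := hinv _ e2
    rw [hx]
    refine ⟨⟨h1.mul (Matrix.isUnit_nonsing_inv_iff.2 e2), ?_, z, h3⟩, Prod.ext ?_ e1⟩
    · dsimp only
      have h5 : (k x)⁻¹ * x = canon D m z * (k x)⁻¹ := by
        calc (k x)⁻¹ * x = (k x)⁻¹ * (x * k x) * (k x)⁻¹ := by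
              rw [← Matrix.mul_assoc, Matrix.mul_assoc _ (k x), i1, Matrix.mul_one]
          _ = _ := by rw [e3, ← Matrix.mul_assoc (k x)⁻¹, i2, Matrix.one_mul]
      rw [Matrix.mul_assoc, h5, ← Matrix.mul_assoc, ← h4, Matrix.mul_assoc]
    · dsimp only
      rw [Matrix.mul_assoc, i2, Matrix.mul_one]

/-- The Feit–Fine formula for commuting pairs with one invertible member. -/
theorem commMot_eq {n D : ℕ} (hD : n ≤ D) :
    commMot n = motiveGL n *
      ∑ m ∈ Fintype.piFinset (fun _ : Fin D => Finset.range (n + 1)) with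
        ∑ i : Fin D, ((i : ℕ) + 1) * m i = n, LL ^ ∑ i, m i := by
  classical
  rw [commMot, mu_eq_sum ({m ∈ Fintype.piFinset (fun _ : Fin D => Finset.range (n + 1)) |
    ∑ i : Fin D, ((i : ℕ) + 1) * m i = n}) (X := commStratum n D), Finset.mul_sum]
  · refine Finset.sum_congr rfl fun m hm => (commStratum_spec ?_).2
    rw [canonDim_eq]
    exact (Finset.mem_filter.1 hm).2
  · intro m hm
    refine (commStratum_spec ?_).1
    rw [canonDim_eq]
    exact (Finset.mem_filter.1 hm).2
  · rintro ⟨g, x⟩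
    constructor
    · rintro ⟨h1, h2⟩
      obtain ⟨m, z, h⟩ := exists_sim_canon D n hD x
      have hm : ∑ i : Fin D, ((i : ℕ) + 1) * m i = n := by
        obtain ⟨g, g', e1, e2, -⟩ := h
        have := Matrix.square_of_invertible g g' e1 e2
        simp only [Fintype.card_fin] at this
        rw [← canonDim_eq, this]
      refine ⟨m, Finset.mem_filter.2 ⟨Fintype.mem_piFinset.2 fun i => ?_, hm⟩, h1, h2, z, h⟩
      have := Finset.single_le_sum (f := fun i : Fin D => ((i : ℕ) + 1) * m i)
        (fun _ _ => Nat.zero_le _) (Finset.mem_univ i)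
      rw [hm] at this
      rw [Finset.mem_range]
      nlinarith
    · rintro ⟨m, -, h1, h2, -⟩
      exact ⟨h1, h2⟩
  · rintro m - m' - ⟨g, x⟩ ⟨-, -, z, h⟩ ⟨-, -, z', h'⟩
    exact eq_of_sameRank_canon D m m' z z' (h.symm.trans h').sameRank

end Canonical

/-! ## Sums of nilpotent strings -/

section Strings

variable {N : ℕ} {I C : Type} [Fintype I] [DecidableEq I] {p : I → ZMod N} {ℓ : I → ℕ}
  {J : Set (ZMod N)}

/-- The standard basis of a sum of strings, the `i`-th of which has `ℓ i + 1` elements. -/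
abbrev Str (ℓ : I → ℕ) : Type := (i : I) × Fin (ℓ i + 1)

/-- The degrees of the standard basis elements, when the `i`-th string starts in degree `p i`. -/
def strDeg (p : I → ZMod N) (ℓ : I → ℕ) (c : Str ℓ) : ZMod N := p c.1 + (c.2 : ℕ)

/-- The nilpotent operator that moves along the strings. -/
def shift (ℓ : I → ℕ) : Matrix (Str ℓ) (Str ℓ) ℂ :=
  Matrix.of fun c b => if c.1 = b.1 ∧ (c.2 : ℕ) = b.2 + 1 then 1 else 0

theorem isDeg_shift : IsDeg (strDeg p ℓ) (strDeg p ℓ) 1 (shift ℓ) := by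
  rintro ⟨u, y⟩ ⟨i, x⟩ h
  simp only [shift, Matrix.of_apply, ne_eq, ite_eq_right_iff, one_ne_zero, imp_false, not_not] at h
  obtain ⟨rfl, h⟩ := h
  simp only [strDeg, h]
  push_cast
  ring

theorem mul_shift_apply (M : Matrix C (Str ℓ) ℂ) (c : C) (i : I) (x : Fin (ℓ i + 1)) :
    (M * shift ℓ) c ⟨i, x⟩ =
      if h : (x : ℕ) + 1 < ℓ i + 1 then M c ⟨i, ⟨x + 1, h⟩⟩ else 0 := by
  rw [Matrix.mul_apply]
  split_ifs with h
  · rw [Finset.sum_eq_single ⟨i, ⟨x + 1, h⟩⟩]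
    · simp [shift]
    · rintro ⟨j, y⟩ - hb
      have : ¬(j = i ∧ (y : ℕ) = x + 1) := by
        rintro ⟨rfl, h'⟩
        exact hb (by congr 1; exact Fin.ext h')
      simp [shift, this]
    · simp
  · refine Finset.sum_eq_zero ?_
    rintro ⟨j, y⟩ -
    have : ¬(j = i ∧ (y : ℕ) = x + 1) := by
      rintro ⟨rfl, h'⟩
      omega
    simp [shift, this]

theorem shift_mul_apply (M : Matrix (Str ℓ) C ℂ) (u : I) (y : Fin (ℓ u + 1)) (b : C) :
    (shift ℓ * M) ⟨u, y⟩ b =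
      if h : 1 ≤ (y : ℕ) then M ⟨u, ⟨y - 1, by omega⟩⟩ b else 0 := by
  rw [Matrix.mul_apply]
  split_ifs with h
  · rw [Finset.sum_eq_single ⟨u, ⟨y - 1, by omega⟩⟩]
    · have : (y : ℕ) = y - 1 + 1 := by omega
      simp [shift, ← this]
    · rintro ⟨j, z⟩ - hb
      have : ¬(u = j ∧ (y : ℕ) = z + 1) := by
        rintro ⟨rfl, h'⟩
        exact hb (by congr 1; exact Fin.ext (by simp; omega))
      simp [shift, this]
    · simp
  · refine Finset.sum_eq_zero ?_
    rintro ⟨j, z⟩ -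
    have : ¬(u = j ∧ (y : ℕ) = z + 1) := by
      rintro ⟨rfl, h'⟩
      omega
    simp [shift, this]

theorem shift_pow_mul_apply (n : ℕ) (M : Matrix (Str ℓ) C ℂ) (u : I) (y : Fin (ℓ u + 1)) (b : C) :
    (shift ℓ ^ n * M) ⟨u, y⟩ b =
      if h : n ≤ (y : ℕ) then M ⟨u, ⟨y - n, by omega⟩⟩ b else 0 := by
  induction n generalizing y with
  | zero => simp
  | succ n ih =>
    rw [pow_succ', Matrix.mul_assoc, shift_mul_apply]
    by_cases h : n + 1 ≤ (y : ℕ)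
    · rw [dif_pos (by omega), dif_pos h, ih, dif_pos (by simp; omega)]
      simp [Nat.sub_sub, add_comm]
    · rw [dif_neg h]
      split_ifs with h'
      · rw [ih, dif_neg (by simp; omega)]
      · rfl

theorem shift_pow_eq_zero {n : ℕ} (hn : ∀ i, ℓ i < n) : shift ℓ ^ n = 0 := by
  ext ⟨u, y⟩ b
  rw [← Matrix.mul_one (shift ℓ ^ n), shift_pow_mul_apply, dif_neg]
  · rfl
  · have := hn u
    omega

theorem isNilpotent_shift : IsNilpotent (shift ℓ) :=
  ⟨∑ i, ℓ i + 1, shift_pow_eq_zero fun i =>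
    Nat.lt_succ_of_le (Finset.single_le_sum (f := ℓ) (fun _ _ => Nat.zero_le _) (Finset.mem_univ i))⟩

section jSpace

variable {B : Type} [Fintype B] {d : B → ZMod N} {H : Matrix B B ℂ}
  {y : MatPair B}

theorem mul_fst_apply_eq_zero (hy : y ∈ jSpace J d) {b : B} (hb : d b - 1 ∉ J) (c : B) :
    (H * y.1) c b = 0 := by
  rw [Matrix.mul_apply]
  refine Finset.sum_eq_zero fun e _ => ?_
  by_cases h : y.1 e b = 0
  · rw [h, mul_zero]
  · have := hy.1 e b h
    rw [this.1] at hb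
    simp [this.2] at hb

theorem fst_mul_apply_eq_zero (hH : IsDeg d d 1 H) (hy : y ∈ jSpace J d) {b : B} (hb : d b ∉ J)
    (c : B) : (y.1 * H) c b = 0 := by
  rw [Matrix.mul_apply]
  refine Finset.sum_eq_zero fun e _ => ?_
  by_cases h : y.1 c e = 0
  · rw [h, zero_mul]
  · by_cases h' : H e b = 0
    · rw [h', mul_zero]
    · have h1 := hy.1 c e h
      have h2 := hH e b h'
      rw [h2, add_left_inj] at h1
      exact absurd (h1.1 ▸ h1.2) hb

theorem snd_apply_eq_zero (hy : y ∈ jSpace J d) {b : B} (hb : d b ∈ J ∨ d b - 1 ∈ J) (c : B) :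
    y.2 c b = 0 := by
  by_contra h
  obtain ⟨h1, h2, h3⟩ := hy.2 c b h
  rw [h1] at h2 h3
  tauto

theorem rho_apply_of_sub_mem (hJ : ∀ k ∈ J, k + 1 ∉ J) (hH : IsDeg d d 1 H) (hy : y ∈ jSpace J d)
    {b : B} (hb : d b - 1 ∈ J) (c : B) : rho H y c b = (H * y.1) c b := by
  have h := hJ _ hb
  rw [sub_add_cancel] at h
  simp [rho, fst_mul_apply_eq_zero hH hy h, snd_apply_eq_zero hy (.inr hb)]

theorem rho_apply_of_mem (hJ : ∀ k ∈ J, k + 1 ∉ J) (hy : y ∈ jSpace J d)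
    {b : B} (hb : d b ∈ J) (c : B) : rho H y c b = (y.1 * H) c b := by
  have h : d b - 1 ∉ J := fun h => hJ _ h (by simpa using hb)
  simp [rho, mul_fst_apply_eq_zero hy h, snd_apply_eq_zero hy (.inl hb)]

theorem rho_apply_of_notMem (hH : IsDeg d d 1 H) (hy : y ∈ jSpace J d)
    {b : B} (hb : d b ∉ J) (hb' : d b - 1 ∉ J) (c : B) : rho H y c b = y.2 c b := by
  simp [rho, mul_fst_apply_eq_zero hy hb', fst_mul_apply_eq_zero hH hy hb]

theorem isDeg_rho (hH : IsDeg d d 1 H) (hy : y ∈ jSpace J d) : IsDeg d d 0 (rho H y) := by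
  have h1 : IsDeg d d (-1) y.1 := (mem_jSpace_iff.1 hy).1.1
  have h2 : IsDeg d d 0 y.2 := (mem_jSpace_iff.1 hy).2.1
  have h3 := hH.mul h1
  have h4 := h1.mul hH
  rw [add_neg_cancel] at h3
  rw [neg_add_cancel] at h4
  exact (h3.add h4).add h2

end jSpace

/-- The `y` that complete the sum of strings to a representation. -/
def strSpace (J : Set (ZMod N)) (p : I → ZMod N) (ℓ : I → ℕ) :
    Set (MatPair (Str ℓ)) :=
  {y | y ∈ jSpace J (strDeg p ℓ) ∧ rho (shift ℓ) y * shift ℓ = shift ℓ * rho (shift ℓ) y}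

open Classical in
/-- Whether the `i`-th string starts next to `J`. -/
def startJ (J : Set (ZMod N)) (p : I → ZMod N) (i : I) : ℕ := if p i - 1 ∈ J then 1 else 0

open Classical in
/-- Whether the `i`-th string ends in `J`. -/
def endJ (J : Set (ZMod N)) (p : I → ZMod N) (ℓ : I → ℕ) (i : I) : ℕ :=
  if p i + (ℓ i : ℕ) ∈ J then 1 else 0

/-- The coordinates on `strSpace`. -/
def StrCoord (J : Set (ZMod N)) (p : I → ZMod N) (ℓ : I → ℕ) (c : Str ℓ) (i : I) : Prop :=
  strDeg p ℓ c = p i - startJ J p i ∧ ℓ c.1 + endJ J p ℓ i < c.2 + ℓ i + 1 + startJ J p i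

open Classical in
/-- The element of `strSpace` with given coordinates. -/
def ofCoord (J : Set (ZMod N)) (p : I → ZMod N) (ℓ : I → ℕ) (W : Matrix (Str ℓ) I ℂ) :
    MatPair (Str ℓ) :=
  (Matrix.of fun c b => if strDeg p ℓ b - 1 ∈ J then
      (shift ℓ ^ ((b.2 : ℕ) + startJ J p b.1 - 1) * W) c b.1 else 0,
    Matrix.of fun c b => if strDeg p ℓ b ∉ J ∧ strDeg p ℓ b - 1 ∉ J then
      (shift ℓ ^ ((b.2 : ℕ) + startJ J p b.1) * W) c b.1 else 0)

open Classical in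
/-- The coordinates of an element of `strSpace`. -/
def toCoord (J : Set (ZMod N)) (p : I → ZMod N) (ℓ : I → ℕ)
    (y : MatPair (Str ℓ)) : Matrix (Str ℓ) I ℂ :=
  Matrix.of fun c i => if p i - 1 ∈ J then y.1 c ⟨i, 0⟩ else rho (shift ℓ) y c ⟨i, 0⟩

theorem tame_ofCoord : Tame (ofCoord J p ℓ) := by
  have h : ∀ (n : ℕ) (c : Str ℓ) (i : I), Tame fun W : Matrix (Str ℓ) I ℂ => (shift ℓ ^ n * W) c i :=
    fun n c i => ((tame_const _).matrixMul tame_id).entry c i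
  refine Tame.prodMk (Tame.matrix fun c b => ?_) (Tame.matrix fun c b => ?_)
  · by_cases hb : strDeg p ℓ b - 1 ∈ J
    · simpa [hb] using h _ _ _
    · simpa [hb] using tame_const _
  · by_cases hb : strDeg p ℓ b ∉ J ∧ strDeg p ℓ b - 1 ∉ J
    · simpa [hb] using h _ _ _
    · simpa only [Matrix.of_apply, hb, if_false] using tame_const _

theorem tame_toCoord : Tame (toCoord J p ℓ) := by
  refine Tame.matrix fun c i => ?_
  by_cases hb : p i - 1 ∈ J
  · simpa [toCoord, hb] using
      (tame_id (E := MatPair (Str ℓ))).fst.entry c ⟨i, 0⟩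
  · simpa [toCoord, hb] using (tame_rho.comp ((tame_const (shift ℓ)).prodMk tame_id)).entry c ⟨i, 0⟩

theorem startJ_of_mem {i : I} (h : p i - 1 ∈ J) : startJ J p i = 1 := if_pos h

theorem startJ_of_notMem {i : I} (h : p i - 1 ∉ J) : startJ J p i = 0 := if_neg h

theorem shift_pow_mul_deg {W : Matrix (Str ℓ) I ℂ} (hW : ∀ c i, W c i ≠ 0 → StrCoord J p ℓ c i)
    {n : ℕ} {c : Str ℓ} {i : I} (h : (shift ℓ ^ n * W) c i ≠ 0) :
    strDeg p ℓ c = p i - startJ J p i + n := by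
  obtain ⟨u, y⟩ := c
  rw [shift_pow_mul_apply] at h
  split_ifs at h with hn
  · have h1 := (hW _ _ h).1
    simp only [strDeg] at h1 ⊢
    rw [← h1, add_assoc, ← Nat.cast_add, Nat.sub_add_cancel hn]
  · exact absurd rfl h

theorem shift_pow_mul_eq_zero {W : Matrix (Str ℓ) I ℂ}
    (hW : ∀ c i, W c i ≠ 0 → StrCoord J p ℓ c i) {n : ℕ} {i : I}
    (hn : ℓ i + 1 + startJ J p i ≤ n + endJ J p ℓ i) (c : Str ℓ) : (shift ℓ ^ n * W) c i = 0 := by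
  obtain ⟨u, y⟩ := c
  rw [shift_pow_mul_apply]
  split_ifs with h
  · by_contra h0
    have h1 := (hW _ _ h0).2
    simp only at h1
    omega
  · rfl

theorem ofCoord_mem_jSpace {W : Matrix (Str ℓ) I ℂ} (hW : ∀ c i, W c i ≠ 0 → StrCoord J p ℓ c i) :
    ofCoord J p ℓ W ∈ jSpace J (strDeg p ℓ) := by
  refine ⟨?_, ?_⟩
  · rintro c ⟨i, x⟩ h
    simp only [ofCoord, Matrix.of_apply, ne_eq, ite_eq_right_iff, Classical.not_imp] at h
    obtain ⟨h1, h2⟩ := h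
    have h3 := shift_pow_mul_deg hW h2
    have h4 : strDeg p ℓ c = strDeg p ℓ ⟨i, x⟩ - 1 := by
      have : 1 ≤ (x : ℕ) + startJ J p i := by
        by_contra h0
        have hx : (x : ℕ) = 0 := by omega
        rw [strDeg] at h1
        simp only [hx, Nat.cast_zero, add_zero] at h1
        rw [startJ_of_mem h1] at h0
        omega
      rw [h3, Nat.cast_sub this, strDeg]
      push_cast
      ring
    rw [h4]
    exact ⟨by ring, h1⟩
  · rintro c ⟨i, x⟩ h
    simp only [ofCoord, Matrix.of_apply, ne_eq, ite_eq_right_iff, Classical.not_imp] at h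
    obtain ⟨h1, h2⟩ := h
    have h3 := shift_pow_mul_deg hW h2
    have h4 : strDeg p ℓ c = strDeg p ℓ ⟨i, x⟩ := by
      rw [h3, strDeg]
      push_cast
      ring
    exact ⟨h4, h4 ▸ h1⟩

theorem rho_ofCoord (hJ : ∀ k ∈ J, k + 1 ∉ J) {W : Matrix (Str ℓ) I ℂ}
    (hW : ∀ c i, W c i ≠ 0 → StrCoord J p ℓ c i) (c : Str ℓ) (i : I) (x : Fin (ℓ i + 1)) :
    rho (shift ℓ) (ofCoord J p ℓ W) c ⟨i, x⟩ = (shift ℓ ^ ((x : ℕ) + startJ J p i) * W) c i := by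
  have hy := ofCoord_mem_jSpace hW
  by_cases h1 : strDeg p ℓ ⟨i, x⟩ - 1 ∈ J
  · have hpos : 1 ≤ (x : ℕ) + startJ J p i := by
      by_contra h0
      have hx : (x : ℕ) = 0 := by omega
      rw [strDeg] at h1
      simp only [hx, Nat.cast_zero, add_zero] at h1
      rw [startJ_of_mem h1] at h0
      omega
    rw [rho_apply_of_sub_mem hJ isDeg_shift hy h1]
    have h2 : ∀ e, (ofCoord J p ℓ W).1 e ⟨i, x⟩ =
        (shift ℓ ^ ((x : ℕ) + startJ J p i - 1) * W) e i := fun e => if_pos h1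
    rw [← Nat.sub_add_cancel hpos, pow_succ', Matrix.mul_assoc, Matrix.mul_apply, Matrix.mul_apply]
    simp only [h2]
  · by_cases h2 : strDeg p ℓ ⟨i, x⟩ ∈ J
    · rw [rho_apply_of_mem hJ hy h2, mul_shift_apply]
      split_ifs with h3
      · have h4 : strDeg p ℓ ⟨i, ⟨x + 1, h3⟩⟩ - 1 ∈ J := by
          convert h2 using 1
          simp only [strDeg]
          push_cast
          ring
        refine (if_pos h4).trans ?_
        change (shift ℓ ^ ((x : ℕ) + 1 + startJ J p i - 1) * W) c i = _
        rw [add_right_comm, Nat.add_sub_cancel]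
      · have hx : (x : ℕ) = ℓ i := by omega
        rw [shift_pow_mul_eq_zero hW]
        have : endJ J p ℓ i = 1 := if_pos (by rw [← hx]; exact h2)
        omega
    · rw [rho_apply_of_notMem isDeg_shift hy h2 h1]
      exact if_pos ⟨h2, h1⟩

theorem rho_eq_shift_pow (hJ : ∀ k ∈ J, k + 1 ∉ J)
    {y : MatPair (Str ℓ)} (hy : y ∈ strSpace J p ℓ) (c : Str ℓ)
    (i : I) (x : ℕ) (hx : x < ℓ i + 1) : rho (shift ℓ) y c ⟨i, ⟨x, hx⟩⟩ =
      (shift ℓ ^ (x + startJ J p i) * toCoord J p ℓ y) c i := by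
  induction x generalizing c with
  | zero =>
    have h0 : (⟨0, hx⟩ : Fin (ℓ i + 1)) = 0 := rfl
    by_cases h : p i - 1 ∈ J
    · have h1 : strDeg p ℓ ⟨i, 0⟩ - 1 ∈ J := by simpa [strDeg] using h
      rw [h0, rho_apply_of_sub_mem hJ isDeg_shift hy.1 h1, startJ_of_mem h, zero_add, pow_one,
        Matrix.mul_apply, Matrix.mul_apply]
      simp only [toCoord, Matrix.of_apply, h, if_true]
    · rw [startJ_of_notMem h, h0]
      simp [toCoord, h]
  | succ x ih =>
    have h1 := congr_fun (congr_fun hy.2 c) ⟨i, ⟨x, by omega⟩⟩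
    rw [mul_shift_apply, dif_pos hx] at h1
    rw [h1, add_right_comm, pow_succ', Matrix.mul_assoc, Matrix.mul_apply, Matrix.mul_apply]
    refine Finset.sum_congr rfl fun e _ => ?_
    rw [ih]

theorem toCoord_spec (hJ : ∀ k ∈ J, k + 1 ∉ J)
    {y : MatPair (Str ℓ)} (hy : y ∈ strSpace J p ℓ)
    (c : Str ℓ) (i : I) (h : toCoord J p ℓ y c i ≠ 0) : StrCoord J p ℓ c i := by
  have hd := isDeg_rho isDeg_shift hy.1
  refine ⟨?_, ?_⟩
  · by_cases hi : p i - 1 ∈ J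
    · simp only [toCoord, Matrix.of_apply, hi, if_true] at h
      have := (hy.1.1 _ _ h).1
      rw [startJ_of_mem hi]
      simp [strDeg] at this ⊢
      rw [this]
      ring
    · simp only [toCoord, Matrix.of_apply, hi, if_false] at h
      have := hd _ _ h
      rw [startJ_of_notMem hi]
      simpa [strDeg] using this
  · have key : ∀ c, (shift ℓ ^ (ℓ i + 1 + startJ J p i - endJ J p ℓ i) * toCoord J p ℓ y) c i = 0 := by
      intro c
      have hl : ℓ i < ℓ i + 1 := Nat.lt_succ_self _
      have h1 := congr_fun (congr_fun hy.2 c) ⟨i, ⟨ℓ i, hl⟩⟩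
      rw [mul_shift_apply, dif_neg (by simp)] at h1
      by_cases hq : p i + (ℓ i : ℕ) ∈ J
      · have h2 : endJ J p ℓ i = 1 := if_pos hq
        have h3 : strDeg p ℓ ⟨i, ⟨ℓ i, hl⟩⟩ ∈ J := hq
        have h4 := rho_apply_of_mem (H := shift ℓ) hJ hy.1 h3 c
        rw [mul_shift_apply, dif_neg (by simp), rho_eq_shift_pow hJ hy] at h4
        rw [h2, ← h4, add_right_comm, Nat.add_sub_cancel]
      · have h2 : endJ J p ℓ i = 0 := if_neg hq
        rw [h2, Nat.sub_zero, add_right_comm, pow_succ', Matrix.mul_assoc, h1, Matrix.mul_apply,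
          Matrix.mul_apply]
        refine Finset.sum_congr rfl fun e _ => ?_
        rw [rho_eq_shift_pow hJ hy]
    by_contra hlt
    obtain ⟨u, z⟩ := c
    simp only at hlt
    have hb : endJ J p ℓ i ≤ 1 := by
      unfold endJ
      split_ifs <;> omega
    have h1 := key ⟨u, ⟨z + (ℓ i + 1 + startJ J p i - endJ J p ℓ i), by omega⟩⟩
    rw [shift_pow_mul_apply, dif_pos (by simp)] at h1
    simp only [Nat.add_sub_cancel] at h1
    exact h h1

theorem ofCoord_toCoord (hJ : ∀ k ∈ J, k + 1 ∉ J)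
    {y : MatPair (Str ℓ)} (hy : y ∈ strSpace J p ℓ) :
    ofCoord J p ℓ (toCoord J p ℓ y) = y := by
  have hr := rho_eq_shift_pow hJ hy
  refine Prod.ext ?_ ?_
  · ext c ⟨i, x⟩
    by_cases h : strDeg p ℓ ⟨i, x⟩ - 1 ∈ J
    · refine (if_pos h).trans ?_
      dsimp only
      obtain ⟨x, hx⟩ := x
      rcases x with _ | x
      · have hi : p i - 1 ∈ J := by simpa [strDeg] using h
        rw [startJ_of_mem hi]
        simp only [zero_add, Nat.sub_self, pow_zero, Matrix.one_mul]
        exact if_pos hi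
      · have h1 : strDeg p ℓ ⟨i, ⟨x, by omega⟩⟩ ∈ J := by
          convert h using 1
          simp only [strDeg]
          push_cast
          ring
        have h2 := rho_apply_of_mem (H := shift ℓ) hJ hy.1 h1 c
        rw [mul_shift_apply, dif_pos hx, hr] at h2
        rw [← h2]
        change (shift ℓ ^ (x + 1 + startJ J p i - 1) * toCoord J p ℓ y) c i = _
        rw [add_right_comm, Nat.add_sub_cancel]
    · refine (if_neg h).trans ?_
      by_contra h0
      have := hy.1.1 _ _ (Ne.symm h0)
      rw [this.1] at h
      simp [this.2] at h
  · ext c ⟨i, x⟩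
    by_cases h : strDeg p ℓ ⟨i, x⟩ ∉ J ∧ strDeg p ℓ ⟨i, x⟩ - 1 ∉ J
    · refine (if_pos h).trans ?_
      rw [← rho_apply_of_notMem isDeg_shift hy.1 h.1 h.2, ← hr]
    · refine (if_neg h).trans ?_
      rw [snd_apply_eq_zero hy.1]
      tauto

theorem ofCoord_mem (hJ : ∀ k ∈ J, k + 1 ∉ J) {W : Matrix (Str ℓ) I ℂ}
    (hW : ∀ c i, W c i ≠ 0 → StrCoord J p ℓ c i) :
    ofCoord J p ℓ W ∈ strSpace J p ℓ ∧ toCoord J p ℓ (ofCoord J p ℓ W) = W := by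
  have hr := rho_ofCoord hJ hW
  refine ⟨⟨ofCoord_mem_jSpace hW, ?_⟩, ?_⟩
  · ext c ⟨i, x⟩
    have h1 : (shift ℓ * rho (shift ℓ) (ofCoord J p ℓ W)) c ⟨i, x⟩ =
        (shift ℓ ^ ((x : ℕ) + 1 + startJ J p i) * W) c i := by
      rw [add_right_comm, pow_succ', Matrix.mul_assoc, Matrix.mul_apply, Matrix.mul_apply]
      simp only [hr]
    rw [h1, mul_shift_apply]
    split_ifs with h
    · rw [hr]
    · rw [shift_pow_mul_eq_zero hW]
      omega
  · ext c i
    by_cases h : p i - 1 ∈ J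
    · refine (if_pos h).trans ?_
      have h1 : strDeg p ℓ ⟨i, 0⟩ - 1 ∈ J := by simpa [strDeg] using h
      refine (if_pos h1).trans ?_
      change (shift ℓ ^ (0 + startJ J p i - 1) * W) c i = W c i
      rw [startJ_of_mem h, pow_zero, Matrix.one_mul]
    · refine (if_neg h).trans ?_
      rw [hr, startJ_of_notMem h, Fin.val_zero, add_zero, pow_zero, Matrix.one_mul]

theorem cons_strSpace : Cons (strSpace J p ℓ) := by
  have h : Tame fun y : MatPair (Str ℓ) => rho (shift ℓ) y :=
    Tame.comp (g := fun z : Matrix (Str ℓ) (Str ℓ) ℂ × _ => rho z.1 z.2)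
      (f := fun y => (shift ℓ, y)) tame_rho ((tame_const (shift ℓ)).prodMk tame_id)
  exact (cons_jSpace J _).and (Cons.eq (h.matrixMul (tame_const _)) ((tame_const _).matrixMul h))

open Classical in
theorem cons_support {B C : Type} [Fintype B] [Fintype C] (P : B → C → Prop) :
    Cons {W : Matrix B C ℂ | ∀ b c, W b c ≠ 0 → P b c} := by
  refine Cons.forall fun b => Cons.forall fun c => ?_
  by_cases h : P b c
  · simpa [h] using Cons.univ
  · simpa [h] using Cons.eq_zero (tame_id.entry b c)

open Classical in
theorem mu_support {B C : Type} [Fintype B] [Fintype C] (P : B → C → Prop) :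
    mu {W : Matrix B C ℂ | ∀ b c, W b c ≠ 0 → P b c} =
      LL ^ Fintype.card {z : B × C // P z.1 z.2} := by
  rw [← mu_univ_fun]
  refine mu_congr (fun W z => W z.1.1 z.1.2)
    (fun v => Matrix.of fun b c => if h : P b c then v ⟨(b, c), h⟩ else 0)
    (Tame.pi fun z => tame_id.entry _ _) (Tame.matrix fun b c => ?_) ?_ ?_
  · by_cases h : P b c
    · simpa [h] using tame_apply _
    · simpa [h] using tame_const _
  · intro W hW
    refine ⟨trivial, ?_⟩
    ext b c
    by_cases h : P b c
    · simp [h]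
    · simp only [Matrix.of_apply, h, dif_neg, not_false_eq_true]
      by_contra h0
      exact h (hW b c (Ne.symm h0))
  · intro v _
    refine ⟨fun b c h => ?_, ?_⟩
    · by_contra h0
      simp [h0] at h
    · funext z
      simp [z.2]

open Classical in
theorem mu_strSpace (hJ : ∀ k ∈ J, k + 1 ∉ J) : mu (strSpace J p ℓ) =
    LL ^ Fintype.card {z : Str ℓ × I // StrCoord J p ℓ z.1 z.2} := by
  rw [← mu_support]
  refine mu_congr (toCoord J p ℓ) (ofCoord J p ℓ) tame_toCoord tame_ofCoord ?_ ?_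
  · exact fun y hy => ⟨toCoord_spec hJ hy, ofCoord_toCoord hJ hy⟩
  · exact fun W hW => ofCoord_mem hJ hW

end Strings

/-! ## Automorphisms of sums of strings -/

section Automorphisms

variable {N : ℕ} {I : Type} [Fintype I] [DecidableEq I] {p : I → ZMod N} {ℓ : I → ℕ}

/-- The graded automorphisms of a sum of strings. -/
def strAut (p : I → ZMod N) (ℓ : I → ℕ) : Set (Matrix (Str ℓ) (Str ℓ) ℂ) :=
  {g | g ∈ gradedUnits (strDeg p ℓ) ∧ g * shift ℓ = shift ℓ * g}

theorem cons_strAut : Cons (strAut p ℓ) :=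
  cons_gradedUnits.and (Cons.eq (tame_id.matrixMul (tame_const _))
    ((tame_const _).matrixMul tame_id))

/-- The endomorphism of the space of generators modulo the image of the shift. -/
def topBlock (g : Matrix (Str ℓ) (Str ℓ) ℂ) : Matrix I I ℂ :=
  Matrix.of fun u i => g ⟨u, 0⟩ ⟨i, 0⟩

theorem mem_strSpace_empty {g : Matrix (Str ℓ) (Str ℓ) ℂ} (hg : IsDeg (strDeg p ℓ) (strDeg p ℓ) 0 g)
    (hs : g * shift ℓ = shift ℓ * g) : (0, g) ∈ strSpace ∅ p ℓ := by
  refine ⟨⟨by simp, fun c b h => ⟨by simpa using hg c b h, by simp, by simp⟩⟩, ?_⟩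
  simpa [rho] using hs

theorem toCoord_empty (g : Matrix (Str ℓ) (Str ℓ) ℂ) :
    toCoord ∅ p ℓ (0, g) = Matrix.of fun c i => g c ⟨i, 0⟩ := by
  ext c i
  refine (if_neg (by simp)).trans ?_
  simp [rho]

theorem apply_eq_shift_pow {g : Matrix (Str ℓ) (Str ℓ) ℂ} (hg : IsDeg (strDeg p ℓ) (strDeg p ℓ) 0 g)
    (hs : g * shift ℓ = shift ℓ * g) (c : Str ℓ) (i : I) (x : Fin (ℓ i + 1)) :
    g c ⟨i, x⟩ = (shift ℓ ^ (x : ℕ) * Matrix.of fun c i => g c ⟨i, 0⟩) c i := by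
  have h := rho_eq_shift_pow (by simp) (mem_strSpace_empty hg hs) c i x x.2
  have h1 : rho (shift ℓ) (0, g) = g := by simp [rho]
  have h2 : startJ ∅ p i = 0 := startJ_of_notMem (by simp)
  rwa [h1, h2, toCoord_empty] at h

theorem topBlock_mul {g h : Matrix (Str ℓ) (Str ℓ) ℂ} (hg : IsDeg (strDeg p ℓ) (strDeg p ℓ) 0 g)
    (hs : g * shift ℓ = shift ℓ * g) : topBlock (g * h) = topBlock g * topBlock h := by
  ext u i
  simp only [topBlock, Matrix.of_apply, Matrix.mul_apply, Fintype.sum_sigma]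
  refine Finset.sum_congr rfl fun k _ => ?_
  rw [Finset.sum_eq_single 0]
  · intro x _ hx
    rw [apply_eq_shift_pow hg hs, shift_pow_mul_apply, dif_neg, zero_mul]
    have : (x : ℕ) ≠ 0 := fun h => hx (Fin.ext h)
    simp only [Fin.val_zero]
    omega
  · simp

theorem isUnit_of_topBlock {g : Matrix (Str ℓ) (Str ℓ) ℂ} (hs : g * shift ℓ = shift ℓ * g)
    (h : IsUnit (topBlock g)) : IsUnit g := by
  have h1 : ∀ w : Str ℓ → ℂ, ∃ c u, w = g.mulVec c + (shift ℓ).mulVec u := by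
    intro w
    obtain ⟨A, hA⟩ := h.exists_right_inv
    let a : I → ℂ := A.mulVec fun i => w ⟨i, 0⟩
    have ha : (topBlock g).mulVec a = fun i => w ⟨i, 0⟩ := by
      rw [Matrix.mulVec_mulVec, hA, Matrix.one_mulVec]
    let c : Str ℓ → ℂ := fun b => if b.2 = 0 then a b.1 else 0
    have hc : ∀ u, (g.mulVec c) ⟨u, 0⟩ = w ⟨u, 0⟩ := by
      intro u
      have := congr_fun ha u
      rw [← this]
      change ∑ b : Str ℓ, g ⟨u, 0⟩ b * c b = ∑ i, g ⟨u, 0⟩ ⟨i, 0⟩ * a i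
      rw [Fintype.sum_sigma]
      refine Finset.sum_congr rfl fun i _ => ?_
      rw [Finset.sum_eq_single 0]
      · simp [c]
      · intro x _ hx
        simp [c, hx]
      · simp
    let u : Str ℓ → ℂ := fun b => if h : (b.2 : ℕ) + 1 < ℓ b.1 + 1 then
      (w - g.mulVec c) ⟨b.1, ⟨b.2 + 1, h⟩⟩ else 0
    refine ⟨c, u, ?_⟩
    rw [← sub_eq_iff_eq_add']
    funext ⟨i, x⟩
    have h2 := shift_mul_apply (Matrix.of fun b (_ : Unit) => u b) i x ()
    have h3 : ((shift ℓ).mulVec u) ⟨i, x⟩ = (shift ℓ * Matrix.of fun b (_ : Unit) => u b) ⟨i, x⟩ () :=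
      rfl
    rw [h3, h2]
    split_ifs with h4
    · have h5 : (x : ℕ) - 1 + 1 = x := by omega
      have h6 : (x : ℕ) - 1 + 1 < ℓ i + 1 := by omega
      simp only [Matrix.of_apply, u, h6, dif_pos]
      simp only [h5]
    · have : x = 0 := Fin.ext (by rw [Fin.val_zero]; omega)
      subst this
      rw [Pi.sub_apply, hc, sub_self]
  have h2 : ∀ n, ∀ w : Str ℓ → ℂ, ∃ c u, w = g.mulVec c + (shift ℓ ^ n).mulVec u := by
    intro n
    induction n with
    | zero => exact fun w => ⟨0, w, by simp⟩
    | succ n ih =>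
      intro w
      obtain ⟨c, u, rfl⟩ := ih w
      obtain ⟨c', u', rfl⟩ := h1 u
      have h3 : shift ℓ ^ n * g = g * shift ℓ ^ n :=
        ((show Commute g (shift ℓ) from hs).pow_right n).eq.symm
      refine ⟨c + (shift ℓ ^ n).mulVec c', u', ?_⟩
      rw [Matrix.mulVec_add, Matrix.mulVec_add, Matrix.mulVec_mulVec, Matrix.mulVec_mulVec,
        Matrix.mulVec_mulVec, h3, pow_succ, add_assoc]
  obtain ⟨n, hn⟩ := isNilpotent_shift (ℓ := ℓ)
  obtain ⟨Y, hY⟩ := exists_mul_eq_one_of_surjective (g := g) fun w => by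
    obtain ⟨c, u, h3⟩ := h2 n w
    rw [hn, Matrix.zero_mulVec, add_zero] at h3
    exact ⟨c, h3.symm⟩
  exact IsUnit.of_mul_eq_one _ hY

theorem isUnit_topBlock_iff {g : Matrix (Str ℓ) (Str ℓ) ℂ}
    (hg : IsDeg (strDeg p ℓ) (strDeg p ℓ) 0 g) (hs : g * shift ℓ = shift ℓ * g) :
    IsUnit (topBlock g) ↔ IsUnit g := by
  refine ⟨isUnit_of_topBlock hs, fun h => ?_⟩
  obtain ⟨h', hh⟩ := h.exists_right_inv
  refine IsUnit.of_mul_eq_one (topBlock h') ?_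
  rw [← topBlock_mul hg hs, hh]
  ext u i
  by_cases hui : u = i
  · subst hui
    simp [topBlock]
  · have : (⟨u, 0⟩ : Str ℓ) ≠ ⟨i, 0⟩ := fun h => hui (congr_arg Sigma.fst h)
    simp [topBlock, Matrix.one_apply, hui]

end Automorphisms

section Types

variable {N : ℕ} {D : ℕ} {m : ZMod N × Fin D → ℕ}

/-- The index set of a sum of strings with `m t` strings of the type `t`; the types are given by
the first degree and by the length. -/
abbrev StrIdx (m : ZMod N × Fin D → ℕ) : Type := (t : ZMod N × Fin D) × Fin (m t)

/-- The first degree of a string. -/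
def spos (m : ZMod N × Fin D → ℕ) (i : StrIdx m) : ZMod N := i.1.1

/-- The length of a string, decreased by one. -/
def slen (m : ZMod N × Fin D → ℕ) (i : StrIdx m) : ℕ := i.1.2

variable [NeZero N]

theorem isUnit_iff_blocks {A : Matrix (StrIdx m) (StrIdx m) ℂ}
    (hA : ∀ u i, A u i ≠ 0 → spos m u = spos m i ∧ slen m u ≤ slen m i) :
    IsUnit A ↔ ∀ t, IsUnit (A.submatrix (Sigma.mk t) (Sigma.mk t)) := by
  let key : ZMod N × Fin D → ℕ ×ₗ ℕ := fun t => toLex ((t.2 : ℕ), t.1.val)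
  have hkey : Function.Injective key := by
    rintro ⟨k, x⟩ ⟨k', x'⟩ h
    have h1 := congr_arg (fun z => (ofLex z).1) h
    have h2 := congr_arg (fun z => (ofLex z).2) h
    exact Prod.ext (ZMod.val_injective N h2) (Fin.ext h1)
  let _ : LinearOrder (ZMod N × Fin D) := LinearOrder.lift' key hkey
  have htri : A.BlockTriangular Sigma.fst := by
    intro u i hlt
    by_contra h0
    obtain ⟨h1, h2⟩ := hA u i h0
    have h3 : key i.1 < key u.1 := hlt
    rw [Prod.Lex.lt_iff] at h3
    simp only [spos, slen] at h1 h2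
    simp only [key, ofLex_toLex, h1, lt_self_iff_false, and_false, or_false] at h3
    omega
  have hdet : A.det = ∏ t, (A.submatrix (Sigma.mk t) (Sigma.mk t)).det := by
    rw [htri.det]
    have h1 : ∀ t, (A.toSquareBlock Sigma.fst t).det = (A.submatrix (Sigma.mk t) (Sigma.mk t)).det := by
      intro t
      rw [← Matrix.det_submatrix_equiv_self (Equiv.sigmaSubtype t).symm]
      rfl
    simp only [h1]
    refine Finset.prod_subset (Finset.subset_univ _) fun t _ ht => ?_
    have : IsEmpty (Fin (m t)) := ⟨fun a => ht (Finset.mem_image.2 ⟨⟨t, a⟩, Finset.mem_univ _, rfl⟩)⟩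
    exact Matrix.det_isEmpty
  rw [Matrix.isUnit_iff_isUnit_det, hdet, IsUnit.prod_univ_iff]
  exact forall_congr' fun t => (Matrix.isUnit_iff_isUnit_det _).symm

/-- The coordinates on the radical of the endomorphism algebra. -/
def RadCoord (m : ZMod N × Fin D → ℕ) (c : Str (slen m)) (i : StrIdx m) : Prop :=
  StrCoord ∅ (spos m) (slen m) c i ∧ ¬(c.2 = 0 ∧ c.1.1 = i.1)

theorem strCoord_empty {c : Str (slen m)} {i : StrIdx m} : StrCoord ∅ (spos m) (slen m) c i ↔
    strDeg (spos m) (slen m) c = spos m i ∧ slen m c.1 ≤ c.2 + slen m i := by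
  have h1 : startJ ∅ (spos m) i = 0 := startJ_of_notMem (by simp)
  have h2 : endJ ∅ (spos m) (slen m) i = 0 := if_neg (by simp)
  rw [StrCoord, h1, h2]
  simp only [Nat.cast_zero, sub_zero, add_zero, Order.lt_add_one_iff]

open Classical in
theorem card_strCoord_empty (m : ZMod N × Fin D → ℕ) :
    Fintype.card {z : Str (slen m) × StrIdx m // StrCoord ∅ (spos m) (slen m) z.1 z.2} =
      Fintype.card {z : Str (slen m) × StrIdx m // RadCoord m z.1 z.2} + ∑ t, m t ^ 2 := by
  have h : Fintype.card {z : Str (slen m) × StrIdx m //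
      StrCoord ∅ (spos m) (slen m) z.1 z.2 ∧ (z.1.2 = 0 ∧ z.1.1.1 = z.2.1)} = ∑ t, m t ^ 2 := by
    have h1 : ∑ t, m t ^ 2 = Fintype.card ((t : ZMod N × Fin D) × Fin (m t) × Fin (m t)) := by
      simp [pow_two]
    rw [h1]
    have h2 : ∀ x : (t : ZMod N × Fin D) × Fin (m t) × Fin (m t),
        StrCoord ∅ (spos m) (slen m) ⟨⟨x.1, x.2.1⟩, 0⟩ ⟨x.1, x.2.2⟩ := by
      intro x
      rw [strCoord_empty]
      simp [strDeg, spos, slen]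
    refine (Fintype.card_congr (Equiv.ofBijective
      (fun x => ⟨(⟨⟨x.1, x.2.1⟩, 0⟩, ⟨x.1, x.2.2⟩), h2 x, rfl, rfl⟩) ⟨?_, ?_⟩)).symm
    · rintro ⟨t, a, b⟩ ⟨t', a', b'⟩ h
      simp only [Subtype.mk.injEq, Prod.mk.injEq] at h
      obtain ⟨h1, h2⟩ := h
      cases h2
      cases h1
      rfl
    · rintro ⟨⟨⟨⟨t, a⟩, y⟩, ⟨t', b⟩⟩, -, h1, h2⟩
      dsimp only at h1 h2
      subst h2
      obtain rfl : y = (0 : Fin (slen m ⟨t, a⟩ + 1)) := h1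
      exact ⟨⟨t, a, b⟩, rfl⟩
  rw [← h, Fintype.card_subtype, Fintype.card_subtype, Fintype.card_subtype, add_comm,
    ← Finset.filter_filter, ← Finset.card_filter_add_card_filter_not
      (fun z : Str (slen m) × StrIdx m => z.1.2 = 0 ∧ z.1.1.1 = z.2.1), add_right_inj,
    Finset.filter_filter]
  congr 1
  refine Finset.filter_congr fun z _ => Iff.rfl

open Classical in
theorem mu_strAut (m : ZMod N × Fin D → ℕ) : mu (strAut (spos m) (slen m)) =
    (∏ t, motiveGL (m t)) * LL ^ Fintype.card {z : Str (slen m) × StrIdx m // RadCoord m z.1 z.2} := by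
  have hu : ∀ t, Cons {A : Matrix (Fin (m t)) (Fin (m t)) ℂ | IsUnit A} := fun t => Cons.isUnit tame_id
  have hpi := mu_pi (ι := ZMod N × Fin D) (V := fun t => Matrix (Fin (m t)) (Fin (m t)) ℂ)
    (X := fun t => {A | IsUnit A}) hu
  rw [finprod_eq_prod_of_fintype] at hpi
  simp only [motiveGL_eq_mu]
  rw [← hpi, ← mu_support, ← mu_prod (Cons.pi hu) (cons_support _)]
  let toW : (∀ t, Matrix (Fin (m t)) (Fin (m t)) ℂ) × Matrix (Str (slen m)) (StrIdx m) ℂ →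
      Matrix (Str (slen m)) (StrIdx m) ℂ := fun x =>
    Matrix.of fun c i => (if c.2 = 0 then Matrix.blockDiagonal' x.1 c.1 i else 0) + x.2 c i
  have htoW : Tame toW := by
    refine Tame.matrix fun c i => Tame.add ?_ (tame_id.snd.entry c i)
    by_cases hc : c.2 = 0
    · simp only [hc, if_true, Matrix.blockDiagonal'_apply]
      by_cases h : c.1.1 = i.1
      · simp only [h, dif_pos]
        exact (tame_id.fst.apply c.1.1).entry _ _
      · simp only [h, dif_neg, not_false_eq_true]
        exact tame_const _
    · simpa only [hc, if_false] using tame_const _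
  refine mu_congr (fun g => (fun t => Matrix.of fun a b => g ⟨⟨t, a⟩, 0⟩ ⟨⟨t, b⟩, 0⟩,
      Matrix.of fun c i => if RadCoord m c i then g c ⟨i, 0⟩ else 0))
    (fun x => (ofCoord ∅ (spos m) (slen m) (toW x)).2) ?_ (tame_ofCoord.comp htoW).snd ?_ ?_
  · refine Tame.prodMk (Tame.pi fun t => Tame.matrix fun a b => tame_id.entry _ _)
      (Tame.matrix fun c i => ?_)
    by_cases h : RadCoord m c i
    · simpa [h] using tame_id.entry _ _
    · simpa [h] using tame_const _
  · rintro g ⟨⟨hg, hgu⟩, hs⟩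
    have hmem := mem_strSpace_empty hg hs
    have hcoord : ∀ c i, g c ⟨i, 0⟩ ≠ 0 → StrCoord ∅ (spos m) (slen m) c i := by
      intro c i h
      refine toCoord_spec (by simp) hmem c i ?_
      rwa [toCoord_empty]
    refine ⟨⟨?_, ?_⟩, ?_⟩
    · refine (isUnit_iff_blocks (A := topBlock g) ?_).1 ((isUnit_topBlock_iff hg hs).2 hgu)
      intro u i h
      have h1 := strCoord_empty.1 (hcoord _ _ h)
      simpa [strDeg] using h1
    · intro c i h
      by_contra h0
      simp [h0] at h
    · have hW : toW (fun t => Matrix.of fun a b => g ⟨⟨t, a⟩, 0⟩ ⟨⟨t, b⟩, 0⟩,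
          Matrix.of fun c i => if RadCoord m c i then g c ⟨i, 0⟩ else 0) =
          toCoord ∅ (spos m) (slen m) (0, g) := by
        rw [toCoord_empty]
        ext ⟨⟨t, a⟩, y⟩ ⟨t', b⟩
        simp only [toW, Matrix.of_apply]
        by_cases h1 : y = 0 ∧ t = t'
        · obtain ⟨rfl, rfl⟩ := h1
          have : ¬RadCoord m ⟨⟨t, a⟩, 0⟩ ⟨t, b⟩ := fun h => h.2 ⟨rfl, rfl⟩
          simp [this, Matrix.blockDiagonal'_apply]
        · have h2 : (if y = 0 then Matrix.blockDiagonal' (fun t => Matrix.of fun a b =>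
              g ⟨⟨t, a⟩, 0⟩ ⟨⟨t, b⟩, 0⟩) ⟨t, a⟩ ⟨t', b⟩ else 0) = 0 := by
            split_ifs with h3
            · rw [Matrix.blockDiagonal'_apply, dif_neg]
              exact fun h4 => h1 ⟨h3, h4⟩
            · rfl
          rw [h2, zero_add]
          split_ifs with h3
          · rfl
          · by_contra h4
            exact h3 ⟨hcoord _ _ (Ne.symm h4), h1⟩
      rw [hW, ofCoord_toCoord (by simp) hmem]
  · rintro ⟨x, r⟩ ⟨hx, hr⟩
    have hW : ∀ c i, toW (x, r) c i ≠ 0 → StrCoord ∅ (spos m) (slen m) c i := by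
      rintro ⟨⟨t, a⟩, y⟩ ⟨t', b⟩ h
      simp only [toW, Matrix.of_apply] at h
      by_cases h1 : y = 0 ∧ t = t'
      · obtain ⟨rfl, rfl⟩ := h1
        rw [strCoord_empty]
        simp [strDeg, spos, slen]
      · have h2 : (if y = 0 then Matrix.blockDiagonal' x ⟨t, a⟩ ⟨t', b⟩ else 0) = 0 := by
          split_ifs with h3
          · rw [Matrix.blockDiagonal'_apply, dif_neg]
            exact fun h4 => h1 ⟨h3, h4⟩
          · rfl
        rw [h2, zero_add] at h
        exact (hr _ _ h).1
    obtain ⟨h1, h2⟩ := ofCoord_mem (p := spos m) (ℓ := slen m) (by simp) hW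
    obtain ⟨g, hg⟩ : ∃ g, ofCoord ∅ (spos m) (slen m) (toW (x, r)) = (0, g) := by
      refine ⟨(ofCoord ∅ (spos m) (slen m) (toW (x, r))).2, Prod.ext ?_ rfl⟩
      ext c b
      by_contra h0
      exact (h1.1.1 c b h0).2
    rw [hg] at h1 h2
    rw [toCoord_empty] at h2
    have hgW : ∀ c i, g c ⟨i, 0⟩ = toW (x, r) c i := fun c i => congr_fun (congr_fun h2 c) i
    have hgd : IsDeg (strDeg (spos m) (slen m)) (strDeg (spos m) (slen m)) 0 g :=
      fun c b h => by simpa using (h1.1.2 c b h).1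
    have hgs : g * shift (slen m) = shift (slen m) * g := by simpa [rho] using h1.2
    have hblock : ∀ t a b, g ⟨⟨t, a⟩, 0⟩ ⟨⟨t, b⟩, 0⟩ = x t a b := by
      intro t a b
      have h3 : r ⟨⟨t, a⟩, 0⟩ ⟨t, b⟩ = 0 := by
        by_contra h0
        exact (hr _ _ h0).2 ⟨rfl, rfl⟩
      rw [hgW]
      simp [toW, h3, Matrix.blockDiagonal'_apply]
    have hg2 : (ofCoord ∅ (spos m) (slen m) (toW (x, r))).2 = g := by rw [hg]
    rw [hg2]
    refine ⟨⟨⟨hgd, (isUnit_topBlock_iff hgd hgs).1 ((isUnit_iff_blocks ?_).2 fun t => ?_)⟩, hgs⟩,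
      Prod.ext ?_ ?_⟩
    · intro u i h
      have h3 : toW (x, r) ⟨u, 0⟩ i ≠ 0 := by rwa [← hgW]
      have h4 := strCoord_empty.1 (hW _ _ h3)
      simpa [strDeg] using h4
    · have h3 : (topBlock g).submatrix (Sigma.mk t) (Sigma.mk t) = x t := by
        ext a b
        exact hblock t a b
      rw [h3]
      exact hx t
    · funext t
      ext a b
      exact hblock t a b
    · ext ⟨⟨t, a⟩, y⟩ ⟨t', b⟩
      simp only [Matrix.of_apply]
      split_ifs with h3
      · rw [hgW]
        simp only [toW, Matrix.of_apply]
        have h4 : (if y = 0 then Matrix.blockDiagonal' x ⟨t, a⟩ ⟨t', b⟩ else 0) = 0 := by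
          split_ifs with h5
          · rw [Matrix.blockDiagonal'_apply, dif_neg]
            exact fun h6 => h3.2 ⟨h5, h6⟩
          · rfl
        rw [h4, zero_add]
      · by_contra h0
        exact h3 (hr _ _ (Ne.symm h0))

end Types

/-! ## Decomposition of nilpotent operators into strings -/

section Decomposition

open Polynomial

variable {N : ℕ} {B : Type} [Fintype B] [DecidableEq B]

/-- The pair of a graded space and an operator is isomorphic to a sum of strings. -/
def StrSim {I : Type} [Fintype I] [DecidableEq I] (d : B → ZMod N) (H : Matrix B B ℂ)
    (p : I → ZMod N) (ℓ : I → ℕ) : Prop :=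
  ∃ (g : Matrix B (Str ℓ) ℂ) (h : Matrix (Str ℓ) B ℂ), g * h = 1 ∧ h * g = 1 ∧
    IsDeg d (strDeg p ℓ) 0 g ∧ H * g = g * shift ℓ

variable {d : B → ZMod N} {H : Matrix B B ℂ}

theorem X_pow_dvd_of_aeval_mulVec_eq_zero {r : ℕ} {v : B → ℂ} (hr : H ^ (r + 1) = 0)
    (hv : (H ^ r).mulVec v ≠ 0) {q : ℂ[X]} (hq : (aeval H q).mulVec v = 0) : X ^ (r + 1) ∣ q := by
  rw [X_pow_dvd_iff]
  intro j
  induction j using Nat.strong_induction_on with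
  | _ j ih =>
    intro hj
    obtain ⟨s, rfl⟩ := X_pow_dvd_iff.2 fun i hi => ih i hi (by omega)
    rw [coeff_X_pow_mul']
    simp only [le_refl, if_true, Nat.sub_self]
    have h1 : (aeval H (X ^ (r - j) * (X ^ j * s))).mulVec v = 0 := by
      rw [map_mul, ← Matrix.mulVec_mulVec, hq, Matrix.mulVec_zero]
    have h2 : X ^ (r - j) * (X ^ j * s) = s.divX * X ^ (r + 1) + Polynomial.C (s.coeff 0) * X ^ r := by
      conv_lhs => rw [← divX_mul_X_add s]
      rw [← mul_assoc, ← pow_add, Nat.sub_add_cancel (by omega)]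
      ring
    rw [h2, map_add, map_mul, map_mul, map_pow, map_pow, aeval_X, aeval_C, hr, mul_zero, zero_add,
      ← Algebra.smul_def, Matrix.smul_mulVec] at h1
    exact (smul_eq_zero.1 h1).resolve_right hv

theorem comp_X_pow_apply (r : ℕ) (x y : Fin (r + 1)) :
    comp (r + 1) (X ^ (r + 1)) x y = if (x : ℕ) = y + 1 then 1 else 0 := by
  have hx := x.2
  simp only [comp, Matrix.of_apply, coeff_X_pow]
  rw [if_neg (c := (x : ℕ) = r + 1) (by omega), neg_zero]
  by_cases h1 : (y : ℕ) + 1 = r + 1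
  · rw [if_pos h1, if_neg (by omega)]
  · rw [if_neg h1]

theorem exists_strSim_succ {m₂ : ZMod N → ℕ} {r : ℕ} {p₀ : ZMod N}
    {g : Matrix B (Fin (r + 1) ⊕ ((k : ZMod N) × Fin (m₂ k))) ℂ}
    {h : Matrix (Fin (r + 1) ⊕ ((k : ZMod N) × Fin (m₂ k))) B ℂ} [NeZero N]
    {Y : Matrix ((k : ZMod N) × Fin (m₂ k)) ((k : ZMod N) × Fin (m₂ k)) ℂ} (hgh : g * h = 1)
    (hhg : h * g = 1) (hg : IsDeg d (Sum.elim (fun x : Fin (r + 1) => p₀ + ((x : ℕ) : ZMod N)) Sigma.fst) 0 g)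
    (hH : H * g = g * Matrix.fromBlocks (comp (r + 1) (X ^ (r + 1))) 0 0 Y)
    {I : Type} [Fintype I] [DecidableEq I] {p : I → ZMod N} {ℓ : I → ℕ}
    (hY : StrSim Sigma.fst Y p ℓ) :
    StrSim d H (fun i : Option I => i.elim p₀ p) (fun i => i.elim r ℓ) := by
  obtain ⟨g', h', e1, e2, e3, e4⟩ := hY
  let e : Str (fun i : Option I => i.elim r ℓ) ≃ Fin (r + 1) ⊕ Str ℓ :=
    { toFun := fun c => match c with
        | ⟨none, x⟩ => .inl x
        | ⟨some i, x⟩ => .inr ⟨i, x⟩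
      invFun := fun c => match c with
        | .inl x => ⟨none, x⟩
        | .inr ⟨i, x⟩ => ⟨some i, x⟩
      left_inv := by rintro ⟨_ | i, x⟩ <;> rfl
      right_inv := by rintro (x | ⟨i, x⟩) <;> rfl }
  let M : Matrix (Fin (r + 1) ⊕ ((k : ZMod N) × Fin (m₂ k))) (Fin (r + 1) ⊕ Str ℓ) ℂ :=
    Matrix.fromBlocks 1 0 0 g'
  let M' : Matrix (Fin (r + 1) ⊕ Str ℓ) (Fin (r + 1) ⊕ ((k : ZMod N) × Fin (m₂ k))) ℂ :=
    Matrix.fromBlocks 1 0 0 h'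
  have hMM' : M * M' = 1 := by
    simp [M, M', Matrix.fromBlocks_multiply, e1]
  have hM'M : M' * M = 1 := by
    simp [M, M', Matrix.fromBlocks_multiply, e2]
  have hshift : (Matrix.fromBlocks (comp (r + 1) (X ^ (r + 1))) 0 0 (shift ℓ)).submatrix e e =
      shift (fun i : Option I => i.elim r ℓ) := by
    ext ⟨_ | i, x⟩ ⟨_ | j, y⟩
    · refine (comp_X_pow_apply r x y).trans ?_
      simp [shift]
    · simp [e, shift]
      try rfl
    · simp [e, shift]
      try rfl
    · simp [e, shift]
  refine ⟨(g * M).submatrix id e, (M' * h).submatrix e id, ?_, ?_, ?_, ?_⟩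
  · rw [Matrix.submatrix_mul_equiv, Matrix.mul_assoc, ← Matrix.mul_assoc M, hMM', Matrix.one_mul,
      hgh, Matrix.submatrix_id_id]
  · rw [← Matrix.submatrix_mul _ _ e id e Function.bijective_id, Matrix.mul_assoc,
      ← Matrix.mul_assoc h, hhg, Matrix.one_mul, hM'M, Matrix.submatrix_one_equiv]
  · have hM : IsDeg (Sum.elim (fun x : Fin (r + 1) => p₀ + ((x : ℕ) : ZMod N)) Sigma.fst)
        (Sum.elim (fun x : Fin (r + 1) => p₀ + ((x : ℕ) : ZMod N)) (strDeg p ℓ)) 0 M := by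
      rintro (x | x) (y | y) hxy
      · have : x = y := by
          by_contra h0
          exact hxy (by simp [M, h0])
        simp [this]
      · exact absurd (by simp [M]) hxy
      · exact absurd (by simp [M]) hxy
      · exact e3 x y (by simpa [M] using hxy)
    have h1 := hg.mul_zero_left hM
    rintro b ⟨_ | i, x⟩ hb
    · exact h1 b (.inl x) hb
    · exact h1 b (.inr ⟨i, x⟩) hb
  · have h1 : H * (g * M) = g * M * Matrix.fromBlocks (comp (r + 1) (X ^ (r + 1))) 0 0 (shift ℓ) := by
      rw [← Matrix.mul_assoc, hH, Matrix.mul_assoc, Matrix.mul_assoc]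
      congr 1
      simp [M, Matrix.fromBlocks_multiply, e4]
    rw [← hshift, Matrix.submatrix_mul_equiv, ← h1]
    have h2 := Matrix.submatrix_mul H (g * M) id id e Function.bijective_id
    rw [Matrix.submatrix_id_id] at h2
    exact h2.symm

theorem exists_strSim [NeZero N] (n : ℕ) : ∀ {B : Type} [Fintype B] [DecidableEq B]
    {d : B → ZMod N} {H : Matrix B B ℂ}, Fintype.card B = n → IsDeg d d 1 H → IsNilpotent H →
    ∃ (I : Type) (_ : Fintype I) (_ : DecidableEq I) (p : I → ZMod N) (ℓ : I → ℕ),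
      StrSim d H p ℓ := by
  induction n using Nat.strong_induction_on with
  | _ n ih =>
    intro B _ _ d H hn hH hnil
    rcases isEmpty_or_nonempty B with hB | hB
    · refine ⟨Empty, inferInstance, inferInstance, Empty.elim, Empty.elim, 0, 0, ?_, ?_, ?_, ?_⟩
      · ext b
        exact isEmptyElim b
      · ext ⟨i, x⟩
        exact i.elim
      · exact fun b => isEmptyElim b
      · ext b
        exact isEmptyElim b
    obtain ⟨r, hr, hr'⟩ : ∃ r, H ^ (r + 1) = 0 ∧ H ^ r ≠ 0 := by
      classical
      have h0 : Nat.find hnil ≠ 0 := fun h0 => by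
        have := Nat.find_spec hnil
        rw [h0, pow_zero] at this
        exact one_ne_zero this
      refine ⟨Nat.find hnil - 1, ?_, Nat.find_min hnil (by omega)⟩
      rw [Nat.sub_add_cancel (by omega)]
      exact Nat.find_spec hnil
    obtain ⟨b₀, hb₀⟩ : ∃ b, (H ^ r).mulVec (Pi.single b 1) ≠ 0 := by
      by_contra! hall
      refine hr' ?_
      ext c b
      have := congr_fun (hall b) c
      simpa using this
    set K := krylov (r + 1) H (Pi.single b₀ 1) with hKdef
    have hmon : (X ^ (r + 1) : ℂ[X]).Monic := monic_X_pow _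
    have hdeg : (X ^ (r + 1) : ℂ[X]).natDegree = r + 1 := natDegree_X_pow _
    have hzero : aeval H (X ^ (r + 1) : ℂ[X]) = 0 := by rw [map_pow, aeval_X, hr]
    have hKinj : ∀ c, K.mulVec c = 0 → c = 0 := krylov_injective hmon hdeg fun q hq =>
      X_pow_dvd_of_aeval_mulVec_eq_zero hr hb₀ hq
    have hHK : H * K = K * comp (r + 1) (X ^ (r + 1)) :=
      mul_krylov hmon hdeg (by rw [hzero, Matrix.zero_mulVec])
    obtain ⟨E, hEK, hEH⟩ := exists_retraction_krylov hmon hdeg hzero hKinj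
    rw [← hKdef] at hEK
    let dK : Fin (r + 1) → ZMod N := fun x => d b₀ + ((x : ℕ) : ZMod N)
    have hKd : IsDeg d dK 0 K := by
      intro c x h
      have h1 : (H ^ (x : ℕ)) c b₀ ≠ 0 := by
        intro h0
        apply h
        simp [K, krylov, h0]
      rw [hH.pow _ c b₀ h1, add_zero]
    let E₀ : Matrix (Fin (r + 1)) B ℂ := Matrix.of fun x c => if d c = dK x then E x c else 0
    have hE₀d : IsDeg dK d 0 E₀ := by
      intro x c h
      by_contra h0
      have : ¬d c = dK x := fun h1 => h0 (by rw [h1, add_zero])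
      simp [E₀, this] at h
    have hE₀K : E₀ * K = 1 := by
      rw [← hEK]
      ext x x'
      have key : ∀ (A : Matrix (Fin (r + 1)) B ℂ), dK x ≠ dK x' → IsDeg dK d 0 A →
          (A * K) x x' = 0 := by
        intro A hne hA
        by_contra h0
        exact hne (by simpa using (hA.mul hKd) x x' h0)
      by_cases hx : dK x = dK x'
      · rw [Matrix.mul_apply, Matrix.mul_apply]
        refine Finset.sum_congr rfl fun c _ => ?_
        by_cases hc : K c x' = 0
        · simp only [hc, mul_zero]
        · have : d c = dK x := by rw [hKd c x' hc, hx, add_zero]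
          simp [E₀, this]
      · rw [key E₀ hx hE₀d, hEK, Matrix.one_apply_ne]
        exact fun h => hx (by rw [h])
    have hCd : IsDeg dK dK 1 (comp (r + 1) (X ^ (r + 1))) := by
      intro x x' h
      rw [comp_X_pow_apply] at h
      have h2 : (x : ℕ) = x' + 1 := by
        by_contra h0
        exact h (if_neg h0)
      simp only [dK, h2]
      push_cast
      ring
    have hE₀H : E₀ * H = comp (r + 1) (X ^ (r + 1)) * E₀ := by
      ext x b
      have h1 := hE₀d.mul_zero_left hH
      have h2 := hCd.mul_zero_right hE₀d
      by_cases hxb : dK x = d b + 1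
      · have h3 := congr_fun (congr_fun hEH x) b
        have h4 : (E₀ * H) x b = (E * H) x b := by
          rw [Matrix.mul_apply, Matrix.mul_apply]
          refine Finset.sum_congr rfl fun c _ => ?_
          by_cases hc : H c b = 0
          · rw [hc, mul_zero, mul_zero]
          · have : d c = dK x := by rw [hH c b hc, hxb]
            simp [E₀, this]
        have h5 : (comp (r + 1) (X ^ (r + 1)) * E₀) x b = (comp (r + 1) (X ^ (r + 1)) * E) x b := by
          rw [Matrix.mul_apply, Matrix.mul_apply]
          refine Finset.sum_congr rfl fun x' _ => ?_
          by_cases hc : comp (r + 1) (X ^ (r + 1)) x x' = 0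
          · rw [hc, zero_mul, zero_mul]
          · have : d b = dK x' := by
              have := hCd x x' hc
              rw [hxb, add_left_inj] at this
              exact this
            simp [E₀, this]
        rw [h4, h5, h3]
      · have h6 : (E₀ * H) x b = 0 := by
          by_contra h0
          exact hxb (h1 x b h0)
        have h7 : (comp (r + 1) (X ^ (r + 1)) * E₀) x b = 0 := by
          by_contra h0
          exact hxb (h2 x b h0)
        rw [h6, h7]
    let W₂ : Submodule ℂ (B → ℂ) := LinearMap.ker E₀.mulVecLin
    have hW₂ : ∀ w, w ∈ W₂ ↔ E₀.mulVec w = 0 := fun w => Iff.rfl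
    obtain ⟨m₂, g₂, hg₂, hg₂i, hg₂r⟩ := exists_homogeneous_basis (d := d) W₂ fun k w hw => by
      rw [hW₂] at hw ⊢
      rw [Matrix.mulVec_mulVec, ← hE₀d.degProj_mul, ← Matrix.mulVec_mulVec, hw, Matrix.mulVec_zero]
    have hcompl : IsCompl (LinearMap.range K.mulVecLin) W₂ := by
      constructor
      · rw [Submodule.disjoint_def]
        rintro _ ⟨c, rfl⟩ hc
        have : E₀.mulVec (K.mulVec c) = 0 := hc
        rw [Matrix.mulVec_mulVec, hE₀K, Matrix.one_mulVec] at this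
        rw [this, map_zero]
      · rw [codisjoint_iff, eq_top_iff]
        intro w _
        refine Submodule.mem_sup.2 ⟨K.mulVec (E₀.mulVec w), ⟨_, rfl⟩,
          w - K.mulVec (E₀.mulVec w), ?_, by abel⟩
        rw [hW₂, Matrix.mulVec_sub, Matrix.mulVec_mulVec, hE₀K, Matrix.one_mulVec, sub_self]
    obtain ⟨h, hgh, hhg⟩ := exists_inverse_fromCols hcompl hKinj hg₂i (fun w => Iff.rfl) hg₂r
    obtain ⟨Y, hY⟩ := exists_mul_eq_mul_of_stable (H := H) (W := W₂) (fun w hw => by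
      rw [hW₂] at hw ⊢
      rw [Matrix.mulVec_mulVec, hE₀H, ← Matrix.mulVec_mulVec, hw, Matrix.mulVec_zero]) hg₂r
    have hHg : H * Matrix.fromCols K g₂ = Matrix.fromCols K g₂ *
        Matrix.fromBlocks (comp (r + 1) (X ^ (r + 1))) 0 0 Y := by
      rw [Matrix.mul_fromCols, hHK, hY, Matrix.fromCols_mul_fromBlocks]
      simp
    have hgd : IsDeg d (Sum.elim dK Sigma.fst) 0 (Matrix.fromCols K g₂) := isDeg_fromCols hKd hg₂
    have hhd : IsDeg (Sum.elim dK Sigma.fst) d 0 h := by simpa using hgd.of_inverse hgh hhg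
    have hhHg : h * H * Matrix.fromCols K g₂ =
        Matrix.fromBlocks (comp (r + 1) (X ^ (r + 1))) 0 0 Y := by
      rw [Matrix.mul_assoc, hHg, ← Matrix.mul_assoc, hhg, Matrix.one_mul]
    have hYd : IsDeg (Sigma.fst : ((k : ZMod N) × Fin (m₂ k)) → ZMod N) Sigma.fst 1 Y := by
      have h1 := (hhd.mul_zero_left hH).mul_zero_right hgd
      rw [hhHg, isDeg_fromBlocks] at h1
      exact h1.2
    have hYnil : IsNilpotent Y := by
      refine ⟨r + 1, ?_⟩
      have h1 := conj_pow hhg hgh H (r + 1)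
      rw [hhHg, Matrix.fromBlocks_diagonal_pow, hr, Matrix.mul_zero, Matrix.zero_mul,
        ← Matrix.fromBlocks_zero, Matrix.fromBlocks_inj] at h1
      exact h1.2.2.2
    have hcard : Fintype.card ((k : ZMod N) × Fin (m₂ k)) < n := by
      have h1 := Matrix.square_of_invertible _ _ hgh hhg
      rw [Fintype.card_sum, Fintype.card_fin] at h1
      omega
    obtain ⟨I, _, _, p, ℓ, hI⟩ := ih _ hcard rfl hYd hYnil
    exact ⟨Option I, inferInstance, inferInstance, _, _, exists_strSim_succ hgh hhg hgd hHg hI⟩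

theorem exists_strSim_types [NeZero N] {D : ℕ} (hD : Fintype.card B ≤ D) (hH : IsDeg d d 1 H)
    (hnil : IsNilpotent H) : ∃ m : ZMod N × Fin D → ℕ, StrSim d H (spos m) (slen m) := by
  obtain ⟨I, _, _, p, ℓ, g, h, e1, e2, e3, e4⟩ := exists_strSim _ rfl hH hnil
  have hlen : ∀ i, ℓ i < D := by
    intro i
    have h1 := Matrix.square_of_invertible _ _ e1 e2
    have h2 : ℓ i + 1 ≤ Fintype.card (Str ℓ) := by
      rw [Fintype.card_sigma]
      simp only [Fintype.card_fin]
      exact Finset.single_le_sum (f := fun i => ℓ i + 1) (fun _ _ => Nat.zero_le _)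
        (Finset.mem_univ i)
    omega
  let τ : I → ZMod N × Fin D := fun i => (p i, ⟨ℓ i, hlen i⟩)
  let m : ZMod N × Fin D → ℕ := fun t => Nat.card {i // τ i = t}
  let σ : I ≃ StrIdx m := (Equiv.sigmaFiberEquiv τ).symm.trans
    (Equiv.sigmaCongrRight fun t => Finite.equivFin _)
  have hσ : ∀ i, (σ i).1 = τ i := fun i => rfl
  let e : Str ℓ ≃ Str (slen m) := Equiv.sigmaCongrLeft (β := fun i => Fin (slen m i + 1)) σ
  refine ⟨m, g.submatrix id e.symm, h.submatrix e.symm id, ?_, ?_, ?_, ?_⟩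
  · rw [Matrix.submatrix_mul_equiv, e1, Matrix.submatrix_id_id]
  · rw [← Matrix.submatrix_mul _ _ e.symm id e.symm Function.bijective_id, e2,
      Matrix.submatrix_one_equiv]
  · intro b c hc
    obtain ⟨⟨i, x⟩, rfl⟩ := e.surjective c
    rw [Matrix.submatrix_apply, Equiv.symm_apply_apply] at hc
    exact e3 b _ hc
  · have h1 : shift (slen m) = (shift ℓ).submatrix e.symm e.symm := by
      ext c b
      obtain ⟨⟨i, x⟩, rfl⟩ := e.surjective c
      obtain ⟨⟨j, y⟩, rfl⟩ := e.surjective b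
      rw [Matrix.submatrix_apply, Equiv.symm_apply_apply, Equiv.symm_apply_apply]
      have h2 : σ i = σ j ↔ i = j := σ.injective.eq_iff
      simp only [shift, Matrix.of_apply]
      change (if σ i = σ j ∧ (x : ℕ) = y + 1 then (1 : ℂ) else 0) = _
      simp only [h2]
    rw [h1, Matrix.submatrix_mul_equiv, ← e4]
    have h2 := Matrix.submatrix_mul H g id id e.symm Function.bijective_id
    rw [Matrix.submatrix_id_id] at h2
    exact h2.symm

/-! ### Uniqueness -/

open Classical in
/-- The number of basis elements in degree `k` in the image of the `j`-th power of the shift. -/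
def imageCount {I : Type} [Fintype I] (p : I → ZMod N) (ℓ : I → ℕ) (k : ZMod N) (j : ℕ) : ℕ :=
  Fintype.card {c : Str ℓ // strDeg p ℓ c = k ∧ j ≤ c.2}

theorem rank_degProj_mul_shift_pow {I : Type} [Fintype I] [DecidableEq I] (p : I → ZMod N)
    (ℓ : I → ℕ) (k : ZMod N) (j : ℕ) :
    (degProj (strDeg p ℓ) {k} * shift ℓ ^ j).rank = imageCount p ℓ k j := by
  classical
  let Q : Matrix (Str ℓ) (Str ℓ) ℂ :=
    Matrix.diagonal fun c => if strDeg p ℓ c = k ∧ j ≤ (c.2 : ℕ) then 1 else 0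
  have hQ : Q.rank = imageCount p ℓ k j := by
    rw [Matrix.rank_diagonal, imageCount]
    simp
  have h0 : ∀ (u : I) (y : Fin (ℓ u + 1)) (b : Str ℓ), (shift ℓ ^ j) ⟨u, y⟩ b =
      if h : j ≤ (y : ℕ) then (1 : Matrix (Str ℓ) (Str ℓ) ℂ) ⟨u, ⟨y - j, by omega⟩⟩ b else 0 := by
    intro u y b
    rw [← shift_pow_mul_apply, Matrix.mul_one]
  have h1 : degProj (strDeg p ℓ) {k} * shift ℓ ^ j = Q * shift ℓ ^ j := by
    ext ⟨u, y⟩ b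
    rw [degProj_mul_apply, Matrix.diagonal_mul, h0]
    by_cases hk : strDeg p ℓ ⟨u, y⟩ = k <;> by_cases hj : j ≤ (y : ℕ) <;> simp [hk, hj]
  have h2 : degProj (strDeg p ℓ) {k} * shift ℓ ^ j * (shift ℓ ^ j).transpose = Q := by
    rw [h1, Matrix.mul_assoc]
    have hQa : ∀ c c', Q c c' =
        if c = c' then (if strDeg p ℓ c = k ∧ j ≤ (c.2 : ℕ) then 1 else 0) else 0 :=
      fun c c' => Matrix.diagonal_apply _ _ _
    ext ⟨u, y⟩ ⟨u', y'⟩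
    rw [Matrix.diagonal_mul, shift_pow_mul_apply]
    by_cases hj : j ≤ (y : ℕ)
    · rw [dif_pos hj, Matrix.transpose_apply, h0]
      by_cases hj' : j ≤ (y' : ℕ)
      · rw [dif_pos hj', hQa, Matrix.one_apply]
        by_cases hc : (⟨u, y⟩ : Str ℓ) = ⟨u', y'⟩
        · cases hc
          simp
        · have : ¬(⟨u', ⟨y' - j, by omega⟩⟩ : Str ℓ) = ⟨u, ⟨y - j, by omega⟩⟩ := by
            intro h
            apply hc
            obtain ⟨rfl, h⟩ := Sigma.mk.inj_iff.1 h
            have h' := congr_arg Fin.val (eq_of_heq h)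
            simp only at h'
            congr 1
            exact Fin.ext (by omega)
          simp [this, hc]
      · rw [dif_neg hj', mul_zero, hQa, if_neg]
        intro h
        cases h
        exact hj' hj
    · rw [dif_neg hj, mul_zero, hQa]
      rw [if_neg (c := _ ∧ _) (fun h => hj h.2), ite_self]
  refine le_antisymm ?_ ?_
  · rw [h1, ← hQ]
    exact Matrix.rank_mul_le_left _ _
  · rw [← hQ, ← h2]
    exact Matrix.rank_mul_le_left _ _

theorem StrSim.rank {I : Type} [Fintype I] [DecidableEq I] {p : I → ZMod N} {ℓ : I → ℕ}
    (h : StrSim d H p ℓ) (k : ZMod N) (j : ℕ) :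
    (degProj d {k} * H ^ j).rank = imageCount p ℓ k j := by
  obtain ⟨g, h, e1, e2, e3, e4⟩ := h
  have h1 : H ^ j * g = g * shift ℓ ^ j := by
    induction j with
    | zero => simp
    | succ j ih => rw [pow_succ, Matrix.mul_assoc, e4, ← Matrix.mul_assoc, ih, pow_succ,
        Matrix.mul_assoc]
  rw [← rank_degProj_mul_shift_pow, ← rank_conj e2 (degProj (strDeg p ℓ) {k} * shift ℓ ^ j),
    ← Matrix.mul_assoc g, ← e3.degProj_mul, Matrix.mul_assoc (degProj d {k}) g, ← h1,
    Matrix.mul_assoc, Matrix.mul_assoc, e1, Matrix.mul_one]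

open Classical in
theorem imageCount_eq_sum {I : Type} [Fintype I] (p : I → ZMod N) (ℓ : I → ℕ) (k : ZMod N) (j : ℕ) :
    imageCount p ℓ k j =
      ∑ i, ∑ x ∈ Finset.range (ℓ i + 1), if p i + (x : ℕ) = k ∧ j ≤ x then 1 else 0 := by
  rw [imageCount, Fintype.card_subtype, Finset.card_filter, Fintype.sum_sigma]
  refine Finset.sum_congr rfl fun i _ => ?_
  rw [← Fin.sum_univ_eq_sum_range (fun x => if p i + (x : ℕ) = k ∧ j ≤ x then 1 else 0)]
  rfl

open Classical in
theorem imageCount_eq_add {I : Type} [Fintype I] (p : I → ZMod N) (ℓ : I → ℕ) (k : ZMod N) (j : ℕ) :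
    imageCount p ℓ k j = imageCount p ℓ (k + 1) (j + 1) +
      ∑ i, if p i + (ℓ i : ℕ) = k ∧ j ≤ ℓ i then 1 else 0 := by
  rw [imageCount_eq_sum, imageCount_eq_sum, ← Finset.sum_add_distrib]
  refine Finset.sum_congr rfl fun i _ => ?_
  rw [Finset.sum_range_succ, Finset.sum_range_succ']
  simp only [Nat.cast_add, Nat.cast_one, ← add_assoc, add_left_inj, add_le_add_iff_right,
    nonpos_iff_eq_zero, Nat.add_eq_zero_iff, one_ne_zero, and_false, if_false, add_zero]

theorem eq_of_strSim [NeZero N] {D : ℕ} {m m' : ZMod N × Fin D → ℕ}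
    (h : StrSim d H (spos m) (slen m)) (h' : StrSim d H (spos m') (slen m')) : m = m' := by
  classical
  have hc : ∀ k j, imageCount (spos m) (slen m) k j = imageCount (spos m') (slen m') k j :=
    fun k j => by rw [← h.rank, h'.rank]
  have he : ∀ k j, (∑ i, if spos m i + (slen m i : ℕ) = k ∧ j ≤ slen m i then 1 else 0) =
      ∑ i, if spos m' i + (slen m' i : ℕ) = k ∧ j ≤ slen m' i then 1 else 0 := by
    intro k j
    have h1 := imageCount_eq_add (spos m) (slen m) k j
    have h2 := imageCount_eq_add (spos m') (slen m') k j
    rw [hc, hc] at h1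
    omega
  have key : ∀ (m : ZMod N × Fin D → ℕ) (t : ZMod N × Fin D),
      (∑ i, if spos m i + (slen m i : ℕ) = t.1 + (t.2 : ℕ) ∧ (t.2 : ℕ) ≤ slen m i then 1 else 0) =
      (∑ i, if spos m i + (slen m i : ℕ) = t.1 + (t.2 : ℕ) ∧ (t.2 : ℕ) + 1 ≤ slen m i then 1 else 0)
        + m t := by
    intro m t
    have h1 : m t = ∑ i : StrIdx m, if i.1 = t then 1 else 0 := by
      rw [Fintype.sum_sigma, Finset.sum_eq_single t]
      · simp
      · intro b _ hb
        simp [hb]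
      · simp
    rw [h1, ← Finset.sum_add_distrib]
    refine Finset.sum_congr rfl fun i _ => ?_
    by_cases hi : i.1 = t
    · subst hi
      simp [spos, slen]
    · have h2 : ¬(spos m i + (slen m i : ℕ) = t.1 + (t.2 : ℕ) ∧ slen m i = t.2) := by
        rintro ⟨h3, h4⟩
        rw [h4, add_left_inj] at h3
        exact hi (Prod.ext h3 (Fin.ext h4))
      rw [if_neg hi, add_zero]
      congr 1
      simp only [eq_iff_iff, and_congr_right_iff]
      intro h3
      have : slen m i ≠ t.2 := fun h4 => h2 ⟨h3, h4⟩
      omega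
  funext t
  have h1 := key m t
  have h2 := key m' t
  rw [he, he] at h1
  omega

end Decomposition

/-! ## The strata of the structures with nilpotent `H` -/

section NilpotentStrata

variable {N : ℕ} {I : Type} [Fintype I] [DecidableEq I] {J : Set (ZMod N)} {p : I → ZMod N}
  {ℓ : I → ℕ}

/-- The structures for which `H` is isomorphic to the given sum of strings. -/
def strStratum (J : Set (ZMod N)) (p : I → ZMod N) (ℓ : I → ℕ) :
    Set (MatTriple (Str ℓ)) :=
  {z | ∃ g ∈ gradedUnits (strDeg p ℓ), ∃ y ∈ strSpace J p ℓ, z = conj g g⁻¹ (shift ℓ, y)}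

theorem mem_strSpace_iff {y : MatPair (Str ℓ)} :
    y ∈ strSpace J p ℓ ↔ (shift ℓ, y) ∈ jReps J (strDeg p ℓ) :=
  ⟨fun h => ⟨isDeg_shift, h.1, h.2⟩, fun h => ⟨h.2.1, h.2.2⟩⟩

theorem mu_strStratum : Cons (strStratum J p ℓ) ∧
    mu (gradedUnits (strDeg p ℓ)) * mu (strSpace J p ℓ) =
      mu (strStratum J p ℓ) * mu (strAut p ℓ) := by
  have hs1 : Cons ({shift ℓ} : Set (Matrix (Str ℓ) (Str ℓ) ℂ)) := Cons.eq tame_id (tame_const _)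
  have hT := hs1.prodSet (cons_strSpace (J := J) (p := p) (ℓ := ℓ))
  have hT' := mu_prod hs1 (cons_strSpace (J := J) (p := p) (ℓ := ℓ))
  rw [mu_singleton, one_mul] at hT'
  rw [← hT']
  set d := strDeg p ℓ with hd
  let A : (MatTriple (Str ℓ)) →
      Matrix (Str ℓ) (Str ℓ) ℂ →ₗ[ℂ] _ := fun z =>
    (LinearMap.mulLeft ℂ z.1 - LinearMap.mulRight ℂ (shift ℓ)) ∘ₗ degZeroPart d
  have hA : Tame A := tame_hom fun v => by
    simp only [A, LinearMap.comp_apply, LinearMap.mulRight_apply, LinearMap.mulLeft_apply,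
      LinearMap.sub_apply]
    fun_prop
  obtain ⟨s, hs, hsp⟩ := exists_tame_isUnit_section hA (tame_const (degZeroPart d))
  have hmemT : ∀ {z}, z.1 = shift ℓ → z ∈ jReps J d →
      z ∈ ({shift ℓ} : Set (Matrix (Str ℓ) (Str ℓ) ℂ)) ×ˢ strSpace J p ℓ := by
    rintro ⟨H, y⟩ rfl h2
    exact ⟨rfl, mem_strSpace_iff.2 h2⟩
  have hmem : ∀ {g}, g ∈ gradedUnits d → ∀ {z}, z ∈ jReps J d → conj g g⁻¹ z ∈ jReps J d :=
    fun hg z hz => conj_mem_jReps hg.1 (gradedUnits_inv hg).1.1 (gradedUnits_inv hg).2.1 hz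
  refine mu_slice (fun g z => conj g g⁻¹ z) (by fun_prop) cons_gradedUnits cons_strAut hT
    (fun g hg => hg.2) (fun g hg h hh => gradedUnits_mul hg hh) (fun g hg => (gradedUnits_inv hg).1)
    (fun g hg => hg.1) ?_ ?_ ?_ ?_ (fun z => degZeroPart d (s z)) (hs.linear _) ?_
  · intro g hg h hh x
    rw [conj_conj, Matrix.mul_inv_rev]
  · intro x
    rw [inv_one, conj_one]
  · rintro g hg ⟨_, y⟩ ⟨rfl, hy⟩
    exact ⟨g, hg, y, hy, rfl⟩
  · rintro g hg ⟨_, y⟩ ⟨rfl, hy⟩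
    obtain ⟨-, h2, h3⟩ := gradedUnits_inv hg
    constructor
    · rintro ⟨h, -⟩
      have h : g * shift ℓ * g⁻¹ = shift ℓ := h
      refine ⟨hg, ?_⟩
      conv_rhs => rw [← h]
      rw [Matrix.mul_assoc _ g⁻¹, h2, Matrix.mul_one]
    · rintro ⟨-, h⟩
      refine hmemT ?_ (hmem hg (mem_strSpace_iff.1 hy))
      change g * shift ℓ * g⁻¹ = shift ℓ
      rw [h, Matrix.mul_assoc, h3, Matrix.mul_one]
  · rintro _ ⟨g, hg, y, hy, rfl⟩
    obtain ⟨hg1, hg2, hg3⟩ := gradedUnits_inv hg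
    set z := conj g g⁻¹ (shift ℓ, y) with hz
    obtain ⟨h1, h2⟩ := hsp z ⟨g, by
      change z.1 * degZeroPart d g - degZeroPart d g * shift ℓ = 0
      rw [degZeroPart_eq hg.1, sub_eq_zero]
      change g * shift ℓ * g⁻¹ * g = _
      rw [Matrix.mul_assoc _ g⁻¹, hg2, Matrix.mul_one], by rw [degZeroPart_eq hg.1]; exact hg.2⟩
    have hG : degZeroPart d (s z) ∈ gradedUnits d := ⟨isDeg_degZeroPart d _, h2⟩
    obtain ⟨hG1, hG2, hG3⟩ := gradedUnits_inv hG
    refine ⟨hG, hmemT ?_ (hmem hG1 (hmem hg (mem_strSpace_iff.1 hy)))⟩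
    have h3 : z.1 * degZeroPart d (s z) = degZeroPart d (s z) * shift ℓ := sub_eq_zero.1 h1
    change (degZeroPart d (s z))⁻¹ * z.1 * (degZeroPart d (s z))⁻¹⁻¹ = shift ℓ
    rw [Matrix.nonsing_inv_nonsing_inv _ ((Matrix.isUnit_iff_isUnit_det _).1 h2), Matrix.mul_assoc,
      h3, ← Matrix.mul_assoc, hG2, Matrix.one_mul]

variable {B : Type} [Fintype B] [DecidableEq B] {d : B → ZMod N}

theorem conj_mem_strStratum_iff (σ : Str ℓ ≃ B) (hσ : ∀ x, d (σ x) = strDeg p ℓ x) {z} :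
    conj (equivMatrix σ.symm) (equivMatrix σ) z ∈ strStratum J p ℓ ↔
      z ∈ nilReps J d ∧ StrSim d z.1 p ℓ := by
  have e1 := equivMatrix_mul_symm σ
  have e2 := equivMatrix_mul_symm σ.symm
  rw [Equiv.symm_symm] at e2
  have hE : IsDeg d (strDeg p ℓ) 0 (equivMatrix σ) := isDeg_equivMatrix hσ
  have hE' : IsDeg (strDeg p ℓ) d 0 (equivMatrix σ.symm) :=
    isDeg_equivMatrix fun b => by rw [← hσ, Equiv.apply_symm_apply]
  constructor
  · rintro ⟨g, hg, y, hy, h⟩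
    obtain ⟨hg1, hg2, hg3⟩ := gradedUnits_inv hg
    have hz : z = conj (equivMatrix σ * g) (g⁻¹ * equivMatrix σ.symm) (shift ℓ, y) := by
      rw [← conj_conj, ← h, conj_conj, e1, conj_one]
    have h1 : equivMatrix σ * g * (g⁻¹ * equivMatrix σ.symm) = 1 := by
      rw [Matrix.mul_assoc, ← Matrix.mul_assoc g, hg3, Matrix.one_mul, e1]
    have h2 : g⁻¹ * equivMatrix σ.symm * (equivMatrix σ * g) = 1 := by
      rw [Matrix.mul_assoc, ← Matrix.mul_assoc _ _ g, e2, Matrix.one_mul, hg2]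
    have h3 : z.1 = equivMatrix σ * g * shift ℓ * (g⁻¹ * equivMatrix σ.symm) := by rw [hz]; rfl
    refine ⟨⟨?_, ?_⟩, equivMatrix σ * g, g⁻¹ * equivMatrix σ.symm, h1, h2, hE.mul_zero_left hg.1, ?_⟩
    · rw [hz]
      exact conj_mem_jReps (hE.mul_zero_left hg.1) (hg1.1.mul_zero_left hE') h2
        (mem_strSpace_iff.1 hy)
    · obtain ⟨n, hn⟩ := isNilpotent_shift (ℓ := ℓ)
      exact ⟨n, by rw [h3, conj_pow h1 h2, hn, Matrix.mul_zero, Matrix.zero_mul]⟩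
    · rw [h3, Matrix.mul_assoc _ (g⁻¹ * _), h2, Matrix.mul_one]
  · rintro ⟨⟨hz, -⟩, g, h, e3, e4, hg, h1⟩
    have hh : IsDeg (strDeg p ℓ) d 0 h := by simpa using hg.of_inverse e3 e4
    have h2 : h * equivMatrix σ * (equivMatrix σ.symm * g) = 1 := by
      rw [Matrix.mul_assoc, ← Matrix.mul_assoc _ _ g, e1, Matrix.one_mul, e4]
    have h3 : equivMatrix σ.symm * g * (h * equivMatrix σ) = 1 := by
      rw [Matrix.mul_assoc, ← Matrix.mul_assoc g, e3, Matrix.one_mul, e2]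
    have h4 : (conj h g z).1 = shift ℓ := by
      change h * z.1 * g = _
      rw [Matrix.mul_assoc, h1, ← Matrix.mul_assoc, e4, Matrix.one_mul]
    refine ⟨equivMatrix σ.symm * g, ⟨hE'.mul_zero_left hg, IsUnit.of_mul_eq_one _ h3⟩,
      (conj h g z).2, mem_strSpace_iff.2 ?_, ?_⟩
    · rw [← h4]
      exact conj_mem_jReps hh hg e3 hz
    · rw [← h4, Matrix.inv_eq_right_inv h3]
      change _ = conj _ _ (conj h g z)
      rw [conj_conj, Matrix.mul_assoc, e3, Matrix.mul_one, ← Matrix.mul_assoc, e3, Matrix.one_mul]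

/-! ### The sum over the types of nilpotent operators -/

variable {D : ℕ}

/-- The dimension vector of a string. -/
def strDim (t : ZMod N × Fin D) : ZMod N →₀ ℕ :=
  ∑ x ∈ Finset.range (t.2 + 1), Finsupp.single (t.1 + (x : ZMod N)) 1

variable [NeZero N]

theorem card_strDeg (m : ZMod N × Fin D → ℕ) (k : ZMod N) :
    Nat.card {c : Str (slen m) // strDeg (spos m) (slen m) c = k} = (∑ t, m t • strDim t) k := by
  classical
  rw [Nat.card_eq_fintype_card, Fintype.card_subtype, Finset.card_filter, Fintype.sum_sigma,
    Fintype.sum_sigma, Finsupp.finsetSum_apply]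
  refine Finset.sum_congr rfl fun t _ => ?_
  rw [Finsupp.smul_apply, strDim, Finsupp.finsetSum_apply, smul_eq_mul]
  have h : ∀ i : Fin (m t), (∑ x : Fin (slen m ⟨t, i⟩ + 1),
      if strDeg (spos m) (slen m) ⟨⟨t, i⟩, x⟩ = k then 1 else 0) =
      ∑ x ∈ Finset.range (t.2 + 1), (Finsupp.single (t.1 + (x : ZMod N)) 1 : ZMod N →₀ ℕ) k := by
    intro i
    rw [← Fin.sum_univ_eq_sum_range (fun x => (Finsupp.single (t.1 + (x : ZMod N)) 1 : ZMod N →₀ ℕ) k)]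
    refine Finset.sum_congr rfl fun x _ => ?_
    rw [Finsupp.single_apply]
    rfl
  rw [Finset.sum_congr rfl fun i _ => h i, Finset.sum_const, Finset.card_univ, Fintype.card_fin,
    smul_eq_mul]

open Classical in
theorem mu_nilReps (hJ : ∀ k ∈ J, k + 1 ∉ J) {α : ZMod N →₀ ℕ} (hD : ∑ k, α k ≤ D) :
    mu (nilReps J (Sigma.fst : ((k : ZMod N) × Fin (α k)) → ZMod N)) *
        Ring.inverse (motiveG fun k => α k) =
      ∑ m ∈ Fintype.piFinset (fun _ : ZMod N × Fin D => Finset.range (D + 1)) with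
        ∑ t, m t • strDim t = α,
          LL ^ Fintype.card {z : Str (slen m) × StrIdx m // StrCoord J (spos m) (slen m) z.1 z.2} *
            Ring.inverse (mu (strAut (spos m) (slen m))) := by
  let d : ((k : ZMod N) × Fin (α k)) → ZMod N := Sigma.fst
  let S : (ZMod N × Fin D → ℕ) → Set _ := fun m =>
    {z | z ∈ nilReps J d ∧ StrSim d z.1 (spos m) (slen m)}
  have hcard : Fintype.card ((k : ZMod N) × Fin (α k)) ≤ D := by simpa using hD
  have hσ : ∀ {m : ZMod N × Fin D → ℕ}, ∑ t, m t • strDim t = α →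
      ∃ σ : Str (slen m) ≃ ((k : ZMod N) × Fin (α k)), ∀ x, d (σ x) = strDeg (spos m) (slen m) x := by
    intro m hm
    obtain ⟨σ, hσ⟩ := exists_equiv_sigma (strDeg (spos m) (slen m)) (α := α)
      fun k => by rw [card_strDeg, hm]
    exact ⟨σ.symm, fun x => by
      change (σ.symm x).1 = _
      rw [← hσ, Equiv.apply_symm_apply]⟩
  have hS : ∀ {m : ZMod N × Fin D → ℕ}, ∑ t, m t • strDim t = α → Cons (S m) ∧
      motiveG (fun k => α k) * LL ^ Fintype.card {z : Str (slen m) × StrIdx m //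
        StrCoord J (spos m) (slen m) z.1 z.2} = mu (S m) * mu (strAut (spos m) (slen m)) := by
    intro m hm
    obtain ⟨σ, hσ⟩ := hσ hm
    have h := mu_strStratum (p := spos m) (ℓ := slen m) (J := J)
    have hSm : S m = {z | conj (equivMatrix σ.symm) (equivMatrix σ) z ∈
        strStratum J (spos m) (slen m)} := by
      ext z
      exact (conj_mem_strStratum_iff σ hσ).symm
    rw [hSm]
    refine ⟨h.1.preimage (by fun_prop), ?_⟩
    rw [mu_equiv, ← h.2, mu_strSpace hJ, mu_gradedUnits_equiv σ hσ, mu_gradedUnits_sigma]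
  rw [mu_eq_sum _ (X := S), Finset.sum_mul]
  · refine Finset.sum_congr rfl fun m hm => ?_
    have h := (hS (Finset.mem_filter.1 hm).2).2
    have e0 := Ring.mul_inverse_cancel _ (isUnit_motiveG fun k => α k)
    have e1 := Ring.mul_inverse_cancel (mu (strAut (spos m) (slen m))) (by
      rw [mu_strAut]
      exact (IsUnit.prod_iff.2 fun _ _ => isUnit_motiveGL _).mul (isUnit_LL.pow _))
    linear_combination (-(Ring.inverse (motiveG fun k => α k) *
      Ring.inverse (mu (strAut (spos m) (slen m))))) * h - mu (S m) *
      Ring.inverse (motiveG fun k => α k) * e1 + LL ^ Fintype.card {z : Str (slen m) × StrIdx m //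
        StrCoord J (spos m) (slen m) z.1 z.2} * Ring.inverse (mu (strAut (spos m) (slen m))) * e0
  · exact fun m hm => (hS (Finset.mem_filter.1 hm).2).1
  · intro z
    constructor
    · intro hz
      obtain ⟨m, hm⟩ := exists_strSim_types hcard hz.1.1 hz.2
      obtain ⟨g, h, e1, e2, e3, -⟩ := id hm
      refine ⟨m, Finset.mem_filter.2 ⟨Fintype.mem_piFinset.2 fun t => ?_, ?_⟩, hz, hm⟩
      · have h1 := Matrix.square_of_invertible _ _ e1 e2
        have h2 : m t ≤ Fintype.card (Str (slen m)) := by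
          rw [← Fintype.card_fin (m t)]
          refine Fintype.card_le_of_injective (fun i => (⟨⟨t, i⟩, 0⟩ : Str (slen m))) ?_
          intro i j hij
          exact (by simpa using hij : i = j ∧ _).1
        rw [Finset.mem_range]
        omega
      · obtain ⟨σ, hσ⟩ := exists_equiv_of_isDeg e3 e1 e2
        ext k
        rw [← card_strDeg]
        rw [Nat.card_congr ((σ.subtypeEquiv fun c => by rw [← add_zero (strDeg _ _ c), ← hσ]).trans
          (Equiv.sigmaSubtype (β := fun k => Fin (α k)) k)), Nat.card_eq_fintype_card,
          Fintype.card_fin]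
    · rintro ⟨m, -, hz⟩
      exact hz.1
  · rintro m - m' - z hz hz'
    exact eq_of_strSim hz.2 hz'.2

end NilpotentStrata

/-! ## The dimensions of the strata -/

section Exponent

variable {N : ℕ} {I : Type} [Fintype I] (J : Set (ZMod N)) (p : I → ZMod N) (ℓ : I → ℕ)

open Classical in
theorem card_strCoord : Fintype.card {z : Str ℓ × I // StrCoord J p ℓ z.1 z.2} =
    ∑ u, ∑ i, ∑ y ∈ Finset.range (ℓ u + 1), if p u + (y : ℕ) = p i - startJ J p i ∧
      ℓ u + endJ J p ℓ i < y + ℓ i + 1 + startJ J p i then 1 else 0 := by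
  rw [Fintype.card_subtype, Finset.card_filter, Fintype.sum_prod_type, Fintype.sum_sigma]
  refine Finset.sum_congr rfl fun u _ => ?_
  rw [Finset.sum_comm]
  refine Finset.sum_congr rfl fun i _ => ?_
  rw [← Fin.sum_univ_eq_sum_range (fun y => if p u + (y : ℕ) = p i - startJ J p i ∧
      ℓ u + endJ J p ℓ i < y + ℓ i + 1 + startJ J p i then 1 else 0)]
  exact Finset.sum_congr rfl fun x _ => if_congr Iff.rfl rfl rfl

open Classical in
theorem sum_range_strCoord (u i : I) : ((∑ y ∈ Finset.range (ℓ u + 1),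
      if p u + (y : ℕ) = p i - startJ J p i ∧ ℓ u + endJ J p ℓ i < y + ℓ i + 1 + startJ J p i
      then 1 else 0 : ℕ) : ℤ) =
    (∑ y ∈ Finset.range (ℓ u + 1), if p u + (y : ℕ) = p i ∧ ℓ u < y + ℓ i + 1 then 1 else 0 : ℕ) +
      (startJ J p i * if p u + (ℓ u : ℕ) = p i - 1 then 1 else 0) -
      (startJ J p i * if p u = p i ∧ ℓ u + endJ J p ℓ i ≤ ℓ i then 1 else 0) -
      endJ J p ℓ i * if p u + (ℓ u : ℕ) = p i + (ℓ i : ℕ) ∧ ℓ i ≤ ℓ u then 1 else 0 := by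
  have hb : endJ J p ℓ i = 0 ∨ endJ J p ℓ i = 1 := by unfold endJ; split_ifs <;> simp
  have h1 : ((∑ y ∈ Finset.range (ℓ u + 1),
      if p u + (y : ℕ) = p i ∧ ℓ u + endJ J p ℓ i < y + ℓ i + 1 then 1 else 0 : ℕ) : ℤ) =
      (∑ y ∈ Finset.range (ℓ u + 1), if p u + (y : ℕ) = p i ∧ ℓ u < y + ℓ i + 1 then 1 else 0 : ℕ) -
      endJ J p ℓ i * if p u + (ℓ u : ℕ) = p i + (ℓ i : ℕ) ∧ ℓ i ≤ ℓ u then 1 else 0 := by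
    rcases hb with hb | hb
    · simp [hb]
    · have h : ∀ y ∈ Finset.range (ℓ u + 1),
          (if p u + (y : ℕ) = p i ∧ ℓ u < y + ℓ i + 1 then 1 else 0 : ℕ) =
          (if p u + (y : ℕ) = p i ∧ ℓ u + 1 < y + ℓ i + 1 then 1 else 0) +
          if ℓ u - ℓ i = y then (if p u + (ℓ u : ℕ) = p i + (ℓ i : ℕ) ∧ ℓ i ≤ ℓ u then 1 else 0)
            else 0 := by
        intro y hy
        rw [Finset.mem_range] at hy
        by_cases hl : ℓ i ≤ ℓ u
        · by_cases h2 : ℓ u - ℓ i = y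
          · have h3 : ℓ u = y + ℓ i := by omega
            have h4 : p u + (ℓ u : ℕ) = p i + (ℓ i : ℕ) ↔ p u + (y : ℕ) = p i := by
              rw [h3, Nat.cast_add, ← add_assoc, add_left_inj]
            have h5 : ¬(ℓ u + 1 < y + ℓ i + 1) := by omega
            have h6 : ℓ u < y + ℓ i + 1 := by omega
            simp only [if_pos h2, h4, h5, h6, hl, and_true, and_false, if_false, zero_add]
          · rw [if_neg h2, add_zero]
            congr 1
            simp only [eq_iff_iff, and_congr_right_iff]
            omega
        · have h6 : ℓ u < y + ℓ i + 1 := by omega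
          have h7 : ℓ u + 1 < y + ℓ i + 1 := by omega
          simp only [h6, h7, hl, and_false, if_false, ite_self, add_zero]
      rw [hb, Finset.sum_congr rfl h, Finset.sum_add_distrib, Finset.sum_ite_eq,
        if_pos (Finset.mem_range.2 (by omega))]
      push_cast
      ring
  by_cases ha : p i - 1 ∈ J
  · rw [startJ_of_mem ha, Nat.cast_one, Nat.cast_one, one_mul, one_mul]
    have h2 : ∀ y : ℕ, p u + (y : ZMod N) = p i - 1 ↔ p u + ((y + 1 : ℕ) : ZMod N) = p i := by
      intro y
      rw [eq_sub_iff_add_eq, Nat.cast_succ, add_assoc]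
    have h3 : ∀ y : ℕ, ℓ u + endJ J p ℓ i < y + ℓ i + 1 + 1 ↔
        ℓ u + endJ J p ℓ i < (y + 1) + ℓ i + 1 := by omega
    simp only [h2, h3]
    have h4 := Finset.sum_range_succ' (fun y : ℕ =>
      if p u + (y : ZMod N) = p i ∧ ℓ u + endJ J p ℓ i < y + ℓ i + 1 then 1 else 0) (ℓ u + 1)
    rw [Finset.sum_range_succ] at h4
    have h5 : ℓ u + endJ J p ℓ i < ℓ u + 1 + ℓ i + 1 := by omega
    have h6 : ℓ u + endJ J p ℓ i < 0 + ℓ i + 1 ↔ ℓ u + endJ J p ℓ i ≤ ℓ i := by omega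
    simp only [h5, h6, and_true, Nat.cast_zero, add_zero] at h4
    have h7 := congrArg (Nat.cast : ℕ → ℤ) h4
    have h8 : p u + ((ℓ u + 1 : ℕ) : ZMod N) = p i ↔ p u + (ℓ u : ℕ) = p i - 1 := (h2 _).symm
    simp only [h8] at h7 ⊢
    push_cast at h7 h1 ⊢
    linarith
  · rw [startJ_of_notMem ha]
    simp only [Nat.cast_zero, sub_zero, add_zero, zero_mul]
    exact h1

open Classical in
theorem imageCount_eq_add_start (k : ZMod N) : imageCount p ℓ k 0 = imageCount p ℓ k 1 +
    ∑ i, if p i = k then 1 else 0 := by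
  rw [imageCount_eq_sum, imageCount_eq_sum, ← Finset.sum_add_distrib]
  refine Finset.sum_congr rfl fun i _ => ?_
  rw [Finset.sum_range_succ', Finset.sum_range_succ']
  simp

open Classical in
theorem sum_ite_mul_ite [NeZero N] (x y : ZMod N) : (∑ j with j ∈ J,
    (if x = j then 1 else 0) * (if y = j then 1 else 0) : ℤ) =
      (if x ∈ J then 1 else 0) * if x = y then 1 else 0 := by
  rw [Finset.sum_filter, Finset.sum_eq_single x]
  · by_cases h : x = y
    · simp [h]
    · simp [h, Ne.symm h]
  · intro b _ hb
    simp [hb.symm]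
  · simp

open Classical in
theorem two_mul_card_strCoord [NeZero N] :
    2 * ((Fintype.card {z : Str ℓ × I // StrCoord J p ℓ z.1 z.2} : ℤ) -
      Fintype.card {z : Str ℓ × I // StrCoord ∅ p ℓ z.1 z.2}) =
      -(∑ j with j ∈ J, ((imageCount p ℓ (j + 1) 0 : ℤ) - imageCount p ℓ j 0) ^ 2) -
      ∑ u, ∑ i, if p u = p i ∧ ℓ u = ℓ i then ((startJ J p i : ℤ) - endJ J p ℓ i) ^ 2 else 0 := by
  have h0 : ∀ i, startJ ∅ p i = 0 := fun i => startJ_of_notMem (by simp)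
  have h0' : ∀ i, endJ ∅ p ℓ i = 0 := fun i => if_neg (by simp)
  have hb : ∀ i, endJ J p ℓ i = 0 ∨ endJ J p ℓ i = 1 := fun i => by unfold endJ; split_ifs <;> simp
  have ha : ∀ i, (startJ J p i : ℤ) = if p i - 1 ∈ J then 1 else 0 := fun i => by
    unfold startJ; split_ifs <;> simp
  have hb' : ∀ i, (endJ J p ℓ i : ℤ) = if p i + (ℓ i : ℕ) ∈ J then 1 else 0 := fun i => by
    unfold endJ; split_ifs <;> simp
  let F : I → I → ℤ := fun u i =>
    (startJ J p i * if p u + (ℓ u : ℕ) = p i - 1 then 1 else 0) -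
      (startJ J p i * if p u = p i ∧ ℓ u + endJ J p ℓ i ≤ ℓ i then 1 else 0) -
      endJ J p ℓ i * if p u + (ℓ u : ℕ) = p i + (ℓ i : ℕ) ∧ ℓ i ≤ ℓ u then 1 else 0
  have h1 : (Fintype.card {z : Str ℓ × I // StrCoord J p ℓ z.1 z.2} : ℤ) -
      Fintype.card {z : Str ℓ × I // StrCoord ∅ p ℓ z.1 z.2} = ∑ u, ∑ i, F u i := by
    rw [card_strCoord, card_strCoord]
    simp only [Nat.cast_sum (R := ℤ) (s := (Finset.univ : Finset I)), ← Finset.sum_sub_distrib]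
    refine Finset.sum_congr rfl fun u _ => Finset.sum_congr rfl fun i _ => ?_
    rw [sum_range_strCoord, h0, h0']
    simp only [F, Nat.cast_zero, sub_zero, add_zero]
    ring
  let c : I → ZMod N → ℤ := fun i j =>
    (if p i - 1 = j then 1 else 0) - if p i + (ℓ i : ℕ) = j then 1 else 0
  have h2 : ∀ j, (imageCount p ℓ (j + 1) 0 : ℤ) - imageCount p ℓ j 0 = ∑ i, c i j := by
    intro j
    rw [imageCount_eq_add_start, imageCount_eq_add p ℓ j 0]
    simp only [c, Finset.sum_sub_distrib, Nat.zero_le, and_true, sub_eq_iff_eq_add]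
    push_cast
    ring
  have h3 : ∀ u i, F u i + F i u = -(∑ j with j ∈ J, c u j * c i j) -
      if p u = p i ∧ ℓ u = ℓ i then ((startJ J p i : ℤ) - endJ J p ℓ i) ^ 2 else 0 := by
    intro u i
    have h4 : (∑ j with j ∈ J, c u j * c i j) =
        startJ J p i * (if p u = p i then 1 else 0) -
        startJ J p i * (if p u + (ℓ u : ℕ) = p i - 1 then 1 else 0) -
        startJ J p u * (if p i + (ℓ i : ℕ) = p u - 1 then 1 else 0) +
        endJ J p ℓ i * if p u + (ℓ u : ℕ) = p i + (ℓ i : ℕ) then 1 else 0 := by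
      have hs : ∀ x y : ZMod N, ((if x ∈ J then 1 else 0) * if x = y then 1 else 0 : ℤ) =
          (if y ∈ J then 1 else 0) * if x = y then 1 else 0 := by
        intro x y
        by_cases h : x = y
        · rw [h]
        · simp [h]
      simp only [c, sub_mul, mul_sub, Finset.sum_sub_distrib, sum_ite_mul_ite, ha, hb']
      rw [hs (p u - 1) (p i - 1), hs _ (p i - 1), hs (p u + _) (p i + _)]
      simp only [sub_left_inj, @eq_comm _ (p i + (ℓ i : ℕ)) (p u - 1)]
      ring
    rw [h4]
    have e1 : (startJ J p i * (if p u = p i ∧ ℓ u + endJ J p ℓ i ≤ ℓ i then 1 else 0) +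
        startJ J p u * if p i = p u ∧ ℓ i + endJ J p ℓ u ≤ ℓ u then 1 else 0 : ℤ) =
        startJ J p i * (if p u = p i then 1 else 0) +
          if p u = p i ∧ ℓ u = ℓ i then (startJ J p i : ℤ) * (1 - 2 * endJ J p ℓ i) else 0 := by
      by_cases hp : p u = p i
      · have hau : startJ J p u = startJ J p i := by rw [startJ, startJ, hp]
        have hu := hb u
        have hi := hb i
        rcases lt_trichotomy (ℓ u) (ℓ i) with hl | hl | hl
        · have c1 : ℓ u + endJ J p ℓ i ≤ ℓ i := by omega
          have c2 : ¬ℓ i + endJ J p ℓ u ≤ ℓ u := by omega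
          simp [hp, c1, c2, hl.ne]
        · have hbu : endJ J p ℓ u = endJ J p ℓ i := by rw [endJ, endJ, hp, hl]
          rcases hi with hi | hi <;> simp [hp, hl, hau, hbu, hi]
        · have c1 : ¬ℓ u + endJ J p ℓ i ≤ ℓ i := by omega
          have c2 : ℓ i + endJ J p ℓ u ≤ ℓ u := by omega
          simp [hp, c1, c2, hl.ne', hau]
      · simp [hp, Ne.symm hp]
    have e2 : (endJ J p ℓ i * (if p u + (ℓ u : ℕ) = p i + (ℓ i : ℕ) ∧ ℓ i ≤ ℓ u then 1 else 0) +
        endJ J p ℓ u * if p i + (ℓ i : ℕ) = p u + (ℓ u : ℕ) ∧ ℓ u ≤ ℓ i then 1 else 0 : ℤ) =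
        endJ J p ℓ i * (if p u + (ℓ u : ℕ) = p i + (ℓ i : ℕ) then 1 else 0) +
          if p u = p i ∧ ℓ u = ℓ i then (endJ J p ℓ i : ℤ) else 0 := by
      by_cases hq : p u + (ℓ u : ℕ) = p i + (ℓ i : ℕ)
      · have hbu : endJ J p ℓ u = endJ J p ℓ i := by rw [endJ, endJ, hq]
        rcases lt_trichotomy (ℓ u) (ℓ i) with hl | hl | hl
        · simp [hq, hbu, hl.le, hl.not_ge, hl.ne]
        · have hp : p u = p i := by rwa [hl, add_left_inj] at hq
          simp [hbu, hl, hp]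
        · simp [hq, hl.le, hl.not_ge, hl.ne']
      · have hs : ¬(p u = p i ∧ ℓ u = ℓ i) := fun h => hq (by rw [h.1, h.2])
        simp [hq, Ne.symm hq, hs]
    have e3 : (if p u = p i ∧ ℓ u = ℓ i then ((startJ J p i : ℤ) - endJ J p ℓ i) ^ 2 else 0) =
        (if p u = p i ∧ ℓ u = ℓ i then (startJ J p i : ℤ) * (1 - 2 * endJ J p ℓ i) else 0) +
          if p u = p i ∧ ℓ u = ℓ i then (endJ J p ℓ i : ℤ) else 0 := by
      by_cases hs : p u = p i ∧ ℓ u = ℓ i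
      · rw [if_pos hs, if_pos hs, if_pos hs, ha, hb']
        split_ifs <;> norm_num
      · rw [if_neg hs, if_neg hs, if_neg hs, add_zero]
    rw [e3]
    simp only [F]
    linarith
  have h5 : ∑ u, ∑ i, F u i = ∑ u, ∑ i, F i u := Finset.sum_comm
  rw [h1, two_mul]
  nth_rewrite 2 [h5]
  simp only [← Finset.sum_add_distrib, h3, Finset.sum_sub_distrib, Finset.sum_neg_distrib]
  congr 2
  simp only [h2, pow_two, Finset.sum_mul_sum]
  rw [Finset.sum_comm' (t' := Finset.univ) (s' := fun _ => Finset.univ.filter (· ∈ J)) (by simp)]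
  refine Finset.sum_congr rfl fun u _ => ?_
  rw [Finset.sum_comm]

end Exponent

section Weights

variable {N D : ℕ} [NeZero N] {J : Set (ZMod N)}

/-- `(-𝕃^{1/2})^{(2 - e) n²} / [GL_n]`. -/
def nilWeight (e : ℤ) (n : ℕ) : Mot :=
  (((-sqrtL) ^ ((2 - e) * (n : ℤ) ^ 2) : Motˣ) : Mot) * Ring.inverse (motiveGL n)

/-- Whether exactly one end of the string is adjacent to `J`. -/
def typeSign (J : Set (ZMod N)) (t : ZMod N × Fin D) : ℤ :=
  ((startJ J Prod.fst t : ℤ) - endJ J Prod.fst (fun t : ZMod N × Fin D => (t.2 : ℕ)) t) ^ 2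

theorem val_neg_sqrtL_zpow_two_mul (n : ℕ) : (((-sqrtL) ^ (2 * (n : ℤ)) : Motˣ) : Mot) = LL ^ n := by
  rw [zpow_mul, LL, show ((2 : ℤ)) = ((2 : ℕ) : ℤ) from rfl, zpow_natCast, zpow_natCast, neg_sq]
  push_cast
  rfl

open Classical in
theorem two_mul_card_strCoord_type (m : ZMod N × Fin D → ℕ) {α : ZMod N → ℕ}
    (hα : ∀ k, α k = (∑ t, m t • strDim t : ZMod N →₀ ℕ) k) :
    (∑ j with j ∈ J, ((α (j + 1) : ℤ) - α j) ^ 2) + 2 * (Fintype.card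
        {z : Str (slen m) × StrIdx m // StrCoord J (spos m) (slen m) z.1 z.2} : ℤ) =
      2 * (Fintype.card {z : Str (slen m) × StrIdx m // RadCoord m z.1 z.2} : ℤ) +
        ∑ t, (2 - typeSign J t) * (m t : ℤ) ^ 2 := by
  have h := two_mul_card_strCoord J (spos m) (slen m)
  have h1 : ∀ k, imageCount (spos m) (slen m) k 0 = α k := by
    intro k
    rw [hα, ← card_strDeg, imageCount, Nat.card_eq_fintype_card]
    simp
  have h2 : (∑ u, ∑ i, if spos m u = spos m i ∧ slen m u = slen m i then
      ((startJ J (spos m) i : ℤ) - endJ J (spos m) (slen m) i) ^ 2 else 0) =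
      ∑ t, typeSign J t * (m t : ℤ) ^ 2 := by
    have h3 : ∀ u i : StrIdx m, (if spos m u = spos m i ∧ slen m u = slen m i then
        ((startJ J (spos m) i : ℤ) - endJ J (spos m) (slen m) i) ^ 2 else 0) =
        if u.1 = i.1 then typeSign J u.1 else 0 := by
      intro u i
      have h4 : (spos m u = spos m i ∧ slen m u = slen m i) ↔ u.1 = i.1 :=
        ⟨fun h => Prod.ext h.1 (Fin.ext h.2), fun h => ⟨congrArg Prod.fst h,
          congrArg (fun t => (t.2 : ℕ)) h⟩⟩
      rw [if_congr h4 rfl rfl]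
      by_cases h5 : u.1 = i.1
      · rw [if_pos h5, if_pos h5, h5]
        rfl
      · rw [if_neg h5, if_neg h5]
    simp only [h3, Fintype.sum_sigma, Finset.sum_const, Finset.card_univ, Fintype.card_fin,
      Finset.smul_sum, smul_ite, smul_zero]
    refine Finset.sum_congr rfl fun t _ => ?_
    rw [Finset.sum_ite_eq, if_pos (Finset.mem_univ t)]
    simp only [nsmul_eq_mul]
    ring
  rw [card_strCoord_empty, h2] at h
  simp only [h1] at h
  simp only [sub_mul, Finset.sum_sub_distrib, ← Finset.mul_sum]
  push_cast at h
  linarith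

open Classical in
theorem mu_nilReps_eq_sum_prod (hJ : ∀ k ∈ J, k + 1 ∉ J) {α : ZMod N →₀ ℕ} (hD : ∑ k, α k ≤ D) :
    (((-sqrtL) ^ (∑ j with j ∈ J, ((α (j + 1) : ℤ) - α j) ^ 2) : Motˣ) : Mot) *
      (mu (nilReps J (Sigma.fst : ((k : ZMod N) × Fin (α k)) → ZMod N)) *
        Ring.inverse (motiveG fun k => α k)) =
      ∑ m ∈ Fintype.piFinset (fun _ : ZMod N × Fin D => Finset.range (D + 1)) with
        ∑ t, m t • strDim t = α, ∏ t, nilWeight (typeSign J t) (m t) := by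
  rw [mu_nilReps hJ hD, Finset.mul_sum]
  refine Finset.sum_congr rfl fun m hm => ?_
  have h := two_mul_card_strCoord_type (J := J) m (α := α) fun k => by
    rw [(Finset.mem_filter.1 hm).2]
  have h1 : (((-sqrtL) ^ (∑ j with j ∈ J, ((α (j + 1) : ℤ) - α j) ^ 2) : Motˣ) : Mot) *
      LL ^ Fintype.card {z : Str (slen m) × StrIdx m // StrCoord J (spos m) (slen m) z.1 z.2} =
      (∏ t, nilWeight (typeSign J t) (m t)) * mu (strAut (spos m) (slen m)) := by
    have h2 : (∏ t, nilWeight (typeSign J t) (m t)) * ∏ t, motiveGL (m t) =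
        (((-sqrtL) ^ ∑ t, (2 - typeSign J t) * (m t : ℤ) ^ 2 : Motˣ) : Mot) := by
      have hz : ∀ (s : Finset (ZMod N × Fin D)) (f : ZMod N × Fin D → ℤ),
          (-sqrtL) ^ ∑ t ∈ s, f t = ∏ t ∈ s, (-sqrtL) ^ f t := by
        intro s f
        induction s using Finset.induction_on with
        | empty => simp
        | insert a s ha ih => rw [Finset.sum_insert ha, Finset.prod_insert ha, zpow_add, ih]
      rw [← Finset.prod_mul_distrib, hz, Units.coe_prod]
      refine Finset.prod_congr rfl fun t _ => ?_
      rw [nilWeight, mul_assoc, Ring.inverse_mul_cancel _ (isUnit_motiveGL _), mul_one]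
    rw [mu_strAut, ← mul_assoc, h2, ← val_neg_sqrtL_zpow_two_mul, ← val_neg_sqrtL_zpow_two_mul,
      ← Units.val_mul, ← Units.val_mul, ← zpow_add, ← zpow_add, h, add_comm]
  have e1 := Ring.mul_inverse_cancel (mu (strAut (spos m) (slen m))) (by
    rw [mu_strAut]
    exact (IsUnit.prod_iff.2 fun _ _ => isUnit_motiveGL _).mul (isUnit_LL.pow _))
  rw [← mul_assoc, h1, mul_assoc, e1, mul_one]

end Weights

/-! ## The coefficients of the series -/

section Coefficients

variable {N₀ N₁ : ℕ} {σ : TrapezoidPartition N₀ N₁} [NeZero (N₀ + N₁)] {N' : ℕ}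

open Classical in
/-- The exponent `∑_{j ∈ J} (α_{j+1} - α_j)²`. -/
def jump {N : ℕ} [NeZero N] (J : Set (ZMod N)) (α : ZMod N → ℕ) : ℤ :=
  ∑ j with j ∈ J, ((α (j + 1) : ℤ) - α j) ^ 2

theorem motiveG_const (N a : ℕ) [NeZero N] : motiveG (fun _ : ZMod N => a) = motiveGL a ^ N := by
  rw [motiveG, Finset.prod_const, Finset.card_univ, ZMod.card]

theorem coeff_nilpotentSeries (hN' : N' ≤ N₀ + N₁)
    (hσ : σ.loopVertices = {k : ZMod (N₀ + N₁) | k.val < N'}) (α : ZMod (N₀ + N₁) →₀ ℕ) :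
    MvPowerSeries.coeff α (σ.nilpotentSeries N') =
      (((-sqrtL) ^ jump (I₂ (N₀ + N₁) N') α : Motˣ) : Mot) *
        (mu (nilReps (I₂ (N₀ + N₁) N') (Sigma.fst : ((k : ZMod (N₀ + N₁)) × Fin (α k)) → _)) *
          Ring.inverse (motiveG α)) := by
  change _ * (σ.motiveNilpotent N' α * _) = _
  rw [TrapezoidPartition.motiveNilpotent, motive_eq_mu]
  have h := TrapezoidPartition.mu_truncatedReps (α := α) (special_hloop hN' hσ)
    (special_hJ hN' (even_sub_of_loopVertices hN' hσ)) {H | IsNilpotent H}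
  exact congrArg₂ (· * ·) rfl (congrArg₂ (· * ·) h rfl)

theorem coeff_invertibleSeries (hN' : N' ≤ N₀ + N₁)
    (hσ : σ.loopVertices = {k : ZMod (N₀ + N₁) | k.val < N'}) (a : ℕ) :
    PowerSeries.coeff a (σ.invertibleSeries N') =
      mu (invReps (I₂ (N₀ + N₁) N') (Sigma.fst : ((_ : ZMod (N₀ + N₁)) × Fin a) → _)) *
        Ring.inverse (motiveG fun _ : ZMod (N₀ + N₁) => a) := by
  rw [TrapezoidPartition.invertibleSeries, PowerSeries.coeff_mk, motiveG_const,
    TrapezoidPartition.motiveInvertible, motive_eq_mu]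
  congr 1
  exact TrapezoidPartition.mu_truncatedReps (α := fun _ => a) (special_hloop hN' hσ)
    (special_hJ hN' (even_sub_of_loopVertices hN' hσ)) {H | IsUnit H}

theorem coeff_invertibleSeries_eq_sum (hN' : N' ≤ N₀ + N₁)
    (hσ : σ.loopVertices = {k : ZMod (N₀ + N₁) | k.val < N'}) {a D : ℕ} (hD : a ≤ D) :
    PowerSeries.coeff a (σ.invertibleSeries N') =
      ∑ m ∈ Fintype.piFinset (fun _ : Fin D => Finset.range (a + 1)) with
        ∑ i : Fin D, ((i : ℕ) + 1) * m i = a, LL ^ ∑ i, m i := by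
  have h1 := mu_invReps (a := a) (special_hJ hN' (even_sub_of_loopVertices hN' hσ))
  rw [commMot_eq hD] at h1
  have e0 := Ring.mul_inverse_cancel _ (isUnit_motiveGL a)
  have e1 := Ring.mul_inverse_cancel _ ((isUnit_motiveGL a).pow (N₀ + N₁))
  rw [coeff_invertibleSeries hN' hσ, motiveG_const]
  set R := Ring.inverse (motiveGL a ^ (N₀ + N₁))
  set M := mu (invReps (I₂ (N₀ + N₁) N') (Sigma.fst : ((_ : ZMod (N₀ + N₁)) × Fin a) → _))
  set Z := ∑ m ∈ Fintype.piFinset (fun _ : Fin D => Finset.range (a + 1)) with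
        ∑ i : Fin D, ((i : ℕ) + 1) * m i = a, LL ^ ∑ i, m i
  linear_combination (R * Ring.inverse (motiveGL a)) * h1 - M * R * e0 + 
    Z * motiveGL a * Ring.inverse (motiveGL a) * e1 + Z * e0

theorem dim_eq_jump (hN' : N' ≤ N₀ + N₁)
    (hσ : σ.loopVertices = {k : ZMod (N₀ + N₁) | k.val < N'}) (α : ZMod (N₀ + N₁) → ℕ)
    [DecidablePred (· ∈ σ.cut N')] :
    (∑ v, (α v : ℤ) ^ 2) - σ.quiver.dimRep α +
      2 * (∑ a with a ∈ σ.cut N', α (σ.quiver.tgt a) * α (σ.quiver.src a) : ℕ) =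
      jump (I₂ (N₀ + N₁) N') α := by
  classical
  have hl := special_hloop hN' hσ
  have hJ := special_hJ hN' (even_sub_of_loopVertices hN' hσ)
  set J := I₂ (N₀ + N₁) N' with hJdef
  have h1 : (σ.quiver.dimRep α : ℤ) = 2 * (∑ j, (α (j + 1) : ℤ) * α j) +
      ∑ k, if k ∈ J ∨ k - 1 ∈ J then 0 else (α k : ℤ) ^ 2 := by
    have h0 : (∑ k : {k // k ∈ σ.loopVertices}, (α k : ℤ) * α k) =
        ∑ k, if k ∈ J ∨ k - 1 ∈ J then 0 else (α k : ℤ) ^ 2 := by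
      rw [← Finset.sum_subtype (Finset.univ.filter (· ∈ σ.loopVertices)) (by simp)
        fun k => (α k : ℤ) * α k, Finset.sum_filter]
      refine Finset.sum_congr rfl fun k _ => ?_
      by_cases hk : k ∈ σ.loopVertices
      · rw [if_pos hk, if_neg (not_or.2 ((hl k).1 hk)), pow_two]
      · rw [if_neg hk, if_pos]
        by_contra h
        exact hk ((hl k).2 (not_or.1 h))
    rw [← h0, ArrowQuiver.dimRep, Fintype.sum_sum_type, Fintype.sum_sum_type]
    push_cast
    rw [two_mul, add_assoc]
    congr 2
    exact Finset.sum_congr rfl fun j _ => mul_comm _ _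
  have h2 : ((∑ a with a ∈ σ.cut N', α (σ.quiver.tgt a) * α (σ.quiver.src a) : ℕ) : ℤ) =
      ∑ j, if j ∈ J then 0 else (α (j + 1) : ℤ) * α j := by
    rw [Finset.sum_filter, Fintype.sum_sum_type, Fintype.sum_sum_type]
    simp only [TrapezoidPartition.hPlus_notMem_cut, TrapezoidPartition.hMinus_mem_cut,
      TrapezoidPartition.loop_notMem_cut, if_false, Finset.sum_const_zero, zero_add, add_zero]
    push_cast
    refine Finset.sum_congr rfl fun j _ => ?_
    rw [ite_not]
    exact if_congr Iff.rfl rfl (mul_comm _ _)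
  have h3 : ∀ k, (if k ∈ J ∨ k - 1 ∈ J then 0 else (α k : ℤ) ^ 2) =
      (α k : ℤ) ^ 2 - (if k ∈ J then (α k : ℤ) ^ 2 else 0) - if k - 1 ∈ J then (α k : ℤ) ^ 2 else 0 := by
    intro k
    by_cases hk : k ∈ J
    · have : k - 1 ∉ J := fun h => hJ _ h (by rwa [sub_add_cancel])
      simp [hk, this]
    · by_cases hk' : k - 1 ∈ J <;> simp [hk, hk']
  have h4 : (∑ k, if k - 1 ∈ J then (α k : ℤ) ^ 2 else 0) =
      ∑ k, if k ∈ J then (α (k + 1) : ℤ) ^ 2 else 0 := by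
    rw [← Equiv.sum_comp (Equiv.addRight (1 : ZMod (N₀ + N₁)))]
    simp
  rw [h1, h2, jump, Finset.sum_filter]
  simp only [h3, Finset.sum_sub_distrib, h4, Finset.mul_sum]
  rw [← sub_eq_zero]
  simp only [← Finset.sum_add_distrib, ← Finset.sum_sub_distrib]
  refine Finset.sum_eq_zero fun k _ => ?_
  split_ifs <;> ring

theorem coeff_universalSeries (hN' : N' ≤ N₀ + N₁)
    (hσ : σ.loopVertices = {k : ZMod (N₀ + N₁) | k.val < N'}) (α : ZMod (N₀ + N₁) →₀ ℕ) :
    MvPowerSeries.coeff α σ.universalSeries =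
      (((-sqrtL) ^ jump (I₂ (N₀ + N₁) N') α : Motˣ) : Mot) *
        (mu (jReps (I₂ (N₀ + N₁) N') (Sigma.fst : ((k : ZMod (N₀ + N₁)) × Fin (α k)) → _)) *
          Ring.inverse (motiveG α)) := by
  classical
  have hl := special_hloop hN' hσ
  have hJ := special_hJ hN' (even_sub_of_loopVertices hN' hσ)
  change σ.quiver.virtualCrit σ.potential α * Ring.inverse (virtualG (α : ZMod (N₀ + N₁) → ℕ)) = _
  have h1 := TrapezoidPartition.mu_truncatedReps (α := α) hl hJ Set.univ
  simp only [Set.mem_univ, Set.ofPred_true, Set.inter_univ, and_true, Set.ofPred_mem_eq] at h1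
  have h2 := ArrowQuiver.vanishingCycle_eq (TrapezoidPartition.isCut hl hJ) α
  rw [ArrowQuiver.virtualCrit, h2, ← dim_eq_jump hN' hσ, virtualG]
  have h3 : Ring.inverse (((-sqrtL) ^ (-(∑ v, (α v : ℤ) ^ 2)) : Motˣ) : Mot) =
      (((-sqrtL) ^ (∑ v, (α v : ℤ) ^ 2) : Motˣ) : Mot) := by
    rw [Ring.inverse_unit, ← zpow_neg, neg_neg]
  rw [Ring.mul_inverse_rev, h3, sub_eq_add_neg (∑ v, (α v : ℤ) ^ 2), zpow_add, zpow_add,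
    Units.val_mul, Units.val_mul,
    val_neg_sqrtL_zpow_two_mul, h1]
  ring

/-- The dimension vector `(a, …, a)`. -/
def constDim (N a : ℕ) [NeZero N] : ZMod N →₀ ℕ := Finsupp.equivFunOnFinite.symm fun _ => a

theorem prod_X_eq {N : ℕ} [NeZero N] {R : Type*} [CommSemiring R] :
    (∏ i : ZMod N, MvPowerSeries.X i : MvPowerSeries (ZMod N) R) =
      MvPowerSeries.monomial (constDim N 1) 1 := by
  have h : (∑ i : ZMod N, Finsupp.single i 1 : ZMod N →₀ ℕ) = constDim N 1 := by
    ext k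
    simp [constDim, Finsupp.finsetSum_apply, Finsupp.single_apply]
  rw [← h]
  simp [MvPowerSeries.X, MvPowerSeries.prod_monomial]

theorem coeff_subst_prod_X {N : ℕ} [NeZero N] {R : Type*} [CommRing R] (F : PowerSeries R)
    (β : ZMod N →₀ ℕ) : MvPowerSeries.coeff β (PowerSeries.subst
        (∏ i : ZMod N, MvPowerSeries.X i : MvPowerSeries (ZMod N) R) F) =
      if β = constDim N (β 0) then PowerSeries.coeff (β 0) F else 0 := by
  have h0 : PowerSeries.HasSubst (∏ i : ZMod N, MvPowerSeries.X i : MvPowerSeries (ZMod N) R) :=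
    PowerSeries.HasSubst.of_constantCoeff_zero (by simp [map_prod, NeZero.ne N])
  have h1 : ∀ d : ℕ, d • constDim N 1 = constDim N d := fun d => by
    ext k
    simp [constDim]
  rw [PowerSeries.coeff_subst h0, prod_X_eq]
  simp only [MvPowerSeries.monomial_pow, one_pow, MvPowerSeries.coeff_monomial, h1]
  rw [finsum_eq_single _ (β 0)]
  · split_ifs <;> simp
  · intro d hd
    rw [if_neg, smul_zero]
    rintro h
    exact hd (by rw [h]; rfl)

theorem universalSeries_eq (hN' : N' ≤ N₀ + N₁)
    (hσ : σ.loopVertices = {k : ZMod (N₀ + N₁) | k.val < N'}) :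
    σ.universalSeries = PowerSeries.subst
      (∏ i : ZMod (N₀ + N₁), MvPowerSeries.X i : MvPowerSeries (ZMod (N₀ + N₁)) Mot)
          (σ.invertibleSeries N') * σ.nilpotentSeries N' := by
  classical
  ext α
  have hJ := special_hJ hN' (even_sub_of_loopVertices hN' hσ)
  rw [coeff_universalSeries hN' hσ, mu_jReps_eq_sum hJ, MvPowerSeries.coeff_mul, Finset.mul_sum]
  simp only [coeff_subst_prod_X, ite_mul, zero_mul]
  rw [← Finset.sum_filter]
  refine Finset.sum_bij (fun a _ => (constDim (N₀ + N₁) a, α - constDim (N₀ + N₁) a)) ?_ ?_ ?_ ?_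
  · intro a ha
    have ha := (Finset.mem_filter.1 ha).2
    exact Finset.mem_filter.2 ⟨Finset.HasAntidiagonal.mem_antidiagonal.2 (add_tsub_cancel_of_le ha), rfl⟩
  · intro a _ b _ h
    exact DFunLike.congr_fun (congrArg Prod.fst h) 0
  · rintro ⟨β, γ⟩ h
    obtain ⟨h1, h2⟩ := Finset.mem_filter.1 h
    have h1 : β + γ = α := Finset.HasAntidiagonal.mem_antidiagonal.1 h1
    have h2 : β = constDim _ (β 0) := h2
    have h3 : ∀ k, β 0 ≤ α k := fun k => by
      have h4 : β k = β 0 := DFunLike.congr_fun h2 k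
      rw [← h1, ← h4]
      exact Nat.le_add_right _ _
    refine ⟨β 0, Finset.mem_filter.2 ⟨Finset.mem_range.2 (Nat.lt_succ_of_le (h3 0)), h3⟩, ?_⟩
    rw [← h2, ← h1, add_tsub_cancel_left]
  · intro a ha
    have ha := (Finset.mem_filter.1 ha).2
    have h1 : jump (I₂ (N₀ + N₁) N') (α - constDim (N₀ + N₁) a : ZMod (N₀ + N₁) →₀ ℕ) =
        jump (I₂ (N₀ + N₁) N') α := by
      refine Finset.sum_congr rfl fun j _ => ?_
      change (((α (j + 1) - a : ℕ) : ℤ) - ((α j - a : ℕ) : ℤ)) ^ 2 = _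
      rw [Nat.cast_sub (ha _), Nat.cast_sub (ha _), sub_sub_sub_cancel_right]
    rw [coeff_nilpotentSeries hN' hσ, h1]
    change _ = PowerSeries.coeff a _ * _
    rw [coeff_invertibleSeries hN' hσ]
    exact mul_left_comm _ _ _

end Coefficients

/-! ## The plethystic exponential of a sum of monomials -/

section Plethystic

open MvPowerSeries

variable {τ K : Type} [Field K]

/-- The Euler derivation. -/
def euler : Derivation K (MvPowerSeries τ K) (MvPowerSeries τ K) :=
  Derivation.mk'
    { toFun := fun f α => (α.degree : K) * f α
      map_add' := fun f g => funext fun α => mul_add _ _ _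
      map_smul' := fun a f => funext fun α => mul_left_comm _ _ _ } fun f g => by
    classical
    ext α
    change (α.degree : K) * coeff α (f * g) = _
    rw [smul_eq_mul, smul_eq_mul, mul_comm g, map_add, coeff_mul, coeff_mul, coeff_mul,
      Finset.mul_sum, ← Finset.sum_add_distrib]
    refine Finset.sum_congr rfl fun p hp => ?_
    rw [← Finset.HasAntidiagonal.mem_antidiagonal.1 hp, map_add Finsupp.degree, Nat.cast_add]
    change _ = coeff p.1 f * ((p.2.degree : K) * coeff p.2 g) + (p.1.degree : K) * coeff p.1 f * _
    ring

theorem coeff_euler (f : MvPowerSeries τ K) (α : τ →₀ ℕ) :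
    coeff α (euler f) = (α.degree : K) * coeff α f := rfl

theorem coeff_pow_eq_zero {G : MvPowerSeries τ K} (h0 : coeff 0 G = 0) (n : ℕ) :
    ∀ α : τ →₀ ℕ, α.degree < n → coeff α (G ^ n) = 0 := by
  classical
  induction n with
  | zero => exact fun α h => absurd h (Nat.not_lt_zero _)
  | succ n ih =>
    intro α h
    rw [pow_succ, coeff_mul]
    refine Finset.sum_eq_zero fun p hp => ?_
    rw [← Finset.HasAntidiagonal.mem_antidiagonal.1 hp, map_add] at h
    by_cases h1 : p.1.degree < n
    · rw [ih _ h1, zero_mul]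
    · rw [(Finsupp.degree_eq_zero_iff p.2).1 (by omega), h0, mul_zero]

theorem euler_prod {T : Type} (s : Finset T) (W H : T → MvPowerSeries τ K)
    (h : ∀ t, euler (W t) = W t * H t) : euler (∏ t ∈ s, W t) = (∏ t ∈ s, W t) * ∑ t ∈ s, H t := by
  classical
  induction s using Finset.induction_on with
  | empty => simp
  | insert a s ha ih =>
    rw [Finset.prod_insert ha, Finset.sum_insert ha, Derivation.leibniz, ih, h a, smul_eq_mul,
      smul_eq_mul]
    ring

variable [Algebra ℚ K] [Finite τ]

theorem coeff_exp_subst {G : MvPowerSeries τ K} (h0 : coeff 0 G = 0) (α : τ →₀ ℕ) {M : ℕ}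
    (hM : α.degree < M) : coeff α (PowerSeries.subst G (PowerSeries.exp K)) =
      coeff α (∑ n ∈ Finset.range M, algebraMap ℚ K (1 / n.factorial) • G ^ n) := by
  rw [PowerSeries.coeff_subst (PowerSeries.HasSubst.of_constantCoeff_zero h0), map_sum,
    finsum_eq_sum_of_support_subset]
  · refine Finset.sum_congr rfl fun n _ => ?_
    rw [PowerSeries.coeff_exp]
    rfl
  · intro n hn
    by_contra h
    rw [Finset.mem_coe, Finset.mem_range] at h
    refine hn ?_
    change _ • _ = _
    rw [coeff_pow_eq_zero h0 n α (by omega), smul_zero]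

theorem euler_exp {G : MvPowerSeries τ K} (h0 : coeff 0 G = 0) :
    euler (PowerSeries.subst G (PowerSeries.exp K)) =
      PowerSeries.subst G (PowerSeries.exp K) * euler G := by
  classical
  ext α
  rw [coeff_euler, coeff_exp_subst h0 α (M := α.degree + 1 + 1) (by omega), ← coeff_euler,
    coeff_mul, map_sum, Finset.sum_range_succ']
  have h1 : ∀ n : ℕ, euler (algebraMap ℚ K (1 / (n + 1).factorial) • G ^ (n + 1)) =
      algebraMap ℚ K (1 / n.factorial) • G ^ n * euler G := by
    intro n
    rw [Derivation.map_smul, Derivation.leibniz_pow, Nat.add_sub_cancel, smul_eq_mul, smul_mul_assoc,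
      ← Nat.cast_smul_eq_nsmul K, smul_smul]
    congr 1
    rw [← map_natCast (algebraMap ℚ K), ← map_mul]
    congr 1
    rw [Nat.factorial_succ]
    push_cast
    have : (n.factorial : ℚ) ≠ 0 := by exact_mod_cast n.factorial_ne_zero
    field_simp
  have h2 : euler (algebraMap ℚ K (1 / Nat.factorial 0) • G ^ 0) = 0 := by simp
  rw [h2, add_zero, Finset.sum_congr rfl fun n _ => h1 n, ← Finset.sum_mul, coeff_mul]
  refine Finset.sum_congr rfl fun p hp => ?_
  rw [coeff_exp_subst h0 p.1 (M := α.degree + 1)]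
  rw [← Finset.HasAntidiagonal.mem_antidiagonal.1 hp, map_add]
  omega

/-- A solution of `θ Q = Q θ G` is determined by its constant term, degree by degree. -/
theorem coeff_eq_of_euler {P Q G H : MvPowerSeries τ K} (hP : euler P = P * euler G)
    (hQ : euler Q = Q * H) (hPQ : coeff 0 P = coeff 0 Q) {D : ℕ}
    (hG : ∀ α : τ →₀ ℕ, α.degree ≤ D → coeff α (euler G) = coeff α H) (n : ℕ) :
    ∀ α : τ →₀ ℕ, α.degree = n → n ≤ D → coeff α P = coeff α Q := by
  classical
  have := algebraRat.charZero K
  induction n using Nat.strong_induction_on with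
  | _ n ih =>
    intro α hα hn
    rcases Nat.eq_zero_or_pos n with rfl | hpos
    · rw [(Finsupp.degree_eq_zero_iff α).1 hα, hPQ]
    have h1 : (α.degree : K) ≠ 0 := Nat.cast_ne_zero.2 (by omega)
    refine mul_left_cancel₀ h1 ?_
    rw [← coeff_euler, ← coeff_euler, hP, hQ, coeff_mul, coeff_mul]
    refine Finset.sum_congr rfl fun p hp => ?_
    have h2 : p.1.degree + p.2.degree = n := by
      rw [← hα, ← Finset.HasAntidiagonal.mem_antidiagonal.1 hp, map_add]
    rw [← hG _ (by omega), coeff_euler]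
    rcases Nat.eq_zero_or_pos p.2.degree with h3 | h3
    · rw [h3, Nat.cast_zero, zero_mul, mul_zero, mul_zero]
    · rw [ih _ (by omega) p.1 rfl (by omega)]

open Classical in
theorem coeff_subst_monomial {δ : τ →₀ ℕ} (hδ : δ ≠ 0) (f : PowerSeries K) (α : τ →₀ ℕ) {M : ℕ}
    (hM : α.degree < M) : coeff α (PowerSeries.subst (monomial δ (1 : K)) f) =
      ∑ d ∈ Finset.range M, if d • δ = α then PowerSeries.coeff d f else 0 := by
  rw [PowerSeries.coeff_subst (PowerSeries.HasSubst.monomial hδ 1),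
    finsum_eq_sum_of_support_subset (s := Finset.range M)]
  · refine Finset.sum_congr rfl fun d _ => ?_
    rw [monomial_pow, one_pow, coeff_monomial, smul_ite, smul_zero, smul_eq_mul, mul_one]
    exact if_congr eq_comm rfl rfl
  · intro d hd
    by_contra h
    rw [Finset.mem_coe, Finset.mem_range] at h
    refine hd ?_
    change _ • _ = _
    rw [monomial_pow, one_pow, coeff_monomial, if_neg, smul_zero]
    rintro rfl
    have h1 : δ.degree ≠ 0 := fun h => hδ ((Finsupp.degree_eq_zero_iff δ).1 h)
    rw [map_nsmul, smul_eq_mul] at hM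
    have := Nat.le_mul_of_pos_right d (Nat.pos_of_ne_zero h1)
    omega

theorem euler_subst_monomial {δ : τ →₀ ℕ} (hδ : δ ≠ 0) (f : PowerSeries K) :
    euler (PowerSeries.subst (monomial δ (1 : K)) f) = (δ.degree : K) •
      PowerSeries.subst (monomial δ (1 : K)) (PowerSeries.mk fun d => d * PowerSeries.coeff d f) := by
  classical
  ext α
  rw [coeff_euler, map_smul, coeff_subst_monomial hδ _ _ α.degree.lt_succ_self,
    coeff_subst_monomial hδ _ _ α.degree.lt_succ_self, Finset.mul_sum, Finset.smul_sum]
  refine Finset.sum_congr rfl fun d _ => ?_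
  split_ifs with h
  · rw [← h, map_nsmul, PowerSeries.coeff_mk, smul_eq_mul, smul_eq_mul, Nat.cast_mul]
    ring
  · rw [mul_zero, smul_zero]

open Classical in
theorem coeff_prod_subst_monomial {T : Type} [Fintype T] {δ : T → τ →₀ ℕ} (hδ : ∀ t, δ t ≠ 0)
    (f : T → PowerSeries K) {α : τ →₀ ℕ} {M : ℕ} (hM : α.degree < M) :
    coeff α (∏ t, PowerSeries.subst (monomial (δ t) (1 : K)) (f t)) =
      ∑ m ∈ Fintype.piFinset (fun _ : T => Finset.range M) with ∑ t, m t • δ t = α,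
        ∏ t, PowerSeries.coeff (m t) (f t) := by
  trans coeff α (∏ t, ∑ d ∈ Finset.range M, monomial (d • δ t) (PowerSeries.coeff d (f t)))
  · rw [coeff_prod, coeff_prod]
    refine Finset.sum_congr rfl fun l hl => Finset.prod_congr rfl fun t _ => ?_
    have h1 : (l t).degree < M := by
      rw [Finset.mem_finsuppAntidiag] at hl
      refine lt_of_le_of_lt ?_ hM
      rw [← hl.1, map_sum]
      exact Finset.single_le_sum (f := fun t => (l t).degree) (fun _ _ => Nat.zero_le _)
        (Finset.mem_univ t)
    rw [coeff_subst_monomial (hδ t) _ _ h1, map_sum]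
    refine Finset.sum_congr rfl fun d _ => ?_
    rw [coeff_monomial]
    exact if_congr eq_comm rfl rfl
  · rw [Finset.prod_univ_sum, map_sum, Finset.sum_filter]
    refine Finset.sum_congr rfl fun m _ => ?_
    rw [prod_monomial, coeff_monomial]
    exact if_congr eq_comm rfl rfl

/-- The logarithmic derivative of the generating series of an atom of class `c`. -/
def adamsDeriv (c : RatFunc ℚ) : PowerSeries (RatFunc ℚ) :=
  PowerSeries.mk fun d => if d = 0 then 0 else adams (d - 1) c

theorem coeff_euler_adamsSum {T : Type} [Fintype T] {δ : T → τ →₀ ℕ} (hδ : ∀ t, δ t ≠ 0)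
    (c : T → RatFunc ℚ) {g : MvPowerSeries τ (RatFunc ℚ)} {α : τ →₀ ℕ}
    (hg : ∀ β : τ →₀ ℕ, β.degree ≤ α.degree →
      coeff β g = ∑ t, open Classical in if δ t = β then c t else 0) :
    coeff α (euler (adamsSum g)) = coeff α (∑ t, ((δ t).degree : RatFunc ℚ) •
      PowerSeries.subst (monomial (δ t) (1 : RatFunc ℚ)) (adamsDeriv (c t))) := by
  classical
  have hR : ∀ t, coeff α (((δ t).degree : RatFunc ℚ) •
      PowerSeries.subst (monomial (δ t) (1 : RatFunc ℚ)) (adamsDeriv (c t))) =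
      ∑ n ∈ Finset.range α.degree,
        if (n + 1) • δ t = α then ((δ t).degree : RatFunc ℚ) * adams n (c t) else 0 := by
    intro t
    rw [map_smul, coeff_subst_monomial (hδ t) _ _ α.degree.lt_succ_self, Finset.sum_range_succ']
    simp only [adamsDeriv, PowerSeries.coeff_mk, if_true, Nat.succ_ne_zero, if_false, ite_self,
      add_zero, Nat.add_sub_cancel, smul_eq_mul, Finset.mul_sum, mul_ite, mul_zero]
  rw [coeff_euler, map_sum, Finset.sum_congr rfl fun t _ => hR t, Finset.sum_comm]
  change _ * ∑ n ∈ Finset.range α.degree, _ = _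
  rw [Finset.mul_sum]
  refine Finset.sum_congr rfl fun n _ => ?_
  split_ifs with h
  · set β := α.mapRange (· / (n + 1)) (Nat.zero_div _) with hβ
    have h1 : (n + 1) • β = α := Finsupp.ext fun i => Nat.mul_div_cancel' (h i)
    have h2 : α.degree = (n + 1) * β.degree := by rw [← h1, map_nsmul, smul_eq_mul]
    have h3 : ((n + 1 : ℕ) : RatFunc ℚ) ≠ 0 := Nat.cast_ne_zero.2 n.succ_ne_zero
    rw [hg β (by rw [h2]; exact Nat.le_mul_of_pos_left _ n.succ_pos), map_sum, Finset.mul_sum,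
      Finset.mul_sum]
    refine Finset.sum_congr rfl fun t _ => ?_
    by_cases h4 : δ t = β
    · rw [if_pos h4, if_pos (by rw [h4, h1]), h2, h4, Nat.cast_mul]
      field_simp
    · rw [if_neg h4, if_neg fun h5 => h4 ?_, map_zero, mul_zero, mul_zero]
      rw [← h1] at h5
      exact smul_right_injective _ n.succ_ne_zero h5
  · rw [mul_zero]
    refine (Finset.sum_eq_zero fun t _ => if_neg fun h1 => h fun i => ?_).symm
    rw [← h1]
    exact Dvd.intro _ rfl

theorem isPlethysticExp_of_atoms {F : MvPowerSeries τ Mot} {g : MvPowerSeries τ (RatFunc ℚ)}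
    (T : ℕ → Type) [∀ D, Fintype (T D)] (δ : ∀ D, T D → τ →₀ ℕ) (hδ : ∀ D t, δ D t ≠ 0)
    (c : ∀ D, T D → RatFunc ℚ) (w : ∀ D, T D → ℕ → CoeffRing) (hw0 : ∀ D t, w D t 0 = 1)
    (hw : ∀ D t (m : ℕ), (m + 1 : RatFunc ℚ) * toRatFunc (w D t (m + 1)) =
      ∑ n ∈ Finset.range (m + 1), adams n (c D t) * toRatFunc (w D t (m - n)))
    (hg : ∀ D (β : τ →₀ ℕ), β.degree ≤ D →
      coeff β g = ∑ t, open Classical in if δ D t = β then c D t else 0)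
    (hF : ∀ α : τ →₀ ℕ, coeff α F = open Classical in
      ∑ m ∈ Fintype.piFinset (fun _ : T α.degree => Finset.range (α.degree + 1)) with
        ∑ t, m t • δ _ t = α, ∏ t, toMot (w _ t (m t))) : IsPlethysticExp F g := by
  classical
  let E : MvPowerSeries τ CoeffRing := fun α =>
    ∑ m ∈ Fintype.piFinset (fun _ : T α.degree => Finset.range (α.degree + 1)) with
      ∑ t, m t • δ _ t = α, ∏ t, w _ t (m t)
  refine ⟨E, ?_, ?_⟩
  · ext α
    set D := α.degree with hD
    let f : T D → PowerSeries (RatFunc ℚ) := fun t => PowerSeries.mk fun d => toRatFunc (w D t d)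
    let W : T D → MvPowerSeries τ (RatFunc ℚ) := fun t =>
      PowerSeries.subst (monomial (δ D t) (1 : RatFunc ℚ)) (f t)
    have hW : ∀ t, euler (W t) = W t * (((δ D t).degree : RatFunc ℚ) •
        PowerSeries.subst (monomial (δ D t) (1 : RatFunc ℚ)) (adamsDeriv (c D t))) := by
      intro t
      have hs := PowerSeries.HasSubst.monomial (hδ D t) (1 : RatFunc ℚ)
      rw [euler_subst_monomial (hδ D t), mul_smul_comm, ← PowerSeries.subst_mul hs]
      congr 2
      ext m
      rw [PowerSeries.coeff_mk, mul_comm (f t), PowerSeries.coeff_mul,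
        Finset.Nat.sum_antidiagonal_eq_sum_range_succ_mk]
      cases m with
      | zero => simp [adamsDeriv]
      | succ m =>
        rw [Finset.sum_range_succ']
        simp only [adamsDeriv, f, PowerSeries.coeff_mk, if_true, zero_mul, add_zero,
          Nat.succ_ne_zero, if_false, Nat.add_sub_cancel, Nat.add_sub_add_right]
        rw [← hw, Nat.cast_succ]
    have h0 : coeff 0 (adamsSum g) = 0 := by
      change adamsSum g 0 = 0
      simp [adamsSum]
    have h1 : coeff 0 (PowerSeries.subst (adamsSum g) (PowerSeries.exp (RatFunc ℚ))) =
        coeff 0 (∏ t, W t) := by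
      rw [coeff_exp_subst h0 0 (M := 1) (by simp)]
      change _ = constantCoeff (∏ t, W t)
      rw [map_prod, Finset.prod_eq_one]
      · simp
      · intro t _
        change coeff 0 (W t) = 1
        rw [coeff_subst_monomial (hδ D t) _ _ (M := 1) (by simp)]
        simp [f, hw0]
    rw [coeff_map, plethysticExp, coeff_eq_of_euler (euler_exp h0) (euler_prod _ W _ hW) h1
      (D := D) (fun β hβ => coeff_euler_adamsSum (hδ D) (c D) fun γ hγ => hg D γ (hγ.trans hβ))
      D α rfl le_rfl, coeff_prod_subst_monomial (hδ D) f D.lt_succ_self]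
    change toRatFunc (∑ m ∈ _, _) = _
    rw [map_sum]
    refine Finset.sum_congr rfl fun m _ => ?_
    rw [map_prod]
    refine Finset.prod_congr rfl fun t _ => ?_
    rw [PowerSeries.coeff_mk]
  · ext α
    rw [hF α, coeff_map]
    change toMot (∑ m ∈ _, _) = _
    rw [map_sum]
    exact Finset.sum_congr rfl fun m _ => map_prod _ _ _

end Plethystic

/-! ## The weights of the strings and of the Jordan blocks -/

section Weights

open Finset

variable {R S : Type*} [CommRing R] [CommRing S]

/-- `[GL_n]` as a function of `𝕃 = s²`. -/
def glPoly (s : Rˣ) (n : ℕ) : R := ∏ i ∈ range n, (((s : R) ^ 2) ^ n - ((s : R) ^ 2) ^ i)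

/-- `(-s)^{(2 - e) n²} / [GL_n]`. -/
def glWeight (s : Rˣ) (e : ℤ) (n : ℕ) : R :=
  (((-s) ^ ((2 - e) * (n : ℤ) ^ 2) : Rˣ) : R) * Ring.inverse (glPoly s n)

theorem map_glWeight (φ : R →+* S) {s : Rˣ} {s' : Sˣ} (hs : φ s = s') (e : ℤ) {n : ℕ}
    (hn : IsUnit (glPoly s n)) : φ (glWeight s e n) = glWeight s' e n := by
  obtain rfl : s' = Units.map φ.toMonoidHom s := Units.ext hs.symm
  have h : glPoly (Units.map φ.toMonoidHom s) n = φ (glPoly s n) := by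
    simp [glPoly, map_prod]
  rw [glWeight, glWeight, map_mul, h]
  congr 1
  · rw [show -(Units.map φ.toMonoidHom s) = Units.map φ.toMonoidHom (-s) by ext; simp, ← map_zpow]
    rfl
  · rw [← one_mul (Ring.inverse (φ _)), Ring.eq_mul_inverse_iff_mul_eq _ _ _ (hn.map φ), ← map_mul,
      Ring.inverse_mul_cancel _ hn, map_one]

theorem nilWeight_eq_glWeight (e : ℤ) (n : ℕ) : nilWeight e n = glWeight sqrtL e n := by
  rw [nilWeight, motiveGL_eq]
  rfl

/-- `s` in `ℤ[s^{±1}, (1 - s^{2n})^{-1}]`. -/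
def coeffSqrt : CoeffRingˣ := IsUnit.unit (IsLocalization.map_units CoeffRing
  (⟨Polynomial.X, Submonoid.subset_closure (Set.mem_insert _ _)⟩ : coeffDenominators))

theorem toMot_coeffSqrt : toMot coeffSqrt = sqrtL := by
  refine (IsLocalization.lift_eq _ _).trans ?_
  simp

theorem toRatFunc_coeffSqrt : toRatFunc coeffSqrt = sq := by
  refine (IsLocalization.lift_eq _ _).trans ?_
  simp [sq]

theorem isUnit_glPoly_coeffSqrt (n : ℕ) : IsUnit (glPoly coeffSqrt n) := by
  refine (IsUnit.prod_iff).2 fun i hi => ?_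
  obtain ⟨k, rfl⟩ := Nat.exists_eq_add_of_lt (Finset.mem_range.1 hi)
  have h : IsUnit (1 - ((coeffSqrt : CoeffRing) ^ 2) ^ (k + 1)) := by
    have h := IsLocalization.map_units CoeffRing
      (⟨1 - Polynomial.X ^ (2 * (k + 1)),
        Submonoid.subset_closure (Set.mem_insert_of_mem _ ⟨k, rfl⟩)⟩ : coeffDenominators)
    simpa [coeffSqrt, ← pow_mul] using h
  have : ((coeffSqrt : CoeffRing) ^ 2) ^ (i + k + 1) - ((coeffSqrt : CoeffRing) ^ 2) ^ i =
      -(((coeffSqrt : CoeffRing) ^ 2) ^ i * (1 - ((coeffSqrt : CoeffRing) ^ 2) ^ (k + 1))) := by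
    ring
  rw [this]
  exact (((coeffSqrt.isUnit.pow 2).pow i).mul h).neg

variable {K : Type*} [Field K]

theorem nsmul_eq_sum_of_recursion {Q a : K} {w : ℕ → K} (hQ : ∀ n : ℕ, 1 - Q ^ (n + 1) ≠ 0)
    (hw : ∀ m, (1 - Q ^ (m + 1)) * w (m + 1) = a * w m) (m : ℕ) :
    m * w m = ∑ n ∈ range m, a ^ (n + 1) / (1 - Q ^ (n + 1)) * w (m - 1 - n) := by
  induction m with
  | zero => simp
  | succ m ih =>
    refine mul_left_cancel₀ (hQ m) ?_
    have h1 : ∀ n ∈ range m, (1 - Q ^ (m + 1)) * (a ^ (n + 1) / (1 - Q ^ (n + 1)) * w (m - n)) =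
        a ^ (n + 1) * w (m - n) - a ^ (n + 2) * w (m - 1 - n) +
          a * (a ^ (n + 1) / (1 - Q ^ (n + 1)) * w (m - 1 - n)) := by
      intro n hn
      obtain ⟨k, rfl⟩ := Nat.exists_eq_add_of_lt (mem_range.1 hn)
      rw [show n + k + 1 - n = k + 1 by omega, show n + k + 1 - 1 - n = k by omega,
        show 1 - Q ^ (n + k + 1 + 1) = (1 - Q ^ (n + 1)) + Q ^ (n + 1) * (1 - Q ^ (k + 1)) by ring,
        show ∀ x y z : K, (x + z * (1 - Q ^ (k + 1))) * (y * w (k + 1)) =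
          x * y * w (k + 1) + z * y * ((1 - Q ^ (k + 1)) * w (k + 1)) from fun x y z => by ring,
        hw k]
      have := hQ n
      field_simp
      ring
    have h2 : ∑ n ∈ range m, (a ^ (n + 1) * w (m - n) - a ^ (n + 2) * w (m - 1 - n)) +
        a ^ (m + 1) * w 0 = a * w m := by
      rcases Nat.eq_zero_or_pos m with rfl | hm
      · simp
      have h3 := Finset.sum_range_sub' (fun n => a ^ (n + 1) * w (m - n)) m
      rw [Finset.sum_congr rfl fun n (_ : n ∈ range m) => by rw [Nat.sub_right_comm,
        Nat.sub_sub m n 1, show a ^ (n + 2) = a ^ (n + 1 + 1) from rfl], h3]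
      simp
    rw [Nat.add_sub_cancel, sum_range_succ, mul_add, Finset.mul_sum, sum_congr rfl h1,
      sum_add_distrib, ← mul_sum, ← ih, Nat.sub_self, ← mul_assoc (1 - Q ^ (m + 1)) (_ / _),
      mul_div_cancel₀ _ (hQ m), mul_left_comm, hw m]
    push_cast
    linear_combination -h2

theorem mul_glWeight_succ {s : Kˣ} (hs : ∀ n : ℕ, ((s : K) ^ 2) ^ (n + 1) - 1 ≠ 0) (e : ℤ) (m : ℕ) :
    (((s : K) ^ 2) ^ (m + 1) - 1) * glWeight s e (m + 1) =
      (((-s) ^ ((2 - e) * (2 * m + 1)) : Kˣ) : K) * (((s : K) ^ 2) ^ m)⁻¹ * glWeight s e m := by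
  have h1 : glPoly s (m + 1) = (((s : K) ^ 2) ^ (m + 1) - 1) * ((s : K) ^ 2) ^ m * glPoly s m := by
    rw [glPoly, prod_range_succ', pow_zero, glPoly, mul_comm, mul_assoc]
    congr 1
    have h : ∏ _i ∈ range m, (s : K) ^ 2 = ((s : K) ^ 2) ^ m := by rw [prod_const, card_range]
    rw [← h, ← prod_mul_distrib]
    exact prod_congr rfl fun i _ => by rw [h]; ring
  have h2 : (2 - e) * ((m + 1 : ℕ) : ℤ) ^ 2 = (2 - e) * (2 * m + 1) + (2 - e) * (m : ℤ) ^ 2 := by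
    push_cast
    ring
  rw [glWeight, glWeight, h1, h2, zpow_add, Units.val_mul, Ring.inverse_eq_inv', mul_inv, mul_inv]
  have := hs m
  field_simp

theorem glWeight_zero (s : Rˣ) (e : ℤ) : glWeight s e 0 = 1 := by
  simp [glWeight, glPoly]

end Weights

section RatFunc

open Finset

theorem sq_ne_zero : sq ≠ 0 := RatFunc.X_ne_zero

theorem sq_pow_sub_one_ne_zero (n : ℕ) : (sq ^ 2) ^ (n + 1) - 1 ≠ 0 := by
  have h := isUnit_eval₂_ratFunc ⟨1 - Polynomial.X ^ (2 * (n + 1)),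
    Submonoid.subset_closure (Set.mem_insert_of_mem _ ⟨n, rfl⟩)⟩
  rw [← pow_mul, ← neg_ne_zero, neg_sub]
  simpa [sq] using h.ne_zero

theorem adams_sq (n : ℕ) : adams n sq = sq ^ (n + 1) := by
  rw [adams, sq, ← RatFunc.algebraMap_X, RatFunc.coe_mapRingHom_eq_coe_map]
  have h := RatFunc.map_apply_div (Polynomial.expand ℚ (n + 1))
    (nonZeroDivisors_le_comap_expand n) Polynomial.X 1
  simpa only [map_one, div_one, Polynomial.expand_X, map_pow] using h

/-- The coefficient of a string in the argument of the plethystic exponential. -/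
def strClass (e : ℤ) : RatFunc ℚ := if e = 0 then sq ^ 2 / (sq ^ 2 - 1) else sq / (1 - sq ^ 2)

theorem glWeight_adams {e : ℤ} (he : e = 0 ∨ e = 1) {s : (RatFunc ℚ)ˣ} (hs : (s : RatFunc ℚ) = sq)
    (m : ℕ) : (m + 1 : RatFunc ℚ) * glWeight s e (m + 1) =
      ∑ n ∈ range (m + 1), adams n (strClass e) * glWeight s e (m - n) := by
  have h0 := sq_ne_zero
  have h1 := sq_pow_sub_one_ne_zero
  have hrec := mul_glWeight_succ (s := s) (by rwa [hs]) e
  rw [hs] at hrec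
  rcases he with rfl | rfl
  · have h := nsmul_eq_sum_of_recursion (Q := (sq ^ 2)⁻¹) (a := 1) (w := glWeight s 0)
      (fun n => ?_) (fun m => ?_) (m + 1)
    · rw [Nat.cast_succ] at h
      rw [h]
      refine sum_congr rfl fun n _ => ?_
      have := h1 n
      rw [Nat.add_sub_cancel, strClass, if_pos rfl, map_div₀, map_sub, map_one, map_pow, adams_sq,
        ← pow_mul, mul_comm (n + 1), pow_mul, one_pow, inv_pow]
      congr 1
      field_simp
    · have := h1 n
      rw [inv_pow]
      field_simp
      exact div_ne_zero this (pow_ne_zero _ (pow_ne_zero _ h0))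
    · have h2 := hrec m
      have h3 : (((-s) ^ ((2 - 0 : ℤ) * (2 * m + 1)) : (RatFunc ℚ)ˣ) : RatFunc ℚ) =
          (sq ^ 2) ^ (m + 1) * (sq ^ 2) ^ m := by
        rw [show (2 - 0 : ℤ) * (2 * m + 1) = ((2 * (2 * m + 1) : ℕ) : ℤ) by push_cast; ring,
          zpow_natCast, pow_mul, neg_sq]
        push_cast
        rw [hs]
        ring
      rw [h3, mul_inv_cancel_right₀ (pow_ne_zero _ (pow_ne_zero _ h0))] at h2
      rw [inv_pow, one_mul]
      refine mul_left_cancel₀ (pow_ne_zero (m + 1) (pow_ne_zero 2 h0)) ?_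
      rw [← h2]
      field_simp
  · have h := nsmul_eq_sum_of_recursion (Q := sq ^ 2) (a := sq) (w := glWeight s 1)
      (fun n => ?_) (fun m => ?_) (m + 1)
    · rw [Nat.cast_succ] at h
      rw [h]
      refine sum_congr rfl fun n _ => ?_
      rw [Nat.add_sub_cancel, strClass, if_neg one_ne_zero, map_div₀, map_sub, map_one, map_pow,
        adams_sq, ← pow_mul sq (n + 1), mul_comm (n + 1), pow_mul]
    · rw [← neg_ne_zero, neg_sub]
      exact h1 n
    · have h2 := hrec m
      have h3 : (((-s) ^ ((2 - 1 : ℤ) * (2 * m + 1)) : (RatFunc ℚ)ˣ) : RatFunc ℚ) =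
          -sq * (sq ^ 2) ^ m := by
        rw [show (2 - 1 : ℤ) * (2 * m + 1) = ((2 * m + 1 : ℕ) : ℤ) by push_cast; ring,
          zpow_natCast, pow_succ, pow_mul, neg_sq]
        push_cast
        rw [hs]
        ring
      rw [h3, mul_inv_cancel_right₀ (pow_ne_zero _ (pow_ne_zero _ h0))] at h2
      linear_combination -h2

end RatFunc

section Invertible

variable {N₀ N₁ : ℕ} [NeZero (N₀ + N₁)] {σ : TrapezoidPartition N₀ N₁} {N' : ℕ}

theorem isPlethysticExp_invertibleSeries (hN' : N' ≤ N₀ + N₁)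
    (hσ : σ.loopVertices = {k : ZMod (N₀ + N₁) | k.val < N'}) :
    IsPlethysticExp (σ.invertibleSeries N') invertibleArgument := by
  classical
  have hdeg : ∀ α : Unit →₀ ℕ, α.degree = α () := fun α => by
    simp [Finsupp.degree_eq_sum]
  have hsingle : ∀ α : Unit →₀ ℕ, α = Finsupp.single () (α ()) := fun α => by
    ext
    simp
  refine isPlethysticExp_of_atoms (fun D => Fin D) (fun D i => Finsupp.single () ((i : ℕ) + 1))
    (fun D i => by simp) (fun D i => sq ^ 2) (fun D i m => ((coeffSqrt : CoeffRing) ^ 2) ^ m)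
    (fun D i => pow_zero _) (fun D i m => ?_) (fun D β hβ => ?_) (fun α => ?_)
  · simp only [map_pow, toRatFunc_coeffSqrt, adams_sq]
    rw [Finset.sum_congr rfl (g := fun _ => (sq ^ 2) ^ (m + 1)) fun n hn => ?_]
    · simp
    · rw [← pow_mul, mul_comm (n + 1), pow_mul, ← pow_add]
      congr 1
      have := Finset.mem_range.1 hn
      omega
  · have h1 : (1 - PowerSeries.X : PowerSeries (RatFunc ℚ))⁻¹ = PowerSeries.mk 1 := by
      rw [PowerSeries.inv_eq_iff_mul_eq_one (by simp)]
      exact PowerSeries.mk_one_mul_one_sub_eq_one _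
    rw [hdeg] at hβ
    rw [hsingle β, invertibleArgument, h1]
    change PowerSeries.coeff (β ()) _ = _
    rw [PowerSeries.coeff_C_mul]
    rcases h : β () with _ | b
    · rw [PowerSeries.coeff_zero_X_mul, mul_zero]
      exact (Finset.sum_eq_zero fun i _ => if_neg (by simp)).symm
    · rw [PowerSeries.coeff_succ_X_mul, PowerSeries.coeff_mk, Pi.one_apply, mul_one,
        Finset.sum_eq_single (⟨b, by omega⟩ : Fin D)]
      · simp
      · intro i _ hi
        refine if_neg fun h2 => hi (Fin.ext ?_)
        have := DFunLike.congr_fun h2 ()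
        simpa using this
      · exact fun h => absurd (Finset.mem_univ _) h
  · have h1 : MvPowerSeries.coeff α (σ.invertibleSeries N') =
        PowerSeries.coeff α.degree (σ.invertibleSeries N') := by
      rw [PowerSeries.coeff, hdeg, ← hsingle]
    rw [h1, coeff_invertibleSeries_eq_sum hN' hσ le_rfl]
    refine Finset.sum_congr ?_ fun m _ => ?_
    · ext m
      simp only [Finset.mem_filter, Fintype.mem_piFinset]
      refine and_congr Iff.rfl ?_
      simp only [Finsupp.smul_single, smul_eq_mul, mul_comm (m _)]
      rw [← Finsupp.single_finsetSum]
      have h2 : α = Finsupp.single () α.degree := by rw [hdeg, ← hsingle]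
      constructor
      · intro h
        rw [h, ← h2]
      · intro h
        exact Finsupp.single_injective () (h.trans h2)
    · rw [← Finset.prod_pow_eq_pow_sum]
      exact Finset.prod_congr rfl fun i _ => by rw [map_pow, map_pow, toMot_coeffSqrt]; rfl

end Invertible

section Nilpotent

variable {N : ℕ} [NeZero N]

theorem sum_range_natCast {M : Type*} [AddCommMonoid M] (f : ZMod N → M) :
    ∑ x ∈ Finset.range N, f (x : ZMod N) = ∑ k, f k := by
  refine Finset.sum_bij (fun x _ => (x : ZMod N)) (fun _ _ => Finset.mem_univ _) ?_ ?_
    (fun _ _ => rfl)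
  · intro x hx y hy h
    rw [← ZMod.val_cast_of_lt (Finset.mem_range.1 hx), h,
      ZMod.val_cast_of_lt (Finset.mem_range.1 hy)]
  · exact fun k _ => ⟨k.val, Finset.mem_range.2 (ZMod.val_lt k), ZMod.natCast_zmod_val k⟩

/-- The dimension vector of the string of length `ℓ + 1` from `p` on. -/
def segDim (p : ZMod N) (ℓ : ℕ) : ZMod N →₀ ℕ :=
  ∑ x ∈ Finset.range (ℓ + 1), Finsupp.single (p + (x : ZMod N)) 1

theorem degree_segDim (p : ZMod N) (ℓ : ℕ) : (segDim p ℓ).degree = ℓ + 1 := by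
  simp [segDim, map_sum]

theorem segDim_add (p : ZMod N) (ℓ : ℕ) : segDim p (N + ℓ) = constDim N 1 + segDim p ℓ := by
  have h : constDim N 1 = ∑ x ∈ Finset.range N, Finsupp.single (p + (x : ZMod N)) 1 := by
    rw [sum_range_natCast fun k => Finsupp.single (p + k) 1,
      Fintype.sum_equiv (Equiv.addLeft p) (fun k => Finsupp.single (p + k) 1)
        (fun k => Finsupp.single k 1) fun _ => rfl]
    ext k
    simp [constDim, Finsupp.finsetSum_apply, Finsupp.single_apply]
  rw [h, segDim, segDim, add_assoc, Finset.sum_range_add]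
  simp

open Classical in
/-- Whether exactly one of `p - 1` and `q` is in `J`. -/
def endSign (J : Set (ZMod N)) (p q : ZMod N) : ℤ :=
  ((if p - 1 ∈ J then 1 else 0) - if q ∈ J then 1 else 0) ^ 2

theorem endSign_eq (J : Set (ZMod N)) (p q : ZMod N) : endSign J p q = 0 ∨ endSign J p q = 1 := by
  unfold endSign
  split_ifs <;> simp

theorem typeSign_eq {D : ℕ} (J : Set (ZMod N)) (t : ZMod N × Fin D) :
    typeSign J t = endSign J t.1 (t.1 + (t.2 : ℕ)) := by
  unfold typeSign endSign startJ endJ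
  split_ifs <;> simp

open MvPowerSeries in
/-- The part of the argument of the plethystic exponential for the strings of length `ℓ + 1`. -/
def segSum (J : Set (ZMod N)) (ℓ : ℕ) : MvPowerSeries (ZMod N) (RatFunc ℚ) :=
  ∑ p, monomial (segDim p ℓ) (strClass (endSign J p (p + (ℓ : ZMod N))))

open MvPowerSeries in
theorem prod_X_mul_segSum (J : Set (ZMod N)) (ℓ : ℕ) :
    (∏ i : ZMod N, X i) * segSum J ℓ = segSum J (N + ℓ) := by
  rw [prod_X_eq, segSum, segSum, Finset.mul_sum]
  refine Finset.sum_congr rfl fun p _ => ?_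
  rw [monomial_mul_monomial, one_mul, segDim_add, Nat.cast_add, ZMod.natCast_self, zero_add]

open MvPowerSeries in
theorem yInterval_eq (a b : ZMod N) : yInterval a b = monomial (segDim a (b - a).val) 1 := by
  simp [yInterval, segDim, X_def, prod_monomial]

open MvPowerSeries in
theorem nilpotentArgument_eq {N' : ℕ} (hN' : N' ≤ N) (he : Even (N - N')) :
    nilpotentArgument N N' =
      (1 - ∏ i : ZMod N, X i)⁻¹ * ∑ ℓ ∈ Finset.range N, segSum (I₂ N N') ℓ := by
  classical
  have h1 : ∀ z : ZMod N × ZMod N, endSign (I₂ N N') z.1 z.2 =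
      if z ∈ intervalSet N N' then 1 else 0 := by
    intro z
    have h : z ∈ intervalSet N N' ↔ (z.1 - 1 ∈ I₂ N N' ∧ z.2 ∉ I₂ N N') ∨
        (z.1 - 1 ∉ I₂ N N' ∧ z.2 ∈ I₂ N N') := by
      rw [← I₃_iff hN' he]
      rfl
    simp only [h, endSign]
    by_cases h2 : z.1 - 1 ∈ I₂ N N' <;> by_cases h3 : z.2 ∈ I₂ N N' <;> simp [h2, h3]
  have h2 : ∑ ℓ ∈ Finset.range N, segSum (I₂ N N') ℓ = ∑ z : ZMod N × ZMod N,
      monomial (segDim z.1 (z.2 - z.1).val) (strClass (endSign (I₂ N N') z.1 z.2)) := by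
    simp only [segSum]
    rw [Finset.sum_comm, Fintype.sum_prod_type]
    refine Finset.sum_congr rfl fun p _ => ?_
    rw [← Fintype.sum_equiv (Equiv.addLeft p) (fun k => monomial (segDim p k.val)
      (strClass (endSign (I₂ N N') p (p + k)))) _ fun k => ?_, ← sum_range_natCast]
    · refine Finset.sum_congr rfl fun x hx => ?_
      rw [ZMod.val_cast_of_lt (Finset.mem_range.1 hx)]
    · simp
  have h3 : strClass 1 = sq ^ 2 / (sq ^ 2 - 1) * -sq⁻¹ := by
    have h0 := sq_ne_zero
    have h4 := sq_pow_sub_one_ne_zero 0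
    rw [zero_add, pow_one] at h4
    have h5 : 1 - sq ^ 2 ≠ 0 := by rwa [← neg_ne_zero, neg_sub]
    rw [strClass, if_neg one_ne_zero, div_mul_eq_mul_div, div_eq_div_iff h5 h4]
    field_simp
    ring
  rw [nilpotentArgument, h2, mul_assoc, mul_left_comm]
  congr 1
  rw [sub_eq_add_neg (Finset.sum _ _), ← neg_mul, mul_add, Finset.mul_sum, Finset.mul_sum,
    Finset.mul_sum, add_comm,
    ← Finset.sum_filter_add_sum_filter_not Finset.univ (fun z => z ∈ intervalSet N N')]
  congr 1
  · refine Finset.sum_congr rfl fun z hz => ?_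
    rw [h1, if_pos (Finset.mem_filter.1 hz).2, h3, yInterval_eq, ← map_neg, ← mul_assoc, ← map_mul,
      ← monomial_zero_eq_C_apply, monomial_mul_monomial, zero_add, mul_one]
  · refine Finset.sum_congr rfl fun z hz => ?_
    rw [h1, if_neg (Finset.mem_filter.1 hz).2, yInterval_eq, ← monomial_zero_eq_C_apply,
      monomial_mul_monomial, zero_add, mul_one]
    rfl

open MvPowerSeries in
theorem coeff_nilpotentArgument {N' : ℕ} (hN' : N' ≤ N) (he : Even (N - N')) {D : ℕ}
    {β : ZMod N →₀ ℕ} (hβ : β.degree ≤ D) : coeff β (nilpotentArgument N N') =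
      coeff β (∑ ℓ ∈ Finset.range D, segSum (I₂ N N') ℓ) := by
  classical
  set S := segSum (I₂ N N')
  set y : MvPowerSeries (ZMod N) (RatFunc ℚ) := ∏ i : ZMod N, X i with hy
  have h1 : ∑ ℓ ∈ Finset.range N, S ℓ = (1 - y) * ∑ ℓ ∈ Finset.range D, S ℓ +
      ∑ ℓ ∈ Finset.range N, S (D + ℓ) := by
    have h := Finset.sum_range_add S N D
    rw [add_comm N D, Finset.sum_range_add] at h
    rw [sub_mul, one_mul, Finset.mul_sum,
      Finset.sum_congr rfl fun ℓ _ => prod_X_mul_segSum (I₂ N N') ℓ]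
    linear_combination -h
  have h0 : constantCoeff (1 - y) ≠ 0 := by
    simp [hy, zero_pow (NeZero.ne N)]
  rw [nilpotentArgument_eq hN' he, h1, mul_add, ← mul_assoc, MvPowerSeries.inv_mul_cancel _ h0,
    one_mul, map_add, Finset.mul_sum, add_eq_left, map_sum]
  refine Finset.sum_eq_zero fun ℓ _ => ?_
  simp only [S, segSum]
  rw [Finset.mul_sum, map_sum]
  refine Finset.sum_eq_zero fun p _ => ?_
  rw [coeff_mul_monomial, if_neg fun h => ?_]
  have h3 := Finsupp.degree_mono h
  rw [degree_segDim] at h3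
  omega

end Nilpotent

section NilpotentSeries

variable {N₀ N₁ : ℕ} [NeZero (N₀ + N₁)] {σ : TrapezoidPartition N₀ N₁} {N' : ℕ}

theorem isPlethysticExp_nilpotentSeries (hN' : N' ≤ N₀ + N₁)
    (hσ : σ.loopVertices = {k : ZMod (N₀ + N₁) | k.val < N'}) :
    IsPlethysticExp (σ.nilpotentSeries N') (nilpotentArgument (N₀ + N₁) N') := by
  classical
  have he := even_sub_of_loopVertices hN' hσ
  refine isPlethysticExp_of_atoms (fun D => ZMod (N₀ + N₁) × Fin D) (fun D t => strDim t)
    (fun D t h => ?_) (fun D t => strClass (typeSign (I₂ _ N') t))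
    (fun D t m => glWeight coeffSqrt (typeSign (I₂ _ N') t) m) (fun D t => glWeight_zero _ _)
    (fun D t m => ?_) (fun D β hβ => ?_) (fun α => ?_)
  · have h1 := degree_segDim t.1 t.2
    rw [show segDim t.1 t.2 = 0 from h, map_zero] at h1
    exact absurd h1 (by omega)
  · simp only [map_glWeight toRatFunc (s' := Units.mk0 sq sq_ne_zero) toRatFunc_coeffSqrt _
      (isUnit_glPoly_coeffSqrt _)]
    refine glWeight_adams ?_ rfl m
    rw [typeSign_eq]
    exact endSign_eq _ _ _
  · rw [coeff_nilpotentArgument hN' he hβ, ← Fin.sum_univ_eq_sum_range, map_sum,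
      Fintype.sum_prod_type_right]
    refine Finset.sum_congr rfl fun ℓ _ => ?_
    rw [segSum, map_sum]
    refine Finset.sum_congr rfl fun p _ => ?_
    rw [MvPowerSeries.coeff_monomial, typeSign_eq]
    by_cases h : β = strDim (p, ℓ)
    · exact (if_pos h).trans (if_pos h.symm).symm
    · exact (if_neg h).trans (if_neg (Ne.symm h)).symm
  · rw [coeff_nilpotentSeries hN' hσ]
    refine (mu_nilReps_eq_sum_prod (special_hJ hN' he) (D := α.degree) ?_).trans ?_
    · rw [Finsupp.degree_eq_sum]
    · refine Finset.sum_congr (by ext; simp only [Finset.mem_filter, Fintype.mem_piFinset])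
        fun m _ =>
        Finset.prod_congr rfl fun t _ => ?_
      rw [nilWeight_eq_glWeight, map_glWeight toMot toMot_coeffSqrt _ (isUnit_glPoly_coeffSqrt _)]

end NilpotentSeries

end MotivicDT

end

theorem mainTheorem4 (N₀ N₁ : ℕ) [NeZero (N₀ + N₁)] (σ : MotivicDT.TrapezoidPartition N₀ N₁)
    (N' : ℕ) (hN' : N' ≤ N₀ + N₁)
    (hσ : σ.loopVertices = {k : ZMod (N₀ + N₁) | k.val < N'}) :
    (∀ n : ℕ, IsUnit (MotivicDT.motiveGL n)) ∧
    σ.universalSeries =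
      PowerSeries.subst
          (∏ i : ZMod (N₀ + N₁), MvPowerSeries.X i : MvPowerSeries (ZMod (N₀ + N₁)) MotivicDT.Mot)
          (σ.invertibleSeries N') *
        σ.nilpotentSeries N' ∧
    MotivicDT.IsPlethysticExp (σ.invertibleSeries N') MotivicDT.invertibleArgument ∧
    MotivicDT.IsPlethysticExp (σ.nilpotentSeries N')
      (MotivicDT.nilpotentArgument (N₀ + N₁) N') :=
  ⟨MotivicDT.isUnit_motiveGL, MotivicDT.universalSeries_eq hN' hσ,
    MotivicDT.isPlethysticExp_invertibleSeries hN' hσ,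
    MotivicDT.isPlethysticExp_nilpotentSeries hN' hσ⟩
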